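/- **Setting.** Consider a ring of $\ell$ sites, each with Hilbert space $\mathbb C^d$ carrying the same unitary representation $\mu$ of $G=\mathbb Z_N$; $U_g=\bigotimes_i\mu_g$, and $U_{g,X}$ is its restriction to a set $X$ of sites. A *QCA of spreading length $\xi$* is a unitary $U$ such that $U^\dagger OU$ is supported on $[i-\xi,i+\xi]$ whenever $O$ is supported on site $i$; it is *symmetric* if $[U,U_g]=0$ for all $g$. A *symmetric circuit of depth $\le D$ and range $\le r$* is a product of at most $D$ layers, each a product of unitary gates supported on disjoint intervals of at most $r$ sites and each commuting with all $U_g$. $U$ and $U'$ are *strongly equivalent* (with depth $D$ and range $r$) if for some $a\ge 0$, after adding to each site $a$ ancillas that carry $\mu$, $U'\otimes 1=W\,(U\otimes 1)$ with $W$ a symmetric circuit of depth $\le D$ and range $\le r$. The GNVW index is $\mathrm{ind}(U)=\eta(U^\dagger\mathcal AU,\mathcal B)/\eta(\mathcal A,U^\dagger\mathcal BU)$, where $\mathcal A,\mathcal B$ are the operator algebras of two adjacent nonempty intervals $A$ (left) and $B$ (right) of lengths $\ge 2\xi$ with $|A|+|B|+2\xi\le\ell$, and $\eta(\mathcal A,\mathcal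 B)^2=\sum|\mathrm{tr}(O_a^\dagger O_b)|^2$ over orthonormal bases for the normalized trace $\mathrm{tr}$. For $I=[x-m,x+m)$ with $m\ge\max(1,2\xi)$ and $2(m+\xi)\le\ell$, write $U^\dagger U_{g,I}U=L_gR_g$ with unitary representations $L,R$ of $G$ supported on $[x-m-\xi,x)$ and on $[x,x+m+\xi)$. With $U_{g,R}=U_{g,[x,x+m)}$, and $d_g$ the order of $g$, put $$\mathrm{rind}_g(U)=\mathrm{ind}(U)\cdot\left[\frac{\mathrm{Tr}\,R_g}{\mathrm{Tr}\,U_{g,R}}\right]^{d_g},$$ both traces being taken over the whole chain. **Statement.** 1. Let $N$ be prime, and let $R,R'$ be finite-dimensional complex representations of $\mathbb Z_N$. Then $\mathrm{Tr}(R_g)^{d_g}=\mathrm{Tr}(R'_g)^{d_g}$ for all $g$ if and only if there is a one-dimensional representation $u$ with $R\cong u\otimes R'$. 2. (Completeness for prime $N$.) For every $\xi$ there is $r_0$ such that for all $D\ge 2$ and $r\ge r_0$ there is $\ell_0$ such that the following holds for all $\ell\ge\ell_0$, all primes $N$, all $d$, and all unitary representations $\mu$ of $\mathbb Z_N$ on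 $\mathbb C^d$ with $\mathrm{Tr}\,\mu_g\ne 0$ for every $g$. For every symmetric QCA $U$ of spreading length $\xi$ on the ring of $\ell$ sites the indices $\mathrm{rind}_g(U)$ exist and do not depend on the choices made; and two such QCA $U,U'$ satisfy $\mathrm{rind}_g(U)=\mathrm{rind}_g(U')$ for all $g$ if and only if they are strongly equivalent with depth $D$ and range $r$. 3. (Counterexample for $N=4$.) The representations $R,R'$ of $\mathbb Z_4$ with $R_1=\mathrm{diag}(1,1,-1,i)$ and $R'_1=\mathrm{diag}(1,i,i,-i)$ have nowhere vanishing characters and satisfy $\mathrm{Tr}(R_g)^{d_g}=\mathrm{Tr}(R'_g)^{d_g}$ for all $g$, but there is no one-dimensional representation $u$ with $R\cong u\otimes R'$. Accordingly, the refined indices do not classify $\mathbb Z_4$-symmetric QCA: there are $d$, $\xi$ and a unitary representation $\mu$ of $\mathbb Z_4$ on $\mathbb C^d$ with nowhere vanishing character such that for all $D,r$ and all sufficiently long rings there are two symmetric QCA of spreading length $\xi$ that have the same refined indices but are not strongly equivalent with depth $D$ and range $r$. -/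

import Mathlib

open scoped Matrix Kronecker

noncomputable section

namespace SpinChain

/-! ### Operators on a collection `ι` of spins with on-site space `ℂ^S` -/

/-- Operators on the Hilbert space `⨂_{i ∈ ι} ℂ^S`, in the product basis `ι → S`. -/
abbrev Op (ι S : Type) : Type := Matrix (ι → S) (ι → S) ℂ

section General

variable {ι S G : Type} [Fintype ι] [DecidableEq ι] [Fintype S] [DecidableEq S]

/-- The tensor product `⨂_i A i` of one-site operators. -/
def prodOp (A : ι → Matrix S S ℂ) : Op ι S :=
  Matrix.of fun f h => ∏ i, A i (f i) (h i)

/-- The operator acting as `M` on every site of `I` and as the identity elsewhere. -/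
def onSites (I : Finset ι) (M : Matrix S S ℂ) : Op ι S :=
  prodOp fun i => if i ∈ I then M else 1

/-- An operator on the spins in `X`, tensored with the identity on the other spins. -/
def extendOp (X : Finset ι) (o : Op X S) : Op ι S :=
  Matrix.of fun f h =>
    if ∀ i, i ∉ X → f i = h i then o (fun i => f i) (fun i => h i) else 0

/-- `O` is supported on `X`: it has the form `o ⊗ 1`, with `o` acting on the spins in `X`. -/
def SupportedOn (X : Finset ι) (O : Op ι S) : Prop :=
  ∃ o : Op X S, O = extendOp X o

/-- The normalized trace, `tr 1 = 1`. -/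
def ntr (O : Op ι S) : ℂ :=
  O.trace / (Fintype.card (ι → S) : ℂ)

/-- The basis of the algebra of operators supported on `X` that consists of the rescaled matrix
units; it is orthonormal for `⟨O, O'⟩ = tr (O† O')`, with the normalized trace. -/
def opBasis (X : Finset ι) (p : (X → S) × (X → S)) : Op ι S :=
  ((Real.sqrt ((Fintype.card S : ℝ) ^ X.card) : ℝ) : ℂ) • extendOp X (Matrix.single p.1 p.2 1)

/-- The overlap `η(𝒜, ℬ) = √(∑ |tr (O_a† O_b)|²)` of two operator algebras, computed in orthonormal
bases `a` of `𝒜` and `b` of `ℬ` (its value does not depend on these bases). -/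
def overlap {α β : Type} [Fintype α] [Fintype β] (a : α → Op ι S) (b : β → Op ι S) : ℝ :=
  Real.sqrt (∑ p, ∑ q, ‖ntr ((a p)ᴴ * b q)‖ ^ 2)

/-- `η(U† 𝒜 U, ℬ) / η(𝒜, U† ℬ U)` for the operator algebras `𝒜, ℬ` of the regions `A, B`. -/
def overlapRatio (U : Op ι S) (A B : Finset ι) : ℝ :=
  overlap (fun p => Uᴴ * opBasis A p * U) (opBasis B) /
    overlap (opBasis A) (fun p => Uᴴ * opBasis B p * U)

/-- `O` commutes with the global symmetry operators `U_g = ⨂_i μ_g`. -/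
def CommutesWithSymmetry (μ : G → Matrix S S ℂ) (O : Op ι S) : Prop :=
  ∀ g, O * prodOp (fun _ => μ g) = prodOp (fun _ => μ g) * O

/-- `U ⊗ 1`, where each site carries in addition `a` ancillas, each with the on-site space `ℂ^S`. -/
def withAncillas (a : ℕ) (U : Op ι S) : Op ι (S × (Fin a → S)) :=
  Matrix.of fun f h =>
    (U ⊗ₖ (1 : Op ι (Fin a → S))) (fun i => (f i).1, fun i => (f i).2)
      (fun i => (h i).1, fun i => (h i).2)

/-- The representation `μ ⊗ μ^{⊗ a}` on a site with `a` ancillas. -/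
def ancillaRep (a : ℕ) (μ : G → Matrix S S ℂ) (g : G) :
    Matrix (S × (Fin a → S)) (S × (Fin a → S)) ℂ :=
  μ g ⊗ₖ prodOp (fun _ : Fin a => μ g)

end General

/-! ### The periodic chain with sites `ZMod ℓ` -/

section Ring

variable {ℓ : ℕ} {S G : Type} [NeZero ℓ] [Fintype S] [DecidableEq S]

/-- The interval `{x, x + 1, …, x + n - 1}` of the ring. -/
def arc (x : ZMod ℓ) (n : ℕ) : Finset (ZMod ℓ) :=
  (Finset.range n).image fun k : ℕ => x + (k : ZMod ℓ)

/-- `U` is a quantum cellular automaton with operator spreading length (at most) `ξ`. -/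
def IsQCA (ξ : ℕ) (U : Op (ZMod ℓ) S) : Prop :=
  U ∈ Matrix.unitaryGroup (ZMod ℓ → S) ℂ ∧
    ∀ (i : ZMod ℓ) (O : Op (ZMod ℓ) S), SupportedOn {i} O →
      SupportedOn (arc (i - (ξ : ZMod ℓ)) (2 * ξ + 1)) (Uᴴ * O * U)

/-- A QCA that commutes with the global symmetry. -/
def IsSymmetricQCA (ξ : ℕ) (μ : G → Matrix S S ℂ) (U : Op (ZMod ℓ) S) : Prop :=
  IsQCA ξ U ∧ CommutesWithSymmetry μ U

/-- One layer of a symmetric circuit: a product of unitary gates supported on disjoint intervals of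
at most `r` sites, each of which commutes with the symmetry. -/
def IsSymmetricLayer (r : ℕ) (μ : G → Matrix S S ℂ) (W : Op (ZMod ℓ) S) : Prop :=
  ∃ (k : ℕ) (x : Fin k → ZMod ℓ) (n : Fin k → ℕ) (V : Fin k → Op (ZMod ℓ) S),
    (∀ j, n j ≤ r) ∧
    (∀ j j', j ≠ j' → Disjoint (arc (x j) (n j)) (arc (x j') (n j'))) ∧
    (∀ j, V j ∈ Matrix.unitaryGroup (ZMod ℓ → S) ℂ ∧ SupportedOn (arc (x j) (n j)) (V j) ∧
      CommutesWithSymmetry μ (V j)) ∧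
    W = (List.ofFn V).prod

/-- A symmetric quantum circuit of depth at most `D` with gates of range at most `r`. -/
def IsSymmetricCircuit (D r : ℕ) (μ : G → Matrix S S ℂ) (W : Op (ZMod ℓ) S) : Prop :=
  ∃ Ws : List (Op (ZMod ℓ) S),
    Ws.length ≤ D ∧ (∀ V ∈ Ws, IsSymmetricLayer r μ V) ∧ W = Ws.prod

/-- Strong equivalence: after adding ancillas that carry the on-site representation `μ`, the two
QCA differ by a symmetric circuit (of depth at most `D` and gate range at most `r`). -/
def StronglyEquivalent (D r : ℕ) (μ : G → Matrix S S ℂ) (U U' : Op (ZMod ℓ) S) : Prop :=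
  ∃ (a : ℕ) (W : Op (ZMod ℓ) (S × (Fin a → S))),
    IsSymmetricCircuit D r (ancillaRep a μ) W ∧ withAncillas a U' = W * withAncillas a U

/-- `q` is the GNVW index of `U`, computed from adjacent intervals `A = [x - a, x)` and
`B = [x, x + b)`, of length at least twice the spreading length, which even after spreading
by `ξ` do not meet around the back of the ring. -/
def IsGNVWIndex (ξ : ℕ) (U : Op (ZMod ℓ) S) (q : ℝ) : Prop :=
  ∃ (x : ZMod ℓ) (a b : ℕ), 1 ≤ a ∧ 1 ≤ b ∧ 2 * ξ ≤ a ∧ 2 * ξ ≤ b ∧ a + b + 2 * ξ ≤ ℓ ∧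
    q = overlapRatio U (arc (x - (a : ZMod ℓ)) a) (arc x b)

/-- `U† U_{g,I} U = L_g R_g` for `I = [x - m, x + m)`, where `L` and `R` are representations of `G`
supported to the left and to the right of the midpoint `x` of `I`. -/
def IsSplitting [Group G] (ξ : ℕ) (μ : G → Matrix S S ℂ) (U : Op (ZMod ℓ) S) (x : ZMod ℓ) (m : ℕ)
    (L R : G →* Matrix.unitaryGroup (ZMod ℓ → S) ℂ) : Prop :=
  ∀ g,
    SupportedOn (arc (x - ((m + ξ : ℕ) : ZMod ℓ)) (m + ξ)) (L g : Op (ZMod ℓ) S) ∧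
    SupportedOn (arc x (m + ξ)) (R g : Op (ZMod ℓ) S) ∧
    Uᴴ * onSites (arc (x - (m : ZMod ℓ)) (2 * m)) (μ g) * U =
      (L g : Op (ZMod ℓ) S) * (R g : Op (ZMod ℓ) S)

/-- `s g` is the refined index `ind(U) · [Tr R_g / Tr U_{g,R}] ^ d_g` for every `g`, where `d_g` is
the order of `g`, and `U_{g,R}` is the restriction of the symmetry to the right half of `I`. -/
def IsRefinedIndex [Group G] (ξ : ℕ) (μ : G → Matrix S S ℂ) (U : Op (ZMod ℓ) S) (s : G → ℂ) :
    Prop :=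
  ∃ q : ℝ, IsGNVWIndex ξ U q ∧
    ∃ (x : ZMod ℓ) (m : ℕ) (L R : G →* Matrix.unitaryGroup (ZMod ℓ → S) ℂ),
      1 ≤ m ∧ 2 * ξ ≤ m ∧ 2 * (m + ξ) ≤ ℓ ∧ IsSplitting ξ μ U x m L R ∧
      ∀ g, s g = (q : ℂ) *
        ((R g : Op (ZMod ℓ) S).trace / (onSites (arc x m) (μ g)).trace) ^ orderOf g

end Ring

/-- Two finite-dimensional representations agree, up to isomorphism, after one of them is multiplied
by a one-dimensional representation `u`. -/
def DifferByCharacter {G : Type} [Group G] {n n' : ℕ} (ρ : G →* Matrix (Fin n) (Fin n) ℂ)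
    (ρ' : G →* Matrix (Fin n') (Fin n') ℂ) : Prop :=
  ∃ (u : G →* ℂ) (P : Matrix (Fin n) (Fin n') ℂ) (Q : Matrix (Fin n') (Fin n) ℂ),
    P * Q = 1 ∧ Q * P = 1 ∧ ∀ g, ρ g = u g • (P * ρ' g * Q)

/-- `Tr(ρ_g)^{d_g} = Tr(ρ'_g)^{d_g}` for all `g`, with `d_g` the order of `g`. -/
def SameCharacterPowers {G : Type} [Group G] {n n' : ℕ} (ρ : G →* Matrix (Fin n) (Fin n) ℂ)
    (ρ' : G →* Matrix (Fin n') (Fin n') ℂ) : Prop :=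
  ∀ g, (ρ g).trace ^ orderOf g = (ρ' g).trace ^ orderOf g

end SpinChain

end

set_option linter.unusedSectionVars false
set_option linter.unusedSimpArgs false
set_option linter.unusedVariables false

/-! Let `M` be the on-site action of one group element, with `M ^ d = 1`. Evolving the symmetry of a
long interval changes it only near the two endpoints, so the result is a left end times the
unchanged bulk times a right end. Each end is unique up to a phase (`IsEnd.eq_smul`), and as the
three factors have disjoint supports, the phase can be chosen so that `T ^ d = 1`
(`IsSym.exists_rightEnd_pow`). Everything is read off from the end ratios `τ j = tr (T ^ j) / tr (M
^ j) ^ ξ` of a normalized right end (`IsEndRatio`). They can be computed at any point of the ring,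
are determined up to `τ j ↦ c ^ j * τ j` with `c ^ d = 1` (`IsSym.endRatio_unique`), multiply under
composition and under tensor products (`IsSym.endRatio_mul`, `IsSym.endRatio_tens`), and are trivial
for symmetric circuits (`IsSymmetricCircuit.endRatio`).

The GNVW index fits into the same scheme. Two copies `U ⊗ U` commute with the on-site exchange of
the copies, a symmetry of order two with nonvanishing trace, and the squared overlaps of operator
algebras are traces of products of exchanges. Hence `ind(U) = ‖σ 1‖⁻¹` with `σ` the end ratio of the
doubled system (`gnvw_eq`), and the refined index is `‖σ 1‖⁻¹ * τ 1 ^ d_g` (`IsRefinedIndex.eq`).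
Independence of choices and invariance under strong equivalence are then properties of end ratios.

For completeness let `V = U' U†`. Equal indices give `‖σ 1‖ = 1` and `τ 1 ^ N = 1` for `V`. The
operators near a cut that come from the left of the cut form a factor, hence a full matrix algebra
(`exists_isMatrixUnits`). The exchange of two copies of this algebra is the end of the evolved
exchange, so `‖σ 1‖ = 1` says that the algebra is as large as that of the left half of the window.
The end `T` lies in it, and for prime `N` the single number `(tr T) ^ N` determines all `tr (T ^ j)`
up to factors `c ^ j`, because `ζ` and `ζ ^ j` are Galois conjugate (`exists_trace_pow_eq`). So a
symmetric local unitary straightens `V` at the cut (`BoundaryGeometry.exists_straightening`). Once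
all cuts are straightened, what remains of `V` preserves every cell and is a product of symmetric
gates (`exists_two_layers`), which makes `V` a circuit of depth two.

The same Galois argument gives the statement on representations. It breaks down for `N = 4`, where
`ζ` and `ζ ^ 2` are not conjugate: the character values 2 and -2 at the element of order two have
the same square. Shifting one or the other tensor factor of the sites then yields equal refined
indices, while strong equivalence would require one `c` that fits all powers `j`. -/

namespace SpinChain

/-! ### Supports, partial traces and product operators -/

section Support
variable {ι S : Type} [Fintype ι] [DecidableEq ι] [Fintype S] [DecidableEq S]

/-- The configurations on `ι` as pairs of configurations on `X` and off `X`. -/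
def splitConfig (S : Type) (X : Finset ι) :
    (ι → S) ≃ (X → S) × ({i // i ∉ X} → S) :=
  Equiv.piEquivPiSubtypeProd (fun i => i ∈ X) (fun _ => S)

theorem extendOp_eq (X : Finset ι) (o : Op X S) :
    extendOp X o = (o ⊗ₖ (1 : Matrix ({i // i ∉ X} → S) _ ℂ)).submatrix
      (splitConfig S X) (splitConfig S X) := by
  ext f h
  simp only [extendOp, Matrix.of_apply, Matrix.submatrix_apply, Matrix.kroneckerMap_apply,
    splitConfig, Equiv.piEquivPiSubtypeProd_apply, Matrix.one_apply, funext_iff, Subtype.forall]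
  by_cases hf : ∀ i, i ∉ X → f i = h i
  · rw [if_pos hf, if_pos hf, mul_one]
  · rw [if_neg hf, if_neg hf, mul_zero]

/-- An operator on the spins off `X`, tensored with the identity on `X`. -/
def extendCompl (X : Finset ι) (o : Matrix ({i // i ∉ X} → S) ({i // i ∉ X} → S) ℂ) : Op ι S :=
  ((1 : Op X S) ⊗ₖ o).submatrix (splitConfig S X) (splitConfig S X)

theorem extendOp_mul (X : Finset ι) (o o' : Op X S) :
    extendOp X (o * o') = extendOp X o * extendOp X o' := by
  simp only [extendOp_eq, Matrix.submatrix_mul_equiv, ← Matrix.mul_kronecker_mul, mul_one]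

theorem extendOp_one (X : Finset ι) : extendOp X (1 : Op X S) = 1 := by
  simp [extendOp_eq]

theorem extendOp_conjTranspose (X : Finset ι) (o : Op X S) :
    (extendOp X o)ᴴ = extendOp X oᴴ := by
  simp [extendOp_eq, Matrix.conjTranspose_submatrix, Matrix.conjTranspose_kronecker]

theorem extendOp_add (X : Finset ι) (o o' : Op X S) :
    extendOp X (o + o') = extendOp X o + extendOp X o' := by
  simp [extendOp_eq, Matrix.add_kronecker]; rfl

theorem extendOp_smul (X : Finset ι) (c : ℂ) (o : Op X S) :
    extendOp X (c • o) = c • extendOp X o := by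
  simp [extendOp_eq, Matrix.smul_kronecker]; rfl

/-- `extendOp` as a homomorphism of star algebras. -/
def extendHom (X : Finset ι) : Op X S →⋆ₐ[ℂ] Op ι S where
  toFun := extendOp X
  map_one' := extendOp_one X
  map_mul' := extendOp_mul X
  map_zero' := by simpa using extendOp_smul X 0 (0 : Op X S)
  map_add' := extendOp_add X
  commutes' c := by
    rw [Algebra.algebraMap_eq_smul_one, extendOp_smul, extendOp_one, Algebra.algebraMap_eq_smul_one]
  map_star' o := (extendOp_conjTranspose X o).symm

theorem extendHom_apply (X : Finset ι) (o : Op X S) : extendHom X o = extendOp X o := rfl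

theorem extendOp_injective [Nonempty S] (X : Finset ι) :
    Function.Injective (extendOp X : Op X S → Op ι S) := by
  intro o o' h
  ext a b
  let c : {i // i ∉ X} → S := fun _ => Classical.arbitrary S
  have := congrFun (congrFun h ((splitConfig S X).symm (a, c))) ((splitConfig S X).symm (b, c))
  simpa [extendOp_eq] using this

theorem trace_extendOp (X : Finset ι) (o : Op X S) :
    (extendOp X o).trace = o.trace * (Fintype.card ({i // i ∉ X} → S) : ℂ) := by
  rw [extendOp_eq]
  have : ∀ A : Matrix ((X → S) × ({i // i ∉ X} → S)) ((X → S) × ({i // i ∉ X} → S)) ℂ,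
      (A.submatrix (splitConfig S X) (splitConfig S X)).trace = A.trace := fun A =>
    Equiv.sum_comp (splitConfig S X) fun x => A x x
  rw [this, Matrix.trace_kronecker, Matrix.trace_one]

/-- Places two operators with disjoint supports in opposite factors of one Kronecker product.
Commutation and factorization of the trace are immediate from this form. -/
theorem SupportedOn.exists_extendCompl {X Y : Finset ι} (h : Disjoint X Y) {O : Op ι S}
    (hO : SupportedOn Y O) : ∃ o, O = extendCompl X o := by
  obtain ⟨o, rfl⟩ := hO
  refine ⟨Matrix.of fun a b => if ∀ i : {i // i ∉ X}, i.1 ∉ Y → a i = b i then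
    o (fun i => a ⟨i, Finset.disjoint_right.1 h i.2⟩) (fun i => b ⟨i, Finset.disjoint_right.1 h i.2⟩)
    else 0, ?_⟩
  ext f g
  simp only [extendOp, extendCompl, Matrix.of_apply, Matrix.submatrix_apply,
    Matrix.kroneckerMap_apply, splitConfig, Equiv.piEquivPiSubtypeProd_apply, Matrix.one_apply,
    funext_iff, Subtype.forall]
  by_cases h1 : ∀ i ∈ X, f i = g i
  · rw [if_pos h1, one_mul]
    refine if_congr ⟨fun h2 i _ hi => h2 i hi, fun h2 i hi => ?_⟩ rfl rfl
    by_cases hx : i ∈ X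
    · exact h1 i hx
    · exact h2 i hx hi
  · rw [if_neg h1, zero_mul, if_neg]
    exact fun h2 => h1 fun i hi => h2 i (Finset.disjoint_left.1 h hi)

theorem SupportedOn.commute {X Y : Finset ι} (h : Disjoint X Y) {O P : Op ι S}
    (hO : SupportedOn X O) (hP : SupportedOn Y P) : Commute O P := by
  obtain ⟨o, rfl⟩ := hO
  obtain ⟨p, rfl⟩ := hP.exists_extendCompl h
  simp only [Commute, SemiconjBy, extendOp_eq, extendCompl, Matrix.submatrix_mul_equiv,
    ← Matrix.mul_kronecker_mul, mul_one, one_mul]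

/-- All index computations rest on this: an evolved symmetry is a product of pieces with disjoint
supports, so its trace splits into one factor per piece. -/
theorem ntr_mul_of_disjoint [Nonempty S] {X Y : Finset ι} (h : Disjoint X Y) {O P : Op ι S}
    (hO : SupportedOn X O) (hP : SupportedOn Y P) : ntr (O * P) = ntr O * ntr P := by
  obtain ⟨o, rfl⟩ := hO
  obtain ⟨p, rfl⟩ := hP.exists_extendCompl h
  have key : ∀ A : Matrix ((X → S) × ({i // i ∉ X} → S)) ((X → S) × ({i // i ∉ X} → S)) ℂ,
      (A.submatrix (splitConfig S X) (splitConfig S X)).trace = A.trace := fun A =>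
    Equiv.sum_comp (splitConfig S X) fun x => A x x
  have hc : (Fintype.card (ι → S) : ℂ) =
      Fintype.card (X → S) * Fintype.card ({i // i ∉ X} → S) := by
    rw [Fintype.card_congr (splitConfig S X), Fintype.card_prod, Nat.cast_mul]
  simp only [ntr, extendOp_eq, extendCompl, Matrix.submatrix_mul_equiv, ← Matrix.mul_kronecker_mul,
    mul_one, one_mul, key, Matrix.trace_kronecker, Matrix.trace_one, hc]
  have h1 : (Fintype.card (X → S) : ℂ) ≠ 0 := Nat.cast_ne_zero.2 Fintype.card_ne_zero
  have h2 : (Fintype.card ({i // i ∉ X} → S) : ℂ) ≠ 0 := Nat.cast_ne_zero.2 Fintype.card_ne_zero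
  field_simp

theorem ntr_one [Nonempty S] : ntr (1 : Op ι S) = 1 := by
  rw [ntr, Matrix.trace_one, div_self]
  exact Nat.cast_ne_zero.2 Fintype.card_ne_zero

theorem ntr_smul (c : ℂ) (O : Op ι S) : ntr (c • O) = c * ntr O := by
  rw [ntr, Matrix.trace_smul, smul_eq_mul, mul_div_assoc, ntr]

theorem ntr_mul_comm (O P : Op ι S) : ntr (O * P) = ntr (P * O) := by
  rw [ntr, Matrix.trace_mul_comm, ntr]

theorem ntr_conj {U O : Op ι S} (hU : U * Uᴴ = 1) : ntr (Uᴴ * O * U) = ntr O := by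
  rw [ntr_mul_comm, ← mul_assoc, hU, one_mul]

theorem ntr_conjTranspose (O : Op ι S) : ntr Oᴴ = star (ntr O) := by
  simp [ntr, Matrix.trace_conjTranspose]

theorem ntr_sum {α : Type*} (s : Finset α) (f : α → Op ι S) :
    ntr (∑ a ∈ s, f a) = ∑ a ∈ s, ntr (f a) := by
  simp only [ntr, Matrix.trace_sum, Finset.sum_div]

/-! ### Product operators -/

theorem prodOp_mul (A B : ι → Matrix S S ℂ) :
    prodOp A * prodOp B = prodOp fun i => A i * B i := by
  ext f h
  simp only [prodOp, Matrix.mul_apply, Matrix.of_apply, Finset.prod_univ_sum,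
    Fintype.piFinset_univ, Finset.prod_mul_distrib]

theorem prodOp_one : prodOp (fun _ : ι => (1 : Matrix S S ℂ)) = 1 := by
  ext f h
  simp only [prodOp, Matrix.of_apply, Matrix.one_apply, Finset.prod_ite_zero,
    Finset.prod_const_one, Finset.mem_univ, true_imp_iff, funext_iff]

theorem prodOp_conjTranspose (A : ι → Matrix S S ℂ) :
    (prodOp A)ᴴ = prodOp fun i => (A i)ᴴ := by
  ext f h
  simp [prodOp, Matrix.conjTranspose_apply]

theorem trace_prodOp (A : ι → Matrix S S ℂ) : (prodOp A).trace = ∏ i, (A i).trace := by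
  simp only [prodOp, Matrix.trace, Matrix.diag_apply, Matrix.of_apply, Finset.prod_univ_sum,
    Fintype.piFinset_univ]

/-- The operator that acts as `m` on the site `i`. -/
abbrev siteOp (i : ι) (m : Matrix S S ℂ) : Op ι S := onSites {i} m

theorem siteOp_apply (i : ι) (m : Matrix S S ℂ) (f h : ι → S) :
    siteOp i m f h = if ∀ j, j ≠ i → f j = h j then m (f i) (h i) else 0 := by
  simp only [siteOp, onSites, prodOp, Matrix.of_apply, Finset.mem_singleton]
  rw [Fintype.prod_eq_mul_prod_compl i]
  simp only [if_true]
  rw [Finset.prod_congr rfl (g := fun j => if f j = h j then (1 : ℂ) else 0)]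
  · rw [Finset.prod_ite_zero]
    simp
  · intro j hj
    simp only [Finset.mem_compl, Finset.mem_singleton] at hj
    simp [hj, Matrix.one_apply]

theorem supportedOn_singleton {i : ι} {O : Op ι S} :
    SupportedOn {i} O ↔ ∃ m, O = siteOp i m := by
  constructor
  · rintro ⟨o, rfl⟩
    refine ⟨Matrix.of fun a b => o (fun _ => a) (fun _ => b), ?_⟩
    ext f h
    rw [siteOp_apply, extendOp]
    simp only [Finset.mem_singleton, Matrix.of_apply]
    refine if_congr Iff.rfl ?_ rfl
    congr 1 <;> · funext j; rw [Finset.mem_singleton.1 j.2]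
  · rintro ⟨m, rfl⟩
    refine ⟨Matrix.of fun a b => m (a ⟨i, by simp⟩) (b ⟨i, by simp⟩), ?_⟩
    ext f h
    rw [siteOp_apply, extendOp]
    simp only [Finset.mem_singleton, Matrix.of_apply]

theorem mul_siteOp_single_apply (O : Op ι S) (i : ι) (a b : S) (f h : ι → S) :
    (O * siteOp i (Matrix.single a b 1)) f h =
      if h i = b then O f (Function.update h i a) else 0 := by
  rw [Matrix.mul_apply, Finset.sum_eq_single (Function.update h i a)]
  · rw [siteOp_apply, if_pos (fun j hj => by simp [hj])]
    by_cases hb : h i = b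
    · simp [hb]
    · simp [hb, Matrix.single_apply, Ne.symm hb]
  · intro g _ hg
    rw [siteOp_apply]
    split_ifs with h1
    · by_cases ha : a = g i
      · exact absurd (by funext j; by_cases hj : j = i <;> simp_all) hg
      · simp [Matrix.single_apply, ha]
    · simp
  · simp

theorem siteOp_single_mul_apply (O : Op ι S) (i : ι) (a b : S) (f h : ι → S) :
    (siteOp i (Matrix.single a b 1) * O) f h =
      if f i = a then O (Function.update f i b) h else 0 := by
  rw [Matrix.mul_apply, Finset.sum_eq_single (Function.update f i b)]
  · rw [siteOp_apply, if_pos (fun j hj => by simp [hj])]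
    by_cases hb : f i = a
    · simp [hb]
    · simp [hb, Matrix.single_apply, Ne.symm hb]
  · intro g _ hg
    rw [siteOp_apply]
    split_ifs with h1
    · by_cases ha : b = g i
      · refine absurd ?_ hg
        funext j
        by_cases hj : j = i
        · subst hj; simp [ha]
        · simp [hj, h1 j hj]
      · simp [Matrix.single_apply, ha]
    · simp
  · simp

/-- An operator is supported on `X` iff it commutes with all one-site operators off `X`. -/
theorem supportedOn_iff {X : Finset ι} {O : Op ι S} :
    SupportedOn X O ↔ ∀ i, i ∉ X → ∀ m : Matrix S S ℂ, Commute O (siteOp i m) := by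
  constructor
  · intro hO i hi m
    exact hO.commute (Finset.disjoint_singleton_right.2 hi) (supportedOn_singleton.2 ⟨m, rfl⟩)
  · intro hO
    -- Comparing entries of both products with a matrix unit at `i` yields two facts: an entry
    -- vanishes unless `f i = h i`, and it does not depend on this common value.
    have key : ∀ i, i ∉ X → ∀ (a : S) (f h : ι → S),
        O f (Function.update h i a) = if f i = a then O (Function.update f i (h i)) h else 0 := by
      intro i hi a f h
      have := congrFun (congrFun (hO i hi (Matrix.single a (h i) 1)).eq f) h
      rwa [mul_siteOp_single_apply, siteOp_single_mul_apply, if_pos rfl] at this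
    have hzero : ∀ i, i ∉ X → ∀ f h : ι → S, f i ≠ h i → O f h = 0 := by
      intro i hi f h hne
      have := key i hi (h i) f h
      rwa [Function.update_eq_self, if_neg hne] at this
    have hmove : ∀ i, i ∉ X → ∀ (t : S) (f h : ι → S), f i = h i →
        O (Function.update f i t) (Function.update h i t) = O f h := by
      intro i hi t f h he
      have := key i hi (f i) f (Function.update h i t)
      rw [if_pos rfl, Function.update_idem, he, Function.update_eq_self, Function.update_self] at this
      exact this.symm
    by_cases hne : Nonempty (ι → S)
    · obtain ⟨c⟩ := hne
      -- The local operator is read off with the configuration off `X` frozen to an arbitrary `c`;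
      -- `hglue` freezes the sites one at a time.
      refine ⟨Matrix.of fun a b => O ((splitConfig S X).symm (a, fun i => c i))
        ((splitConfig S X).symm (b, fun i => c i)), ?_⟩
      have hglue : ∀ (T : Finset ι), (∀ i ∈ T, i ∉ X) → ∀ f h : ι → S,
          (∀ i, i ∉ X → f i = h i) →
          O (fun j => if j ∈ T then c j else f j) (fun j => if j ∈ T then c j else h j) = O f h := by
        intro T
        induction T using Finset.induction with
        | empty => intro _ f h _; simp
        | insert i T hi ih =>
          intro hT f h hfh
          rw [← ih (fun j hj => hT j (Finset.mem_insert_of_mem hj)) f h hfh,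
            ← hmove i (hT i (Finset.mem_insert_self _ _)) (c i)
              (fun j => if j ∈ T then c j else f j)]
          · congr 1 <;>
            · funext j
              by_cases hj : j = i
              · subst hj; simp
              · simp [hj]
          · simp [hi, hfh i (hT i (Finset.mem_insert_self _ _))]
      ext f h
      rw [extendOp]
      simp only [Matrix.of_apply]
      split_ifs with hfh
      · rw [← hglue Xᶜ (fun i hi => Finset.mem_compl.1 hi) f h hfh]
        congr 1 <;>
        · funext j
          by_cases hj : j ∈ X <;> simp [splitConfig, Equiv.piEquivPiSubtypeProd, hj]
      · push Not at hfh
        obtain ⟨i, hi, hne⟩ := hfh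
        exact hzero i hi f h hne
    · refine ⟨0, ?_⟩
      ext f
      exact absurd ⟨f⟩ hne

theorem SupportedOn.mono {X Y : Finset ι} (h : X ⊆ Y) {O : Op ι S} (hO : SupportedOn X O) :
    SupportedOn Y O :=
  supportedOn_iff.2 fun i hi m => supportedOn_iff.1 hO i (fun hx => hi (h hx)) m

theorem SupportedOn.inter {X Y Z : Finset ι} {O : Op ι S} (hX : SupportedOn X O)
    (hY : SupportedOn Y O) (h : ∀ i, i ∈ X → i ∈ Y → i ∈ Z) : SupportedOn Z O := by
  refine supportedOn_iff.2 fun i hi m => ?_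
  by_cases hx : i ∈ X
  · exact supportedOn_iff.1 hY i (fun hy => hi (h i hx hy)) m
  · exact supportedOn_iff.1 hX i hx m

theorem SupportedOn.mul {X : Finset ι} {O P : Op ι S} (hO : SupportedOn X O)
    (hP : SupportedOn X P) : SupportedOn X (O * P) :=
  supportedOn_iff.2 fun i hi m => (supportedOn_iff.1 hO i hi m).mul_left (supportedOn_iff.1 hP i hi m)

theorem SupportedOn.add {X : Finset ι} {O P : Op ι S} (hO : SupportedOn X O)
    (hP : SupportedOn X P) : SupportedOn X (O + P) :=
  supportedOn_iff.2 fun i hi m => (supportedOn_iff.1 hO i hi m).add_left (supportedOn_iff.1 hP i hi m)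

theorem SupportedOn.smul {X : Finset ι} {O : Op ι S} (c : ℂ) (hO : SupportedOn X O) :
    SupportedOn X (c • O) :=
  supportedOn_iff.2 fun i hi m => (supportedOn_iff.1 hO i hi m).smul_left c

theorem supportedOn_one (X : Finset ι) : SupportedOn X (1 : Op ι S) :=
  supportedOn_iff.2 fun _ _ _ => Commute.one_left _

theorem supportedOn_univ (O : Op ι S) : SupportedOn Finset.univ O :=
  supportedOn_iff.2 fun i hi => absurd (Finset.mem_univ i) hi

theorem SupportedOn.pow {X : Finset ι} {O : Op ι S} (hO : SupportedOn X O) (n : ℕ) :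
    SupportedOn X (O ^ n) :=
  supportedOn_iff.2 fun i hi m => (supportedOn_iff.1 hO i hi m).pow_left n

theorem SupportedOn.sum {α : Type*} {X : Finset ι} (s : Finset α) {f : α → Op ι S}
    (h : ∀ a ∈ s, SupportedOn X (f a)) : SupportedOn X (∑ a ∈ s, f a) :=
  supportedOn_iff.2 fun i hi m =>
    Commute.sum_left _ _ _ fun a ha => supportedOn_iff.1 (h a ha) i hi m

theorem SupportedOn.conjTranspose {X : Finset ι} {O : Op ι S} (hO : SupportedOn X O) :
    SupportedOn X Oᴴ := by
  obtain ⟨o, rfl⟩ := hO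
  exact ⟨oᴴ, extendOp_conjTranspose X o⟩

theorem supportedOn_siteOp {X : Finset ι} {i : ι} (hi : i ∈ X) (m : Matrix S S ℂ) :
    SupportedOn X (siteOp i m) :=
  (supportedOn_singleton.2 ⟨m, rfl⟩).mono (Finset.singleton_subset_iff.2 hi)

theorem supportedOn_prodOp {X : Finset ι} {A : ι → Matrix S S ℂ} (h : ∀ i, i ∉ X → A i = 1) :
    SupportedOn X (prodOp A) := by
  refine supportedOn_iff.2 fun i hi m => ?_
  rw [Commute, SemiconjBy, siteOp, onSites, prodOp_mul, prodOp_mul]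
  congr 1
  funext j
  by_cases hj : j = i
  · subst hj; simp [h j hi]
  · simp [hj]

theorem supportedOn_onSites (I : Finset ι) (m : Matrix S S ℂ) : SupportedOn I (onSites I m) :=
  supportedOn_prodOp fun i hi => if_neg hi

theorem onSites_mul (I : Finset ι) (m m' : Matrix S S ℂ) :
    onSites I m * onSites I m' = onSites I (m * m') := by
  rw [onSites, onSites, prodOp_mul, onSites]
  congr 1; funext i; split_ifs <;> simp

theorem onSites_one (I : Finset ι) : onSites I (1 : Matrix S S ℂ) = 1 := by
  rw [onSites, ← prodOp_one]
  congr 1; funext i; split_ifs <;> simp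

theorem onSites_empty (m : Matrix S S ℂ) : onSites (∅ : Finset ι) m = 1 := by
  rw [onSites, ← prodOp_one]
  congr 1

theorem onSites_pow (I : Finset ι) (m : Matrix S S ℂ) (n : ℕ) :
    onSites I m ^ n = onSites I (m ^ n) := by
  induction n with
  | zero => rw [pow_zero, pow_zero, onSites_one]
  | succ n ih => rw [pow_succ, pow_succ, ih, onSites_mul]

theorem onSites_conjTranspose (I : Finset ι) (m : Matrix S S ℂ) :
    (onSites I m)ᴴ = onSites I mᴴ := by
  rw [onSites, prodOp_conjTranspose, onSites]
  congr 1; funext i; split_ifs <;> simp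

theorem onSites_union {I J K : Finset ι} (m : Matrix S S ℂ) (hd : Disjoint I J)
    (h : ∀ i, i ∈ K ↔ i ∈ I ∨ i ∈ J) : onSites I m * onSites J m = onSites K m := by
  rw [onSites, onSites, prodOp_mul, onSites]
  congr 1; funext i
  have hd' : i ∈ I → i ∉ J := fun hi => Finset.disjoint_left.1 hd hi
  simp only [h i]
  by_cases hi : i ∈ I
  · simp [hi, hd' hi]
  · simp [hi]

theorem onSites_univ (m : Matrix S S ℂ) : onSites Finset.univ m = prodOp fun _ : ι => m := by
  simp [onSites]

theorem onSites_commute (I J : Finset ι) (m : Matrix S S ℂ) :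
    Commute (onSites I m) (onSites J m) := by
  rw [Commute, SemiconjBy, onSites, onSites, prodOp_mul, prodOp_mul]
  congr 1; funext i; split_ifs <;> simp

theorem ntr_onSites [Nonempty S] (I : Finset ι) (m : Matrix S S ℂ) :
    ntr (onSites I m) = (m.trace / Fintype.card S) ^ I.card := by
  have hc : (Fintype.card S : ℂ) ≠ 0 := Nat.cast_ne_zero.2 Fintype.card_ne_zero
  rw [ntr, onSites, trace_prodOp, Fintype.card_fun]
  have : ∀ i, (if i ∈ I then m else 1).trace =
      (if i ∈ I then m.trace / Fintype.card S else 1) * (Fintype.card S : ℂ) := by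
    intro i; split_ifs
    · field_simp
    · simp
  rw [Finset.prod_congr rfl fun i _ => this i, Finset.prod_mul_distrib, Finset.prod_ite_mem]
  simp [hc, div_pow]

/-- An operator supported nowhere is a scalar. -/
theorem SupportedOn.exists_eq_smul_one {O : Op ι S} (hO : SupportedOn ∅ O) :
    ∃ c : ℂ, O = c • 1 := by
  obtain ⟨o, rfl⟩ := hO
  refine ⟨o default default, ?_⟩
  rw [show o = o default default • 1 from ?_, extendOp_smul, extendOp_one]
  · simp
  · ext a b
    rw [Subsingleton.elim a default, Subsingleton.elim b default]
    simp

end Support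

theorem mul_ct {n : Type} [Fintype n] [DecidableEq n] {U : Matrix n n ℂ}
    (hU : U ∈ Matrix.unitaryGroup n ℂ) : U * Uᴴ = 1 := Matrix.mem_unitaryGroup_iff.1 hU

theorem ct_mul {n : Type} [Fintype n] [DecidableEq n] {U : Matrix n n ℂ}
    (hU : U ∈ Matrix.unitaryGroup n ℂ) : Uᴴ * U = 1 := Matrix.mem_unitaryGroup_iff'.1 hU

theorem ct_mem {n : Type} [Fintype n] [DecidableEq n] {U : Matrix n n ℂ}
    (hU : U ∈ Matrix.unitaryGroup n ℂ) : Uᴴ ∈ Matrix.unitaryGroup n ℂ :=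
  Matrix.mem_unitaryGroup_iff.2 (by
    rw [Matrix.star_eq_conjTranspose, Matrix.conjTranspose_conjTranspose, ct_mul hU])

theorem smul_mem_unitary {n : Type} [Fintype n] [DecidableEq n] {U : Matrix n n ℂ}
    (hU : U ∈ Matrix.unitaryGroup n ℂ) {c : ℂ} (hc : ‖c‖ = 1) :
    c • U ∈ Matrix.unitaryGroup n ℂ := by
  refine Matrix.mem_unitaryGroup_iff.2 ?_
  rw [Matrix.star_eq_conjTranspose, Matrix.conjTranspose_smul, Matrix.smul_mul, Matrix.mul_smul,
    mul_ct hU, smul_smul, Complex.star_def, Complex.mul_conj, Complex.normSq_eq_norm_sq, hc]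
  simp

theorem norm_eq_one_of_smul_mem_unitary {n : Type} [Fintype n] [DecidableEq n] [Nonempty n]
    {U : Matrix n n ℂ} (hU : U ∈ Matrix.unitaryGroup n ℂ) {c : ℂ}
    (h : c • U ∈ Matrix.unitaryGroup n ℂ) : ‖c‖ = 1 := by
  have := mul_ct h
  rw [Matrix.conjTranspose_smul, Matrix.smul_mul, Matrix.mul_smul,
    mul_ct hU, smul_smul, Complex.star_def, Complex.mul_conj, Complex.normSq_eq_norm_sq] at this
  have h2 := congrFun (congrFun this (Classical.arbitrary n)) (Classical.arbitrary n)
  simp only [Matrix.smul_apply, Matrix.one_apply_eq, smul_eq_mul, mul_one] at h2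
  have h3 : ‖c‖ ^ 2 = 1 := by exact_mod_cast h2
  nlinarith [norm_nonneg c]

/-! ### Heisenberg evolution -/

section Heis
variable {n : Type} [Fintype n] [DecidableEq n]

/-- The evolved observable `U† O U`. -/
def heis (U O : Matrix n n ℂ) : Matrix n n ℂ := Uᴴ * O * U

variable {U V : Matrix n n ℂ}

theorem heis_mul (hU : U ∈ Matrix.unitaryGroup n ℂ) (A B : Matrix n n ℂ) :
    heis U (A * B) = heis U A * heis U B := by
  have : heis U A * heis U B = Uᴴ * A * (U * Uᴴ) * B * U := by simp only [heis, mul_assoc]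
  rw [this, mul_ct hU, mul_one, heis, mul_assoc Uᴴ A B]

theorem heis_one (hU : U ∈ Matrix.unitaryGroup n ℂ) : heis U 1 = 1 := by
  rw [heis, mul_one, ct_mul hU]

theorem heis_ct (A : Matrix n n ℂ) : (heis U A)ᴴ = heis U Aᴴ := by
  simp [heis, Matrix.conjTranspose_mul, mul_assoc]

theorem heis_smul (c : ℂ) (A : Matrix n n ℂ) : heis U (c • A) = c • heis U A := by
  simp [heis]

theorem heis_pow (hU : U ∈ Matrix.unitaryGroup n ℂ) (A : Matrix n n ℂ) (k : ℕ) :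
    heis U A ^ k = heis U (A ^ k) := by
  induction k with
  | zero => rw [pow_zero, pow_zero, heis_one hU]
  | succ k ih => rw [pow_succ, pow_succ, ih, heis_mul hU]

theorem heis_heis (A : Matrix n n ℂ) : heis U (heis V A) = heis (V * U) A := by
  simp [heis, Matrix.conjTranspose_mul, mul_assoc]

theorem heis_ct_heis (hU : U ∈ Matrix.unitaryGroup n ℂ) (A : Matrix n n ℂ) :
    heis Uᴴ (heis U A) = A := by
  rw [heis_heis, mul_ct hU, heis]; simp

theorem heis_heis_ct (hU : U ∈ Matrix.unitaryGroup n ℂ) (A : Matrix n n ℂ) :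
    heis U (heis Uᴴ A) = A := by
  rw [heis_heis, ct_mul hU, heis]; simp

theorem heis_mem (hU : U ∈ Matrix.unitaryGroup n ℂ) {A : Matrix n n ℂ}
    (hA : A ∈ Matrix.unitaryGroup n ℂ) : heis U A ∈ Matrix.unitaryGroup n ℂ :=
  mul_mem (mul_mem (ct_mem hU) hA) hU

theorem heis_commute (hU : U ∈ Matrix.unitaryGroup n ℂ) {A B : Matrix n n ℂ} (h : Commute A B) :
    Commute (heis U A) (heis U B) := by
  rw [Commute, SemiconjBy, ← heis_mul hU, ← heis_mul hU, h.eq]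

theorem commute_heis_iff (hU : U ∈ Matrix.unitaryGroup n ℂ) {A B : Matrix n n ℂ} :
    Commute (heis U A) B ↔ Commute A (heis Uᴴ B) := by
  constructor
  · intro h
    have := heis_commute (ct_mem hU) h
    rwa [heis_ct_heis hU] at this
  · intro h
    have := heis_commute hU h
    rwa [heis_heis_ct hU] at this

theorem heis_of_commute (hU : U ∈ Matrix.unitaryGroup n ℂ) {A : Matrix n n ℂ} (h : Commute U A) :
    heis U A = A := by
  rw [heis, mul_assoc, ← h.eq, ← mul_assoc, ct_mul hU, one_mul]

end Heis

/-! ### Expansion over a system of matrix units -/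

section Units
variable {A κ : Type} [Ring A] [Fintype κ] [DecidableEq κ]

/-- A system of matrix units. -/
def IsMatrixUnits (e : κ → κ → A) : Prop :=
  (∀ a b c d, e a b * e c d = if b = c then e a d else 0) ∧ ∑ a, e a a = 1

/-- The coefficient of `x` with respect to a system of matrix units. -/
def slice (e : κ → κ → A) (x : A) (p q : κ) : A := ∑ r, e r p * x * e q r

variable {e : κ → κ → A}

/-- In either product only one summand survives, and both collapse to `e a p * x * e q b`. Together
with `IsMatrixUnits.sum_slice` this expands every element over the matrix units with coefficients in
their commutant. -/
theorem IsMatrixUnits.slice_commute (he : IsMatrixUnits e) (x : A) (p q a b : κ) :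
    Commute (slice e x p q) (e a b) := by
  have h1 : slice e x p q * e a b = e a p * x * e q b := by
    rw [slice, Finset.sum_mul, Finset.sum_eq_single a]
    · rw [mul_assoc, he.1, if_pos rfl]
    · intro r _ hr
      rw [mul_assoc, he.1, if_neg hr, mul_zero]
    · simp
  have h2 : e a b * slice e x p q = e a p * x * e q b := by
    rw [slice, Finset.mul_sum, Finset.sum_eq_single b]
    · rw [← mul_assoc, ← mul_assoc, he.1, if_pos rfl]
    · intro r _ hr
      rw [← mul_assoc, ← mul_assoc, he.1, if_neg (Ne.symm hr), zero_mul, zero_mul]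
    · simp
  rw [Commute, SemiconjBy, h1, h2]

theorem IsMatrixUnits.sum_slice (he : IsMatrixUnits e) (x : A) :
    ∑ p, ∑ q, slice e x p q * e p q = x := by
  have h1 : ∀ p q, slice e x p q * e p q = e p p * x * e q q := by
    intro p q
    rw [slice, Finset.sum_mul, Finset.sum_eq_single p]
    · rw [mul_assoc, he.1, if_pos rfl]
    · intro r _ hr
      rw [mul_assoc, he.1, if_neg hr, mul_zero]
    · simp
  simp only [h1]
  simp only [← Finset.mul_sum, he.2, mul_one, ← Finset.sum_mul, one_mul]

/-- Relations with elements of the commutant of the units pass from `x` to its coefficients. An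
intertwiner thus has intertwining slices, which are supported on a smaller region. -/
theorem slice_semiconj {x y z : A} (hy : ∀ a b, Commute y (e a b)) (hz : ∀ a b, Commute z (e a b))
    (h : x * y = z * x) (p q : κ) : slice e x p q * y = z * slice e x p q := by
  rw [slice, Finset.sum_mul, Finset.mul_sum]
  refine Finset.sum_congr rfl fun r _ => ?_
  rw [mul_assoc, ← (hy q r).eq, ← mul_assoc, mul_assoc _ x y, h, ← mul_assoc, ← mul_assoc,
    ← (hz r p).eq]
  simp only [mul_assoc]

end Units

/-! ### Factoring unitaries and the ends of an evolved symmetry -/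

section Ends
variable {ι S : Type} [Fintype ι] [DecidableEq ι] [Fintype S] [DecidableEq S]

/-- The matrix units of the algebra of operators supported on `F`. -/
def unitOp (F : Finset ι) (a b : F → S) : Op ι S := extendOp F (Matrix.single a b 1)

theorem isMatrixUnits_single {κ : Type} [Fintype κ] [DecidableEq κ] :
    IsMatrixUnits fun a b : κ => Matrix.single a b (1 : ℂ) := by
  refine ⟨fun a b c d => ?_, ?_⟩
  · split_ifs with h
    · subst h; simp
    · simp [h]
  · ext i j
    rw [Matrix.sum_apply]
    beta_reduce
    by_cases h : i = j
    · subst h; simp [Matrix.single_apply]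
    · rw [Matrix.one_apply_ne h]
      refine Finset.sum_eq_zero fun x _ => ?_
      rw [Matrix.single_apply, if_neg]
      rintro ⟨rfl, rfl⟩; exact h rfl

theorem isMatrixUnits_map {A B κ : Type} [Ring A] [Ring B] [Fintype κ] [DecidableEq κ]
    {e : κ → κ → A} (he : IsMatrixUnits e) {F : Type} [FunLike F A B] [RingHomClass F A B] (f : F) :
    IsMatrixUnits fun a b => f (e a b) := by
  refine ⟨fun a b c d => ?_, ?_⟩
  · rw [← map_mul, he.1]; split_ifs <;> simp
  · rw [← map_sum, he.2, map_one]

theorem isMatrixUnits_unitOp (F : Finset ι) : IsMatrixUnits (unitOp F : (F → S) → (F → S) → Op ι S) :=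
  isMatrixUnits_map isMatrixUnits_single (extendHom F)

theorem supportedOn_unitOp (F : Finset ι) (a b : F → S) : SupportedOn F (unitOp F a b) := ⟨_, rfl⟩

theorem SupportedOn.eq_sum_unitOp {F : Finset ι} {O : Op ι S} (hO : SupportedOn F O) :
    ∃ o : Op F S, O = ∑ a, ∑ b, o a b • unitOp F a b := by
  obtain ⟨o, rfl⟩ := hO
  refine ⟨o, ?_⟩
  rw [← extendHom_apply]
  conv_lhs => rw [Matrix.matrix_eq_sum_single o]
  rw [map_sum]
  refine Finset.sum_congr rfl fun a _ => ?_
  rw [map_sum]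
  refine Finset.sum_congr rfl fun b _ => ?_
  rw [show Matrix.single a b (o a b) = o a b • Matrix.single a b (1 : ℂ) by simp, map_smul]
  rfl

theorem commute_of_commute_unitOp {F : Finset ι} {O X : Op ι S} (hO : SupportedOn F O)
    (h : ∀ a b, Commute X (unitOp F a b)) : Commute X O := by
  obtain ⟨o, rfl⟩ := hO.eq_sum_unitOp
  exact Commute.sum_right _ _ _ fun a _ => Commute.sum_right _ _ _ fun b _ => (h a b).smul_right _

theorem supportedOn_compl_of_commute {E : Finset ι} {O : Op ι S}
    (h : ∀ P, SupportedOn E P → Commute O P) : SupportedOn Eᶜ O :=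
  supportedOn_iff.2 fun i hi m => h _ (supportedOn_siteOp (by simpa using hi) m)

theorem SupportedOn.commute_compl {E : Finset ι} {O P : Op ι S} (hO : SupportedOn Eᶜ O)
    (hP : SupportedOn E P) : Commute O P := hO.commute disjoint_compl_left hP

theorem SupportedOn.exists_smul_of_disjoint {E F : Finset ι} (h : Disjoint E F) {O : Op ι S}
    (hE : SupportedOn E O) (hF : SupportedOn F O) : ∃ c : ℂ, O = c • 1 :=
  (hE.inter hF fun _ h1 h2 => absurd h2 (Finset.disjoint_left.1 h h1)).exists_eq_smul_one

theorem supportedOn_slice {F : Finset ι} (x : Op ι S) (p q : F → S) :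
    SupportedOn Fᶜ (slice (unitOp F) x p q) :=
  supportedOn_compl_of_commute fun _ hP =>
    commute_of_commute_unitOp hP fun a b => (isMatrixUnits_unitOp F).slice_commute x p q a b

/-- A diagonal entry of `Zᴴ * Z` is the squared norm of a column, so `c` is real and, a nonzero
column being available, positive. Dividing by its square root gives the unitary. -/
theorem exists_smul_mem_unitary {n : Type} [Fintype n] [DecidableEq n] {Z : Matrix n n ℂ} {c : ℂ}
    (hZ : Z ≠ 0) (h : Zᴴ * Z = c • 1) : ∃ r : ℂ, r ≠ 0 ∧ r • Z ∈ Matrix.unitaryGroup n ℂ := by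
  obtain ⟨i, j, hij⟩ : ∃ i j, Z i j ≠ 0 := by
    by_contra hcon; push Not at hcon; exact hZ (by ext i j; exact hcon i j)
  have h1 := congrFun (congrFun h j) j
  simp only [Matrix.mul_apply, Matrix.conjTranspose_apply, Matrix.smul_apply, Matrix.one_apply_eq,
    smul_eq_mul, mul_one] at h1
  have h2 : c = ((∑ k, ‖Z k j‖ ^ 2 : ℝ) : ℂ) := by
    rw [← h1]; push_cast
    refine Finset.sum_congr rfl fun k _ => ?_
    rw [Complex.star_def, ← Complex.normSq_eq_conj_mul_self, Complex.normSq_eq_norm_sq]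
    push_cast; rfl
  set t : ℝ := ∑ k, ‖Z k j‖ ^ 2 with ht
  have htpos : 0 < t := by
    have h3 : ‖Z i j‖ ^ 2 ≤ t :=
      Finset.single_le_sum (f := fun k => ‖Z k j‖ ^ 2) (fun k _ => sq_nonneg _) (Finset.mem_univ i)
    have : 0 < ‖Z i j‖ ^ 2 := pow_pos (norm_pos_iff.2 hij) 2
    linarith
  have hs : Real.sqrt t ≠ 0 := (Real.sqrt_pos.2 htpos).ne'
  refine ⟨((Real.sqrt t)⁻¹ : ℝ), by exact_mod_cast inv_ne_zero hs, Matrix.mem_unitaryGroup_iff'.2 ?_⟩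
  rw [Matrix.star_eq_conjTranspose, Matrix.conjTranspose_smul, Matrix.smul_mul, Matrix.mul_smul, h,
    smul_smul, smul_smul, h2, Complex.star_def, Complex.conj_ofReal]
  have : (Real.sqrt t)⁻¹ * (Real.sqrt t)⁻¹ * t = 1 := by
    nth_rewrite 3 [← Real.mul_self_sqrt htpos.le]
    field_simp
  rw [show (((Real.sqrt t)⁻¹ : ℝ) : ℂ) * (((Real.sqrt t)⁻¹ : ℝ) : ℂ) * (t : ℂ) = 1 by
    exact_mod_cast this, one_smul]

/-- A unitary that normalizes the operators supported on `E` is a product of unitaries supported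
on `E` and off `E`. -/
theorem exists_factor [Nonempty S] {X : Op ι S} (hX : X ∈ Matrix.unitaryGroup (ι → S) ℂ)
    {E : Finset ι} (h : ∀ O, SupportedOn E O → SupportedOn E (X * O * Xᴴ)) :
    ∃ T ∈ Matrix.unitaryGroup (ι → S) ℂ, SupportedOn E T ∧ SupportedOn Eᶜ (Tᴴ * X) := by
  -- The slices along the complement of `E` reassemble to `X`, so they cannot all vanish.
  have hex : ∃ p q, slice (unitOp Eᶜ) X p q ≠ 0 := by
    by_contra hcon
    push Not at hcon
    have := (isMatrixUnits_unitOp (S := S) Eᶜ).sum_slice X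
    simp only [hcon, zero_mul, Finset.sum_const_zero] at this
    have h2 := mul_ct hX
    rw [← this, zero_mul] at h2
    exact zero_ne_one h2
  obtain ⟨p, q, hpq⟩ := hex
  set Z := slice (unitOp Eᶜ) X p q with hZ
  have hZE : SupportedOn E Z := by simpa using supportedOn_slice (F := Eᶜ) X p q
  -- The slice `Z` lives on `E` and implements there the same automorphism as `X`. Hence `Zᴴ * Z`
  -- commutes with all operators on `E` and is a scalar, as in the Skolem–Noether theorem.
  have hint : ∀ O, SupportedOn E O → Z * O = (X * O * Xᴴ) * Z := by
    intro O hO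
    refine slice_semiconj (fun a b => (SupportedOn.commute_compl (supportedOn_unitOp Eᶜ a b) hO).symm)
      (fun a b => (SupportedOn.commute_compl (supportedOn_unitOp Eᶜ a b) (h O hO)).symm) ?_ p q
    rw [mul_assoc _ Xᴴ X, ct_mul hX, mul_one]
  have hint2 : ∀ O, SupportedOn E O → O * Zᴴ = Zᴴ * (X * O * Xᴴ) := by
    intro O hO
    have := congrArg Matrix.conjTranspose (hint Oᴴ hO.conjTranspose)
    simpa [Matrix.conjTranspose_mul, mul_assoc] using this
  obtain ⟨c, hc⟩ : ∃ c : ℂ, Zᴴ * Z = c • 1 := by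
    refine SupportedOn.exists_smul_of_disjoint (disjoint_compl_right (a := E))
      (hZE.conjTranspose.mul hZE) (supportedOn_compl_of_commute fun O hO => ?_)
    rw [Commute, SemiconjBy, mul_assoc, hint O hO, ← mul_assoc, ← hint2 O hO, mul_assoc]
  obtain ⟨r, hr, hrZ⟩ := exists_smul_mem_unitary hpq hc
  refine ⟨r • Z, hrZ, hZE.smul r, supportedOn_compl_of_commute fun O hO => ?_⟩
  rw [Matrix.conjTranspose_smul, Matrix.smul_mul]
  refine Commute.smul_left ?_ _
  rw [Commute, SemiconjBy, ← mul_assoc, hint2 O hO]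
  simp only [mul_assoc, ct_mul hX, mul_one]

/-! ### Locality -/

/-- `U` spreads one-site operators at `i` at most to the sites `j` with `N i j`. -/
def IsLocal (N : ι → ι → Prop) (U : Op ι S) : Prop :=
  U ∈ Matrix.unitaryGroup (ι → S) ℂ ∧
    ∀ i j, ¬ N i j → ∀ m m' : Matrix S S ℂ, Commute (heis U (siteOp i m)) (siteOp j m')

variable {N : ι → ι → Prop} {U : Op ι S}

theorem IsLocal.ct (hN : ∀ i j, N i j → N j i) (hU : IsLocal N U) : IsLocal N Uᴴ :=
  ⟨ct_mem hU.1, fun i j hij m m' =>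
    ((commute_heis_iff hU.1).1 (hU.2 j i (fun h => hij (hN _ _ h)) m' m)).symm⟩

/-- The evolved operator commutes with a site `j` iff `O` commutes with the backward evolution of
that site. By locality the latter avoids `X` when `j` is not in `Y`. Locality of one-site operators
therefore suffices for all regions. -/
theorem IsLocal.supportedOn (hN : ∀ i j, N i j → N j i) (hU : IsLocal N U) {X Y : Finset ι}
    (h : ∀ i ∈ X, ∀ j, N i j → j ∈ Y) {O : Op ι S} (hO : SupportedOn X O) :
    SupportedOn Y (heis U O) := by
  refine supportedOn_iff.2 fun j hj m => (commute_heis_iff hU.1).2 ?_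
  refine hO.commute (disjoint_compl_right (a := X)) (supportedOn_iff.2 fun i hi m' => ?_)
  have hi : i ∈ X := by simpa using hi
  exact (hU.ct hN).2 j i (fun hji => hj (h i hi j (hN _ _ hji))) m m'

theorem SupportedOn.conj_onSites {Y J J' : Finset ι} {O : Op ι S} (hO : SupportedOn Y O)
    {M : Matrix S S ℂ} (hM : M ∈ Matrix.unitaryGroup S ℂ) (h : ∀ i ∈ Y, (i ∈ J ↔ i ∈ J')) :
    onSites J M * O * (onSites J M)ᴴ = onSites J' M * O * (onSites J' M)ᴴ := by
  have key : ∀ J : Finset ι, onSites J M * O * (onSites J M)ᴴ =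
      onSites (J ∩ Y) M * O * (onSites (J ∩ Y) M)ᴴ := by
    intro J
    have h1 : onSites (J ∩ Y) M * onSites (J \ Y) M = onSites J M :=
      onSites_union M (Finset.disjoint_left.2 (by simp; tauto)) (by intro i; simp; tauto)
    have h2 : Commute (onSites (J \ Y) M) O :=
      (supportedOn_onSites _ M).commute (Finset.disjoint_left.2 (by simp)) hO
    have h3 : onSites (J \ Y) M * (onSites (J \ Y) M)ᴴ = 1 := by
      rw [onSites_conjTranspose, onSites_mul, mul_ct hM, onSites_one]
    calc _ = onSites (J ∩ Y) M * (onSites (J \ Y) M * O) * ((onSites (J \ Y) M)ᴴ *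
          (onSites (J ∩ Y) M)ᴴ) := by
            rw [← h1, Matrix.conjTranspose_mul]; simp only [mul_assoc]
      _ = onSites (J ∩ Y) M * O * (onSites (J \ Y) M * (onSites (J \ Y) M)ᴴ) *
          (onSites (J ∩ Y) M)ᴴ := by rw [h2.eq]; simp only [mul_assoc]
      _ = _ := by rw [h3, mul_one]
  rw [key J, key J']
  have : J ∩ Y = J' ∩ Y := by
    ext i; simp only [Finset.mem_inter]
    exact ⟨fun ⟨a, b⟩ => ⟨(h i b).1 a, b⟩, fun ⟨a, b⟩ => ⟨(h i b).2 a, b⟩⟩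
  rw [this]

theorem onSites_mem {M : Matrix S S ℂ} (hM : M ∈ Matrix.unitaryGroup S ℂ) (J : Finset ι) :
    onSites J M ∈ Matrix.unitaryGroup (ι → S) ℂ :=
  Matrix.mem_unitaryGroup_iff.2 (by
    rw [Matrix.star_eq_conjTranspose, onSites_conjTranspose, onSites_mul, mul_ct hM, onSites_one])

theorem SupportedOn.conj_onSites_mem {Y J : Finset ι} {O : Op ι S} (hO : SupportedOn Y O)
    {M : Matrix S S ℂ} (hM : M ∈ Matrix.unitaryGroup S ℂ) :
    SupportedOn Y (onSites J M * O * (onSites J M)ᴴ) := by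
  rw [hO.conj_onSites hM (J' := J ∩ Y) (by intro i hi; simp [hi])]
  have h1 : SupportedOn Y (onSites (J ∩ Y) M) :=
    (supportedOn_onSites _ M).mono Finset.inter_subset_right
  exact (h1.mul hO).mul h1.conjTranspose

/-- The evolved restricted symmetry acts like the global symmetry in the bulk. -/
theorem heis_onSites_conj (hN : ∀ i j, N i j → N j i) (hU : IsLocal N U) {M : Matrix S S ℂ}
    (hM : M ∈ Matrix.unitaryGroup S ℂ) (hUM : Commute U (onSites Finset.univ M)) {Y J : Finset ι}
    (h : ∀ i ∈ Y, ∀ j, N i j → j ∈ J) {O : Op ι S} (hO : SupportedOn Y O) :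
    heis U (onSites J M) * O * (heis U (onSites J M))ᴴ =
      onSites Finset.univ M * O * (onSites Finset.univ M)ᴴ := by
  have h1 : SupportedOn J (heis Uᴴ O) := (hU.ct hN).supportedOn hN h hO
  have h2 := h1.conj_onSites hM (J := J) (J' := Finset.univ) (by simp)
  have h3 := congrArg (heis U) h2
  rw [heis_mul hU.1, heis_mul hU.1, heis_mul hU.1, heis_mul hU.1, heis_heis_ct hU.1,
    heis_of_commute hU.1 hUM, ← heis_ct, ← heis_ct, heis_of_commute hU.1 hUM] at h3
  exact h3

/-- `S` is the part in `K` of the evolved symmetry of the region `J`. -/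
def IsEnd (U : Op ι S) (M : Matrix S S ℂ) (K J : Finset ι) (T : Op ι S) : Prop :=
  T ∈ Matrix.unitaryGroup (ι → S) ℂ ∧ SupportedOn K T ∧
    SupportedOn Kᶜ (Tᴴ * heis U (onSites J M))

/-- A change of `J` at sites whose evolution does not reach `K` multiplies the evolved symmetry by
an operator supported off `K`. The end at `K` thus depends only on `J` near `K`. -/
theorem IsEnd.congr (hN : ∀ i j, N i j → N j i) (hU : IsLocal N U) {M : Matrix S S ℂ}
    (hM : M ∈ Matrix.unitaryGroup S ℂ) {K J J' : Finset ι} {T : Op ι S}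
    (h : ∀ k ∈ K, ∀ j, N k j → (j ∈ J ↔ j ∈ J')) (hT : IsEnd U M K J T) : IsEnd U M K J' T := by
  refine ⟨hT.1, hT.2.1, ?_⟩
  have h1 : onSites (J ∩ J') M * onSites (J \ J') M = onSites J M :=
    onSites_union M (Finset.disjoint_left.2 (by simp; tauto)) (by intro i; simp; tauto)
  have h2 : onSites (J ∩ J') M * onSites (J' \ J) M = onSites J' M :=
    onSites_union M (Finset.disjoint_left.2 (by simp; tauto)) (by intro i; simp; tauto)
  have h3 : onSites J' M = onSites J M * ((onSites (J \ J') M)ᴴ * onSites (J' \ J) M) := by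
    rw [← h1, ← h2, mul_assoc, ← mul_assoc _ _ (onSites (J' \ J) M), mul_ct (onSites_mem hM _),
      one_mul]
  rw [h3, heis_mul hU.1, ← mul_assoc]
  refine hT.2.2.mul (hU.supportedOn hN (X := (J \ J') ∪ (J' \ J)) ?_ ?_)
  · intro i hi j hij
    rw [Finset.mem_compl]
    intro hj
    have := h j hj i (hN _ _ hij)
    simp only [Finset.mem_union, Finset.mem_sdiff] at hi
    tauto
  · exact ((supportedOn_onSites _ M).mono Finset.subset_union_left).conjTranspose.mul
      ((supportedOn_onSites _ M).mono Finset.subset_union_right)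

/-- The operator `Tᴴ * T'` is supported on `K`, and as a quotient of the two remainders it is also
supported off `K`, so it is a scalar. -/
theorem IsEnd.eq_smul (hU : U ∈ Matrix.unitaryGroup (ι → S) ℂ) {M : Matrix S S ℂ}
    (hM : M ∈ Matrix.unitaryGroup S ℂ) {K J : Finset ι} {T T' : Op ι S}
    (hT : IsEnd U M K J T) (hT' : IsEnd U M K J T') : ∃ c : ℂ, T' = c • T := by
  obtain ⟨c, hc⟩ : ∃ c : ℂ, Tᴴ * T' = c • 1 := by
    refine SupportedOn.exists_smul_of_disjoint (disjoint_compl_right (a := K))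
      (hT.2.1.conjTranspose.mul hT'.2.1) ?_
    have h1 : Tᴴ * T' = (Tᴴ * heis U (onSites J M)) * (T'ᴴ * heis U (onSites J M))ᴴ := by
      rw [Matrix.conjTranspose_mul, Matrix.conjTranspose_conjTranspose, mul_assoc,
        ← mul_assoc _ _ T', mul_ct (heis_mem hU (onSites_mem hM J)), one_mul]
    rw [h1]
    exact hT.2.2.mul hT'.2.2.conjTranspose
  refine ⟨c, ?_⟩
  calc T' = T * (Tᴴ * T') := by rw [← mul_assoc, mul_ct hT.1, one_mul]
    _ = c • T := by rw [hc]; simp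

theorem IsEnd.smul {M : Matrix S S ℂ} {K J : Finset ι} {T : Op ι S}
    (hT : IsEnd U M K J T) {c : ℂ} (hc : ‖c‖ = 1) : IsEnd U M K J (c • T) := by
  refine ⟨smul_mem_unitary hT.1 hc, hT.2.1.smul c, ?_⟩
  rw [Matrix.conjTranspose_smul, Matrix.smul_mul]
  exact hT.2.2.smul _

/-- Conjugation by the end piece agrees with conjugation by the evolved symmetry. -/
theorem IsEnd.conj {M : Matrix S S ℂ} {K J : Finset ι} {T : Op ι S}
    (hU : U ∈ Matrix.unitaryGroup (ι → S) ℂ) (hM : M ∈ Matrix.unitaryGroup S ℂ)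
    (hT : IsEnd U M K J T) {O : Op ι S} (hO : SupportedOn K O) :
    T * O * Tᴴ = heis U (onSites J M) * O * (heis U (onSites J M))ᴴ := by
  set X := heis U (onSites J M) with hX
  have hXu : X ∈ Matrix.unitaryGroup (ι → S) ℂ := heis_mem hU (onSites_mem hM J)
  have h1 : X = T * (Tᴴ * X) := by rw [← mul_assoc, mul_ct hT.1, one_mul]
  have h2 := (hT.2.2.commute_compl hO).eq
  have h3 : (Tᴴ * X) * (Tᴴ * X)ᴴ = 1 := mul_ct (mul_mem (ct_mem hT.1) hXu)
  calc T * O * Tᴴ = T * (O * ((Tᴴ * X) * (Tᴴ * X)ᴴ)) * Tᴴ := by rw [h3, mul_one]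
    _ = T * ((Tᴴ * X) * O * (Tᴴ * X)ᴴ) * Tᴴ := by rw [← mul_assoc O, ← h2]
    _ = (T * (Tᴴ * X)) * O * ((T * (Tᴴ * X)))ᴴ := by
      rw [Matrix.conjTranspose_mul T]; simp only [mul_assoc]
    _ = _ := by rw [← h1]

/-- Converse of `IsEnd.conj`: ends are recognized by their action on one-site operators, which is
the practical way of verifying an explicit candidate. -/
theorem isEnd_of_conj {M : Matrix S S ℂ} {K J : Finset ι} {T : Op ι S}
    (hT : T ∈ Matrix.unitaryGroup (ι → S) ℂ) (hK : SupportedOn K T)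
    (h : ∀ i ∈ K, ∀ m, T * siteOp i m * Tᴴ =
      heis U (onSites J M) * siteOp i m * (heis U (onSites J M))ᴴ)
    (hU : U ∈ Matrix.unitaryGroup (ι → S) ℂ) (hM : M ∈ Matrix.unitaryGroup S ℂ) :
    IsEnd U M K J T := by
  refine ⟨hT, hK, supportedOn_iff.2 fun i hi m => ?_⟩
  have h1 := h i (by simpa using hi) m
  set X := heis U (onSites J M) with hX
  have hXu : X ∈ Matrix.unitaryGroup (ι → S) ℂ := heis_mem hU (onSites_mem hM J)
  have h2 : X * siteOp i m = T * siteOp i m * Tᴴ * X := by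
    rw [h1, mul_assoc _ Xᴴ, ct_mul hXu, mul_one]
  rw [Commute, SemiconjBy, mul_assoc, h2]
  simp only [← mul_assoc, ct_mul hT, one_mul]

/-- By `exists_factor` it is enough that conjugation by the evolved symmetry `X` preserves the
operators on `K`, that is, creates no support at a site `j` off `K`. If `j` is more than two steps
of `N` away from `K`, this is locality. Otherwise all neighbours of `j` lie outside `J`, and `X`
does not act at `j`, or all lie inside `J`, and `X` acts at `j` as the on-site symmetry. -/
theorem exists_isEnd [Nonempty S] (hN : ∀ i j, N i j → N j i) (hU : IsLocal N U) {M : Matrix S S ℂ}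
    (hM : M ∈ Matrix.unitaryGroup S ℂ) (hUM : Commute U (onSites Finset.univ M)) {K J : Finset ι}
    (h : ∀ k ∈ K, ∀ a, N k a → ∀ j, N a j → j ∉ K →
      (∀ i, N j i → i ∉ J) ∨ (∀ i, N j i → i ∈ J)) : ∃ T, IsEnd U M K J T := by
  classical
  set X := heis U (onSites J M) with hX
  have hXu : X ∈ Matrix.unitaryGroup (ι → S) ℂ := heis_mem hU.1 (onSites_mem hM J)
  obtain ⟨T, h1, h2, h3⟩ := exists_factor hXu (E := K) fun O hO => by
    refine supportedOn_iff.2 fun j hj m => ?_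
    by_cases hjk : ∃ k ∈ K, ∃ a, N k a ∧ N a j
    · obtain ⟨k, hk, a, hka, haj⟩ := hjk
      rcases h k hk a hka j haj hj with h0 | h0
      · have hXj : SupportedOn {j}ᶜ X := hU.supportedOn hN (X := J)
          (fun i hi b hib => by
            rw [Finset.mem_compl, Finset.mem_singleton]
            rintro rfl
            exact h0 i (hN _ _ hib) hi) (supportedOn_onSites J M)
        have hOj : SupportedOn {j}ᶜ O := hO.mono fun i hi => by
          rw [Finset.mem_compl, Finset.mem_singleton]; rintro rfl; exact hj hi
        exact ((hXj.mul hOj).mul hXj.conjTranspose).commute_compl (supportedOn_singleton.2 ⟨m, rfl⟩)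
      · have hMu : Mᴴ ∈ Matrix.unitaryGroup S ℂ := ct_mem hM
        have hUM' : Commute U (onSites Finset.univ Mᴴ) := by
          have := (heis_of_commute hU.1 hUM)
          have h4 := congrArg Matrix.conjTranspose this
          rw [heis_ct, onSites_conjTranspose] at h4
          rw [Commute, SemiconjBy]
          nth_rewrite 1 [← h4]
          rw [heis, ← mul_assoc, ← mul_assoc, mul_ct hU.1, one_mul]
        have h5 := heis_onSites_conj hN hU hMu hUM' (Y := {j}) (J := J)
          (fun i hi b hb => h0 b (by rwa [← Finset.mem_singleton.1 hi]))
          (supportedOn_singleton.2 ⟨m, rfl⟩)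
        have h6 : heis U (onSites J Mᴴ) = Xᴴ := by rw [hX, heis_ct, onSites_conjTranspose]
        rw [h6, Matrix.conjTranspose_conjTranspose] at h5
        have h7 : SupportedOn {j} (Xᴴ * siteOp j m * X) := by
          rw [h5]; exact SupportedOn.conj_onSites_mem (supportedOn_singleton.2 ⟨m, rfl⟩) hMu
        have h8 : Commute O (Xᴴ * siteOp j m * X) :=
          hO.commute (Finset.disjoint_singleton_right.2 hj) h7
        have h9 := (commute_heis_iff (ct_mem hXu) (A := O) (B := siteOp j m)).2
          (by rw [Matrix.conjTranspose_conjTranspose]; exact h8)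
        rwa [heis, Matrix.conjTranspose_conjTranspose] at h9
    · have h4 : SupportedOn {a | ∃ k ∈ K, N k a} (heis Uᴴ O) :=
        (hU.ct hN).supportedOn hN (X := K) (fun i hi b hb => by simp; exact ⟨i, hi, hb⟩) hO
      have h5 := h4.conj_onSites_mem (J := J) hM
      have h6 : SupportedOn {j}ᶜ (heis U (onSites J M * heis Uᴴ O * (onSites J M)ᴴ)) :=
        hU.supportedOn hN (fun a ha b hab => by
          rw [Finset.mem_compl, Finset.mem_singleton]
          rintro rfl
          obtain ⟨k, hk, hka⟩ : ∃ k ∈ K, N k a := by simpa using ha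
          exact hjk ⟨k, hk, a, hka, hab⟩) h5
      rw [heis_mul hU.1, heis_mul hU.1, heis_heis_ct hU.1, ← heis_ct] at h6
      exact h6.commute_compl (supportedOn_singleton.2 ⟨m, rfl⟩)
  exact ⟨T, h1, h2, h3⟩

/-- The evolved symmetry of `J` is the product of its two ends and the symmetry in the bulk `R`. -/
theorem exists_eq_smul_ends [Nonempty S] (hN : ∀ i j, N i j → N j i) (hU : IsLocal N U)
    {M : Matrix S S ℂ} (hM : M ∈ Matrix.unitaryGroup S ℂ)
    (hUM : Commute U (onSites Finset.univ M)) {K K' J R : Finset ι} {T T' : Op ι S}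
    (hT : IsEnd U M K J T) (hT' : IsEnd U M K' J T') (hK : Disjoint K K')
    (hKR : ∀ i ∈ R, i ∉ K ∧ i ∉ K' ∧ ∀ j, N i j → j ∈ J)
    (hR : ∀ i, i ∉ R → i ∉ K → i ∉ K' → ∀ j, N i j → j ∉ J) :
    ∃ c : ℂ, ‖c‖ = 1 ∧ heis U (onSites J M) = c • (T * onSites R M * T') := by
  set X := heis U (onSites J M) with hX
  have hXu : X ∈ Matrix.unitaryGroup (ι → S) ℂ := heis_mem hU.1 (onSites_mem hM J)
  have hRK : Disjoint R K := Finset.disjoint_left.2 fun i hi => (hKR i hi).1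
  have hRK' : Disjoint R K' := Finset.disjoint_left.2 fun i hi => (hKR i hi).2.1
  have hMR := supportedOn_onSites R M
  have cTT' : Commute T T' := hT.2.1.commute hK hT'.2.1
  have cTT2 : Commute Tᴴ T'ᴴ := hT.2.1.conjTranspose.commute hK hT'.2.1.conjTranspose
  -- With both ends and the bulk stripped off, the remainder commutes with every site. On `K` and
  -- `K'` this is the defining property of the ends, on `R` the evolved symmetry acts like `M`, and
  -- elsewhere it does not act.
  obtain ⟨c, hc⟩ : ∃ c : ℂ, (onSites R M)ᴴ * (T'ᴴ * (Tᴴ * X)) = c • 1 := by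
    refine SupportedOn.exists_eq_smul_one (supportedOn_iff.2 fun i _ m => ?_)
    have hi : SupportedOn {i} (siteOp i m) := supportedOn_singleton.2 ⟨m, rfl⟩
    by_cases hiK : i ∈ K
    · have h1 : SupportedOn Kᶜ ((onSites R M)ᴴ * (T'ᴴ * (Tᴴ * X))) :=
        (hMR.conjTranspose.mono fun j hj => Finset.mem_compl.2 (hKR j hj).1).mul
          ((hT'.2.1.conjTranspose.mono fun j hj => Finset.mem_compl.2
            (Finset.disjoint_right.1 hK hj)).mul hT.2.2)
      exact h1.commute_compl (hi.mono (by simpa using hiK))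
    by_cases hiK' : i ∈ K'
    · have h1 : SupportedOn K'ᶜ ((onSites R M)ᴴ * (T'ᴴ * (Tᴴ * X))) := by
        rw [← mul_assoc T'ᴴ, ← cTT2.eq, mul_assoc]
        exact (hMR.conjTranspose.mono fun j hj => Finset.mem_compl.2 (hKR j hj).2.1).mul
          ((hT.2.1.conjTranspose.mono fun j hj => Finset.mem_compl.2
            (Finset.disjoint_left.1 hK hj)).mul hT'.2.2)
      exact h1.commute_compl (hi.mono (by simpa using hiK'))
    by_cases hiR : i ∈ R
    · have h1 := heis_onSites_conj hN hU hM hUM (Y := {i}) (J := J)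
          (fun k hk b hb => (hKR i hiR).2.2 b (by rwa [← Finset.mem_singleton.1 hk])) hi
      rw [hi.conj_onSites hM (J' := R) (by simp [hiR])] at h1
      have h2 : SupportedOn R (onSites R M * siteOp i m * (onSites R M)ᴴ) :=
        (hMR.mul (hi.mono (by simpa using hiR))).mul hMR.conjTranspose
      have h3 : X * siteOp i m = onSites R M * siteOp i m * (onSites R M)ᴴ * X := by
        rw [← h1, mul_assoc _ Xᴴ, ct_mul hXu, mul_one]
      set P := onSites R M * siteOp i m * (onSites R M)ᴴ with hP
      have h4 : Commute Tᴴ P := hT.2.1.conjTranspose.commute hRK.symm h2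
      have h5 : Commute T'ᴴ P := hT'.2.1.conjTranspose.commute hRK'.symm h2
      have h6 : (onSites R M)ᴴ * P = siteOp i m * (onSites R M)ᴴ := by
        rw [hP, ← mul_assoc, ← mul_assoc, ct_mul (onSites_mem hM R), one_mul]
      calc (onSites R M)ᴴ * (T'ᴴ * (Tᴴ * X)) * siteOp i m
          = (onSites R M)ᴴ * (T'ᴴ * (Tᴴ * (X * siteOp i m))) := by simp only [mul_assoc]
        _ = (onSites R M)ᴴ * (T'ᴴ * (Tᴴ * P * X)) := by rw [h3, mul_assoc Tᴴ]
        _ = (onSites R M)ᴴ * ((T'ᴴ * P) * (Tᴴ * X)) := by rw [h4.eq]; simp only [mul_assoc]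
        _ = ((onSites R M)ᴴ * P) * (T'ᴴ * (Tᴴ * X)) := by rw [h5.eq]; simp only [mul_assoc]
        _ = _ := by rw [h6, mul_assoc]
    · have hc : ∀ {F : Finset ι} {O : Op ι S}, i ∉ F → SupportedOn F O → Commute O (siteOp i m) :=
        fun hF hO => hO.commute (Finset.disjoint_singleton_right.2 hF) hi
      have hXi : SupportedOn {i}ᶜ X := hU.supportedOn hN (X := J)
          (fun k hk b hb => by
            rw [Finset.mem_compl, Finset.mem_singleton]
            rintro rfl
            exact hR _ hiR hiK hiK' k (hN _ _ hb) hk) (supportedOn_onSites J M)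
      exact (hc hiR hMR.conjTranspose).mul_left ((hc hiK' hT'.2.1.conjTranspose).mul_left
        ((hc hiK hT.2.1.conjTranspose).mul_left (hc (by simp) hXi)))
  have hu : (onSites R M)ᴴ * (T'ᴴ * (Tᴴ * X)) ∈ Matrix.unitaryGroup (ι → S) ℂ :=
    mul_mem (ct_mem (onSites_mem hM R)) (mul_mem (ct_mem hT'.1) (mul_mem (ct_mem hT.1) hXu))
  refine ⟨c, ?_, ?_⟩
  · rw [hc] at hu
    exact norm_eq_one_of_smul_mem_unitary (one_mem _) hu
  · have cMT' : Commute (onSites R M) T' := hMR.commute hRK' hT'.2.1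
    calc X = T * (T' * (onSites R M * ((onSites R M)ᴴ * (T'ᴴ * (Tᴴ * X))))) := by
          rw [← mul_assoc (onSites R M), mul_ct (onSites_mem hM R), one_mul, ← mul_assoc T',
            mul_ct hT'.1, one_mul, ← mul_assoc, mul_ct hT.1, one_mul]
      _ = c • (T * onSites R M * T') := by
          rw [hc, Matrix.mul_smul, mul_one, Matrix.mul_smul, Matrix.mul_smul, mul_assoc, cMT'.eq]

end Ends

/-! ### Intervals and distances on the ring -/

section Coordinates
variable {ℓ : ℕ} [NeZero ℓ]

/-- The position of `z` counted from `b`. -/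
def crd (b z : ZMod ℓ) : ℕ := (z - b).val

theorem crd_lt (b z : ZMod ℓ) : crd b z < ℓ := ZMod.val_lt _

theorem add_crd (b z : ZMod ℓ) : b + (crd b z : ℕ) = z := by
  rw [crd, ZMod.natCast_zmod_val]; ring

theorem crd_add {b : ZMod ℓ} {k : ℕ} (h : k < ℓ) : crd b (b + (k : ℕ)) = k := by
  rw [crd, add_sub_cancel_left, ZMod.val_natCast, Nat.mod_eq_of_lt h]

/-- Counted from a base point that the arc does not run past, membership is a pair of linear
inequalities between natural numbers. All geometry of the ring is reduced to arithmetic in this way.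
-/
theorem mem_arc_crd {b x : ZMod ℓ} {α n : ℕ} (hx : x = b + (α : ℕ)) (h : α + n ≤ ℓ) {z : ZMod ℓ} :
    z ∈ arc x n ↔ α ≤ crd b z ∧ crd b z < α + n := by
  subst hx
  simp only [arc, Finset.mem_image, Finset.mem_range]
  constructor
  · rintro ⟨k, hk, rfl⟩
    rw [show b + (α : ZMod ℓ) + (k : ZMod ℓ) = b + ((α + k : ℕ) : ZMod ℓ) by push_cast; ring,
      crd_add (by omega)]
    omega
  · rintro ⟨h1, h2⟩
    refine ⟨crd b z - α, by omega, ?_⟩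
    conv_rhs => rw [← add_crd b z]
    rw [Nat.cast_sub h1]; ring

theorem card_arc {x : ZMod ℓ} {n : ℕ} (h : n ≤ ℓ) : (arc x n).card = n := by
  rw [arc, Finset.card_image_of_injOn, Finset.card_range]
  intro k hk k' hk' hkk
  have hk : k < n := by simpa using hk
  have hk' : k' < n := by simpa using hk'
  have h1 : crd x (x + (k : ZMod ℓ)) = crd x (x + (k' : ZMod ℓ)) := congrArg _ hkk
  rwa [crd_add (by omega), crd_add (by omega)] at h1

/-- `j` is at distance at most `ξ` from `i`. -/
def near (ξ : ℕ) (i j : ZMod ℓ) : Prop := j ∈ arc (i - (ξ : ZMod ℓ)) (2 * ξ + 1)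

theorem near_iff {ξ : ℕ} {i j : ZMod ℓ} :
    near ξ i j ↔ ∃ k, k ≤ 2 * ξ ∧ j + (ξ : ZMod ℓ) = i + (k : ZMod ℓ) := by
  simp only [near, arc, Finset.mem_image, Finset.mem_range]
  constructor
  · rintro ⟨k, hk, rfl⟩
    exact ⟨k, by omega, by ring⟩
  · rintro ⟨k, hk, h⟩
    exact ⟨k, by omega, by rw [← eq_sub_iff_add_eq] at h; rw [h]; ring⟩

theorem near_symm (ξ : ℕ) (i j : ZMod ℓ) (h : near ξ i j) : near ξ j i := by
  obtain ⟨k, hk, h⟩ := near_iff.1 h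
  refine near_iff.2 ⟨2 * ξ - k, by omega, ?_⟩
  rw [Nat.cast_sub hk]
  push_cast
  linear_combination -h

theorem near_trans {ξ ξ' : ℕ} {i j a : ZMod ℓ} (h : near ξ i j) (h' : near ξ' j a) :
    near (ξ + ξ') i a := by
  obtain ⟨k, hk, h⟩ := near_iff.1 h
  obtain ⟨k', hk', h'⟩ := near_iff.1 h'
  refine near_iff.2 ⟨k + k', by omega, ?_⟩
  push_cast
  linear_combination h + h'

theorem near_mono {ξ ξ' : ℕ} (hle : ξ ≤ ξ') {i j : ZMod ℓ} (h : near ξ i j) : near ξ' i j := by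
  obtain ⟨k, hk, h⟩ := near_iff.1 h
  refine near_iff.2 ⟨k + (ξ' - ξ), by omega, ?_⟩
  push_cast [Nat.cast_sub hle]
  linear_combination h

/-- The last two alternatives are neighbours on different sides of the base point, where the
coordinate jumps by `ℓ`. Choosing `b` far from the regions in question excludes them. -/
theorem near_crd (b : ZMod ℓ) {ξ : ℕ} {i j : ZMod ℓ} (h : near ξ i j) :
    (crd b j ≤ crd b i + ξ ∧ crd b i ≤ crd b j + ξ) ∨ crd b i + ℓ ≤ crd b j + ξ ∨
      crd b j + ℓ ≤ crd b i + ξ := by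
  obtain ⟨k, hk, h⟩ := near_iff.1 h
  have h1 : ((crd b j + ξ : ℕ) : ZMod ℓ) = ((crd b i + k : ℕ) : ZMod ℓ) := by
    have hj := add_crd b j
    have hi := add_crd b i
    push_cast
    linear_combination hj - hi + h
  rw [ZMod.natCast_eq_natCast_iff] at h1
  rcases lt_trichotomy (crd b j + ξ) (crd b i + k) with h2 | h2 | h2
  · have h3 := (Nat.modEq_iff_dvd' h2.le).1 h1
    have := Nat.le_of_dvd (by omega) h3
    omega
  · omega
  · have h3 := (Nat.modEq_iff_dvd' h2.le).1 h1.symm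
    have := Nat.le_of_dvd (by omega) h3
    omega

end Coordinates

/-! ### Left and right ends on the ring, and end ratios -/

section RingEnds
variable {ℓ : ℕ} [NeZero ℓ] {S : Type} [Fintype S] [DecidableEq S]

/-- `U` is a quantum cellular automaton with the on-site symmetry `M`. -/
structure IsSym (ξ : ℕ) (M : Matrix S S ℂ) (U : Op (ZMod ℓ) S) : Prop where
  loc : IsLocal (near ξ) U
  mem : M ∈ Matrix.unitaryGroup S ℂ
  comm : Commute U (onSites Finset.univ M)

/-- The normalized trace of a one-site operator. -/
noncomputable def mtr (M : Matrix S S ℂ) : ℂ := M.trace / Fintype.card S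

/-- The right end at `y` of the evolved symmetry of an interval `[x, y)`. -/
def RightEnd (ξ : ℕ) (U : Op (ZMod ℓ) S) (M : Matrix S S ℂ) (y : ZMod ℓ) (T : Op (ZMod ℓ) S) :
    Prop :=
  IsEnd U M (arc (y - (ξ : ZMod ℓ)) (2 * ξ)) (arc (y - ((2 * ξ : ℕ) : ZMod ℓ)) (2 * ξ)) T

/-- The left end at `x` of the evolved symmetry of an interval `[x, y)`. -/
def LeftEnd (ξ : ℕ) (U : Op (ZMod ℓ) S) (M : Matrix S S ℂ) (x : ZMod ℓ) (T : Op (ZMod ℓ) S) :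
    Prop :=
  IsEnd U M (arc (x - (ξ : ZMod ℓ)) (2 * ξ)) (arc x (2 * ξ)) T

variable {ξ : ℕ} {M : Matrix S S ℂ} {U : Op (ZMod ℓ) S}

theorem ntr_onSites_arc [Nonempty S] {x : ZMod ℓ} {n : ℕ} (h : n ≤ ℓ) (M : Matrix S S ℂ) :
    ntr (onSites (arc x n) M) = mtr M ^ n := by
  rw [ntr_onSites, card_arc h, mtr]

/-- The definition uses the shortest sensible interval before the endpoint. By `IsEnd.congr` any
longer one has the same right end, as long as it does not come close to the window from behind. -/
theorem IsSym.rightEnd_iff (hU : IsSym ξ M U) {x : ZMod ℓ} {n : ℕ} (h1 : 2 * ξ ≤ n)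
    (h2 : n + 2 * ξ ≤ ℓ) {T : Op (ZMod ℓ) S} :
    RightEnd ξ U M (x + (n : ZMod ℓ)) T ↔
      IsEnd U M (arc (x + (n : ZMod ℓ) - (ξ : ZMod ℓ)) (2 * ξ)) (arc x n) T := by
  have key : ∀ k ∈ arc (x + (n : ZMod ℓ) - (ξ : ZMod ℓ)) (2 * ξ), ∀ j, near ξ k j →
      (j ∈ arc (x + (n : ZMod ℓ) - ((2 * ξ : ℕ) : ZMod ℓ)) (2 * ξ) ↔ j ∈ arc x n) := by
    intro k hk j hkj
    have hl := crd_lt (x - (ξ : ZMod ℓ)) j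
    have hl' := crd_lt (x - (ξ : ZMod ℓ)) k
    have hn := near_crd (x - (ξ : ZMod ℓ)) hkj
    rw [mem_arc_crd (b := x - (ξ : ZMod ℓ)) (α := n) (by ring) (by omega)] at hk
    rw [mem_arc_crd (b := x - (ξ : ZMod ℓ)) (α := n - ξ) (by
        rw [Nat.cast_sub (by omega)]; push_cast; ring) (by omega),
      mem_arc_crd (b := x - (ξ : ZMod ℓ)) (α := ξ) (by ring) (by omega)]
    omega
  exact ⟨fun h => IsEnd.congr (near_symm ξ) hU.loc hU.mem key h,
    fun h => IsEnd.congr (near_symm ξ) hU.loc hU.mem (fun k hk j hj => (key k hk j hj).symm) h⟩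

theorem IsSym.leftEnd_iff (hU : IsSym ξ M U) {x : ZMod ℓ} {n : ℕ} (h1 : 2 * ξ ≤ n)
    (h2 : n + 2 * ξ ≤ ℓ) {T : Op (ZMod ℓ) S} :
    LeftEnd ξ U M x T ↔ IsEnd U M (arc (x - (ξ : ZMod ℓ)) (2 * ξ)) (arc x n) T := by
  have key : ∀ k ∈ arc (x - (ξ : ZMod ℓ)) (2 * ξ), ∀ j, near ξ k j →
      (j ∈ arc x (2 * ξ) ↔ j ∈ arc x n) := by
    intro k hk j hkj
    have hl := crd_lt (x - (ξ : ZMod ℓ)) j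
    have hl' := crd_lt (x - (ξ : ZMod ℓ)) k
    have hn := near_crd (x - (ξ : ZMod ℓ)) hkj
    rw [mem_arc_crd (b := x - (ξ : ZMod ℓ)) (α := 0) (by simp) (by omega)] at hk
    rw [mem_arc_crd (b := x - (ξ : ZMod ℓ)) (α := ξ) (by ring) (by omega),
      mem_arc_crd (b := x - (ξ : ZMod ℓ)) (α := ξ) (by ring) (by omega)]
    omega
  exact ⟨fun h => IsEnd.congr (near_symm ξ) hU.loc hU.mem key h,
    fun h => IsEnd.congr (near_symm ξ) hU.loc hU.mem (fun k hk j hj => (key k hk j hj).symm) h⟩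

theorem IsSym.exists_rightEnd [Nonempty S] (hU : IsSym ξ M U) (hℓ : 12 * ξ ≤ ℓ) (y : ZMod ℓ) :
    ∃ T, RightEnd ξ U M y T := by
  have hx : y = (y - ((4 * ξ : ℕ) : ZMod ℓ)) + ((4 * ξ : ℕ) : ZMod ℓ) := by ring
  rw [hx]
  -- With length `4 * ξ`, a site left of the window and within `2 * ξ` of it has its whole
  -- neighbourhood inside the interval, as `exists_isEnd` demands.
  simp only [hU.rightEnd_iff (x := y - ((4 * ξ : ℕ) : ZMod ℓ)) (n := 4 * ξ) (by omega) (by omega)]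
  refine exists_isEnd (near_symm ξ) hU.loc hU.mem hU.comm ?_
  intro k hk a hka j haj hj
  set b := y - ((6 * ξ : ℕ) : ZMod ℓ) with hb
  have e1 : y - ((4 * ξ : ℕ) : ZMod ℓ) + ((4 * ξ : ℕ) : ZMod ℓ) - (ξ : ZMod ℓ) =
    b + ((5 * ξ : ℕ) : ZMod ℓ) := by rw [hb]; push_cast; ring
  have e2 : y - ((4 * ξ : ℕ) : ZMod ℓ) = b + ((2 * ξ : ℕ) : ZMod ℓ) := by
    rw [hb]; push_cast; ring
  have n1 := near_crd b hka
  have n2 := near_crd b haj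
  rw [mem_arc_crd e1 (by omega)] at hk hj
  have l1 := crd_lt b k
  have l2 := crd_lt b a
  have l3 := crd_lt b j
  by_cases h5 : crd b j < 5 * ξ
  · right
    intro i hji
    have n3 := near_crd b hji
    have l4 := crd_lt b i
    rw [mem_arc_crd e2 (by omega)]
    omega
  · left
    intro i hji
    have n3 := near_crd b hji
    have l4 := crd_lt b i
    rw [mem_arc_crd e2 (by omega)]
    omega

theorem IsSym.exists_leftEnd [Nonempty S] (hU : IsSym ξ M U) (hℓ : 12 * ξ ≤ ℓ) (x : ZMod ℓ) :
    ∃ T, LeftEnd ξ U M x T := by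
  simp only [hU.leftEnd_iff (x := x) (n := 4 * ξ) (by omega) (by omega)]
  refine exists_isEnd (near_symm ξ) hU.loc hU.mem hU.comm ?_
  intro k hk a hka j haj hj
  set b := x - ((6 * ξ : ℕ) : ZMod ℓ) with hb
  have e1 : x - (ξ : ZMod ℓ) = b + ((5 * ξ : ℕ) : ZMod ℓ) := by rw [hb]; push_cast; ring
  have e2 : x = b + ((6 * ξ : ℕ) : ZMod ℓ) := by rw [hb]; push_cast; ring
  have n1 := near_crd b hka
  have n2 := near_crd b haj
  rw [mem_arc_crd e1 (by omega)] at hk hj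
  have l1 := crd_lt b k
  have l2 := crd_lt b a
  have l3 := crd_lt b j
  by_cases h5 : crd b j < 5 * ξ
  · left
    intro i hji
    have n3 := near_crd b hji
    have l4 := crd_lt b i
    rw [mem_arc_crd e2 (by omega)]
    omega
  · right
    intro i hji
    have n3 := near_crd b hji
    have l4 := crd_lt b i
    rw [mem_arc_crd e2 (by omega)]
    omega

theorem IsSym.exists_eq_ends [Nonempty S] (hU : IsSym ξ M U) {x : ZMod ℓ} {n : ℕ} (h1 : 2 * ξ ≤ n)
    (h2 : n + 2 * ξ ≤ ℓ) {T T' : Op (ZMod ℓ) S} (hT : LeftEnd ξ U M x T)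
    (hT' : RightEnd ξ U M (x + (n : ZMod ℓ)) T') :
    ∃ c : ℂ, ‖c‖ = 1 ∧ heis U (onSites (arc x n) M) =
      c • (T * onSites (arc (x + (ξ : ZMod ℓ)) (n - 2 * ξ)) M * T') := by
  rw [hU.leftEnd_iff h1 h2] at hT
  rw [hU.rightEnd_iff h1 h2] at hT'
  have e1 : x - (ξ : ZMod ℓ) = (x - (ξ : ZMod ℓ)) + ((0 : ℕ) : ZMod ℓ) := by simp
  have e2 : x + (n : ZMod ℓ) - (ξ : ZMod ℓ) = (x - (ξ : ZMod ℓ)) + (n : ZMod ℓ) := by ring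
  have e3 : x = (x - (ξ : ZMod ℓ)) + (ξ : ZMod ℓ) := by ring
  have e4 : x + (ξ : ZMod ℓ) = (x - (ξ : ZMod ℓ)) + ((2 * ξ : ℕ) : ZMod ℓ) := by push_cast; ring
  refine exists_eq_smul_ends (near_symm ξ) hU.loc hU.mem hU.comm hT hT' ?_ ?_ ?_
  · refine Finset.disjoint_left.2 fun i hi => ?_
    rw [mem_arc_crd e1 (by omega)] at hi
    rw [mem_arc_crd e2 (by omega)]
    omega
  · intro i hi
    rw [mem_arc_crd e4 (by omega)] at hi
    rw [mem_arc_crd e2 (by omega), mem_arc_crd e1 (by omega)]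
    refine ⟨by omega, by omega, fun j hj => ?_⟩
    have n1 := near_crd (x - (ξ : ZMod ℓ)) hj
    have l4 := crd_lt (x - (ξ : ZMod ℓ)) j
    rw [mem_arc_crd e3 (by omega)]
    omega
  · intro i hi hi' hi'' j hj
    rw [mem_arc_crd e4 (by omega)] at hi
    rw [mem_arc_crd e1 (by omega)] at hi'
    rw [mem_arc_crd e2 (by omega)] at hi''
    have n1 := near_crd (x - (ξ : ZMod ℓ)) hj
    have l4 := crd_lt (x - (ξ : ZMod ℓ)) j
    have l5 := crd_lt (x - (ξ : ZMod ℓ)) i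
    rw [mem_arc_crd e3 (by omega)]
    omega

/-- The three factors of an evolved symmetry have disjoint supports. -/
theorem disjoint_ends {x : ZMod ℓ} {n : ℕ} (h1 : 2 * ξ ≤ n) (h2 : n + 2 * ξ ≤ ℓ) :
    Disjoint (arc (x - (ξ : ZMod ℓ)) (2 * ξ)) (arc (x + (ξ : ZMod ℓ)) (n - 2 * ξ)) ∧
    Disjoint (arc (x - (ξ : ZMod ℓ)) n) (arc (x + (n : ZMod ℓ) - (ξ : ZMod ℓ)) (2 * ξ)) ∧
    Disjoint (arc (x - (ξ : ZMod ℓ)) (2 * ξ)) (arc (x + (ξ : ZMod ℓ)) n) ∧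
    arc (x - (ξ : ZMod ℓ)) (2 * ξ) ⊆ arc (x - (ξ : ZMod ℓ)) n ∧
    arc (x + (ξ : ZMod ℓ)) (n - 2 * ξ) ⊆ arc (x - (ξ : ZMod ℓ)) n ∧
    arc (x + (ξ : ZMod ℓ)) (n - 2 * ξ) ⊆ arc (x + (ξ : ZMod ℓ)) n ∧
    arc (x + (n : ZMod ℓ) - (ξ : ZMod ℓ)) (2 * ξ) ⊆ arc (x + (ξ : ZMod ℓ)) n := by
  have e1 : x - (ξ : ZMod ℓ) = (x - (ξ : ZMod ℓ)) + ((0 : ℕ) : ZMod ℓ) := by simp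
  have e2 : x + (n : ZMod ℓ) - (ξ : ZMod ℓ) = (x - (ξ : ZMod ℓ)) + (n : ZMod ℓ) := by ring
  have e4 : x + (ξ : ZMod ℓ) = (x - (ξ : ZMod ℓ)) + ((2 * ξ : ℕ) : ZMod ℓ) := by push_cast; ring
  simp only [Finset.disjoint_left, Finset.subset_iff]
  refine ⟨fun i => ?_, fun i => ?_, fun i => ?_, fun i => ?_, fun i => ?_, fun i => ?_,
    fun i => ?_⟩ <;>
  simp only [mem_arc_crd (z := i) e1 (show 0 + 2 * ξ ≤ ℓ by omega),
    mem_arc_crd (z := i) e1 (show 0 + n ≤ ℓ by omega),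
    mem_arc_crd (z := i) e2 (show n + 2 * ξ ≤ ℓ by omega),
    mem_arc_crd (z := i) e4 (show 2 * ξ + (n - 2 * ξ) ≤ ℓ by omega),
    mem_arc_crd (z := i) e4 (show 2 * ξ + n ≤ ℓ by omega)] <;> omega

theorem mul_mul_pow_of_commute {R : Type*} [Monoid R] {a b c : R} (hab : Commute a b)
    (hac : Commute a c) (hbc : Commute b c) (j : ℕ) : (a * b * c) ^ j = a ^ j * b ^ j * c ^ j := by
  rw [(hac.mul_left hbc).mul_pow, hab.mul_pow]

section Triple
variable {x : ZMod ℓ} {n : ℕ} {T T' : Op (ZMod ℓ) S}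

theorem ends_commute (h1 : 2 * ξ ≤ n) (h2 : n + 2 * ξ ≤ ℓ)
    (hT : SupportedOn (arc (x - (ξ : ZMod ℓ)) (2 * ξ)) T)
    (hT' : SupportedOn (arc (x + (n : ZMod ℓ) - (ξ : ZMod ℓ)) (2 * ξ)) T') :
    Commute T (onSites (arc (x + (ξ : ZMod ℓ)) (n - 2 * ξ)) M) ∧ Commute T T' ∧
      Commute (onSites (arc (x + (ξ : ZMod ℓ)) (n - 2 * ξ)) M) T' := by
  obtain ⟨d1, d2, d3, s1, s2, s3, s4⟩ := disjoint_ends (x := x) h1 h2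
  exact ⟨hT.commute d1 (supportedOn_onSites _ _), (hT.mono s1).commute d2 hT',
    ((supportedOn_onSites _ _).mono s2).commute d2 hT'⟩

theorem ntr_ends [Nonempty S] (h1 : 2 * ξ ≤ n) (h2 : n + 2 * ξ ≤ ℓ)
    (hT : SupportedOn (arc (x - (ξ : ZMod ℓ)) (2 * ξ)) T)
    (hT' : SupportedOn (arc (x + (n : ZMod ℓ) - (ξ : ZMod ℓ)) (2 * ξ)) T') :
    ntr (T * onSites (arc (x + (ξ : ZMod ℓ)) (n - 2 * ξ)) M * T') =
      ntr T * mtr M ^ (n - 2 * ξ) * ntr T' := by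
  obtain ⟨d1, d2, d3, s1, s2, s3, s4⟩ := disjoint_ends (x := x) h1 h2
  rw [ntr_mul_of_disjoint d2 ((hT.mono s1).mul ((supportedOn_onSites _ _).mono s2)) hT',
    ntr_mul_of_disjoint d1 hT (supportedOn_onSites _ _), ntr_onSites_arc (by omega)]

theorem ends_pow (h1 : 2 * ξ ≤ n) (h2 : n + 2 * ξ ≤ ℓ) (hU : U ∈ Matrix.unitaryGroup _ ℂ)
    (hT : SupportedOn (arc (x - (ξ : ZMod ℓ)) (2 * ξ)) T)
    (hT' : SupportedOn (arc (x + (n : ZMod ℓ) - (ξ : ZMod ℓ)) (2 * ξ)) T')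
    (h : heis U (onSites (arc x n) M) =
      T * onSites (arc (x + (ξ : ZMod ℓ)) (n - 2 * ξ)) M * T') (j : ℕ) :
    heis U (onSites (arc x n) (M ^ j)) =
      T ^ j * onSites (arc (x + (ξ : ZMod ℓ)) (n - 2 * ξ)) (M ^ j) * T' ^ j := by
  obtain ⟨c1, c2, c3⟩ := ends_commute (M := M) h1 h2 hT hT'
  rw [← onSites_pow, ← heis_pow hU, h, mul_mul_pow_of_commute c1 c2 c3, onSites_pow]

/-- Evolution preserves the trace, and the trace of the evolved symmetry factors over its three
pieces. So the traces at the two ends determine each other and do not vanish when those of the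
symmetry do not. -/
theorem ntr_ends_pow [Nonempty S] (h1 : 2 * ξ ≤ n) (h2 : n + 2 * ξ ≤ ℓ)
    (hU : U ∈ Matrix.unitaryGroup _ ℂ)
    (hT : SupportedOn (arc (x - (ξ : ZMod ℓ)) (2 * ξ)) T)
    (hT' : SupportedOn (arc (x + (n : ZMod ℓ) - (ξ : ZMod ℓ)) (2 * ξ)) T')
    (h : heis U (onSites (arc x n) M) =
      T * onSites (arc (x + (ξ : ZMod ℓ)) (n - 2 * ξ)) M * T') (j : ℕ) :
    ntr (T ^ j) * mtr (M ^ j) ^ (n - 2 * ξ) * ntr (T' ^ j) = mtr (M ^ j) ^ n := by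
  have := congrArg ntr (ends_pow h1 h2 hU hT hT' h j)
  rw [heis, ntr_conj (mul_ct hU), ntr_onSites_arc (by omega),
    ntr_ends h1 h2 (hT.pow j) (hT'.pow j)] at this
  exact this.symm

end Triple

variable {d : ℕ}

/-- The phase in `IsSym.exists_eq_ends` is absorbed into the left end. The `d`-th power of the
resulting identity then forces the left end to be normalized as well. -/
theorem IsSym.exists_left_of_right [Nonempty S] (hU : IsSym ξ M U) (hℓ : 12 * ξ ≤ ℓ)
    (hd : M ^ d = 1) {x : ZMod ℓ} {n : ℕ} (h1 : 2 * ξ ≤ n)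
    (h2 : n + 2 * ξ ≤ ℓ) {T' : Op (ZMod ℓ) S} (hT' : RightEnd ξ U M (x + (n : ZMod ℓ)) T')
    (hd' : T' ^ d = 1) : ∃ T, LeftEnd ξ U M x T ∧ T ^ d = 1 ∧
      heis U (onSites (arc x n) M) = T * onSites (arc (x + (ξ : ZMod ℓ)) (n - 2 * ξ)) M * T' := by
  obtain ⟨T, hT⟩ := hU.exists_leftEnd hℓ x
  obtain ⟨c, hc, h⟩ := hU.exists_eq_ends h1 h2 hT hT'
  have h' : heis U (onSites (arc x n) M) =
      (c • T) * onSites (arc (x + (ξ : ZMod ℓ)) (n - 2 * ξ)) M * T' := by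
    rw [h, Matrix.smul_mul, Matrix.smul_mul]
  have hT2 : LeftEnd ξ U M x (c • T) := IsEnd.smul hT hc
  refine ⟨c • T, hT2, ?_, h'⟩
  have h3 := ends_pow h1 h2 hU.loc.1 hT2.2.1 hT'.2.1 h' d
  rwa [hd, onSites_one, onSites_one, heis_one hU.loc.1, hd', mul_one, mul_one, eq_comm] at h3

theorem IsSym.exists_right_of_left [Nonempty S] (hU : IsSym ξ M U) (hℓ : 12 * ξ ≤ ℓ)
    (hd : M ^ d = 1) {x : ZMod ℓ} {n : ℕ} (h1 : 2 * ξ ≤ n)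
    (h2 : n + 2 * ξ ≤ ℓ) {T : Op (ZMod ℓ) S} (hT : LeftEnd ξ U M x T)
    (hd' : T ^ d = 1) : ∃ T', RightEnd ξ U M (x + (n : ZMod ℓ)) T' ∧ T' ^ d = 1 ∧
      heis U (onSites (arc x n) M) = T * onSites (arc (x + (ξ : ZMod ℓ)) (n - 2 * ξ)) M * T' := by
  obtain ⟨T', hT'⟩ := hU.exists_rightEnd hℓ (x + (n : ZMod ℓ))
  obtain ⟨c, hc, h⟩ := hU.exists_eq_ends h1 h2 hT hT'
  have h' : heis U (onSites (arc x n) M) =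
      T * onSites (arc (x + (ξ : ZMod ℓ)) (n - 2 * ξ)) M * (c • T') := by
    rw [h, Matrix.mul_smul]
  have hT2 : RightEnd ξ U M (x + (n : ZMod ℓ)) (c • T') := IsEnd.smul hT' hc
  refine ⟨c • T', hT2, ?_, h'⟩
  have h3 := ends_pow h1 h2 hU.loc.1 hT.2.1 hT2.2.1 h' d
  rwa [hd, onSites_one, onSites_one, heis_one hU.loc.1, hd', one_mul, one_mul, eq_comm] at h3

/-- Since `M ^ d = 1`, the `d`-th powers of the two ends are inverse to each other. Their supports
are disjoint, so both are phases, and dividing by a `d`-th root of the phase normalizes the end. -/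
theorem IsSym.exists_rightEnd_pow [Nonempty S] (hU : IsSym ξ M U) (hℓ : 12 * ξ ≤ ℓ) (hd0 : 0 < d)
    (hd : M ^ d = 1) (y : ZMod ℓ) : ∃ T, RightEnd ξ U M y T ∧ T ^ d = 1 := by
  obtain ⟨T', hT'⟩ := hU.exists_rightEnd hℓ y
  obtain ⟨T, hT⟩ := hU.exists_leftEnd hℓ (y - ((4 * ξ : ℕ) : ZMod ℓ))
  have hx : y = (y - ((4 * ξ : ℕ) : ZMod ℓ)) + ((4 * ξ : ℕ) : ZMod ℓ) := by ring
  have hT2 := hT'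
  rw [hx] at hT2
  obtain ⟨c, hc, h⟩ := hU.exists_eq_ends (by omega) (by omega) hT hT2
  have h' : heis U (onSites (arc (y - ((4 * ξ : ℕ) : ZMod ℓ)) (4 * ξ)) M) = (c • T) *
      onSites (arc (y - ((4 * ξ : ℕ) : ZMod ℓ) + (ξ : ZMod ℓ)) (4 * ξ - 2 * ξ)) M * T' := by
    rw [h, Matrix.smul_mul, Matrix.smul_mul]
  have hT3 : LeftEnd ξ U M (y - ((4 * ξ : ℕ) : ZMod ℓ)) (c • T) := IsEnd.smul hT hc
  have h3 := ends_pow (by omega) (by omega) hU.loc.1 hT3.2.1 hT2.2.1 h' d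
  rw [hd, onSites_one, onSites_one, heis_one hU.loc.1, mul_one] at h3
  have hTd : T' ^ d ∈ Matrix.unitaryGroup (ZMod ℓ → S) ℂ := pow_mem hT'.1 d
  have h4 : (c • T) ^ d = (T' ^ d)ᴴ := by
    calc (c • T) ^ d = (c • T) ^ d * (T' ^ d * (T' ^ d)ᴴ) := by rw [mul_ct hTd, mul_one]
      _ = _ := by rw [← mul_assoc, ← h3, one_mul]
  obtain ⟨d1, d2, d3, s1, s2, s3, s4⟩ :=
    disjoint_ends (x := y - ((4 * ξ : ℕ) : ZMod ℓ)) (ξ := ξ) (n := 4 * ξ) (by omega) (by omega)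
  obtain ⟨s, hs⟩ : ∃ s : ℂ, T' ^ d = s • 1 := by
    refine SupportedOn.exists_smul_of_disjoint d2 ?_ (hT2.2.1.pow d)
    have := (hT3.2.1.pow d).conjTranspose.mono s1
    rwa [h4, Matrix.conjTranspose_conjTranspose] at this
  have hs1 : ‖s‖ = 1 := by
    rw [hs] at hTd
    exact norm_eq_one_of_smul_mem_unitary (one_mem _) hTd
  obtain ⟨r, hr⟩ := IsAlgClosed.exists_pow_nat_eq s hd0
  have hr1 : ‖r⁻¹‖ = 1 := by
    rw [norm_inv, inv_eq_one]
    have : ‖r‖ ^ d = 1 := by rw [← norm_pow, hr, hs1]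
    exact (pow_eq_one_iff_of_nonneg (norm_nonneg r) hd0.ne').1 this
  refine ⟨r⁻¹ • T', IsEnd.smul hT' hr1, ?_⟩
  have hs0 : s ≠ 0 := by intro h0; rw [h0, norm_zero] at hs1; exact zero_ne_one hs1
  rw [smul_pow, hs, inv_pow, hr, smul_smul, inv_mul_cancel₀ hs0, one_smul]

/-- The traces of the powers of a normalized right end, relative to those of the symmetry. -/
def IsEndRatio (ξ : ℕ) (U : Op (ZMod ℓ) S) (M : Matrix S S ℂ) (d : ℕ) (τ : ℕ → ℂ) : Prop :=
  ∃ y T, RightEnd ξ U M y T ∧ T ^ d = 1 ∧ ∀ j, τ j = ntr (T ^ j) / mtr (M ^ j) ^ ξ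

/-- The right ends at `y` and at `y + 1` are completed by the same left end at `y - 4 * ξ`, whose
traces determine those of both. Iteration moves an end ratio around the ring. -/
theorem IsSym.exists_succ [Nonempty S] (hU : IsSym ξ M U) (hℓ : 12 * ξ + 1 ≤ ℓ)
    (hd : M ^ d = 1) (htr : ∀ j, mtr (M ^ j) ≠ 0) {y : ZMod ℓ} {T : Op (ZMod ℓ) S}
    (hT : RightEnd ξ U M y T) (hTd : T ^ d = 1) :
    ∃ T', RightEnd ξ U M (y + 1) T' ∧ T' ^ d = 1 ∧ ∀ j, ntr (T' ^ j) = ntr (T ^ j) := by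
  have hx : y = (y - ((4 * ξ : ℕ) : ZMod ℓ)) + ((4 * ξ : ℕ) : ZMod ℓ) := by ring
  have hx' : y + 1 = (y - ((4 * ξ : ℕ) : ZMod ℓ)) + ((4 * ξ + 1 : ℕ) : ZMod ℓ) := by
    push_cast; ring
  rw [hx] at hT
  rw [hx']
  obtain ⟨L, hL, hLd, h⟩ := hU.exists_left_of_right (by omega) hd (by omega) (by omega) hT hTd
  obtain ⟨T', hT', hTd', h'⟩ := hU.exists_right_of_left (n := 4 * ξ + 1) (by omega) hd (by omega)
    (by omega) hL hLd
  refine ⟨T', hT', hTd', fun j => ?_⟩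
  have e1 := ntr_ends_pow (by omega) (by omega) hU.loc.1 hL.2.1 hT.2.1 h j
  have e2 := ntr_ends_pow (by omega) (by omega) hU.loc.1 hL.2.1 hT'.2.1 h' j
  have hm := htr j
  have hLj : ntr (L ^ j) ≠ 0 := by
    intro h0
    rw [h0, zero_mul, zero_mul] at e1
    exact pow_ne_zero _ hm e1.symm
  rw [pow_succ, ← e1, show 4 * ξ + 1 - 2 * ξ = (4 * ξ - 2 * ξ) + 1 by omega, pow_succ] at e2
  have : (ntr (L ^ j) * mtr (M ^ j) ^ (4 * ξ - 2 * ξ) * mtr (M ^ j)) * ntr (T' ^ j) =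
      (ntr (L ^ j) * mtr (M ^ j) ^ (4 * ξ - 2 * ξ) * mtr (M ^ j)) * ntr (T ^ j) := by
    linear_combination e2
  exact mul_left_cancel₀ (mul_ne_zero (mul_ne_zero hLj (pow_ne_zero _ hm)) hm) this

theorem IsSym.endRatio_at [Nonempty S] (hU : IsSym ξ M U) (hℓ : 12 * ξ + 1 ≤ ℓ)
    (hd : M ^ d = 1) (htr : ∀ j, mtr (M ^ j) ≠ 0) {τ : ℕ → ℂ} (hτ : IsEndRatio ξ U M d τ)
    (y : ZMod ℓ) :
    ∃ T, RightEnd ξ U M y T ∧ T ^ d = 1 ∧ ∀ j, τ j = ntr (T ^ j) / mtr (M ^ j) ^ ξ := by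
  obtain ⟨y₀, T₀, h₀, hd₀, ht₀⟩ := hτ
  have : ∀ k : ℕ, ∃ T, RightEnd ξ U M (y₀ + (k : ZMod ℓ)) T ∧ T ^ d = 1 ∧
      ∀ j, τ j = ntr (T ^ j) / mtr (M ^ j) ^ ξ := by
    intro k
    induction k with
    | zero => exact ⟨T₀, by simpa using h₀, hd₀, ht₀⟩
    | succ k ih =>
      obtain ⟨T, hT, hTd, ht⟩ := ih
      obtain ⟨T', hT', hTd', ht'⟩ := hU.exists_succ hℓ hd htr hT hTd
      refine ⟨T', ?_, hTd', fun j => by rw [ht' j, ht j]⟩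
      rwa [show y₀ + ((k + 1 : ℕ) : ZMod ℓ) = y₀ + (k : ZMod ℓ) + 1 by push_cast; ring]
  have h := this (crd y₀ y)
  rwa [add_crd] at h

theorem IsSym.exists_endRatio [Nonempty S] (hU : IsSym ξ M U) (hℓ : 12 * ξ + 1 ≤ ℓ) (hd0 : 0 < d)
    (hd : M ^ d = 1) : ∃ τ, IsEndRatio ξ U M d τ := by
  obtain ⟨T, hT, hTd⟩ := hU.exists_rightEnd_pow (by omega) hd0 hd 0
  exact ⟨_, 0, T, hT, hTd, fun j => rfl⟩

/-- Two normalized ends, moved to the same point, differ by a scalar, and `T ^ d = 1` for both makes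
this scalar a `d`-th root of unity. The same `c` serves all powers; raising only `τ 1` to the power
`d` forgets this. -/
theorem IsSym.endRatio_unique [Nonempty S] (hU : IsSym ξ M U) (hℓ : 12 * ξ + 1 ≤ ℓ)
    (hd : M ^ d = 1) (htr : ∀ j, mtr (M ^ j) ≠ 0) {τ τ' : ℕ → ℂ} (hτ : IsEndRatio ξ U M d τ)
    (hτ' : IsEndRatio ξ U M d τ') : ∃ c : ℂ, c ^ d = 1 ∧ ∀ j, τ' j = c ^ j * τ j := by
  obtain ⟨T, hT, hTd, ht⟩ := hU.endRatio_at hℓ hd htr hτ 0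
  obtain ⟨T', hT', hTd', ht'⟩ := hU.endRatio_at hℓ hd htr hτ' 0
  obtain ⟨c, rfl⟩ := IsEnd.eq_smul hU.loc.1 hU.mem hT hT'
  refine ⟨c, ?_, fun j => ?_⟩
  · rw [smul_pow, hTd] at hTd'
    have := congrArg ntr hTd'
    rwa [ntr_smul, ntr_one, mul_one] at this
  · rw [ht', ht, smul_pow, ntr_smul, mul_div_assoc]

end RingEnds

/-! ### End ratios under change of spreading length and under composition -/

section RingEnds
variable {ℓ : ℕ} [NeZero ℓ] {S : Type} [Fintype S] [DecidableEq S]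
variable {ξ ξ' : ℕ} {M : Matrix S S ℂ} {U U' : Op (ZMod ℓ) S} {d : ℕ}

theorem IsLocal.mono {ι : Type} [Fintype ι] [DecidableEq ι] {N N' : ι → ι → Prop} {U : Op ι S}
    (hU : IsLocal N U) (h : ∀ i j, N i j → N' i j) : IsLocal N' U :=
  ⟨hU.1, fun i j hij m m' => hU.2 i j (fun h' => hij (h i j h')) m m'⟩

theorem IsSym.mono (hU : IsSym ξ M U) (h : ξ ≤ ξ') : IsSym ξ' M U :=
  ⟨hU.loc.mono fun _ _ => near_mono h, hU.mem, hU.comm⟩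

theorem IsLocal.near_mul {U U' : Op (ZMod ℓ) S} (hU : IsLocal (near ξ) U)
    (hU' : IsLocal (near ξ') U') : IsLocal (near (ξ + ξ')) (U' * U) := by
  refine ⟨mul_mem hU'.1 hU.1, fun i j hij m m' => ?_⟩
  rw [← heis_heis, commute_heis_iff hU.1]
  classical
  have h1 : SupportedOn {a | near ξ' i a} (heis U' (siteOp i m)) :=
    hU'.supportedOn (near_symm ξ') (X := {i}) (fun k hk a ha => by
      rw [Finset.mem_singleton] at hk; subst hk; simpa using ha) (supportedOn_singleton.2 ⟨m, rfl⟩)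
  have h2 : SupportedOn {a | near ξ j a} (heis Uᴴ (siteOp j m')) :=
    (hU.ct (near_symm ξ)).supportedOn (near_symm ξ) (X := {j}) (fun k hk a ha => by
      rw [Finset.mem_singleton] at hk; subst hk; simpa using ha) (supportedOn_singleton.2 ⟨m', rfl⟩)
  refine h1.commute (Finset.disjoint_left.2 fun a ha hb => hij ?_) h2
  have ha : near ξ' i a := by simpa using ha
  have hb : near ξ j a := by simpa using hb
  rw [add_comm]
  exact near_trans ha (near_symm _ _ _ hb)

theorem IsSym.mul (hU : IsSym ξ M U) (hU' : IsSym ξ' M U') : IsSym (ξ + ξ') M (U' * U) :=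
  ⟨hU.loc.near_mul hU'.loc, hU.mem, hU'.comm.mul_left hU.comm⟩

theorem commute_ct {n : Type} [Fintype n] [DecidableEq n] {U A : Matrix n n ℂ}
    (hU : U ∈ Matrix.unitaryGroup n ℂ) (h : Commute U A) : Commute Uᴴ A := by
  have h1 := heis_of_commute hU h
  rw [Commute, SemiconjBy]
  nth_rewrite 2 [← h1]
  rw [heis, mul_assoc, mul_ct hU, mul_one]

theorem IsSym.ct (hU : IsSym ξ M U) : IsSym ξ M Uᴴ :=
  ⟨hU.loc.ct (near_symm ξ), hU.mem, commute_ct hU.loc.1 hU.comm⟩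

theorem mtr_one [Nonempty S] : mtr (1 : Matrix S S ℂ) = 1 := by
  rw [mtr, Matrix.trace_one, div_self]
  exact Nat.cast_ne_zero.2 Fintype.card_ne_zero

/-- The window grows by `ξ' - ξ` sites on either side. On the left these belong to the bulk, where
the evolved symmetry acts as `M`; on the right it does not act. Normalization by `mtr (M ^ j) ^ ξ`
is chosen to cancel exactly the added factor. -/
theorem IsSym.rightEnd_mono (hU : IsSym ξ M U) (h : ξ ≤ ξ') (hℓ : 12 * ξ' ≤ ℓ) {y : ZMod ℓ}
    {T : Op (ZMod ℓ) S} (hT : RightEnd ξ U M y T) :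
    RightEnd ξ' U M y (onSites (arc (y - (ξ' : ZMod ℓ)) (ξ' - ξ)) M * T) := by
  set b := y - ((4 * ξ' : ℕ) : ZMod ℓ) with hb
  have e1 : y - (ξ' : ZMod ℓ) = b + ((3 * ξ' : ℕ) : ZMod ℓ) := by rw [hb]; push_cast; ring
  have e2 : y - (ξ : ZMod ℓ) = b + ((4 * ξ' - ξ : ℕ) : ZMod ℓ) := by
    rw [hb, Nat.cast_sub (by omega)]; ring
  have e3 : y - ((2 * ξ' : ℕ) : ZMod ℓ) = b + ((2 * ξ' : ℕ) : ZMod ℓ) := by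
    rw [hb]; push_cast; ring
  have e4 : y - ((2 * ξ : ℕ) : ZMod ℓ) = b + ((4 * ξ' - 2 * ξ : ℕ) : ZMod ℓ) := by
    rw [hb, Nat.cast_sub (by omega)]; ring
  have hA : SupportedOn (arc (y - (ξ' : ZMod ℓ)) (ξ' - ξ))
    (onSites (arc (y - (ξ' : ZMod ℓ)) (ξ' - ξ)) M) := supportedOn_onSites _ _
  have hdis : Disjoint (arc (y - (ξ' : ZMod ℓ)) (ξ' - ξ)) (arc (y - (ξ : ZMod ℓ)) (2 * ξ)) := by
    refine Finset.disjoint_left.2 fun i hi => ?_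
    rw [mem_arc_crd e1 (by omega)] at hi
    rw [mem_arc_crd e2 (by omega)]
    omega
  have hcomm := hA.commute hdis hT.2.1
  have hT' : IsEnd U M (arc (y - (ξ : ZMod ℓ)) (2 * ξ))
      (arc (y - ((2 * ξ' : ℕ) : ZMod ℓ)) (2 * ξ')) T := by
    refine IsEnd.congr (near_symm ξ) hU.loc hU.mem (fun k hk j hj => ?_) hT
    rw [mem_arc_crd e2 (by omega)] at hk
    rw [mem_arc_crd e3 (by omega), mem_arc_crd e4 (by omega)]
    have := near_crd b hj
    have := crd_lt b j
    omega
  have hAu := onSites_mem hU.mem (arc (y - (ξ' : ZMod ℓ)) (ξ' - ξ))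
  refine isEnd_of_conj (mul_mem hAu hT.1) ?_ ?_ hU.loc.1 hU.mem
  · refine (hA.mono ?_).mul (hT.2.1.mono ?_)
    · intro i hi
      rw [mem_arc_crd e1 (by omega)] at hi ⊢
      omega
    · intro i hi
      rw [mem_arc_crd e2 (by omega)] at hi
      rw [mem_arc_crd e1 (by omega)]
      omega
  · intro i hi m
    rw [mem_arc_crd e1 (by omega)] at hi
    have him : SupportedOn {i} (siteOp i m) := supportedOn_singleton.2 ⟨m, rfl⟩
    rw [Matrix.conjTranspose_mul]
    by_cases h1 : i ∈ arc (y - (ξ : ZMod ℓ)) (2 * ξ)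
    · have h2 := hT'.conj hU.loc.1 hU.mem (him.mono (by simpa using h1))
      rw [← h2]
      have h3 : SupportedOn (arc (y - (ξ : ZMod ℓ)) (2 * ξ)) (T * siteOp i m * Tᴴ) :=
        (hT.2.1.mul (him.mono (by simpa using h1))).mul hT.2.1.conjTranspose
      have h4 := (hA.commute hdis h3).eq
      calc _ = (onSites (arc (y - (ξ' : ZMod ℓ)) (ξ' - ξ)) M * (T * siteOp i m * Tᴴ)) *
            (onSites (arc (y - (ξ' : ZMod ℓ)) (ξ' - ξ)) M)ᴴ := by simp only [mul_assoc]
        _ = _ := by rw [h4, mul_assoc, mul_ct hAu, mul_one]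
    · have h5 : T * siteOp i m * Tᴴ = siteOp i m := by
        rw [(hT.2.1.commute (Finset.disjoint_singleton_right.2 h1) him).eq, mul_assoc, mul_ct hT.1,
          mul_one]
      have h6 : onSites (arc (y - (ξ' : ZMod ℓ)) (ξ' - ξ)) M * T * siteOp i m *
          (Tᴴ * (onSites (arc (y - (ξ' : ZMod ℓ)) (ξ' - ξ)) M)ᴴ) =
          onSites (arc (y - (ξ' : ZMod ℓ)) (ξ' - ξ)) M * siteOp i m *
          (onSites (arc (y - (ξ' : ZMod ℓ)) (ξ' - ξ)) M)ᴴ := by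
        nth_rewrite 2 [← h5]; simp only [mul_assoc]
      rw [h6]
      rw [mem_arc_crd e2 (by omega)] at h1
      by_cases h7 : crd b i < 4 * ξ' - ξ
      · rw [heis_onSites_conj (near_symm ξ) hU.loc hU.mem hU.comm (Y := {i}) ?_ him]
        · refine him.conj_onSites hU.mem fun k hk => ?_
          rw [Finset.mem_singleton] at hk
          subst hk
          rw [mem_arc_crd e1 (by omega)]
          simp only [Finset.mem_univ, iff_true]
          omega
        · intro k hk j hj
          rw [Finset.mem_singleton] at hk
          subst hk
          rw [mem_arc_crd e3 (by omega)]
          have := near_crd b hj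
          have := crd_lt b j
          omega
      · have h8 : i ∉ arc (y - (ξ' : ZMod ℓ)) (ξ' - ξ) := by
          rw [mem_arc_crd e1 (by omega)]
          omega
        have h9 : SupportedOn {i}ᶜ (heis U (onSites (arc (y - ((2 * ξ' : ℕ) : ZMod ℓ)) (2 * ξ')) M)) := by
          refine hU.loc.supportedOn (near_symm ξ) (fun k hk j hj => ?_) (supportedOn_onSites _ _)
          rw [Finset.mem_compl, Finset.mem_singleton]
          rintro rfl
          rw [mem_arc_crd e3 (by omega)] at hk
          have := near_crd b hj
          omega
        rw [(hA.commute (Finset.disjoint_singleton_right.2 h8) him).eq, mul_assoc, mul_ct hAu,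
          (h9.commute_compl him).eq, mul_assoc, mul_ct (heis_mem hU.loc.1 (onSites_mem hU.mem _))]

theorem IsSym.endRatio_mono [Nonempty S] (hU : IsSym ξ M U) (h : ξ ≤ ξ') (hℓ : 12 * ξ' ≤ ℓ)
    (hd : M ^ d = 1) (htr : ∀ j, mtr (M ^ j) ≠ 0) {τ : ℕ → ℂ} (hτ : IsEndRatio ξ U M d τ) :
    IsEndRatio ξ' U M d τ := by
  obtain ⟨y, T, hT, hTd, ht⟩ := hτ
  have hdis : Disjoint (arc (y - (ξ' : ZMod ℓ)) (ξ' - ξ)) (arc (y - (ξ : ZMod ℓ)) (2 * ξ)) := by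
    refine Finset.disjoint_left.2 fun i hi => ?_
    rw [mem_arc_crd (b := y - (ξ' : ZMod ℓ)) (α := 0) (by simp) (by omega)] at hi
    rw [mem_arc_crd (b := y - (ξ' : ZMod ℓ)) (α := ξ' - ξ) (by
      rw [Nat.cast_sub h]; ring) (by omega)]
    omega
  have hA : SupportedOn (arc (y - (ξ' : ZMod ℓ)) (ξ' - ξ))
    (onSites (arc (y - (ξ' : ZMod ℓ)) (ξ' - ξ)) M) := supportedOn_onSites _ _
  have hp : ∀ j, (onSites (arc (y - (ξ' : ZMod ℓ)) (ξ' - ξ)) M * T) ^ j =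
      onSites (arc (y - (ξ' : ZMod ℓ)) (ξ' - ξ)) (M ^ j) * T ^ j := fun j => by
    rw [(hA.commute hdis hT.2.1).mul_pow, onSites_pow]
  refine ⟨y, _, hU.rightEnd_mono h hℓ hT, ?_, fun j => ?_⟩
  · rw [hp, hd, hTd, onSites_one, mul_one]
  · rw [hp, ntr_mul_of_disjoint hdis (supportedOn_onSites _ _) (hT.2.1.pow j),
      ntr_onSites_arc (by omega), ht j]
    have hm := htr j
    have : mtr (M ^ j) ^ ξ' = mtr (M ^ j) ^ (ξ' - ξ) * mtr (M ^ j) ^ ξ := by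
      rw [← pow_add]; congr 1; omega
    rw [this, mul_div_mul_left _ _ (pow_ne_zero _ hm)]

/-- End ratios are multiplicative under composition. -/
theorem IsSym.endRatio_mul [Nonempty S] (hU : IsSym ξ M U) (hU' : IsSym ξ' M U')
    (hℓ : 20 * (ξ + ξ') + 1 ≤ ℓ) (hd0 : 0 < d) (hd : M ^ d = 1) (htr : ∀ j, mtr (M ^ j) ≠ 0)
    {τ τ' : ℕ → ℂ}
    (hτ : IsEndRatio ξ U M d τ) (hτ' : IsEndRatio ξ' U' M d τ') :
    IsEndRatio (ξ + ξ') (U' * U) M d fun j => τ j * τ' j := by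
  -- `U'` turns the symmetry of `[x, x + n)` into ends `T₂`, `S₂` and the bulk `[x', x' + n')`; `U`
  -- turns this bulk into ends `T₁`, `S₁` and a smaller bulk. The right end of the composition is
  -- `S₁` times the evolved `S₂`. The length `n` keeps left and right apart.
  set n := 8 * (ξ + ξ') with hn
  let x : ZMod ℓ := 0
  set x' : ZMod ℓ := x + (ξ' : ZMod ℓ) with hx'
  set n' := n - 2 * ξ' with hn'
  set y : ZMod ℓ := x + (n : ZMod ℓ) with hy
  obtain ⟨S₂, hS₂, hd₂, ht₂⟩ := hU'.endRatio_at (by omega) hd htr hτ' y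
  obtain ⟨S₁, hS₁, hd₁, ht₁⟩ := hU.endRatio_at (by omega) hd htr hτ (x' + (n' : ZMod ℓ))
  obtain ⟨T₂, hT₂, -, hX₂⟩ := hU'.exists_left_of_right (x := x) (n := n) (by omega) hd (by omega)
    (by omega) hS₂ hd₂
  obtain ⟨T₁, hT₁, -, hX₁⟩ := hU.exists_left_of_right (x := x') (n := n') (by omega) hd (by omega)
    (by omega) hS₁ hd₁
  obtain ⟨-, cT₂S₂, cMS₂⟩ := ends_commute (M := M) (n := n) (by omega) (by omega) hT₂.2.1 hS₂.2.1
  set b : ZMod ℓ := x - ((ξ + ξ' : ℕ) : ZMod ℓ) with hb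
  have e0 : b = b + ((0 : ℕ) : ZMod ℓ) := by simp
  have eK : y - ((ξ + ξ' : ℕ) : ZMod ℓ) = b + (n : ZMod ℓ) := by rw [hy, hb]; ring
  have eS₁ : x' + (n' : ZMod ℓ) - (ξ : ZMod ℓ) = b + (n : ZMod ℓ) := by
    rw [hx', hb, hn', Nat.cast_sub (by omega)]; push_cast; ring
  have eS₂ : y - (ξ' : ZMod ℓ) = b + ((n + ξ : ℕ) : ZMod ℓ) := by
    rw [hy, hb]; push_cast; ring
  have eT₂ : x - (ξ' : ZMod ℓ) = b + (ξ : ZMod ℓ) := by rw [hb]; push_cast; ring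
  have eT₁ : x' - (ξ : ZMod ℓ) = b + ((2 * ξ' : ℕ) : ZMod ℓ) := by
    rw [hx', hb]; push_cast; ring
  have eM₁ : x' + (ξ : ZMod ℓ) = b + ((2 * ξ' + 2 * ξ : ℕ) : ZMod ℓ) := by
    rw [hx', hb]; push_cast; ring
  have sS₁ : SupportedOn (arc (y - ((ξ + ξ' : ℕ) : ZMod ℓ)) (2 * (ξ + ξ'))) S₁ := by
    refine hS₁.2.1.mono fun i hi => ?_
    rw [mem_arc_crd eS₁ (by omega)] at hi
    rw [mem_arc_crd eK (by omega)]
    omega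
  have sS₂ : SupportedOn (arc (y - ((ξ + ξ' : ℕ) : ZMod ℓ)) (2 * (ξ + ξ'))) (heis U S₂) := by
    refine hU.loc.supportedOn (near_symm ξ) (fun i hi j hj => ?_) hS₂.2.1
    rw [mem_arc_crd eS₂ (by omega)] at hi
    rw [mem_arc_crd eK (by omega)]
    have := near_crd b hj
    have := crd_lt b j
    omega
  have sT₁ : SupportedOn (arc b n) T₁ := by
    refine hT₁.2.1.mono fun i hi => ?_
    rw [mem_arc_crd eT₁ (by omega)] at hi
    rw [mem_arc_crd e0 (by omega)]
    omega
  have sT₂ : SupportedOn (arc b n) (heis U T₂) := by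
    refine hU.loc.supportedOn (near_symm ξ) (fun i hi j hj => ?_) hT₂.2.1
    rw [mem_arc_crd eT₂ (by omega)] at hi
    rw [mem_arc_crd e0 (by omega)]
    have := near_crd b hj
    have := crd_lt b j
    omega
  have sM₁ : ∀ A : Matrix S S ℂ,
      SupportedOn (arc b n) (onSites (arc (x' + (ξ : ZMod ℓ)) (n' - 2 * ξ)) A) := by
    intro A
    refine (supportedOn_onSites _ _).mono fun i hi => ?_
    rw [mem_arc_crd eM₁ (by omega)] at hi
    rw [mem_arc_crd e0 (by omega)]
    omega
  have hdis : Disjoint (arc b n) (arc (y - ((ξ + ξ' : ℕ) : ZMod ℓ)) (2 * (ξ + ξ'))) := by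
    refine Finset.disjoint_left.2 fun i hi => ?_
    rw [mem_arc_crd e0 (by omega)] at hi
    rw [mem_arc_crd eK (by omega)]
    omega
  set P := heis U S₂ with hP
  have hPu : P ∈ Matrix.unitaryGroup (ZMod ℓ → S) ℂ := heis_mem hU.loc.1 hS₂.1
  set B := T₁ * onSites (arc (x' + (ξ : ZMod ℓ)) (n' - 2 * ξ)) M with hB
  have hBu : B ∈ Matrix.unitaryGroup (ZMod ℓ → S) ℂ := mul_mem hT₁.1 (onSites_mem hU.mem _)
  have sB : SupportedOn (arc b n) B := sT₁.mul (sM₁ M)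
  -- The supports of `S₁` and `P` overlap, so locality does not help directly. But `B * S₁` is the
  -- evolved bulk, which commutes with the evolved `S₂`, and `B` is supported away from `P`.
  have cS₁P : Commute S₁ P := by
    have h1 : Commute (B * S₁) P := by
      rw [hB, ← hX₁]
      exact heis_commute hU.loc.1 cMS₂
    have h2 : Commute B P := sB.commute hdis sS₂
    calc S₁ * P = Bᴴ * ((B * S₁) * P) := by
          rw [← mul_assoc, ← mul_assoc, ct_mul hBu, one_mul]
      _ = Bᴴ * (P * B * S₁) := by rw [h1.eq, mul_assoc P]
      _ = P * S₁ := by rw [← h2.eq, mul_assoc B, ← mul_assoc, ct_mul hBu, one_mul]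
  have hX : heis (U' * U) (onSites (arc x n) M) = heis U T₂ * B * (S₁ * P) := by
    rw [← heis_heis, hX₂, heis_mul hU.loc.1, heis_mul hU.loc.1, hX₁]
    simp only [mul_assoc, hB, hP]
  have hpow : ∀ j, (S₁ * P) ^ j = S₁ ^ j * heis U (S₂ ^ j) := fun j => by
    rw [cS₁P.mul_pow, hP, heis_pow hU.loc.1]
  refine ⟨y, S₁ * P, ((hU.mul hU').rightEnd_iff (x := x) (n := n) (by omega) (by omega)).2 ?_, ?_,
    fun j => ?_⟩
  · have hSu : S₁ * P ∈ Matrix.unitaryGroup (ZMod ℓ → S) ℂ := mul_mem hS₁.1 hPu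
    refine ⟨hSu, sS₁.mul sS₂, ?_⟩
    have h3 : Commute (heis U T₂ * B) (S₁ * P) := (sT₂.mul sB).commute hdis (sS₁.mul sS₂)
    rw [hX, h3.eq, ← mul_assoc, ct_mul hSu, one_mul]
    refine (sT₂.mul sB).mono fun i hi => ?_
    rw [Finset.mem_compl]
    exact Finset.disjoint_left.1 hdis hi
  · rw [hpow, hd₁, hd₂, heis_one hU.loc.1, one_mul]
  · have hm := htr j
    -- Since `S₁` and the evolved `S₂` overlap, the trace of their product is obtained indirectly:
    -- before the evolution by `U`, bulk and `S₂` are disjoint, and afterwards the left end and the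
    -- bulk split off and cancel against `f3`.
    have f1 : heis U (onSites (arc (x + (ξ' : ZMod ℓ)) (n - 2 * ξ')) (M ^ j) * S₂ ^ j) =
        (T₁ ^ j * onSites (arc (x' + (ξ : ZMod ℓ)) (n' - 2 * ξ)) (M ^ j)) *
          (S₁ ^ j * heis U (S₂ ^ j)) := by
      rw [heis_mul hU.loc.1, ends_pow (by omega) (by omega) hU.loc.1 hT₁.2.1 hS₁.2.1 hX₁ j,
        mul_assoc _ (S₁ ^ j)]
    have f2 := congrArg ntr f1
    rw [heis, ntr_conj (mul_ct hU.loc.1)] at f2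
    obtain ⟨-, d2, -, -, s2, -, -⟩ := disjoint_ends (x := x) (ξ := ξ') (n := n) (by omega) (by omega)
    obtain ⟨d1, -, -, -, -, -, -⟩ := disjoint_ends (x := x') (ξ := ξ) (n := n') (by omega) (by omega)
    have sP : SupportedOn (arc (y - ((ξ + ξ' : ℕ) : ZMod ℓ)) (2 * (ξ + ξ'))) (S₁ ^ j * heis U (S₂ ^ j)) := by
      rw [← hpow]; exact (sS₁.mul sS₂).pow j
    rw [ntr_mul_of_disjoint d2 ((supportedOn_onSites _ _).mono s2) (hS₂.2.1.pow j),
      ntr_mul_of_disjoint hdis ((sT₁.pow j).mul (sM₁ _)) sP,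
      ntr_mul_of_disjoint d1 (hT₁.2.1.pow j) (supportedOn_onSites _ _),
      ntr_onSites_arc (by omega), ntr_onSites_arc (by omega), ← hpow] at f2
    have f3 := ntr_ends_pow (by omega) (by omega) hU.loc.1 hT₁.2.1 hS₁.2.1 hX₁ j
    have hne : ntr (T₁ ^ j) * mtr (M ^ j) ^ (n' - 2 * ξ) ≠ 0 := by
      intro h0
      rw [h0, zero_mul] at f3
      exact pow_ne_zero _ hm f3.symm
    have f4 : ntr ((S₁ * P) ^ j) = ntr (S₁ ^ j) * ntr (S₂ ^ j) := by
      refine mul_left_cancel₀ hne ?_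
      rw [← f2, ← mul_assoc, f3]
    beta_reduce
    rw [f4, ht₁, ht₂, pow_add, div_mul_div_comm]

end RingEnds

/-! ### Chains whose sites are pairs of sites -/

section Tensor
variable {ι R S T : Type} [Fintype ι] [DecidableEq ι] [Fintype R] [DecidableEq R]
  [Fintype S] [DecidableEq S] [Fintype T] [DecidableEq T]

/-- Configurations of pairs as pairs of configurations. -/
def pairConfig (ι : Type) (e : R ≃ S × T) : (ι → R) ≃ (ι → S) × (ι → T) :=
  (Equiv.arrowCongr (Equiv.refl ι) e).trans (Equiv.arrowProdEquivProdArrow ι (fun _ => S) (fun _ => T))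

/-- The operator `A ⊗ B` on a chain whose sites are pairs of sites. -/
def tens (e : R ≃ S × T) (A : Op ι S) (B : Op ι T) : Op ι R :=
  (A ⊗ₖ B).submatrix (pairConfig ι e) (pairConfig ι e)

/-- The one-site operator `A ⊗ B`. -/
def stens (e : R ≃ S × T) (A : Matrix S S ℂ) (B : Matrix T T ℂ) : Matrix R R ℂ :=
  (A ⊗ₖ B).submatrix e e

variable {e : R ≃ S × T}

theorem tens_apply (A : Op ι S) (B : Op ι T) (f h : ι → R) :
    tens e A B f h = A (fun i => (e (f i)).1) (fun i => (e (h i)).1) *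
      B (fun i => (e (f i)).2) (fun i => (e (h i)).2) := rfl

theorem tens_mul (A A' : Op ι S) (B B' : Op ι T) :
    tens e A B * tens e A' B' = tens e (A * A') (B * B') := by
  simp only [tens, Matrix.submatrix_mul_equiv, Matrix.mul_kronecker_mul]

theorem tens_one : tens e (1 : Op ι S) (1 : Op ι T) = 1 := by simp [tens]

theorem tens_ct (A : Op ι S) (B : Op ι T) : (tens e A B)ᴴ = tens e Aᴴ Bᴴ := by
  simp [tens, Matrix.conjTranspose_submatrix, Matrix.conjTranspose_kronecker]

theorem tens_pow (A : Op ι S) (B : Op ι T) (j : ℕ) : tens e A B ^ j = tens e (A ^ j) (B ^ j) := by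
  induction j with
  | zero => simp [tens_one]
  | succ j ih => rw [pow_succ, ih, tens_mul, pow_succ, pow_succ]

theorem tens_mem {A : Op ι S} {B : Op ι T} (hA : A ∈ Matrix.unitaryGroup _ ℂ)
    (hB : B ∈ Matrix.unitaryGroup _ ℂ) : tens e A B ∈ Matrix.unitaryGroup (ι → R) ℂ :=
  Matrix.mem_unitaryGroup_iff.2 (by
    rw [Matrix.star_eq_conjTranspose, tens_ct, tens_mul, mul_ct hA, mul_ct hB, tens_one])

theorem heis_tens (U A : Op ι S) (V B : Op ι T) :
    heis (tens e U V) (tens e A B) = tens e (heis U A) (heis V B) := by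
  simp only [heis, tens_ct, tens_mul]

theorem trace_submatrix_equiv {m n : Type} [Fintype m] [Fintype n] (c : m ≃ n)
    (A : Matrix n n ℂ) : (A.submatrix c c).trace = A.trace :=
  Equiv.sum_comp c fun x => A x x

theorem ntr_tens (A : Op ι S) (B : Op ι T) : ntr (tens e A B) = ntr A * ntr B := by
  rw [ntr, tens, trace_submatrix_equiv, Matrix.trace_kronecker,
    Fintype.card_congr (pairConfig ι e), Fintype.card_prod, ntr, ntr, Nat.cast_mul,
    mul_div_mul_comm]

theorem tens_prodOp (A : ι → Matrix S S ℂ) (B : ι → Matrix T T ℂ) :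
    tens e (prodOp A) (prodOp B) = prodOp fun i => stens e (A i) (B i) := by
  ext f h
  simp [tens_apply, prodOp, stens, Finset.prod_mul_distrib]

theorem stens_one : stens e (1 : Matrix S S ℂ) (1 : Matrix T T ℂ) = 1 := by simp [stens]

theorem stens_mul (A A' : Matrix S S ℂ) (B B' : Matrix T T ℂ) :
    stens e A B * stens e A' B' = stens e (A * A') (B * B') := by
  simp only [stens, Matrix.submatrix_mul_equiv, Matrix.mul_kronecker_mul]

theorem stens_pow (A : Matrix S S ℂ) (B : Matrix T T ℂ) (j : ℕ) :
    stens e A B ^ j = stens e (A ^ j) (B ^ j) := by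
  induction j with
  | zero => simp [stens_one]
  | succ j ih => rw [pow_succ, ih, stens_mul, pow_succ, pow_succ]

theorem stens_mem {A : Matrix S S ℂ} {B : Matrix T T ℂ} (hA : A ∈ Matrix.unitaryGroup _ ℂ)
    (hB : B ∈ Matrix.unitaryGroup _ ℂ) : stens e A B ∈ Matrix.unitaryGroup R ℂ :=
  Matrix.mem_unitaryGroup_iff.2 (by
    rw [Matrix.star_eq_conjTranspose, stens, Matrix.conjTranspose_submatrix,
      Matrix.conjTranspose_kronecker, ← stens, ← stens, stens_mul, mul_ct hA, mul_ct hB, stens_one])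

theorem mtr_stens (A : Matrix S S ℂ) (B : Matrix T T ℂ) : mtr (stens e A B) = mtr A * mtr B := by
  rw [mtr, stens, trace_submatrix_equiv, Matrix.trace_kronecker,
    Fintype.card_congr e, Fintype.card_prod, mtr, mtr, Nat.cast_mul, mul_div_mul_comm]

theorem tens_onSites (I : Finset ι) (A : Matrix S S ℂ) (B : Matrix T T ℂ) :
    tens e (onSites I A) (onSites I B) = onSites I (stens e A B) := by
  rw [onSites, onSites, tens_prodOp, onSites]
  congr 1; funext i; split_ifs
  · rfl
  · exact stens_one

theorem siteOp_eq_sum (i : ι) (m : Matrix R R ℂ) :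
    siteOp i m = ∑ r, ∑ r', m r r' • siteOp i (Matrix.single r r' 1) := by
  ext f h
  simp only [Matrix.sum_apply, Matrix.smul_apply, siteOp_apply]
  split_ifs with h1
  · rw [Finset.sum_eq_single (f i), Finset.sum_eq_single (h i)]
    · simp
    · intro b _ hb; simp [hb]
    · simp
    · intro b _ hb; simp [hb]
    · simp
  · simp

/-- Every matrix unit of a pair of sites is a product of matrix units, so product operators detect
commutation. Supports and locality of tensor products follow. -/
theorem commute_siteOp_of_stens {O : Op ι R} {i : ι}
    (h : ∀ A B, Commute O (siteOp i (stens e A B))) (m : Matrix R R ℂ) :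
    Commute O (siteOp i m) := by
  rw [siteOp_eq_sum]
  refine Commute.sum_right _ _ _ fun r _ => Commute.sum_right _ _ _ fun r' _ =>
    Commute.smul_right ?_ _
  have : stens e (Matrix.single (e r).1 (e r').1 1) (Matrix.single (e r).2 (e r').2 1) =
      Matrix.single r r' (1 : ℂ) := by
    ext a b
    simp only [stens, Matrix.submatrix_apply, Matrix.kroneckerMap_apply, Matrix.single_apply]
    by_cases ha : r = a
    · by_cases hb : r' = b
      · simp [ha, hb]
      · have : ¬((e r').1 = (e b).1 ∧ (e r').2 = (e b).2) := fun h0 =>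
          hb (e.injective (Prod.ext h0.1 h0.2))
        rw [ite_zero_mul_ite_zero, if_neg, if_neg] <;> tauto
    · have : ¬((e r).1 = (e a).1 ∧ (e r).2 = (e a).2) := fun h0 =>
          ha (e.injective (Prod.ext h0.1 h0.2))
      rw [ite_zero_mul_ite_zero, if_neg, if_neg] <;> tauto
  rw [← this]
  exact h _ _

theorem tens_commute {A A' : Op ι S} {B B' : Op ι T} (hA : Commute A A') (hB : Commute B B') :
    Commute (tens e A B) (tens e A' B') := by
  rw [Commute, SemiconjBy, tens_mul, tens_mul, hA.eq, hB.eq]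

theorem SupportedOn.tens {X : Finset ι} {A : Op ι S} {B : Op ι T} (hA : SupportedOn X A)
    (hB : SupportedOn X B) : SupportedOn X (tens e A B) := by
  refine supportedOn_iff.2 fun i hi => commute_siteOp_of_stens (e := e) fun a b => ?_
  rw [siteOp, ← tens_onSites]
  exact tens_commute (supportedOn_iff.1 hA i hi a) (supportedOn_iff.1 hB i hi b)

theorem IsLocal.tens {N : ι → ι → Prop} {U : Op ι S} {V : Op ι T} (hU : IsLocal N U)
    (hV : IsLocal N V) : IsLocal N (tens e U V) := by
  have hW : SpinChain.tens e U V ∈ Matrix.unitaryGroup (ι → R) ℂ := tens_mem hU.1 hV.1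
  refine ⟨hW, fun i j hij m m' => ?_⟩
  refine commute_siteOp_of_stens (e := e) (fun a b => ?_) m'
  rw [commute_heis_iff hW]
  refine (commute_siteOp_of_stens (e := e) (fun a' b' => ?_) m).symm
  refine ((commute_heis_iff hW).1 ?_).symm
  rw [siteOp, siteOp, ← tens_onSites, ← tens_onSites, heis_tens]
  exact tens_commute (hU.2 i j hij _ _) (hV.2 i j hij _ _)

end Tensor

/-! ### End ratios of tensor products -/

section RingTensor
variable {ℓ : ℕ} [NeZero ℓ] {R S T : Type} [Fintype R] [DecidableEq R]
  [Fintype S] [DecidableEq S] [Fintype T] [DecidableEq T] {e : R ≃ S × T} {ξ ξ' d : ℕ}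

theorem IsSym.tens {M : Matrix S S ℂ} {M' : Matrix T T ℂ} {U : Op (ZMod ℓ) S} {V : Op (ZMod ℓ) T}
    (hU : IsSym ξ M U) (hV : IsSym ξ M' V) : IsSym ξ (stens e M M') (tens e U V) :=
  ⟨hU.loc.tens hV.loc, stens_mem hU.mem hV.mem, by
    rw [← tens_onSites]; exact tens_commute hU.comm hV.comm⟩

theorem RightEnd.tens {M : Matrix S S ℂ} {M' : Matrix T T ℂ} {U : Op (ZMod ℓ) S}
    {V : Op (ZMod ℓ) T} {y : ZMod ℓ} {A : Op (ZMod ℓ) S} {B : Op (ZMod ℓ) T}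
    (hA : RightEnd ξ U M y A) (hB : RightEnd ξ V M' y B) :
    RightEnd ξ (tens e U V) (stens e M M') y (tens e A B) := by
  refine ⟨tens_mem hA.1 hB.1, hA.2.1.tens hB.2.1, ?_⟩
  rw [← tens_onSites, heis_tens, tens_ct, tens_mul]
  exact hA.2.2.tens hB.2.2

theorem IsSym.endRatio_tens [Nonempty S] [Nonempty T] {M : Matrix S S ℂ} {M' : Matrix T T ℂ}
    {U : Op (ZMod ℓ) S} {V : Op (ZMod ℓ) T} (hU : IsSym ξ M U)
    (hℓ : 12 * ξ + 1 ≤ ℓ) (hd : M ^ d = 1)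
    (htr : ∀ j, mtr (M ^ j) ≠ 0)
    {τ τ' : ℕ → ℂ} (hτ : IsEndRatio ξ U M d τ) (hτ' : IsEndRatio ξ V M' d τ') :
    IsEndRatio ξ (SpinChain.tens e U V) (stens e M M') d fun j => τ j * τ' j := by
  obtain ⟨y, B, hB, hBd, hBt⟩ := hτ'
  obtain ⟨A, hA, hAd, hAt⟩ := hU.endRatio_at hℓ hd htr hτ y
  refine ⟨y, _, hA.tens hB, ?_, fun j => ?_⟩
  · rw [tens_pow, hAd, hBd, tens_one]
  · beta_reduce
    rw [hAt, hBt, tens_pow, ntr_tens, stens_pow, mtr_stens, mul_pow, div_mul_div_comm]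

theorem isSym_one {M : Matrix S S ℂ} (hM : M ∈ Matrix.unitaryGroup S ℂ) :
    IsSym ξ M (1 : Op (ZMod ℓ) S) := by
  refine ⟨⟨one_mem _, fun i j hij m m' => ?_⟩, hM, Commute.one_left _⟩
  have hne : i ≠ j := by
    rintro rfl
    exact hij (near_iff.2 ⟨ξ, by omega, rfl⟩)
  have : heis (1 : Op (ZMod ℓ) S) (siteOp i m) = siteOp i m := by simp [heis]
  rw [this]
  exact (supportedOn_singleton.2 ⟨m, rfl⟩).commute (by simpa using hne)
    (supportedOn_singleton.2 ⟨m', rfl⟩)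

/-- With spreading length zero the window is empty and the end is 1; `IsSym.endRatio_mono` enlarges
the spreading length. -/
theorem endRatio_one [Nonempty S] {M : Matrix S S ℂ} (hM : M ∈ Matrix.unitaryGroup S ℂ)
    (hℓ : 12 * ξ ≤ ℓ) (hd : M ^ d = 1) (htr : ∀ j, mtr (M ^ j) ≠ 0) :
    IsEndRatio ξ (1 : Op (ZMod ℓ) S) M d fun _ => 1 := by
  refine IsSym.endRatio_mono (ξ := 0) (isSym_one hM) (Nat.zero_le _) hℓ hd htr ?_
  refine ⟨0, 1, ⟨one_mem _, supportedOn_one _, ?_⟩, one_pow _, fun j => by simp [ntr_one]⟩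
  have : (arc (0 - ((0 : ℕ) : ZMod ℓ)) (2 * 0))ᶜ = Finset.univ := by simp [arc]
  rw [this]
  exact supportedOn_univ _

end RingTensor

/-! ### Two copies of a chain and their exchange -/

section Doubling
variable {ι S T : Type} [Fintype ι] [DecidableEq ι] [Fintype S] [DecidableEq S]
  [Fintype T] [DecidableEq T]

/-- Two copies of a chain. -/
def dbl (U : Op ι S) : Op ι (S × S) := tens (Equiv.refl _) U U

/-- The exchange of two copies of a site. -/
def swapM (S : Type) [DecidableEq S] : Matrix (S × S) (S × S) ℂ :=
  Matrix.of fun p q => if p = q.swap then 1 else 0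

theorem swapM_mul_self : swapM S * swapM S = 1 := by
  ext p q
  rw [Matrix.mul_apply, Finset.sum_eq_single q.swap]
  · simp [swapM, Matrix.one_apply]
  · intro r _ hr
    simp [swapM, hr]
  · simp

theorem swapM_ct : (swapM S)ᴴ = swapM S := by
  ext p q
  simp only [swapM, Matrix.conjTranspose_apply, Matrix.of_apply, apply_ite (star : ℂ → ℂ), star_one,
    star_zero]
  exact if_congr ⟨fun h => by rw [h]; simp, fun h => by rw [h]; simp⟩ rfl rfl

theorem swapM_mem : swapM S ∈ Matrix.unitaryGroup (S × S) ℂ :=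
  Matrix.mem_unitaryGroup_iff.2 (by
    rw [Matrix.star_eq_conjTranspose, swapM_ct, swapM_mul_self])

theorem trace_swapM : (swapM S).trace = Fintype.card S := by
  simp only [Matrix.trace, Matrix.diag_apply, swapM, Matrix.of_apply, Fintype.sum_prod_type]
  rw [Finset.sum_congr rfl (g := fun _ => (1 : ℂ))]
  · simp
  · intro x _
    rw [Finset.sum_eq_single x]
    · simp
    · intro b _ hb
      rw [if_neg]
      intro h
      exact hb (Prod.ext_iff.1 h).2
    · simp

theorem mtr_swapM [Nonempty S] : mtr (swapM S) = (Fintype.card S : ℂ)⁻¹ := by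
  have : (Fintype.card S : ℂ) ≠ 0 := Nat.cast_ne_zero.2 Fintype.card_ne_zero
  rw [mtr, trace_swapM, Fintype.card_prod, Nat.cast_mul]
  field_simp

theorem swapM_sq : swapM S ^ 2 = 1 := by rw [sq, swapM_mul_self]

theorem mtr_swapM_pow_ne_zero [Nonempty S] (j : ℕ) : mtr (swapM S ^ j) ≠ 0 := by
  have hc : (Fintype.card S : ℂ) ≠ 0 := Nat.cast_ne_zero.2 Fintype.card_ne_zero
  rcases Nat.even_or_odd' j with ⟨k, rfl | rfl⟩
  · rw [pow_mul, swapM_sq, one_pow, mtr_one]; exact one_ne_zero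
  · rw [pow_succ, pow_mul, swapM_sq, one_pow, one_mul, mtr_swapM]
    exact inv_ne_zero hc

theorem onSites_swapM_apply (I : Finset ι) (f h : ι → S × S) :
    onSites I (swapM S) f h =
      if f = fun i => if i ∈ I then (h i).swap else h i then 1 else 0 := by
  simp only [onSites, prodOp, Matrix.of_apply, funext_iff]
  rw [Finset.prod_congr rfl (g := fun i => if f i = (if i ∈ I then (h i).swap else h i) then (1 : ℂ)
    else 0), Finset.prod_ite_zero]
  · simp
  · intro i _
    by_cases hi : i ∈ I <;> simp [hi, swapM, Matrix.one_apply]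

theorem dbl_commute_swap (U : Op ι S) : Commute (dbl U) (onSites Finset.univ (swapM S)) := by
  ext f h
  rw [Matrix.mul_apply, Matrix.mul_apply, Finset.sum_eq_single fun i => (h i).swap,
    Finset.sum_eq_single fun i => (f i).swap]
  · simp [onSites_swapM_apply, dbl, tens_apply, mul_comm]
  · intro g _ hg
    rw [onSites_swapM_apply, if_neg, zero_mul]
    rintro rfl
    exact hg (by simp)
  · simp
  · intro g _ hg
    rw [onSites_swapM_apply, if_neg, mul_zero]
    rintro rfl
    exact hg (by simp)
  · simp

theorem IsLocal.dbl {N : ι → ι → Prop} {U : Op ι S} (hU : IsLocal N U) : IsLocal N (dbl U) :=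
  hU.tens hU

/-- The exchange is an on-site symmetry of order two that every doubled automaton has. The theory of
ends thereby also covers the GNVW index, with no assumption on the original symmetry. -/
theorem isSym_dbl {ℓ ξ : ℕ} [NeZero ℓ] {U : Op (ZMod ℓ) S} (hU : IsLocal (near ξ) U) :
    IsSym ξ (swapM S) (dbl U) := ⟨hU.dbl, swapM_mem, dbl_commute_swap U⟩

theorem dbl_mul (U V : Op ι S) : dbl U * dbl V = dbl (U * V) := tens_mul ..

theorem dbl_ct (U : Op ι S) : (dbl U)ᴴ = dbl Uᴴ := tens_ct ..

theorem dbl_one : dbl (1 : Op ι S) = 1 := tens_one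

theorem dbl_mem {U : Op ι S} (hU : U ∈ Matrix.unitaryGroup _ ℂ) :
    dbl U ∈ Matrix.unitaryGroup _ ℂ := tens_mem hU hU

theorem dbl_tens {R : Type} [Fintype R] [DecidableEq R] (e : R ≃ S × T) (U : Op ι S) (V : Op ι T) :
    dbl (tens e U V) = tens ((Equiv.prodCongr e e).trans (Equiv.prodProdProdComm S T S T))
      (dbl U) (dbl V) := by
  ext f h
  simp only [dbl, tens_apply, Equiv.refl_apply, Equiv.trans_apply, Equiv.prodCongr_apply,
    Prod.map, Equiv.prodProdProdComm_apply]
  ring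

theorem swapM_stens {R : Type} [Fintype R] [DecidableEq R] (e : R ≃ S × T) :
    swapM R = stens ((Equiv.prodCongr e e).trans (Equiv.prodProdProdComm S T S T))
      (swapM S) (swapM T) := by
  ext p q
  simp only [swapM, stens, Matrix.of_apply, Matrix.submatrix_apply, Matrix.kroneckerMap_apply,
    Equiv.trans_apply, Equiv.prodCongr_apply, Prod.map, Equiv.prodProdProdComm_apply,
    ite_zero_mul_ite_zero, mul_one]
  refine if_congr ?_ rfl rfl
  rw [Prod.ext_iff, Prod.ext_iff, Prod.ext_iff, ← e.injective.eq_iff, ← e.injective.eq_iff,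
    Prod.ext_iff, Prod.ext_iff]
  simp only [Prod.fst_swap, Prod.snd_swap]
  tauto

end Doubling

/-! ### Overlaps of operator algebras as traces of exchanges -/

section Overlap
variable {ι S : Type} [Fintype ι] [DecidableEq ι] [Fintype S] [DecidableEq S]

/-- Each squared modulus is a number times its conjugate, hence one trace on two copies of the
chain; the double sum then factors inside this trace. For bases of local algebras the two factors
become exchanges, by `sum_tens_unitOp`. -/
theorem sum_norm_ntr_sq {α β : Type} [Fintype α] [Fintype β] (a : α → Op ι S) (b : β → Op ι S) :
    ((∑ p, ∑ q, ‖ntr ((a p)ᴴ * b q)‖ ^ 2 : ℝ) : ℂ) =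
      ntr ((∑ p, tens (Equiv.refl (S × S)) (a p)ᴴ (a p)) *
        ∑ q, tens (Equiv.refl (S × S)) (b q) (b q)ᴴ) := by
  simp only [Finset.sum_mul, Finset.mul_sum, ntr_sum, tens_mul, ntr_tens]
  push_cast
  rw [Finset.sum_comm]
  refine Finset.sum_congr rfl fun q _ => Finset.sum_congr rfl fun p _ => ?_
  have h : ntr (a p * (b q)ᴴ) = star (ntr ((a p)ᴴ * b q)) := by
    rw [← ntr_conjTranspose, Matrix.conjTranspose_mul, Matrix.conjTranspose_conjTranspose,
      ntr_mul_comm]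
  rw [h, Complex.star_def, Complex.mul_conj, Complex.normSq_eq_norm_sq]
  push_cast; rfl

theorem unitOp_apply (F : Finset ι) (a b : F → S) (f h : ι → S) :
    unitOp F a b f h = (if ∀ i, i ∉ F → f i = h i then 1 else 0) *
      ((if a = fun i : F => f i then 1 else 0) * if b = fun i : F => h i then 1 else 0) := by
  simp only [unitOp, extendOp, Matrix.of_apply, Matrix.single_apply, ite_zero_mul_ite_zero, mul_one,
    one_mul, ite_and]

theorem sum_tens_unitOp (F : Finset ι) :
    ∑ p : (F → S) × (F → S), tens (Equiv.refl (S × S)) (unitOp F p.1 p.2)ᴴ (unitOp F p.1 p.2) =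
      onSites F (swapM S) := by
  ext f h
  rw [Matrix.sum_apply, onSites_swapM_apply]
  simp only [tens_apply, Matrix.conjTranspose_apply, unitOp_apply, Fintype.sum_prod_type,
    Equiv.refl_apply, star_mul', apply_ite (star : ℂ → ℂ), star_one, star_zero]
  have : ∀ (c c' : ℂ) (u u' v v' : F → S),
      ∑ a : F → S, ∑ b : F → S, (c * ((if a = u then 1 else 0) * if b = v then 1 else 0)) *
        (c' * ((if a = u' then 1 else 0) * if b = v' then 1 else 0)) =
      c * c' * ((if u = u' then 1 else 0) * if v = v' then 1 else 0) := by
    intro c c' u u' v v'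
    rw [Finset.sum_eq_single u, Finset.sum_eq_single v]
    · simp only [if_true]; ring
    · intro b _ hb; simp [hb]
    · simp
    · intro a _ ha; simp [ha]
    · simp
  rw [this]
  simp only [ite_zero_mul_ite_zero, mul_one]
  refine if_congr ?_ rfl rfl
  simp only [funext_iff, Subtype.forall]
  constructor
  · rintro ⟨⟨h1, h2⟩, h3, h4⟩ i
    by_cases hi : i ∈ F
    · rw [if_pos hi]
      exact Prod.ext (h4 i hi) (h3 i hi).symm
    · rw [if_neg hi]
      exact Prod.ext (h1 i hi).symm (h2 i hi)
  · intro h0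
    refine ⟨⟨fun i hi => ?_, fun i hi => ?_⟩, fun i hi => ?_, fun i hi => ?_⟩ <;>
    · have := h0 i
      simp only [hi, if_true, if_false] at this
      rw [this]
      try rfl

theorem opBasis_eq (X : Finset ι) (p : (X → S) × (X → S)) :
    opBasis X p = ((Real.sqrt ((Fintype.card S : ℝ) ^ X.card) : ℝ) : ℂ) • unitOp X p.1 p.2 := rfl

theorem tens_smul_smul (c c' : ℂ) (A B : Op ι S) :
    tens (Equiv.refl (S × S)) (c • A) (c' • B) = (c * c') • tens (Equiv.refl (S × S)) A B := by
  ext f h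
  simp only [tens_apply, Matrix.smul_apply, smul_eq_mul]; ring

theorem sqrt_mul_sqrt_card (X : Finset ι) :
    ((Real.sqrt ((Fintype.card S : ℝ) ^ X.card) : ℝ) : ℂ) *
      ((Real.sqrt ((Fintype.card S : ℝ) ^ X.card) : ℝ) : ℂ) = (Fintype.card S : ℂ) ^ X.card := by
  rw [← Complex.ofReal_mul, Real.mul_self_sqrt (by positivity)]
  push_cast; rfl

theorem sum_tens_opBasis (X : Finset ι) :
    ∑ p, tens (Equiv.refl (S × S)) (opBasis X p)ᴴ (opBasis X p) =
      ((Fintype.card S : ℂ) ^ X.card) • onSites X (swapM S) := by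
  rw [← sum_tens_unitOp, Finset.smul_sum]
  refine Finset.sum_congr rfl fun p _ => ?_
  rw [opBasis_eq, Matrix.conjTranspose_smul, tens_smul_smul, Complex.star_def,
    Complex.conj_ofReal, sqrt_mul_sqrt_card]

theorem sum_tens_opBasis' (X : Finset ι) :
    ∑ p, tens (Equiv.refl (S × S)) (opBasis X p) (opBasis X p)ᴴ =
      ((Fintype.card S : ℂ) ^ X.card) • onSites X (swapM S) := by
  have := congrArg Matrix.conjTranspose (sum_tens_opBasis (S := S) X)
  rw [Matrix.conjTranspose_sum, Matrix.conjTranspose_smul, onSites_conjTranspose, swapM_ct] at this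
  simp only [tens_ct, Matrix.conjTranspose_conjTranspose] at this
  rw [this]
  simp

theorem sum_opBasis_diag (X : Finset ι) :
    ∑ a : X → S, opBasis X (a, a) =
      ((Real.sqrt ((Fintype.card S : ℝ) ^ X.card) : ℝ) : ℂ) • (1 : Op ι S) := by
  simp only [opBasis_eq, ← Finset.smul_sum, (isMatrixUnits_unitOp X).2]

theorem overlap_heis_left {U : Op ι S} (A B : Finset ι) :
    ((overlap (fun p => Uᴴ * opBasis A p * U) (opBasis B) ^ 2 : ℝ) : ℂ) =
      (Fintype.card S : ℂ) ^ (A.card + B.card) *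
        ntr (heis (dbl U) (onSites A (swapM S)) * onSites B (swapM S)) := by
  rw [overlap, Real.sq_sqrt (Finset.sum_nonneg fun _ _ => Finset.sum_nonneg fun _ _ => sq_nonneg _),
    sum_norm_ntr_sq, sum_tens_opBasis']
  have : ∀ p, tens (Equiv.refl (S × S)) (Uᴴ * opBasis A p * U)ᴴ (Uᴴ * opBasis A p * U) =
      heis (dbl U) (tens (Equiv.refl (S × S)) (opBasis A p)ᴴ (opBasis A p)) := by
    intro p
    rw [dbl, heis_tens]
    simp only [heis, Matrix.conjTranspose_mul, Matrix.conjTranspose_conjTranspose, mul_assoc]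
  simp only [this]
  have h2 : ∑ p, heis (dbl U) (tens (Equiv.refl (S × S)) (opBasis A p)ᴴ (opBasis A p)) =
      heis (dbl U) (∑ p, tens (Equiv.refl (S × S)) (opBasis A p)ᴴ (opBasis A p)) := by
    simp only [heis, Finset.mul_sum, Finset.sum_mul]
  rw [h2, sum_tens_opBasis, heis_smul, Matrix.smul_mul, Matrix.mul_smul, ntr_smul, ntr_smul, pow_add]
  ring

theorem overlap_heis_right {U : Op ι S} (A B : Finset ι) :
    ((overlap (opBasis A) (fun p => Uᴴ * opBasis B p * U) ^ 2 : ℝ) : ℂ) =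
      (Fintype.card S : ℂ) ^ (A.card + B.card) *
        ntr (onSites A (swapM S) * heis (dbl U) (onSites B (swapM S))) := by
  rw [overlap, Real.sq_sqrt (Finset.sum_nonneg fun _ _ => Finset.sum_nonneg fun _ _ => sq_nonneg _),
    sum_norm_ntr_sq, sum_tens_opBasis]
  have : ∀ p, tens (Equiv.refl (S × S)) (Uᴴ * opBasis B p * U) (Uᴴ * opBasis B p * U)ᴴ =
      heis (dbl U) (tens (Equiv.refl (S × S)) (opBasis B p) (opBasis B p)ᴴ) := by
    intro p
    rw [dbl, heis_tens]
    simp only [heis, Matrix.conjTranspose_mul, Matrix.conjTranspose_conjTranspose, mul_assoc]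
  simp only [this]
  have h2 : ∑ p, heis (dbl U) (tens (Equiv.refl (S × S)) (opBasis B p) (opBasis B p)ᴴ) =
      heis (dbl U) (∑ p, tens (Equiv.refl (S × S)) (opBasis B p) (opBasis B p)ᴴ) := by
    simp only [heis, Finset.mul_sum, Finset.sum_mul]
  rw [h2, sum_tens_opBasis', heis_smul, Matrix.smul_mul, Matrix.mul_smul, ntr_smul, ntr_smul, pow_add]
  ring

/-- Both algebras contain the identity as a combination of diagonal basis elements. If all overlaps
vanished, so would the trace of 1. -/
theorem overlap_heis_left_ne_zero [Nonempty S] {U : Op ι S} (hU : U ∈ Matrix.unitaryGroup _ ℂ)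
    (A B : Finset ι) : overlap (fun p => Uᴴ * opBasis A p * U) (opBasis B) ≠ 0 := by
  intro h0
  rw [overlap, Real.sqrt_eq_zero (Finset.sum_nonneg fun _ _ => Finset.sum_nonneg fun _ _ =>
    sq_nonneg _), Finset.sum_eq_zero_iff_of_nonneg (fun _ _ => Finset.sum_nonneg fun _ _ =>
    sq_nonneg _)] at h0
  have h1 : ∀ p q, ntr ((Uᴴ * opBasis A p * U)ᴴ * opBasis B q) = 0 := by
    intro p q
    have h2 := h0 p (Finset.mem_univ _)
    rw [Finset.sum_eq_zero_iff_of_nonneg (fun _ _ => sq_nonneg _)] at h2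
    simpa using h2 q (Finset.mem_univ _)
  have h3 : ntr ((Uᴴ * (∑ a : A → S, opBasis A (a, a)) * U)ᴴ * ∑ b : B → S, opBasis B (b, b)) = 0 := by
    simp only [Finset.mul_sum, Finset.sum_mul, Matrix.conjTranspose_sum, ntr_sum, h1,
      Finset.sum_const_zero]
  have hc : ∀ X : Finset ι, ((Real.sqrt ((Fintype.card S : ℝ) ^ X.card) : ℝ) : ℂ) ≠ 0 := fun X => by
    have : (0 : ℝ) < (Fintype.card S : ℝ) ^ X.card := pow_pos (Nat.cast_pos.2 Fintype.card_pos) _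
    exact_mod_cast (Real.sqrt_pos.2 this).ne'
  have h4 : ∀ c : ℂ, Uᴴ * (c • (1 : Op ι S)) * U = c • 1 := fun c => by
    rw [Matrix.mul_smul, mul_one, Matrix.smul_mul, ct_mul hU]
  rw [sum_opBasis_diag, sum_opBasis_diag, h4, Matrix.mul_smul, mul_one,
    Matrix.conjTranspose_smul, Matrix.conjTranspose_one, ntr_smul,
    ntr_smul, ntr_one, mul_one, Complex.star_def, Complex.conj_ofReal] at h3
  exact mul_ne_zero (hc B) (hc A) h3

end Overlap

/-! ### The GNVW index as an end ratio -/

section GNVW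
variable {ℓ : ℕ} [NeZero ℓ] {S : Type} [Fintype S] [DecidableEq S]
variable {ξ d : ℕ} {M : Matrix S S ℂ} {U : Op (ZMod ℓ) S}

theorem onSites_arc_add {x x' : ZMod ℓ} {m n k : ℕ} (M : Matrix S S ℂ) (hx : x' = x + (m : ZMod ℓ))
    (h : m + n ≤ ℓ) (hk : k = m + n) :
    onSites (arc x m) M * onSites (arc x' n) M = onSites (arc x k) M := by
  have e0 : x = x + ((0 : ℕ) : ZMod ℓ) := by simp
  refine onSites_union M (Finset.disjoint_left.2 fun i hi => ?_) fun i => ?_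
  · rw [mem_arc_crd e0 (by omega)] at hi
    rw [mem_arc_crd hx (by omega)]
    omega
  · rw [mem_arc_crd e0 (by omega), mem_arc_crd e0 (by omega), mem_arc_crd hx (by omega)]
    omega

theorem IsSym.ntr_rightEnd_ne_zero [Nonempty S] (hU : IsSym ξ M U) (hℓ : 12 * ξ + 1 ≤ ℓ)
    (hd : M ^ d = 1) (htr : ∀ j, mtr (M ^ j) ≠ 0) {y : ZMod ℓ} {T : Op (ZMod ℓ) S}
    (hT : RightEnd ξ U M y T) (hTd : T ^ d = 1) (j : ℕ) : ntr (T ^ j) ≠ 0 := by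
  have hx : y = (y - ((4 * ξ : ℕ) : ZMod ℓ)) + ((4 * ξ : ℕ) : ZMod ℓ) := by ring
  rw [hx] at hT
  obtain ⟨L, hL, hLd, h⟩ := hU.exists_left_of_right (by omega) hd (by omega) (by omega) hT hTd
  have e1 := ntr_ends_pow (by omega) (by omega) hU.loc.1 hL.2.1 hT.2.1 h j
  intro h0
  rw [h0, mul_zero] at e1
  exact pow_ne_zero _ (htr j) e1.symm

theorem IsSym.endRatio_ne_zero [Nonempty S] (hU : IsSym ξ M U) (hℓ : 12 * ξ + 1 ≤ ℓ)
    (hd : M ^ d = 1) (htr : ∀ j, mtr (M ^ j) ≠ 0) {τ : ℕ → ℂ} (hτ : IsEndRatio ξ U M d τ) (j : ℕ) :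
    τ j ≠ 0 := by
  obtain ⟨y, T, hT, hTd, ht⟩ := hτ
  rw [ht]
  exact div_ne_zero (hU.ntr_rightEnd_ne_zero hℓ hd htr hT hTd j) (pow_ne_zero _ (htr j))

/-- The right and the left end at a common point multiply to the symmetry, up to a phase. -/
theorem IsSym.right_mul_left [Nonempty S] (hU : IsSym ξ M U) {x : ZMod ℓ} {a b : ℕ}
    (ha : 2 * ξ ≤ a) (hb : 2 * ξ ≤ b) (hab : a + b + 2 * ξ ≤ ℓ) {L T₁ T₂ R : Op (ZMod ℓ) S}
    (hL : LeftEnd ξ U M (x - (a : ZMod ℓ)) L) (hR : RightEnd ξ U M (x + (b : ZMod ℓ)) R)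
    (h1 : heis U (onSites (arc (x - (a : ZMod ℓ)) a) M) =
      L * onSites (arc (x - (a : ZMod ℓ) + (ξ : ZMod ℓ)) (a - 2 * ξ)) M * T₁)
    (h2 : heis U (onSites (arc x b) M) =
      T₂ * onSites (arc (x + (ξ : ZMod ℓ)) (b - 2 * ξ)) M * R) :
    ∃ c : ℂ, ‖c‖ = 1 ∧ T₁ * T₂ = c • onSites (arc (x - (ξ : ZMod ℓ)) (2 * ξ)) M := by
  have hR' : RightEnd ξ U M (x - (a : ZMod ℓ) + ((a + b : ℕ) : ZMod ℓ)) R := by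
    rwa [show x - (a : ZMod ℓ) + ((a + b : ℕ) : ZMod ℓ) = x + (b : ZMod ℓ) by push_cast; ring]
  obtain ⟨c, hc, h⟩ := hU.exists_eq_ends (n := a + b) (by omega) (by omega) hL hR'
  refine ⟨c, hc, ?_⟩
  have e1 : onSites (arc (x - (a : ZMod ℓ)) a) M * onSites (arc x b) M =
      onSites (arc (x - (a : ZMod ℓ)) (a + b)) M := onSites_arc_add M (by ring) (by omega) rfl
  set M₁ := onSites (arc (x - (a : ZMod ℓ) + (ξ : ZMod ℓ)) (a - 2 * ξ)) M with hM₁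
  set M₂ := onSites (arc (x + (ξ : ZMod ℓ)) (b - 2 * ξ)) M with hM₂
  have e2 : onSites (arc (x - (a : ZMod ℓ) + (ξ : ZMod ℓ)) (a + b - 2 * ξ)) M =
      M₁ * onSites (arc (x - (ξ : ZMod ℓ)) (2 * ξ)) M * M₂ := by
    rw [hM₁, onSites_arc_add (k := a) M (by rw [Nat.cast_sub ha]; push_cast; ring) (by omega)
      (by omega), hM₂,
      onSites_arc_add (k := a + b - 2 * ξ) M (by ring) (by omega) (by omega)]
  rw [← e1, heis_mul hU.loc.1, h1, h2, e2] at h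
  have hM₁u : M₁ ∈ Matrix.unitaryGroup _ ℂ := onSites_mem hU.mem _
  have hM₂u : M₂ ∈ Matrix.unitaryGroup _ ℂ := onSites_mem hU.mem _
  have h3 : ∀ Z : Op (ZMod ℓ) S, M₁ᴴ * (Lᴴ * (L * M₁ * Z * (M₂ * R))) * (Rᴴ * M₂ᴴ) = Z := by
    intro Z
    calc _ = M₁ᴴ * ((Lᴴ * L) * M₁) * Z * (M₂ * (R * Rᴴ) * M₂ᴴ) := by simp only [mul_assoc]
      _ = Z := by rw [ct_mul hL.1, mul_ct hR.1, one_mul, mul_one, ct_mul hM₁u, mul_ct hM₂u, one_mul,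
        mul_one]
  calc T₁ * T₂ = M₁ᴴ * (Lᴴ * (L * M₁ * (T₁ * T₂) * (M₂ * R))) * (Rᴴ * M₂ᴴ) := (h3 _).symm
    _ = M₁ᴴ * (Lᴴ * (L * M₁ * T₁ * (T₂ * M₂ * R))) * (Rᴴ * M₂ᴴ) := by simp only [mul_assoc]
    _ = c • (M₁ᴴ * (Lᴴ * (L * M₁ * onSites (arc (x - (ξ : ZMod ℓ)) (2 * ξ)) M * (M₂ * R))) *
        (Rᴴ * M₂ᴴ)) := by
      rw [h]; simp only [Matrix.mul_smul, Matrix.smul_mul, mul_assoc]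
    _ = _ := by rw [h3]

/-- The arithmetic of `gnvw_eq`: the trace `g` of the overlap at the cut is unknown but occurs in
both squares. With `L = s / t` and `R = t * s` their quotient is `t⁻²` up to the phase `c`. -/
theorem ratio_eq_inv_norm {η₁ η₂ : ℝ} {t p p' s L T R g c n : ℂ} (h1 : 0 < η₁) (h2 : 0 ≤ η₂)
    (ht : t ≠ 0) (hp : p ≠ 0) (hs : s ≠ 0) (hc : ‖c‖ = 1)
    (F1 : ((η₁ ^ 2 : ℝ) : ℂ) = n * (L * p * g * (p' * s)))
    (F2 : ((η₂ ^ 2 : ℝ) : ℂ) = n * (p * s * (c * g) * p' * R)) (hL : L * p * T = p * s * s)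
    (hT : T = t * s) (hR : R = t * s) : η₁ / η₂ = ‖t‖⁻¹ := by
  have hL2 : L * t = s := by
    refine mul_left_cancel₀ (mul_ne_zero hp hs) ?_
    rw [hT] at hL
    linear_combination hL
  have G2 : t ^ 2 * ((η₁ ^ 2 : ℝ) : ℂ) * c = ((η₂ ^ 2 : ℝ) : ℂ) := by
    rw [F1, F2, hR]
    linear_combination (t * c * n * g * p * p' * s) * hL2
  have G3 := congrArg norm G2
  rw [norm_mul, norm_mul, norm_pow, hc, mul_one, Complex.norm_real, Complex.norm_real,
    Real.norm_of_nonneg (sq_nonneg _), Real.norm_of_nonneg (sq_nonneg _), ← mul_pow] at G3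
  have hn : 0 < ‖t‖ := norm_pos_iff.2 ht
  have G4 : ‖t‖ * η₁ = η₂ := (pow_left_inj₀ (by positivity) h2 two_ne_zero).1 G3
  rw [← G4]
  field_simp

/-- The GNVW index in terms of the evolved exchange of two copies of the chain. -/
theorem gnvw_eq [Nonempty S] (hU : IsLocal (near ξ) U) (hℓ : 12 * ξ + 1 ≤ ℓ) {q : ℝ}
    (hq : IsGNVWIndex ξ U q) {τ : ℕ → ℂ} (hτ : IsEndRatio ξ (dbl U) (swapM S) 2 τ) :
    q = ‖τ 1‖⁻¹ := by
  obtain ⟨x, a, b, ha1, hb1, ha, hb, hab, rfl⟩ := hq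
  have hW := isSym_dbl hU
  have htr := mtr_swapM_pow_ne_zero (S := S)
  obtain ⟨T₁, hT₁, hT₁d, ht₁⟩ := hW.endRatio_at hℓ swapM_sq htr hτ x
  obtain ⟨R, hR, hRd, htR⟩ := hW.endRatio_at hℓ swapM_sq htr hτ (x + (b : ZMod ℓ))
  have hT₁' : RightEnd ξ (dbl U) (swapM S) (x - (a : ZMod ℓ) + (a : ZMod ℓ)) T₁ := by
    rwa [sub_add_cancel]
  obtain ⟨L, hL, hLd, h1⟩ := hW.exists_left_of_right (by omega) swapM_sq ha (by omega) hT₁' hT₁d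
  obtain ⟨T₂, hT₂, hT₂d, h2⟩ := hW.exists_left_of_right (by omega) swapM_sq hb (by omega) hR hRd
  -- `T₁` is the right end of `A` and `T₂` the left end of `B`, both in the window around `x`. In
  -- the two overlaps `T₁` meets the exchange on the right half of this window and `T₂` the one on
  -- the left half.
  obtain ⟨c, hc, h3⟩ := hW.right_mul_left ha hb hab hL hR h1 h2
  set W := dbl U with hWdef
  set Sw := swapM S with hSw
  have hm : mtr Sw ≠ 0 := by simpa using htr 1
  have e0 : x - (a : ZMod ℓ) - (ξ : ZMod ℓ) = x - (a : ZMod ℓ) - (ξ : ZMod ℓ) + ((0 : ℕ) : ZMod ℓ) := by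
    simp
  have eK : x - (ξ : ZMod ℓ) = x - (a : ZMod ℓ) - (ξ : ZMod ℓ) + (a : ZMod ℓ) := by ring
  have eA : x - (a : ZMod ℓ) = x - (a : ZMod ℓ) - (ξ : ZMod ℓ) + (ξ : ZMod ℓ) := by ring
  have ex : x = x - (a : ZMod ℓ) - (ξ : ZMod ℓ) + ((a + ξ : ℕ) : ZMod ℓ) := by push_cast; ring
  have eB : x + (ξ : ZMod ℓ) = x - (a : ZMod ℓ) - (ξ : ZMod ℓ) + ((a + 2 * ξ : ℕ) : ZMod ℓ) := by
    push_cast; ring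
  have eM : x - (a : ZMod ℓ) + (ξ : ZMod ℓ) =
      x - (a : ZMod ℓ) - (ξ : ZMod ℓ) + ((2 * ξ : ℕ) : ZMod ℓ) := by push_cast; ring
  have eR : x + (b : ZMod ℓ) - (ξ : ZMod ℓ) =
      x - (a : ZMod ℓ) - (ξ : ZMod ℓ) + ((a + b : ℕ) : ZMod ℓ) := by push_cast; ring
  have sMr : SupportedOn (arc (x - (ξ : ZMod ℓ)) (2 * ξ)) (onSites (arc x ξ) Sw) := by
    refine (supportedOn_onSites _ _).mono fun i hi => ?_
    rw [mem_arc_crd ex (by omega)] at hi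
    rw [mem_arc_crd eK (by omega)]
    omega
  have sMl : SupportedOn (arc (x - (ξ : ZMod ℓ)) (2 * ξ)) (onSites (arc (x - (ξ : ZMod ℓ)) ξ) Sw) := by
    refine (supportedOn_onSites _ _).mono fun i hi => ?_
    rw [mem_arc_crd eK (by omega)] at hi ⊢
    omega
  set g := ntr (T₁ * onSites (arc x ξ) Sw) with hg
  have E1 : ntr (heis W (onSites (arc (x - (a : ZMod ℓ)) a) Sw) * onSites (arc x b) Sw) =
      ntr L * mtr Sw ^ (a - 2 * ξ) * g * mtr Sw ^ (b - ξ) := by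
    rw [h1, ← onSites_arc_add (x := x) (x' := x + (ξ : ZMod ℓ)) (m := ξ) (n := b - ξ) Sw rfl
      (by omega) (by omega), ← mul_assoc, mul_assoc _ T₁]
    have sLM : SupportedOn (arc (x - (a : ZMod ℓ) - (ξ : ZMod ℓ)) a)
        (L * onSites (arc (x - (a : ZMod ℓ) + (ξ : ZMod ℓ)) (a - 2 * ξ)) Sw) := by
      refine (hL.2.1.mono fun i hi => ?_).mul ((supportedOn_onSites _ _).mono fun i hi => ?_)
      · rw [mem_arc_crd e0 (by omega)] at hi ⊢
        omega
      · rw [mem_arc_crd eM (by omega)] at hi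
        rw [mem_arc_crd e0 (by omega)]
        omega
    rw [ntr_mul_of_disjoint (X := arc (x - (a : ZMod ℓ) - (ξ : ZMod ℓ)) (a + 2 * ξ)) ?_ ?_
      (supportedOn_onSites _ _), ntr_mul_of_disjoint ?_ sLM (hT₁.2.1.mul sMr),
      ntr_mul_of_disjoint (disjoint_ends (ξ := ξ) (n := a) ha (by omega)).1 hL.2.1
        (supportedOn_onSites _ _), ntr_onSites_arc (by omega), ntr_onSites_arc (by omega)]
    · refine Finset.disjoint_left.2 fun i hi => ?_
      rw [mem_arc_crd e0 (by omega)] at hi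
      rw [mem_arc_crd eK (by omega)]
      omega
    · refine Finset.disjoint_left.2 fun i hi => ?_
      rw [mem_arc_crd e0 (by omega)] at hi
      rw [mem_arc_crd eB (by omega)]
      omega
    · refine (sLM.mono fun i hi => ?_).mul ((hT₁.2.1.mul sMr).mono fun i hi => ?_)
      · rw [mem_arc_crd e0 (by omega)] at hi ⊢
        omega
      · rw [mem_arc_crd eK (by omega)] at hi
        rw [mem_arc_crd e0 (by omega)]
        omega
  -- As `T₁ ^ 2 = 1`, the relation `h3` expresses `T₂` by `T₁` and the exchange on the window. The
  -- left half of that exchange cancels, and the same trace `g` reappears.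
  have hgT : ntr (onSites (arc (x - (ξ : ZMod ℓ)) ξ) Sw * T₂) = c * g := by
    have h4 : T₂ = c • (T₁ * onSites (arc (x - (ξ : ZMod ℓ)) (2 * ξ)) Sw) := by
      rw [← Matrix.mul_smul, ← h3, ← mul_assoc, ← sq, hT₁d, one_mul]
    have h5 : onSites (arc (x - (ξ : ZMod ℓ)) (2 * ξ)) Sw =
        onSites (arc x ξ) Sw * onSites (arc (x - (ξ : ZMod ℓ)) ξ) Sw := by
      rw [(onSites_commute _ _ _).eq]
      exact (onSites_arc_add Sw (by ring) (by omega) (by omega)).symm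
    rw [h4, Matrix.mul_smul, ntr_smul, h5, ntr_mul_comm, mul_assoc, mul_assoc, onSites_mul,
      swapM_mul_self, onSites_one, mul_one]
  have E2 : ntr (onSites (arc (x - (a : ZMod ℓ)) a) Sw * heis W (onSites (arc x b) Sw)) =
      mtr Sw ^ (a - ξ) * (c * g) * mtr Sw ^ (b - 2 * ξ) * ntr R := by
    have sMR : SupportedOn (arc (x + (ξ : ZMod ℓ)) b)
        (onSites (arc (x + (ξ : ZMod ℓ)) (b - 2 * ξ)) Sw * R) := by
      refine ((supportedOn_onSites _ _).mono fun i hi => ?_).mul (hR.2.1.mono fun i hi => ?_)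
      · rw [mem_arc_crd eB (by omega)] at hi ⊢
        omega
      · rw [mem_arc_crd eR (by omega)] at hi
        rw [mem_arc_crd eB (by omega)]
        omega
    rw [h2, ← onSites_arc_add (x := x - (a : ZMod ℓ)) (x' := x - (ξ : ZMod ℓ)) (m := a - ξ)
      (n := ξ) Sw (by rw [Nat.cast_sub (by omega)]; ring) (by omega) (by omega), mul_assoc,
      mul_assoc T₂, ← mul_assoc _ T₂,
      ntr_mul_of_disjoint (Y := arc (x - (ξ : ZMod ℓ)) (b + 2 * ξ)) ?_ (supportedOn_onSites _ _) ?_,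
      ntr_mul_of_disjoint ?_ (sMl.mul hT₂.2.1) sMR,
      ntr_mul_of_disjoint ?_ (supportedOn_onSites _ _) hR.2.1, hgT, ntr_onSites_arc (by omega),
      ntr_onSites_arc (by omega)]
    · ring
    · refine Finset.disjoint_left.2 fun i hi => ?_
      rw [mem_arc_crd eB (by omega)] at hi
      rw [mem_arc_crd eR (by omega)]
      omega
    · refine Finset.disjoint_left.2 fun i hi => ?_
      rw [mem_arc_crd eK (by omega)] at hi
      rw [mem_arc_crd eB (by omega)]
      omega
    · refine Finset.disjoint_left.2 fun i hi => ?_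
      rw [mem_arc_crd eA (by omega)] at hi
      rw [mem_arc_crd eK (by omega)]
      omega
    · refine ((sMl.mul hT₂.2.1).mono fun i hi => ?_).mul (sMR.mono fun i hi => ?_)
      · rw [mem_arc_crd eK (by omega)] at hi ⊢
        omega
      · rw [mem_arc_crd eB (by omega)] at hi
        rw [mem_arc_crd eK (by omega)]
        omega
  have hL1 := ntr_ends_pow ha (by omega) hW.loc.1 hL.2.1 hT₁'.2.1 h1 1
  simp only [pow_one] at hL1
  set A := arc (x - (a : ZMod ℓ)) a with hA
  set B := arc x b with hB
  have hcard : (Fintype.card S : ℂ) ≠ 0 := Nat.cast_ne_zero.2 Fintype.card_ne_zero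
  have F1 := overlap_heis_left (U := U) A B
  have F2 := overlap_heis_right (U := U) A B
  rw [← hWdef, ← hSw, E1] at F1
  rw [← hWdef, ← hSw, E2] at F2
  have hη1 := overlap_heis_left_ne_zero hU.1 A B
  set η₁ := overlap (fun p => Uᴴ * opBasis A p * U) (opBasis B) with hη₁
  set η₂ := overlap (opBasis A) (fun p => Uᴴ * opBasis B p * U) with hη₂
  have hη1' : (((η₁ ^ 2 : ℝ)) : ℂ) ≠ 0 := by exact_mod_cast pow_ne_zero 2 hη1
  have hg0 : g ≠ 0 := by
    intro h0
    rw [h0] at F1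
    simp only [mul_zero, zero_mul] at F1
    exact hη1' F1
  have hT₁1 := ht₁ 1
  have hR1 := htR 1
  simp only [pow_one] at hT₁1 hR1
  have hτ0 := hW.endRatio_ne_zero hℓ swapM_sq htr hτ 1
  have hmξ : mtr Sw ^ ξ ≠ 0 := pow_ne_zero _ hm
  rw [eq_div_iff hmξ] at hT₁1 hR1
  have p1 : mtr Sw ^ (a - ξ) = mtr Sw ^ (a - 2 * ξ) * mtr Sw ^ ξ := by
    rw [← pow_add]; congr 1; omega
  have p2 : mtr Sw ^ (b - ξ) = mtr Sw ^ (b - 2 * ξ) * mtr Sw ^ ξ := by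
    rw [← pow_add]; congr 1; omega
  have p3 : mtr Sw ^ a = mtr Sw ^ (a - 2 * ξ) * mtr Sw ^ ξ * mtr Sw ^ ξ := by
    rw [← pow_add, ← pow_add]; congr 1; omega
  rw [p2] at F1
  rw [p1] at F2
  rw [p3] at hL1
  exact ratio_eq_inv_norm (lt_of_le_of_ne (Real.sqrt_nonneg _) (Ne.symm hη1)) (Real.sqrt_nonneg _)
    hτ0 (pow_ne_zero _ hm) hmξ hc F1 F2 hL1 hT₁1.symm hR1.symm

end GNVW

/-! ### Symmetric circuits have trivial end ratios -/

section Circuits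
variable {ℓ : ℕ} [NeZero ℓ] {R S T G : Type} [Fintype R] [DecidableEq R]
  [Fintype S] [DecidableEq S] [Fintype T] [DecidableEq T] {ξ d D r : ℕ}

theorem heis_list_prod_supportedOn {ι : Type} [Fintype ι] [DecidableEq ι] {E : Finset ι}
    (l : List (Op ι S)) (hl : ∀ V ∈ l, V ∈ Matrix.unitaryGroup (ι → S) ℂ ∧
      (SupportedOn E V ∨ SupportedOn Eᶜ V)) {O : Op ι S} (hO : SupportedOn E O) :
    SupportedOn E (heis l.prod O) := by
  induction l generalizing O with
  | nil => simpa [heis] using hO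
  | cons V l ih =>
    rw [List.prod_cons, ← heis_heis]
    refine ih (fun W hW => hl W (List.mem_cons_of_mem _ hW)) ?_
    obtain ⟨hu, h | h⟩ := hl V List.mem_cons_self
    · exact (h.conjTranspose.mul hO).mul h
    · rwa [heis_of_commute hu (h.commute_compl hO)]

/-- The gates of a layer with the symmetry forgotten. -/
theorem IsSymmetricLayer.isSym {μ : G → Matrix S S ℂ} {W : Op (ZMod ℓ) S}
    (hW : IsSymmetricLayer r μ W) (g : G) (hM : μ g ∈ Matrix.unitaryGroup S ℂ)
    (hr : 12 * r + 1 ≤ ℓ) [Nonempty S] :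
    IsSym r (μ g) W ∧ ((μ g) ^ d = 1 → (∀ j, mtr (μ g ^ j) ≠ 0) →
      IsEndRatio r W (μ g) d fun _ => 1) := by
  obtain ⟨k, x, n, V, hn, hdis, hV, rfl⟩ := hW
  set W := (List.ofFn V).prod with hW
  have hWu : W ∈ Matrix.unitaryGroup (ZMod ℓ → S) ℂ :=
    list_prod_mem fun Z hZ => by
      obtain ⟨j, rfl⟩ := List.mem_ofFn.1 hZ
      exact (hV j).1
  have hWc : Commute W (onSites Finset.univ (μ g)) := by
    refine Commute.list_prod_left _ _ fun Z hZ => ?_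
    obtain ⟨j, rfl⟩ := List.mem_ofFn.1 hZ
    rw [onSites_univ]
    exact (hV j).2.2 g
  have hpres : ∀ (E : Finset (ZMod ℓ)), (∀ j, arc (x j) (n j) ⊆ E ∨ Disjoint (arc (x j) (n j)) E) →
      ∀ O, SupportedOn E O → SupportedOn E (heis W O) := by
    intro E hE O hO
    refine heis_list_prod_supportedOn _ (fun Z hZ => ?_) hO
    obtain ⟨j, rfl⟩ := List.mem_ofFn.1 hZ
    refine ⟨(hV j).1, (hE j).imp (fun h => (hV j).2.1.mono h) fun h => (hV j).2.1.mono fun i hi => ?_⟩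
    rw [Finset.mem_compl]
    exact Finset.disjoint_left.1 h hi
  have hpres' : ∀ (E : Finset (ZMod ℓ)), (∀ j, arc (x j) (n j) ⊆ E ∨ Disjoint (arc (x j) (n j)) E) →
      ∀ O, SupportedOn E O → SupportedOn E (heis Wᴴ O) := by
    intro E hE O hO
    rw [← compl_compl E]
    refine supportedOn_compl_of_commute fun P hP => ?_
    refine ((commute_heis_iff hWu).1 ?_).symm
    refine (hpres Eᶜ (fun j => ?_) P hP).commute_compl hO
    rcases hE j with h | h
    · exact Or.inr (Finset.disjoint_left.2 fun i hi => by simpa using h hi)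
    · exact Or.inl fun i hi => Finset.mem_compl.2 (Finset.disjoint_left.1 h hi)
  -- Every site lies in a cell that the layer preserves: the interval of the gate that acts on it,
  -- or the site alone.
  have hcell : ∀ i : ZMod ℓ, ∃ E : Finset (ZMod ℓ), i ∈ E ∧ (E = {i} ∨ ∃ j, E = arc (x j) (n j)) ∧
      ∀ j, arc (x j) (n j) ⊆ E ∨ Disjoint (arc (x j) (n j)) E := by
    intro i
    by_cases h : ∃ j, i ∈ arc (x j) (n j)
    · obtain ⟨j, hj⟩ := h
      refine ⟨_, hj, Or.inr ⟨j, rfl⟩, fun j' => ?_⟩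
      by_cases hjj : j' = j
      · subst hjj; exact Or.inl subset_rfl
      · exact Or.inr (hdis j' j hjj)
    · push Not at h
      exact ⟨{i}, by simp, Or.inl rfl, fun j => Or.inr (by simpa using h j)⟩
  have hoff : ∀ {j : Fin k} {i z : ZMod ℓ}, i ∈ arc (x j) (n j) → z ∈ arc (x j) (n j) →
      ∃ a b, a < n j ∧ b < n j ∧ i = x j + (a : ZMod ℓ) ∧ z = x j + (b : ZMod ℓ) := by
    intro j i z hi hz
    simp only [arc, Finset.mem_image, Finset.mem_range] at hi hz
    obtain ⟨a, ha, rfl⟩ := hi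
    obtain ⟨b, hb, rfl⟩ := hz
    exact ⟨a, b, ha, hb, rfl, rfl⟩
  have hnear : ∀ {j : Fin k} {i z : ZMod ℓ}, i ∈ arc (x j) (n j) → z ∈ arc (x j) (n j) →
      near r i z := by
    intro j i z hi hz
    obtain ⟨a, b, ha, hb, rfl, rfl⟩ := hoff hi hz
    have := hn j
    refine near_iff.2 ⟨b + r - a, by omega, ?_⟩
    rw [Nat.cast_sub (by omega)]
    push_cast; ring
  have hsym : IsSym r (μ g) W := by
    refine ⟨⟨hWu, fun i z hiz m m' => ?_⟩, hM, hWc⟩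
    obtain ⟨E, hiE, hE, hj⟩ := hcell i
    refine (hpres E hj _ (supportedOn_siteOp hiE m)).commute ?_ (supportedOn_singleton.2 ⟨m', rfl⟩)
    rw [Finset.disjoint_singleton_right]
    intro hz
    rcases hE with rfl | ⟨j, rfl⟩
    · rw [Finset.mem_singleton] at hz
      subst hz
      exact hiz (near_iff.2 ⟨r, by omega, rfl⟩)
    · exact hiz (hnear hiE hz)
  refine ⟨hsym, fun hd htr => ?_⟩
  -- The cut is placed at the left edge of a gate, so that no gate straddles it; if no gate has
  -- positive length, any point will do. At such a cut the evolved symmetry ends sharply, and its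
  -- end is the plain symmetry on `[y - r, y)`.
  obtain ⟨y, hy⟩ : ∃ y : ZMod ℓ, ∀ j, y ∈ arc (x j) (n j) → y = x j := by
    by_cases h : ∃ j, 1 ≤ n j
    · obtain ⟨j, hj⟩ := h
      refine ⟨x j, fun j' hj' => ?_⟩
      by_cases hjj : j' = j
      · rw [hjj]
      · refine absurd ?_ (Finset.disjoint_left.1 (hdis j' j hjj) hj')
        simp only [arc, Finset.mem_image, Finset.mem_range]
        exact ⟨0, by omega, by simp⟩
    · push Not at h
      refine ⟨0, fun j hj => ?_⟩
      have := h j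
      rw [show n j = 0 by omega] at hj
      simp [arc] at hj
  set b := y - ((4 * r : ℕ) : ZMod ℓ) with hb
  have ey : y = b + ((4 * r : ℕ) : ZMod ℓ) := by rw [hb]; ring
  have eK : y - (r : ZMod ℓ) = b + ((3 * r : ℕ) : ZMod ℓ) := by rw [hb]; push_cast; ring
  have eJ : y - ((2 * r : ℕ) : ZMod ℓ) = b + ((2 * r : ℕ) : ZMod ℓ) := by rw [hb]; push_cast; ring
  -- A gate with sites on both sides of the cut would contain `y`, hence start at `y`, and then has
  -- no site before `y`.
  have hcross : ∀ {j : Fin k} {i z : ZMod ℓ}, i ∈ arc (x j) (n j) → z ∈ arc (x j) (n j) →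
      crd b i < 4 * r → 4 * r ≤ crd b z → crd b z ≤ crd b i + r → False := by
    intro j i z hi hz h1 h2 h3
    obtain ⟨p, q, hp, hq, hi', hz'⟩ := hoff hi hz
    have hnj := hn j
    have e1 : ((crd b z + p : ℕ) : ZMod ℓ) = ((crd b i + q : ℕ) : ZMod ℓ) := by
      have hj := add_crd b z
      have hi := add_crd b i
      push_cast
      linear_combination hj - hi + hz' - hi'
    have l1 := crd_lt b z
    rw [ZMod.natCast_eq_natCast_iff', Nat.mod_eq_of_lt (by omega), Nat.mod_eq_of_lt (by omega)] at e1
    have hya : y = x j + ((p + (4 * r - crd b i) : ℕ) : ZMod ℓ) := by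
      rw [ey]
      have hi := add_crd b i
      push_cast [Nat.cast_sub h1.le]
      linear_combination hi' + hi
    have hyx := hy j (by
      simp only [arc, Finset.mem_image, Finset.mem_range]
      exact ⟨p + (4 * r - crd b i), by omega, hya.symm⟩)
    rw [← hyx, ey, add_assoc, ← Nat.cast_add] at hi'
    have := crd_add (b := b) (k := 4 * r + p) (by omega)
    rw [← hi'] at this
    omega
  refine ⟨y, onSites (arc (y - (r : ZMod ℓ)) r) (μ g), ?_, ?_, fun j => ?_⟩
  · refine isEnd_of_conj (onSites_mem hM _) ?_ (fun i hi m => ?_) hWu hM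
    · refine (supportedOn_onSites _ _).mono fun i hi => ?_
      rw [mem_arc_crd eK (by omega)] at hi ⊢
      omega
    · rw [mem_arc_crd eK (by omega)] at hi
      obtain ⟨E, hiE, hE, hj⟩ := hcell i
      have him : SupportedOn {i} (siteOp i m) := supportedOn_singleton.2 ⟨m, rfl⟩
      have hsE : SupportedOn E (heis Wᴴ (siteOp i m)) := hpres' E hj _ (supportedOn_siteOp hiE m)
      have hEn : ∀ z ∈ E, (crd b z ≤ crd b i + r ∧ crd b i ≤ crd b z + r) ∧
          (crd b i < 4 * r ↔ crd b z < 4 * r) := by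
        intro z hz
        rcases hE with rfl | ⟨j, rfl⟩
        · rw [Finset.mem_singleton] at hz
          subst hz
          exact ⟨⟨by omega, by omega⟩, Iff.rfl⟩
        · have h1 := near_crd b (hnear hiE hz)
          have l1 := crd_lt b z
          refine ⟨by omega, ⟨fun h2 => ?_, fun h2 => ?_⟩⟩
          · by_contra h3
            exact hcross hiE hz h2 (by omega) (by omega)
          · by_contra h3
            exact hcross hz hiE h2 (by omega) (by omega)
      have key : heis W (onSites (arc (y - ((2 * r : ℕ) : ZMod ℓ)) (2 * r)) (μ g)) * siteOp i m *
          (heis W (onSites (arc (y - ((2 * r : ℕ) : ZMod ℓ)) (2 * r)) (μ g)))ᴴ =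
          heis W (onSites (arc (y - ((2 * r : ℕ) : ZMod ℓ)) (2 * r)) (μ g) * heis Wᴴ (siteOp i m) *
            (onSites (arc (y - ((2 * r : ℕ) : ZMod ℓ)) (2 * r)) (μ g))ᴴ) := by
        rw [heis_mul hWu, heis_mul hWu, heis_heis_ct hWu, heis_ct]
      rw [key]
      by_cases h4 : crd b i < 4 * r
      · rw [hsE.conj_onSites hM (J' := Finset.univ), heis_mul hWu, heis_mul hWu, heis_heis_ct hWu,
          ← heis_ct, heis_of_commute hWu hWc]
        · refine him.conj_onSites hM fun z hz => ?_
          rw [Finset.mem_singleton] at hz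
          subst hz
          rw [mem_arc_crd eK (by omega)]
          simp only [Finset.mem_univ, iff_true]
          omega
        · intro z hz
          have := hEn z hz
          rw [mem_arc_crd eJ (by omega)]
          simp only [Finset.mem_univ, iff_true]
          omega
      · rw [hsE.conj_onSites hM (J' := ∅), onSites_empty, one_mul, Matrix.conjTranspose_one, mul_one,
          heis_heis_ct hWu, him.conj_onSites hM (J' := ∅), onSites_empty, one_mul,
          Matrix.conjTranspose_one, mul_one]
        · intro z hz
          rw [Finset.mem_singleton] at hz
          subst hz
          rw [mem_arc_crd eK (by omega)]
          simp only [Finset.notMem_empty, iff_false]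
          omega
        · intro z hz
          have := hEn z hz
          rw [mem_arc_crd eJ (by omega)]
          simp only [Finset.notMem_empty, iff_false]
          omega
  · rw [onSites_pow, hd, onSites_one]
  · rw [onSites_pow, ntr_onSites_arc (by omega), div_self (pow_ne_zero _ (htr j))]

/-- Layers compose by `IsSym.endRatio_mul`, each adding `r` to the spreading length; at the end all
circuits of depth at most `D` are brought to the common length `D * r`. -/
theorem IsSymmetricCircuit.endRatio [Nonempty S] {μ : G → Matrix S S ℂ} {W : Op (ZMod ℓ) S}
    (hW : IsSymmetricCircuit D r μ W) (g : G) (hM : μ g ∈ Matrix.unitaryGroup S ℂ)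
    (hr : 20 * (D * r) + 12 * r + 1 ≤ ℓ) (hd0 : 0 < d) (hd : (μ g) ^ d = 1)
    (htr : ∀ j, mtr (μ g ^ j) ≠ 0) :
    IsSym (D * r) (μ g) W ∧ IsEndRatio (D * r) W (μ g) d fun _ => 1 := by
  obtain ⟨Ws, hlen, hlay, rfl⟩ := hW
  have key : ∀ l : List (Op (ZMod ℓ) S), l.length ≤ D → (∀ V ∈ l, IsSymmetricLayer r μ V) →
      IsSym (l.length * r) (μ g) l.prod ∧ IsEndRatio (l.length * r) l.prod (μ g) d fun _ => 1 := by
    intro l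
    induction l with
    | nil =>
      intro _ _
      simp only [List.length_nil, Nat.zero_mul, List.prod_nil]
      exact ⟨isSym_one hM, endRatio_one hM (by omega) hd htr⟩
    | cons V l ih =>
      intro hl hV
      rw [List.length_cons] at hl
      obtain ⟨h1, h2⟩ := ih (by omega) (fun Z hZ => hV Z (List.mem_cons_of_mem _ hZ))
      obtain ⟨h3, h4⟩ := (hV V List.mem_cons_self).isSym (d := d) g hM (by omega)
      have h5 : l.length * r + r ≤ D * r := by
        have := Nat.mul_le_mul_right r hl
        rwa [Nat.add_mul, Nat.one_mul] at this
      rw [List.prod_cons, List.length_cons, Nat.add_mul, Nat.one_mul]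
      refine ⟨h1.mul h3, ?_⟩
      have := h1.endRatio_mul h3 (by omega) hd0 hd htr h2 (h4 hd htr)
      simpa using this
  obtain ⟨h1, h2⟩ := key Ws hlen hlay
  have h3 : Ws.length * r ≤ D * r := Nat.mul_le_mul_right r hlen
  exact ⟨h1.mono h3, h1.endRatio_mono h3 (by omega) hd htr h2⟩

/-- A doubled gate commutes with the exchange whatever the gate is. Invariance of the GNVW index
under circuits thus becomes a case of invariance of end ratios. -/
theorem IsSymmetricCircuit.dbl {μ : G → Matrix S S ℂ} {W : Op (ZMod ℓ) S}
    (hW : IsSymmetricCircuit D r μ W) :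
    IsSymmetricCircuit D r (fun _ : Unit => swapM S) (dbl W) := by
  let φ : Op (ZMod ℓ) S →* Op (ZMod ℓ) (S × S) :=
    { toFun := SpinChain.dbl, map_one' := dbl_one, map_mul' := fun U V => (dbl_mul U V).symm }
  obtain ⟨Ws, hlen, hlay, rfl⟩ := hW
  refine ⟨Ws.map φ, by simpa using hlen, fun Z hZ => ?_, map_list_prod φ Ws⟩
  obtain ⟨V, hV, rfl⟩ := List.mem_map.1 hZ
  obtain ⟨k, x, n, v, hn, hdis, hv, rfl⟩ := hlay V hV
  refine ⟨k, x, n, fun j => SpinChain.dbl (v j), hn, hdis, fun j => ⟨dbl_mem (hv j).1,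
    (hv j).2.1.tens (hv j).2.1, fun _ => ?_⟩, ?_⟩
  · have := dbl_commute_swap (v j)
    rwa [onSites_univ] at this
  · rw [map_list_prod, List.map_ofFn]
    rfl

/-- End ratios do not change under ancillas and symmetric circuits. -/
theorem endRatio_of_circuit [Nonempty S] [Nonempty T] {e : R ≃ S × T} {μ : G → Matrix R R ℂ} {g : G}
    {M : Matrix S S ℂ} {M' : Matrix T T ℂ} (hμ : μ g = stens e M M')
    {U U' : Op (ZMod ℓ) S} {W : Op (ZMod ℓ) R} (hU : IsSym ξ M U) (hU' : IsSym ξ M U')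
    (hM' : M' ∈ Matrix.unitaryGroup T ℂ) (hW : IsSymmetricCircuit D r μ W)
    (hℓ : 20 * (ξ + D * r) + 12 * r + 1 ≤ ℓ) (hd0 : 0 < d) (hd : M ^ d = 1) (hd' : M' ^ d = 1)
    (htr : ∀ j, mtr (M ^ j) ≠ 0) (htr' : ∀ j, mtr (M' ^ j) ≠ 0)
    (h : tens e U' (1 : Op (ZMod ℓ) T) = W * tens e U 1) {τ τ' : ℕ → ℂ}
    (hτ : IsEndRatio ξ U M d τ) (hτ' : IsEndRatio ξ U' M d τ') :
    ∃ c : ℂ, c ^ d = 1 ∧ ∀ j, τ' j = c ^ j * τ j := by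
  have : Nonempty R := ⟨e.symm (Classical.arbitrary _)⟩
  have hRd : (stens e M M') ^ d = 1 := by rw [stens_pow, hd, hd', stens_one]
  have hRtr : ∀ j, mtr (stens e M M' ^ j) ≠ 0 := fun j => by
    rw [stens_pow, mtr_stens]; exact mul_ne_zero (htr j) (htr' j)
  have h1 : IsSym ξ (stens e M M') (tens e U (1 : Op (ZMod ℓ) T)) := hU.tens (isSym_one hM')
  have h1' : IsSym ξ (stens e M M') (tens e U' (1 : Op (ZMod ℓ) T)) := hU'.tens (isSym_one hM')
  have hone : IsEndRatio ξ (1 : Op (ZMod ℓ) T) M' d fun _ => 1 :=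
    endRatio_one hM' (by omega) hd' htr'
  have h2 := hU.endRatio_tens (e := e) (by omega) hd htr hτ hone
  have h2' := hU'.endRatio_tens (e := e) (by omega) hd htr hτ' hone
  simp only [mul_one] at h2 h2'
  obtain ⟨h3, h4⟩ := hW.endRatio (d := d) g (by rw [hμ]; exact h1.mem) (by omega) hd0
    (by rw [hμ]; exact hRd) (by rw [hμ]; exact hRtr)
  rw [hμ] at h3 h4
  have h5 := h1.endRatio_mul h3 (by omega) hd0 hRd hRtr h2 h4
  simp only [mul_one] at h5
  rw [← h] at h5
  have h6 := h1'.endRatio_mono (ξ' := ξ + D * r) (by omega) (by omega) hRd hRtr h2'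
  exact (h1'.mono (by omega : ξ ≤ ξ + D * r)).endRatio_unique (by omega) hRd hRtr h5 h6

theorem withAncillas_eq {ι : Type} [Fintype ι] [DecidableEq ι] (a : ℕ) (U : Op ι S) :
    withAncillas a U = tens (Equiv.refl _) U 1 := rfl

theorem ancillaRep_eq (a : ℕ) (μ : G → Matrix S S ℂ) (g : G) :
    ancillaRep a μ g = stens (Equiv.refl _) (μ g) (prodOp fun _ : Fin a => μ g) := rfl

theorem mtr_prodOp [Nonempty S] (a : ℕ) (M : Matrix S S ℂ) :
    mtr (prodOp fun _ : Fin a => M) = mtr M ^ a := by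
  rw [mtr, trace_prodOp, Fintype.card_fun]
  simp [mtr, div_pow]

theorem prodOp_pow {ι : Type} [Fintype ι] [DecidableEq ι] (M : Matrix S S ℂ) (j : ℕ) :
    (prodOp fun _ : ι => M) ^ j = prodOp fun _ => M ^ j := by
  rw [← onSites_univ, onSites_pow, onSites_univ]

/-- Strong equivalence preserves the end ratios of the symmetry. -/
theorem StronglyEquivalent.endRatio [Nonempty S] {μ : G → Matrix S S ℂ} {U U' : Op (ZMod ℓ) S}
    (h : StronglyEquivalent D r μ U U') (g : G) (hU : IsSym ξ (μ g) U) (hU' : IsSym ξ (μ g) U')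
    (hℓ : 20 * (ξ + D * r) + 12 * r + 1 ≤ ℓ) (hd0 : 0 < d) (hd : μ g ^ d = 1)
    (htr : ∀ j, mtr (μ g ^ j) ≠ 0) {τ τ' : ℕ → ℂ}
    (hτ : IsEndRatio ξ U (μ g) d τ) (hτ' : IsEndRatio ξ U' (μ g) d τ') :
    ∃ c : ℂ, c ^ d = 1 ∧ ∀ j, τ' j = c ^ j * τ j := by
  obtain ⟨a, W, hW, h⟩ := h
  rw [withAncillas_eq, withAncillas_eq] at h
  refine endRatio_of_circuit (ancillaRep_eq a μ g) hU hU' ?_ hW hℓ hd0 hd ?_ htr ?_ h hτ hτ'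
  · rw [← onSites_univ]; exact onSites_mem hU.mem _
  · rw [prodOp_pow, hd, prodOp_one]
  · intro j
    rw [prodOp_pow, mtr_prodOp]
    exact pow_ne_zero _ (htr j)

/-- Strong equivalence preserves the end ratios of the exchange of two copies. -/
theorem StronglyEquivalent.endRatio_dbl [Nonempty S] {μ : G → Matrix S S ℂ} {U U' : Op (ZMod ℓ) S}
    (h : StronglyEquivalent D r μ U U') (hU : IsLocal (near ξ) U) (hU' : IsLocal (near ξ) U')
    (hℓ : 20 * (ξ + D * r) + 12 * r + 1 ≤ ℓ) {τ τ' : ℕ → ℂ}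
    (hτ : IsEndRatio ξ (dbl U) (swapM S) 2 τ) (hτ' : IsEndRatio ξ (dbl U') (swapM S) 2 τ') :
    ‖τ' 1‖ = ‖τ 1‖ := by
  obtain ⟨a, W, hW, h⟩ := h
  rw [withAncillas_eq, withAncillas_eq] at h
  have h2 := congrArg dbl h
  rw [← dbl_mul, dbl_tens, dbl_tens, dbl_one] at h2
  obtain ⟨c, hc, hcj⟩ := endRatio_of_circuit (g := ()) (swapM_stens (Equiv.refl (S × (Fin a → S))))
    (isSym_dbl hU) (isSym_dbl hU') swapM_mem hW.dbl hℓ two_pos swapM_sq swapM_sq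
    mtr_swapM_pow_ne_zero mtr_swapM_pow_ne_zero h2 hτ hτ'
  have hc1 : ‖c‖ = 1 := by
    have := congrArg norm hc
    rw [norm_pow, norm_one] at this
    exact (pow_eq_one_iff_of_nonneg (norm_nonneg c) two_ne_zero).1 this
  rw [hcj 1, norm_mul, norm_pow, hc1, one_pow, one_mul]

end Circuits

/-! ### Refined indices in terms of end ratios -/

section Refined
variable {ℓ : ℕ} [NeZero ℓ] {S G : Type} [Fintype S] [DecidableEq S] {ξ : ℕ} {U : Op (ZMod ℓ) S}

theorem IsQCA.isLocal (h : IsQCA ξ U) : IsLocal (near ξ) U :=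
  ⟨h.1, fun i j hij m m' => (h.2 i _ (supportedOn_siteOp (Finset.mem_singleton_self i) m)).commute
    (Finset.disjoint_singleton_right.2 hij)
    (supportedOn_siteOp (Finset.mem_singleton_self j) m')⟩

theorem IsLocal.isQCA (h : IsLocal (near ξ) U) : IsQCA ξ U :=
  ⟨h.1, fun i _ hO => h.supportedOn (near_symm ξ)
    (fun k hk j hj => by rwa [Finset.mem_singleton.1 hk] at hj) hO⟩

theorem IsSymmetricQCA.isSym {μ : G → Matrix S S ℂ} (h : IsSymmetricQCA ξ μ U)
    (hμ : ∀ g, μ g ∈ Matrix.unitaryGroup S ℂ) (g : G) : IsSym ξ (μ g) U :=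
  ⟨h.1.isLocal, hμ g, by rw [onSites_univ]; exact h.2 g⟩

section Group
variable [Group G] {μ : G →* Matrix.unitaryGroup S ℂ}

theorem coe_map_pow (μ : G →* Matrix.unitaryGroup S ℂ) (g : G) (j : ℕ) :
    (μ g : Matrix S S ℂ) ^ j = μ (g ^ j) := by
  rw [map_pow]; rfl

theorem coe_map_pow_orderOf (μ : G →* Matrix.unitaryGroup S ℂ) (g : G) :
    (μ g : Matrix S S ℂ) ^ orderOf g = 1 := by
  rw [coe_map_pow, pow_orderOf_eq_one, map_one]; rfl

theorem mtr_map_pow_ne_zero [Nonempty S] (htr : ∀ g, (μ g : Matrix S S ℂ).trace ≠ 0) (g : G)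
    (j : ℕ) : mtr ((μ g : Matrix S S ℂ) ^ j) ≠ 0 := by
  rw [coe_map_pow, mtr]
  exact div_ne_zero (htr _) (by simp [Fintype.card_ne_zero])

theorem trace_div_trace [Nonempty S] (A B : Op (ZMod ℓ) S) : A.trace / B.trace = ntr A / ntr B := by
  rw [ntr, ntr, div_div_div_cancel_right₀]
  simp [Fintype.card_ne_zero]

theorem arc_halves {x : ZMod ℓ} {m ξ : ℕ} (h1 : ξ ≤ m) :
    x - (m : ZMod ℓ) + ((2 * m : ℕ) : ZMod ℓ) = x + (m : ZMod ℓ) ∧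
    x - (m : ZMod ℓ) + (ξ : ZMod ℓ) + ((m - ξ : ℕ) : ZMod ℓ) = x ∧
    2 * m - 2 * ξ = (m - ξ) + (m - ξ) := by
  refine ⟨by push_cast; ring, by push_cast [Nat.cast_sub h1]; ring, by omega⟩

theorem subset_halves {x : ZMod ℓ} {m ξ : ℕ} (h1 : ξ ≤ m) (h2 : 2 * (m + ξ) ≤ ℓ) :
    arc (x - (m : ZMod ℓ) - (ξ : ZMod ℓ)) (2 * ξ) ⊆ arc (x - ((m + ξ : ℕ) : ZMod ℓ)) (m + ξ) ∧
    arc (x - (m : ZMod ℓ) + (ξ : ZMod ℓ)) (m - ξ) ⊆ arc (x - ((m + ξ : ℕ) : ZMod ℓ)) (m + ξ) ∧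
    arc x (m - ξ) ⊆ arc x (m + ξ) ∧
    arc (x + (m : ZMod ℓ) - (ξ : ZMod ℓ)) (2 * ξ) ⊆ arc x (m + ξ) ∧
    Disjoint (arc (x - ((m + ξ : ℕ) : ZMod ℓ)) (m + ξ)) (arc x (m + ξ)) ∧
    Disjoint (arc x (m - ξ)) (arc (x + (m : ZMod ℓ) - (ξ : ZMod ℓ)) (2 * ξ)) ∧
    Disjoint (arc (x - (m : ZMod ℓ) - (ξ : ZMod ℓ)) (2 * ξ))
      (arc (x - (m : ZMod ℓ) + (ξ : ZMod ℓ)) (m - ξ)) := by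
  set b := x - ((m + ξ : ℕ) : ZMod ℓ) with hb
  have e1 : x - (m : ZMod ℓ) - (ξ : ZMod ℓ) = b + ((0 : ℕ) : ZMod ℓ) := by
    rw [hb]; push_cast; ring
  have e2 : x - (m : ZMod ℓ) + (ξ : ZMod ℓ) = b + ((2 * ξ : ℕ) : ZMod ℓ) := by
    rw [hb]; push_cast; ring
  have e3 : x = b + ((m + ξ : ℕ) : ZMod ℓ) := by rw [hb]; ring
  have e4 : x + (m : ZMod ℓ) - (ξ : ZMod ℓ) = b + ((2 * m : ℕ) : ZMod ℓ) := by
    rw [hb]; push_cast; ring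
  have e0 : b = b + ((0 : ℕ) : ZMod ℓ) := by simp
  refine ⟨fun z hz => ?_, fun z hz => ?_, fun z hz => ?_, fun z hz => ?_, ?_, ?_, ?_⟩
  · rw [mem_arc_crd e1 (by omega)] at hz; rw [mem_arc_crd e0 (by omega)]; omega
  · rw [mem_arc_crd e2 (by omega)] at hz; rw [mem_arc_crd e0 (by omega)]; omega
  · rw [mem_arc_crd e3 (by omega)] at hz ⊢; omega
  · rw [mem_arc_crd e4 (by omega)] at hz; rw [mem_arc_crd e3 (by omega)]; omega
  · refine Finset.disjoint_left.2 fun z hz hz' => ?_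
    rw [mem_arc_crd e0 (by omega)] at hz; rw [mem_arc_crd e3 (by omega)] at hz'; omega
  · refine Finset.disjoint_left.2 fun z hz hz' => ?_
    rw [mem_arc_crd e3 (by omega)] at hz; rw [mem_arc_crd e4 (by omega)] at hz'; omega
  · refine Finset.disjoint_left.2 fun z hz hz' => ?_
    rw [mem_arc_crd e1 (by omega)] at hz; rw [mem_arc_crd e2 (by omega)] at hz'; omega

/-- Two factorizations of an operator over disjoint regions agree up to a scalar. -/
theorem exists_smul_of_mul_eq_mul [Nonempty S] {X Y : Finset (ZMod ℓ)} (hXY : Disjoint X Y)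
    {A A' B B' : Op (ZMod ℓ) S} (hA : SupportedOn X A) (hA' : SupportedOn X A')
    (hB : SupportedOn Y B) (hB' : SupportedOn Y B') (uA : A ∈ Matrix.unitaryGroup _ ℂ)
    (uB' : B' ∈ Matrix.unitaryGroup _ ℂ) (h : A * B = A' * B') : ∃ z : ℂ, B = z • B' := by
  have h1 : Aᴴ * A' = B * B'ᴴ := by
    calc Aᴴ * A' = Aᴴ * (A' * B') * B'ᴴ := by
          rw [Matrix.mul_assoc, Matrix.mul_assoc, mul_ct uB', Matrix.mul_one]
      _ = (Aᴴ * A) * B * B'ᴴ := by rw [← h]; simp only [Matrix.mul_assoc]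
      _ = B * B'ᴴ := by rw [ct_mul uA, Matrix.one_mul]
  obtain ⟨z, hz⟩ := SupportedOn.exists_smul_of_disjoint hXY (hA.conjTranspose.mul hA')
    (h1 ▸ hB.mul hB'.conjTranspose)
  refine ⟨z, ?_⟩
  calc B = B * B'ᴴ * B' := by rw [Matrix.mul_assoc, ct_mul uB', Matrix.mul_one]
    _ = z • B' := by rw [← h1, hz, Matrix.smul_mul, Matrix.one_mul]

/-- The evolved symmetry is factored over the same two disjoint halves in two ways, by `L g * R g`
and by the ends with half of the bulk each. So `R g` is a phase times its half of the bulk and the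
right end, and the bulk cancels in the quotient of traces. -/
theorem IsSplitting.exists_end [Nonempty S] {x : ZMod ℓ} {m : ℕ}
    {L R : G →* Matrix.unitaryGroup (ZMod ℓ → S) ℂ}
    (h : IsSplitting ξ (fun g => (μ g : Matrix S S ℂ)) U x m L R) (g : G)
    (hU : IsSym ξ (μ g : Matrix S S ℂ) U)
    (hℓ : 12 * ξ ≤ ℓ) (h1 : 2 * ξ ≤ m) (h2 : 2 * (m + ξ) ≤ ℓ) (htr : mtr (μ g : Matrix S S ℂ) ≠ 0) :
    ∃ T, RightEnd ξ U (μ g : Matrix S S ℂ) (x + (m : ZMod ℓ)) T ∧ T ^ orderOf g = 1 ∧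
      (R g : Op (ZMod ℓ) S).trace / (onSites (arc x m) (μ g : Matrix S S ℂ)).trace =
        ntr T / mtr (μ g : Matrix S S ℂ) ^ ξ := by
  set M : Matrix S S ℂ := (μ g : Matrix S S ℂ) with hM
  obtain ⟨a1, a2, a3⟩ := arc_halves (x := x) (show ξ ≤ m by omega)
  obtain ⟨s1, s2, s3, s4, d1, d2, d3⟩ := subset_halves (x := x) (show ξ ≤ m by omega) h2
  obtain ⟨T₀, hT₀⟩ := hU.exists_leftEnd hℓ (x - (m : ZMod ℓ))
  obtain ⟨T, hT⟩ := hU.exists_rightEnd hℓ (x + (m : ZMod ℓ))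
  obtain ⟨c, hc, hX⟩ := hU.exists_eq_ends (x := x - (m : ZMod ℓ)) (n := 2 * m) (by omega) (by omega)
    hT₀ (by rw [a1]; exact hT)
  obtain ⟨hL, hR, hLR⟩ := h g
  have key : (L g : Op (ZMod ℓ) S) * (R g : Op (ZMod ℓ) S) =
      (c • (T₀ * onSites (arc (x - (m : ZMod ℓ) + (ξ : ZMod ℓ)) (m - ξ)) M)) *
        (onSites (arc x (m - ξ)) M * T) := by
    rw [← hLR]
    change heis U _ = _
    rw [hX, ← onSites_arc_add M a2.symm (by omega) a3]
    simp only [Matrix.smul_mul, Matrix.mul_assoc]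
  obtain ⟨z, hz⟩ := exists_smul_of_mul_eq_mul d1 hL
    (((hT₀.2.1.mono s1).mul ((supportedOn_onSites _ _).mono s2)).smul c) hR
    (((supportedOn_onSites _ _).mono s3).mul (hT.2.1.mono s4)) (L g).2
    (mul_mem (onSites_mem hU.mem _) hT.1) key
  have hcm : Commute (onSites (arc x (m - ξ)) M) T :=
    (supportedOn_onSites _ _).commute d2 hT.2.1
  have hz1 : ‖z‖ = 1 := norm_eq_one_of_smul_mem_unitary
    (mul_mem (onSites_mem hU.mem _) hT.1) (hz ▸ (R g).2)
  have hR' : (R g : Op (ZMod ℓ) S) = onSites (arc x (m - ξ)) M * (z • T) := by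
    rw [hz, Matrix.mul_smul]
  have hcm' : Commute (onSites (arc x (m - ξ)) M) (z • T) := hcm.smul_right z
  refine ⟨z • T, hT.smul hz1, ?_, ?_⟩
  -- Because `R` is a homomorphism and not merely a family of unitaries, the end extracted from it
  -- is normalized.
  · have e1 := coe_map_pow_orderOf R g
    rw [hR', hcm'.mul_pow, onSites_pow, hM, coe_map_pow_orderOf, onSites_one, one_mul] at e1
    exact e1
  · rw [trace_div_trace, hR', ntr_mul_of_disjoint d2 (supportedOn_onSites _ _) (hT.2.1.smul z),
      ntr_onSites_arc (by omega), ntr_onSites_arc (by omega)]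
    have : m = (m - ξ) + ξ := by omega
    conv_lhs => rw [show mtr M ^ m = mtr M ^ ((m - ξ) + ξ) by rw [← this], pow_add]
    rw [mul_div_mul_left _ _ (pow_ne_zero _ htr)]

/-- The only freedom in `τ 1` is a root of unity of order dividing `orderOf g`, which the power
`orderOf g` removes. Neither the intervals nor the splitting matter any more. -/
theorem IsRefinedIndex.eq [Finite G] [Nonempty S] {s : G → ℂ}
    (hs : IsRefinedIndex ξ (fun g => (μ g : Matrix S S ℂ)) U s)
    (hU : IsSymmetricQCA ξ (fun g => (μ g : Matrix S S ℂ)) U)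
    (hℓ : 12 * ξ + 1 ≤ ℓ) (htr : ∀ g, (μ g : Matrix S S ℂ).trace ≠ 0) {σ τ : ℕ → ℂ}
    (hσ : IsEndRatio ξ (dbl U) (swapM S) 2 σ) (g : G)
    (hτ : IsEndRatio ξ U (μ g : Matrix S S ℂ) (orderOf g) τ) :
    s g = ((‖σ 1‖⁻¹ : ℝ) : ℂ) * τ 1 ^ orderOf g := by
  obtain ⟨q, hq, x, m, L, R, h1, h2, h3, h4, h5⟩ := hs
  have hsym := hU.isSym (fun g => (μ g).2) g
  obtain ⟨T, hT, hTd, ht⟩ := h4.exists_end g hsym (by omega) h2 h3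
    (by simpa using mtr_map_pow_ne_zero htr g 1)
  have hτ' : IsEndRatio ξ U (μ g : Matrix S S ℂ) (orderOf g)
    (fun j => ntr (T ^ j) / mtr ((μ g : Matrix S S ℂ) ^ j) ^ ξ) := ⟨_, T, hT, hTd, fun j => rfl⟩
  obtain ⟨c, hc, h⟩ := hsym.endRatio_unique hℓ (coe_map_pow_orderOf μ g)
    (mtr_map_pow_ne_zero htr g) hτ hτ'
  have h' := h 1
  simp only [pow_one] at h'
  rw [h5 g, ht, h', mul_pow, hc, one_mul, gnvw_eq hU.1.isLocal hℓ hq hσ]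

end Group

section Cyclic
variable {N : ℕ} [NeZero N] {μ : Multiplicative (ZMod N) →* Matrix.unitaryGroup S ℂ}

theorem exists_hom_zmod {H : Type*} [Group H] {u : H} (hu : u ^ N = 1) :
    ∃ φ : Multiplicative (ZMod N) →* H, φ (Multiplicative.ofAdd 1) = u := by
  let f : ℤ →+ Additive H := zmultiplesHom (Additive H) (Additive.ofMul u)
  have hf : f N = 0 := by
    simp only [f, zmultiplesHom_apply, natCast_zsmul]
    rw [← ofMul_pow, hu]; rfl
  refine ⟨AddMonoidHom.toMultiplicativeLeft (ZMod.lift N ⟨f, hf⟩), ?_⟩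
  have : (ZMod.lift N ⟨f, hf⟩) ((1 : ℤ) : ZMod N) = f 1 := ZMod.lift_coe N ⟨f, hf⟩ 1
  rw [Int.cast_one] at this
  change Additive.toMul ((ZMod.lift N ⟨f, hf⟩) 1) = u
  rw [this]
  simp [f]

theorem ofAdd_one_pow_val (g : Multiplicative (ZMod N)) :
    (Multiplicative.ofAdd (1 : ZMod N)) ^ (Multiplicative.toAdd g).val = g := by
  rw [← ofAdd_nsmul, nsmul_eq_mul, mul_one, ZMod.natCast_zmod_val]; rfl

theorem ofAdd_one_pow_card : (Multiplicative.ofAdd (1 : ZMod N)) ^ N = 1 := by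
  rw [← ofAdd_nsmul, nsmul_eq_mul, mul_one, ZMod.natCast_self]; rfl

/-- For a cyclic group it suffices to split the evolved symmetry of the generator into commuting
factors whose `N`-th power is 1. Normalized ends provide these, and their powers are the
representations. -/
theorem exists_splitting [Nonempty S]
    (hU : IsSymmetricQCA ξ (fun g => (μ g : Matrix S S ℂ)) U)
    (hℓ : 12 * ξ ≤ ℓ) (x : ZMod ℓ) {m : ℕ} (h1 : 2 * ξ ≤ m) (h2 : 2 * (m + ξ) ≤ ℓ) :
    ∃ L R : Multiplicative (ZMod N) →* Matrix.unitaryGroup (ZMod ℓ → S) ℂ,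
      IsSplitting ξ (fun g => (μ g : Matrix S S ℂ)) U x m L R := by
  set g₀ : Multiplicative (ZMod N) := Multiplicative.ofAdd 1 with hg₀
  have hsym := hU.isSym (fun g => (μ g).2) g₀
  set M : Matrix S S ℂ := (μ g₀ : Matrix S S ℂ) with hM
  have hMN : M ^ N = 1 := by
    rw [hM, coe_map_pow, hg₀, ofAdd_one_pow_card, map_one]; rfl
  obtain ⟨a1, a2, a3⟩ := arc_halves (x := x) (show ξ ≤ m by omega)
  obtain ⟨s1, s2, s3, s4, d1, d2, d3⟩ := subset_halves (x := x) (show ξ ≤ m by omega) h2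
  obtain ⟨T, hT, hTN⟩ := hsym.exists_rightEnd_pow hℓ (NeZero.pos N) hMN (x + (m : ZMod ℓ))
  obtain ⟨T₀, hT₀, hT₀N, hX⟩ := hsym.exists_left_of_right hℓ hMN (x := x - (m : ZMod ℓ))
    (n := 2 * m) (by omega) (by omega) (by rw [a1]; exact hT) hTN
  set Ml := onSites (arc (x - (m : ZMod ℓ) + (ξ : ZMod ℓ)) (m - ξ)) M with hMl
  set Mr := onSites (arc x (m - ξ)) M with hMr
  have cl : Commute T₀ Ml := hT₀.2.1.commute d3 (supportedOn_onSites _ _)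
  have cr : Commute Mr T := (supportedOn_onSites _ _).commute d2 hT.2.1
  have sl : SupportedOn (arc (x - ((m + ξ : ℕ) : ZMod ℓ)) (m + ξ)) (T₀ * Ml) :=
    (hT₀.2.1.mono s1).mul ((supportedOn_onSites _ _).mono s2)
  have sr : SupportedOn (arc x (m + ξ)) (Mr * T) :=
    ((supportedOn_onSites _ _).mono s3).mul (hT.2.1.mono s4)
  have hX' : heis U (onSites (arc (x - (m : ZMod ℓ)) (2 * m)) M) = (T₀ * Ml) * (Mr * T) := by
    rw [hX, ← onSites_arc_add M a2.symm (by omega) a3]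
    simp only [Matrix.mul_assoc, hMl, hMr]
  have uM : ∀ J : Finset (ZMod ℓ), onSites J M ∈ Matrix.unitaryGroup (ZMod ℓ → S) ℂ :=
    onSites_mem hsym.mem
  let uL : Matrix.unitaryGroup (ZMod ℓ → S) ℂ := ⟨T₀ * Ml, mul_mem hT₀.1 (uM _)⟩
  let uR : Matrix.unitaryGroup (ZMod ℓ → S) ℂ := ⟨Mr * T, mul_mem (uM _) hT.1⟩
  have hL : uL ^ N = 1 := Subtype.ext (by
    change (T₀ * Ml) ^ N = 1
    rw [cl.mul_pow, hT₀N, hMl, onSites_pow, hMN, onSites_one, one_mul])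
  have hR : uR ^ N = 1 := Subtype.ext (by
    change (Mr * T) ^ N = 1
    rw [cr.mul_pow, hTN, hMr, onSites_pow, hMN, onSites_one, one_mul])
  obtain ⟨L, hL1⟩ := exists_hom_zmod hL
  obtain ⟨R, hR1⟩ := exists_hom_zmod hR
  refine ⟨L, R, fun g => ?_⟩
  rw [← ofAdd_one_pow_val g]
  set k := (Multiplicative.toAdd g).val
  have eL : (L (g₀ ^ k) : Op (ZMod ℓ) S) = (T₀ * Ml) ^ k := by
    rw [map_pow, hL1]; rfl
  have eR : (R (g₀ ^ k) : Op (ZMod ℓ) S) = (Mr * T) ^ k := by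
    rw [map_pow, hR1]; rfl
  have eM : (μ (g₀ ^ k) : Matrix S S ℂ) = M ^ k := (coe_map_pow μ g₀ k).symm
  refine ⟨by rw [eL]; exact sl.pow k, by rw [eR]; exact sr.pow k, ?_⟩
  simp only
  rw [eL, eR, eM]
  change heis U _ = _
  rw [← onSites_pow, ← heis_pow hU.1.1, hX', ((sl.commute d1 sr)).mul_pow]

theorem exists_refinedIndex [Nonempty S]
    (hU : IsSymmetricQCA ξ (fun g => (μ g : Matrix S S ℂ)) U) (hℓ : 12 * ξ + 4 ≤ ℓ) :
    ∃ s, IsRefinedIndex ξ (fun g => (μ g : Matrix S S ℂ)) U s := by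
  obtain ⟨L, R, h⟩ := exists_splitting hU (by omega) 0 (show 2 * ξ ≤ 2 * ξ + 1 by omega) (by omega)
  exact ⟨_, _, ⟨0, 2 * ξ + 1, 2 * ξ + 1, by omega, by omega, by omega, by omega, by omega, rfl⟩,
    0, 2 * ξ + 1, L, R, by omega, by omega, by omega, h, fun g => rfl⟩

end Cyclic

end Refined

/-! ### Matrices of finite order -/

section FiniteOrder
variable {n n' : Type} [Fintype n] [DecidableEq n] [Fintype n'] [DecidableEq n']
variable {N : ℕ} {ζ : ℂ} {A : Matrix n n ℂ} {B : Matrix n' n' ℂ}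

/-- The projection onto the eigenspace of `A` with eigenvalue `ζ ^ k`, when `A ^ N = 1`. -/
noncomputable def eigProj (N : ℕ) (ζ : ℂ) (A : Matrix n n ℂ) (k : ℕ) : Matrix n n ℂ :=
  (N : ℂ)⁻¹ • ∑ j ∈ Finset.range N, (ζ⁻¹) ^ (j * k) • A ^ j

theorem sum_pow_root (hζ : IsPrimitiveRoot ζ N) {k l : ℕ} (hk : k < N) (hl : l < N) :
    ∑ j ∈ Finset.range N, (ζ⁻¹) ^ (j * k) * ζ ^ (j * l) = if k = l then (N : ℂ) else 0 := by
  have hN : N ≠ 0 := by omega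
  have h0 : ζ ≠ 0 := hζ.ne_zero hN
  have e : ∀ j, (ζ⁻¹) ^ (j * k) * ζ ^ (j * l) = (ζ⁻¹ ^ k * ζ ^ l) ^ j := fun j => by
    rw [mul_pow, ← pow_mul, ← pow_mul, mul_comm k, mul_comm l]
  simp only [e]
  split_ifs with h
  · subst h
    rw [← mul_pow, inv_mul_cancel₀ h0, one_pow]
    simp
  · have h1 : ζ⁻¹ ^ k * ζ ^ l ≠ 1 := by
      intro h1
      rw [inv_pow, inv_mul_eq_one₀ (pow_ne_zero _ h0)] at h1
      exact h (hζ.pow_inj hk hl h1)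
    rw [geom_sum_eq h1, mul_pow, ← pow_mul, ← pow_mul, mul_comm k, mul_comm l, pow_mul, pow_mul,
      inv_pow, hζ.pow_eq_one]
    simp

theorem trace_eigProj (k : ℕ) : (eigProj N ζ A k).trace =
    (N : ℂ)⁻¹ * ∑ j ∈ Finset.range N, (ζ⁻¹) ^ (j * k) * (A ^ j).trace := by
  simp [eigProj, Matrix.trace_smul, Matrix.trace_sum, smul_eq_mul]

theorem mul_eigProj (hζ : IsPrimitiveRoot ζ N) (hN : N ≠ 0) (hA : A ^ N = 1) (k : ℕ) :
    A * eigProj N ζ A k = ζ ^ k • eigProj N ζ A k := by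
  have h0 : ζ ≠ 0 := hζ.ne_zero hN
  have h1 : ∑ j ∈ Finset.range N, (ζ⁻¹) ^ ((j + 1) * k) • A ^ (j + 1) =
      ∑ j ∈ Finset.range N, (ζ⁻¹) ^ (j * k) • A ^ j := by
    have e1 := Finset.sum_range_succ (fun j : ℕ => (ζ⁻¹) ^ (j * k) • A ^ j) N
    have e2 := Finset.sum_range_succ' (fun j : ℕ => (ζ⁻¹) ^ (j * k) • A ^ j) N
    have e3 : (ζ⁻¹) ^ (N * k) • A ^ N = (ζ⁻¹) ^ (0 * k) • A ^ 0 := by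
      rw [pow_mul, inv_pow, hζ.pow_eq_one, hA]; simp
    rw [e1, e3] at e2
    exact (add_right_cancel (b := (ζ⁻¹) ^ (0 * k) • A ^ 0) e2).symm
  rw [eigProj, Matrix.mul_smul, smul_comm]
  conv_rhs => rw [← h1]
  rw [Finset.mul_sum, Finset.smul_sum (r := ζ ^ k)]
  refine congrArg ((N : ℂ)⁻¹ • ·) (Finset.sum_congr rfl fun j _ => ?_)
  have e : ζ ^ k * ζ⁻¹ ^ ((j + 1) * k) = ζ⁻¹ ^ (j * k) := by
    rw [add_mul, one_mul, pow_add, mul_left_comm, ← mul_pow, mul_inv_cancel₀ h0, one_pow, mul_one]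
  rw [Matrix.mul_smul, ← pow_succ', smul_smul, e]

theorem pow_mul_eigProj (hζ : IsPrimitiveRoot ζ N) (hN : N ≠ 0) (hA : A ^ N = 1) (k j : ℕ) :
    A ^ j * eigProj N ζ A k = ζ ^ (j * k) • eigProj N ζ A k := by
  induction j with
  | zero => simp
  | succ j ih =>
    rw [pow_succ, Matrix.mul_assoc, mul_eigProj hζ hN hA, Matrix.mul_smul, ih, smul_smul, ← pow_add]
    congr 2; ring

theorem eigProj_mul (hζ : IsPrimitiveRoot ζ N) (hA : A ^ N = 1) {k l : ℕ}
    (hk : k < N) (hl : l < N) :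
    eigProj N ζ A k * eigProj N ζ A l = if k = l then eigProj N ζ A k else 0 := by
  have hN : N ≠ 0 := by omega
  conv_lhs => rw [eigProj, Matrix.smul_mul, Finset.sum_mul]
  simp only [Matrix.smul_mul, pow_mul_eigProj hζ hN hA, smul_smul]
  rw [← Finset.sum_smul, sum_pow_root hζ hk hl, smul_smul]
  split_ifs with h
  · rw [inv_mul_cancel₀ (by exact_mod_cast hN), one_smul, h]
  · simp

theorem sum_eigProj (hζ : IsPrimitiveRoot ζ N) (hN : N ≠ 0) :
    ∑ k ∈ Finset.range N, eigProj N ζ A k = 1 := by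
  have h : ∀ j ∈ Finset.range N, ∑ k ∈ Finset.range N, (ζ⁻¹) ^ (j * k) • A ^ j =
      if j = 0 then (N : ℂ) • (1 : Matrix n n ℂ) else 0 := by
    intro j hj
    have := sum_pow_root hζ (Finset.mem_range.1 hj) (Nat.pos_of_ne_zero hN)
    simp only [mul_zero, pow_zero, mul_one] at this
    rw [← Finset.sum_smul]
    simp only [mul_comm j, this]
    split_ifs with h0
    · rw [h0, pow_zero]
    · simp
  simp only [eigProj]
  rw [← Finset.smul_sum, Finset.sum_comm, Finset.sum_congr rfl h, Finset.sum_ite_eq',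
    if_pos (Finset.mem_range.2 (Nat.pos_of_ne_zero hN)), smul_smul,
    inv_mul_cancel₀ (by exact_mod_cast hN), one_smul]

theorem pow_eq_sum_eigProj (hζ : IsPrimitiveRoot ζ N) (hN : N ≠ 0) (hA : A ^ N = 1) (j : ℕ) :
    A ^ j = ∑ k ∈ Finset.range N, ζ ^ (j * k) • eigProj N ζ A k := by
  conv_lhs => rw [← mul_one (A ^ j), ← sum_eigProj (A := A) hζ hN, Finset.mul_sum]
  exact Finset.sum_congr rfl fun k _ => pow_mul_eigProj hζ hN hA k j

/-- Unitarity makes `Pᴴ` a left eigenvector of `A` for the same eigenvalue, whence `Pᴴ * P = Pᴴ`.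
The left side is self-adjoint. -/
theorem eigProj_isHermitian (hζ : IsPrimitiveRoot ζ N) (hA : A ^ N = 1)
    (hU : A ∈ Matrix.unitaryGroup n ℂ) {k : ℕ} (hk : k < N) :
    (eigProj N ζ A k)ᴴ = eigProj N ζ A k := by
  have hN : N ≠ 0 := by omega
  have h0 : ζ ≠ 0 := hζ.ne_zero hN
  have hz : star ζ = ζ⁻¹ := by
    have h1 : ‖ζ‖ = 1 := hζ.norm'_eq_one hN
    rw [Complex.inv_def, Complex.normSq_eq_norm_sq, h1]; simp
  set P := eigProj N ζ A k with hP
  have h1 : Pᴴ * A = ζ ^ k • Pᴴ := by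
    have := congrArg Matrix.conjTranspose (mul_eigProj hζ hN hA k)
    rw [Matrix.conjTranspose_mul, Matrix.conjTranspose_smul, star_pow, hz, ← hP] at this
    have h2 := congrArg (fun X => ζ ^ k • (X * A)) this
    simp only [Matrix.mul_assoc, Matrix.smul_mul, smul_smul] at h2
    rw [ct_mul hU, Matrix.mul_one, ← mul_pow, mul_inv_cancel₀ h0, one_pow, one_smul] at h2
    exact h2.symm
  have h2 : ∀ j, Pᴴ * A ^ j = ζ ^ (j * k) • Pᴴ := fun j => by
    induction j with
    | zero => simp
    | succ j ih =>
      rw [pow_succ, ← Matrix.mul_assoc, ih, Matrix.smul_mul, h1, smul_smul, ← pow_add]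
      congr 2; ring
  have h3 : ∀ l ∈ Finset.range N, Pᴴ * eigProj N ζ A l = if l = k then Pᴴ else 0 := by
    intro l hl
    rw [eigProj, Matrix.mul_smul, Finset.mul_sum]
    simp only [Matrix.mul_smul, h2, smul_smul]
    rw [← Finset.sum_smul, sum_pow_root hζ (Finset.mem_range.1 hl) hk, smul_smul]
    split_ifs with h
    · rw [inv_mul_cancel₀ (by exact_mod_cast hN), one_smul]
    · simp
  have h4 : Pᴴ * P = Pᴴ := by rw [hP, h3 k (Finset.mem_range.2 hk), if_pos rfl]
  have h5 := congrArg Matrix.conjTranspose h4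
  rw [Matrix.conjTranspose_mul, Matrix.conjTranspose_conjTranspose, h4] at h5
  exact h5

/-- Factoring through the range shows that the trace of an idempotent is its rank. Traces of
eigenprojections are therefore natural numbers, and equal traces give isomorphic ranges. -/
theorem exists_factor_of_idempotent {P : Matrix n n ℂ} (hP : P * P = P) :
    ∃ (k : ℕ) (V : Matrix n (Fin k) ℂ) (W : Matrix (Fin k) n ℂ),
      P.trace = k ∧ W * V = 1 ∧ V * W = P := by
  set f := Matrix.toLin' P with hf
  have hff : ∀ x, f (f x) = f x := fun x => by
    rw [hf, ← LinearMap.comp_apply, ← Matrix.toLin'_mul, hP]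
  let b := Module.finBasis ℂ (LinearMap.range f)
  let e := b.equivFun
  let v : (Fin (Module.finrank ℂ (LinearMap.range f)) → ℂ) →ₗ[ℂ] (n → ℂ) :=
    (LinearMap.range f).subtype ∘ₗ e.symm.toLinearMap
  let w : (n → ℂ) →ₗ[ℂ] (Fin (Module.finrank ℂ (LinearMap.range f)) → ℂ) :=
    e.toLinearMap ∘ₗ f.rangeRestrict
  have hvw : v ∘ₗ w = f := by
    refine LinearMap.ext fun x => ?_
    simp [v, w]
  have hwv : w ∘ₗ v = LinearMap.id := by
    refine LinearMap.ext fun x => ?_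
    have : f.rangeRestrict (e.symm x : n → ℂ) = e.symm x := by
      refine Subtype.ext ?_
      obtain ⟨z, hz⟩ := (e.symm x).2
      rw [← hz]; exact hff _
    simp only [v, w, LinearMap.comp_apply, Submodule.subtype_apply, LinearEquiv.coe_coe, this,
      LinearEquiv.apply_symm_apply, LinearMap.id_apply]
  have h1 : LinearMap.toMatrix' v * LinearMap.toMatrix' w = P := by
    rw [← LinearMap.toMatrix'_comp, hvw, hf, LinearMap.toMatrix'_toLin']
  have h2 : LinearMap.toMatrix' w * LinearMap.toMatrix' v = 1 := by
    rw [← LinearMap.toMatrix'_comp, hwv, LinearMap.toMatrix'_id]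
  refine ⟨_, LinearMap.toMatrix' v, LinearMap.toMatrix' w, ?_, h2, h1⟩
  rw [← h1, Matrix.trace_mul_comm, h2, Matrix.trace_one, Fintype.card_fin]

theorem exists_factor_of_projection {P : Matrix n n ℂ} (hP : P * P = P) (hP' : Pᴴ = P) :
    ∃ (k : ℕ) (V : Matrix n (Fin k) ℂ), P.trace = k ∧ Vᴴ * V = 1 ∧ V * Vᴴ = P := by
  classical
  have hH : P.IsHermitian := hP'
  set W : Matrix n n ℂ := (hH.eigenvectorUnitary : Matrix n n ℂ) with hW
  have hWu : W ∈ Matrix.unitaryGroup n ℂ := hH.eigenvectorUnitary.2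
  set D : Matrix n n ℂ := Matrix.diagonal (fun i => (hH.eigenvalues i : ℂ)) with hD
  have hPD : P = W * D * Wᴴ := by
    have := hH.spectral_theorem
    rw [Unitary.conjStarAlgAut_apply] at this
    exact this
  have hDD : D * D = D := by
    have h1 : D = Wᴴ * P * W := by
      rw [hPD, Matrix.mul_assoc, Matrix.mul_assoc, Matrix.mul_assoc, ct_mul hWu, Matrix.mul_one,
        ← Matrix.mul_assoc, ct_mul hWu, Matrix.one_mul]
    rw [h1]
    calc Wᴴ * P * W * (Wᴴ * P * W) = Wᴴ * P * (W * Wᴴ) * P * W := by simp only [Matrix.mul_assoc]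
      _ = Wᴴ * P * W := by rw [mul_ct hWu, Matrix.mul_one, Matrix.mul_assoc Wᴴ, hP]
  have hl : ∀ i, hH.eigenvalues i = 0 ∨ hH.eigenvalues i = 1 := fun i => by
    have := congrFun (congrFun hDD i) i
    rw [hD, Matrix.diagonal_mul_diagonal, Matrix.diagonal_apply_eq, Matrix.diagonal_apply_eq] at this
    have h2 : hH.eigenvalues i * hH.eigenvalues i = hH.eigenvalues i := by exact_mod_cast this
    rcases mul_eq_zero.1 (show hH.eigenvalues i * (hH.eigenvalues i - 1) = 0 by linarith) with h | h
    · exact Or.inl h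
    · exact Or.inr (by linarith)
  let s := {i : n // hH.eigenvalues i = 1}
  let e : Fin (Fintype.card s) ≃ s := (Fintype.equivFin s).symm
  let V : Matrix n (Fin (Fintype.card s)) ℂ := W.submatrix id (fun k => (e k : n))
  have h1 : Vᴴ * V = 1 := by
    ext i j
    have := congrFun (congrFun (ct_mul hWu) (e i : n)) (e j : n)
    rw [Matrix.mul_apply] at this ⊢
    simp only [V, Matrix.conjTranspose_apply, Matrix.submatrix_apply, id_eq] at this ⊢
    rw [this, Matrix.one_apply, Matrix.one_apply]
    simp [Subtype.ext_iff.symm]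
  have h2 : V * Vᴴ = P := by
    ext i j
    have h3 : P i j = ∑ k, W i k * ((hH.eigenvalues k : ℂ) * star (W j k)) := by
      conv_lhs => rw [hPD, Matrix.mul_assoc, hD, Matrix.mul_apply]
      simp only [Matrix.diagonal_mul, Matrix.conjTranspose_apply]
    rw [h3, Matrix.mul_apply]
    simp only [Matrix.conjTranspose_apply, V, Matrix.submatrix_apply, id_eq]
    rw [e.sum_comp (fun k : s => W i k * star (W j k)),
      ← Finset.sum_filter_add_sum_filter_not Finset.univ (fun k => hH.eigenvalues k = 1)
        (fun k => W i k * ((hH.eigenvalues k : ℂ) * star (W j k))),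
      Finset.sum_eq_zero (s := Finset.univ.filter fun k => ¬ hH.eigenvalues k = 1), add_zero]
    · rw [Finset.sum_subtype (p := fun k => hH.eigenvalues k = 1) _ (by simp)]
      exact Finset.sum_congr rfl fun k _ => by rw [k.2]; simp
    · intro k hk
      rw [(hl k).resolve_right (Finset.mem_filter.1 hk).2]; simp
  have h3 : P.trace = (V * Vᴴ).trace := by rw [h2]
  exact ⟨_, V, by rw [h3, Matrix.trace_mul_comm, h1, Matrix.trace_one, Fintype.card_fin], h1, h2⟩

theorem eigProj_mul_self (hζ : IsPrimitiveRoot ζ N) (hN : N ≠ 0) (hA : A ^ N = 1) (k : ℕ) :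
    eigProj N ζ A k * A = ζ ^ k • eigProj N ζ A k := by
  rw [← mul_eigProj hζ hN hA]
  have : Commute (eigProj N ζ A k) A := by
    refine Commute.smul_left (Commute.sum_left _ _ _ fun j _ => Commute.smul_left ?_ _) _
    exact (Commute.refl A).pow_left j
  exact this

/-- Isomorphisms between corresponding eigenspaces add up to an intertwiner; mixed products contain
two different eigenprojections and vanish. Stated for pairs `x`, `y`, so that it serves both
similarity and, with `y = xᴴ`, unitary equivalence. -/
theorem sum_intertwine (hζ : IsPrimitiveRoot ζ N) (hN : N ≠ 0) (hA : A ^ N = 1) (hB : B ^ N = 1)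
    {x : ℕ → Matrix n' n ℂ} {y : ℕ → Matrix n n' ℂ}
    (h1 : ∀ k < N, y k * x k = eigProj N ζ A k) (h2 : ∀ k < N, x k * y k = eigProj N ζ B k)
    (h3 : ∀ k < N, x k * y k * x k = x k) (h4 : ∀ k < N, y k * x k * y k = y k) :
    (∑ k ∈ Finset.range N, y k) * (∑ k ∈ Finset.range N, x k) = 1 ∧
    (∑ k ∈ Finset.range N, x k) * (∑ k ∈ Finset.range N, y k) = 1 ∧
    (∑ k ∈ Finset.range N, x k) * A = B * (∑ k ∈ Finset.range N, x k) := by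
  refine ⟨?_, ?_, ?_⟩
  · rw [← sum_eigProj (A := A) hζ hN, Matrix.sum_mul]
    refine Finset.sum_congr rfl fun k hk => ?_
    rw [Finset.mem_range] at hk
    rw [Matrix.mul_sum, Finset.sum_eq_single_of_mem k (Finset.mem_range.2 hk), h1 k hk]
    intro l hl hlk
    rw [Finset.mem_range] at hl
    calc y k * x l = y k * x k * y k * (x l * y l * x l) := by rw [h4 k hk, h3 l hl]
      _ = y k * ((x k * y k) * (x l * y l)) * x l := by simp only [Matrix.mul_assoc]
      _ = 0 := by
        rw [h2 k hk, h2 l hl, eigProj_mul hζ hB hk hl, if_neg (Ne.symm hlk), Matrix.mul_zero,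
          Matrix.zero_mul]
  · rw [← sum_eigProj (A := B) hζ hN, Matrix.sum_mul]
    refine Finset.sum_congr rfl fun k hk => ?_
    rw [Finset.mem_range] at hk
    rw [Matrix.mul_sum, Finset.sum_eq_single_of_mem k (Finset.mem_range.2 hk), h2 k hk]
    intro l hl hlk
    rw [Finset.mem_range] at hl
    calc x k * y l = x k * y k * x k * (y l * x l * y l) := by rw [h3 k hk, h4 l hl]
      _ = x k * ((y k * x k) * (y l * x l)) * y l := by simp only [Matrix.mul_assoc]
      _ = 0 := by
        rw [h1 k hk, h1 l hl, eigProj_mul hζ hA hk hl, if_neg (Ne.symm hlk), Matrix.mul_zero,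
          Matrix.zero_mul]
  · rw [Matrix.sum_mul, Matrix.mul_sum]
    refine Finset.sum_congr rfl fun k hk => ?_
    rw [Finset.mem_range] at hk
    calc x k * A = x k * ((y k * x k) * A) := by
          conv_lhs => rw [← h3 k hk]
          simp only [Matrix.mul_assoc]
      _ = ζ ^ k • (x k * y k * x k) := by
          rw [h1 k hk, eigProj_mul_self hζ hN hA, Matrix.mul_smul, ← h1 k hk, Matrix.mul_assoc]
      _ = B * ((x k * y k) * x k) := by
          rw [h2 k hk, ← Matrix.mul_assoc, mul_eigProj hζ hN hB, Matrix.smul_mul]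
      _ = B * x k := by rw [h3 k hk]

/-- Matrices of order dividing `N` with equal traces of all powers are similar. -/
theorem exists_similarity (hN : N ≠ 0) (hA : A ^ N = 1) (hB : B ^ N = 1)
    (h : ∀ j, (A ^ j).trace = (B ^ j).trace) :
    ∃ (P : Matrix n n' ℂ) (Q : Matrix n' n ℂ), P * Q = 1 ∧ Q * P = 1 ∧ Q * A = B * Q := by
  have hζ := Complex.isPrimitiveRoot_exp N hN
  set ζ := Complex.exp (2 * Real.pi * Complex.I / N)
  have ht : ∀ k, (eigProj N ζ A k).trace = (eigProj N ζ B k).trace := fun k => by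
    simp only [trace_eigProj, h]
  have hx : ∀ k : ℕ, ∃ (x : Matrix n' n ℂ) (y : Matrix n n' ℂ), k < N →
      (y * x = eigProj N ζ A k ∧ x * y = eigProj N ζ B k) ∧ x * y * x = x ∧ y * x * y = y := by
    intro k
    by_cases hk : k < N
    · obtain ⟨a, V, W, h1, h2, h3⟩ := exists_factor_of_idempotent
        (show eigProj N ζ A k * eigProj N ζ A k = eigProj N ζ A k by
          rw [eigProj_mul hζ hA hk hk, if_pos rfl])
      obtain ⟨b, V', W', h1', h2', h3'⟩ := exists_factor_of_idempotent
        (show eigProj N ζ B k * eigProj N ζ B k = eigProj N ζ B k by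
          rw [eigProj_mul hζ hB hk hk, if_pos rfl])
      have hab : a = b := by
        have := ht k; rw [h1, h1'] at this; exact_mod_cast this
      subst hab
      have e1 : V * W' * (V' * W) = V * W := by
        rw [Matrix.mul_assoc, ← Matrix.mul_assoc W', h2', Matrix.one_mul]
      have e2 : V' * W * (V * W') = V' * W' := by
        rw [Matrix.mul_assoc, ← Matrix.mul_assoc W, h2, Matrix.one_mul]
      refine ⟨V' * W, V * W', fun _ => ⟨⟨by rw [e1, h3], by rw [e2, h3']⟩, ?_, ?_⟩⟩
      · rw [e2, Matrix.mul_assoc, ← Matrix.mul_assoc W', h2', Matrix.one_mul]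
      · rw [e1, Matrix.mul_assoc, ← Matrix.mul_assoc W, h2, Matrix.one_mul]
    · exact ⟨0, 0, fun h => absurd h hk⟩
  choose x y hx using hx
  obtain ⟨e1, e2, e3⟩ := sum_intertwine hζ hN hA hB (fun k hk => (hx k hk).1.1)
    (fun k hk => (hx k hk).1.2) (fun k hk => (hx k hk).2.1) (fun k hk => (hx k hk).2.2)
  exact ⟨_, _, e1, e2, e3⟩

theorem exists_partialIsometry {P Q : Matrix n n ℂ} (hP : P * P = P) (hP' : Pᴴ = P)
    (hQ : Q * Q = Q) (hQ' : Qᴴ = Q) (h : P.trace = Q.trace) :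
    ∃ x : Matrix n n ℂ, xᴴ * x = P ∧ x * xᴴ = Q ∧ x * P = x ∧ Q * x = x := by
  obtain ⟨a, V, h1, h2, h3⟩ := exists_factor_of_projection hP hP'
  obtain ⟨b, V', h1', h2', h3'⟩ := exists_factor_of_projection hQ hQ'
  have hab : a = b := by
    rw [h1, h1'] at h; exact_mod_cast h
  subst hab
  refine ⟨V' * Vᴴ, ?_, ?_, ?_, ?_⟩
  · rw [Matrix.conjTranspose_mul, Matrix.conjTranspose_conjTranspose, Matrix.mul_assoc,
      ← Matrix.mul_assoc V'ᴴ, h2', Matrix.one_mul, h3]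
  · rw [Matrix.conjTranspose_mul, Matrix.conjTranspose_conjTranspose, Matrix.mul_assoc,
      ← Matrix.mul_assoc Vᴴ, h2, Matrix.one_mul, h3']
  · rw [← h3, Matrix.mul_assoc, ← Matrix.mul_assoc Vᴴ, h2, Matrix.one_mul]
  · rw [← h3', Matrix.mul_assoc, ← Matrix.mul_assoc V'ᴴ, h2', Matrix.one_mul]

/-- Unitaries of order dividing `N` with equal traces of all powers are unitarily conjugate. -/
theorem exists_unitary_conj {A B : Matrix n n ℂ} (hN : N ≠ 0) (hA : A ^ N = 1) (hB : B ^ N = 1)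
    (uA : A ∈ Matrix.unitaryGroup n ℂ) (uB : B ∈ Matrix.unitaryGroup n ℂ)
    (h : ∀ j, (A ^ j).trace = (B ^ j).trace) :
    ∃ W ∈ Matrix.unitaryGroup n ℂ, W * A = B * W := by
  have hζ := Complex.isPrimitiveRoot_exp N hN
  set ζ := Complex.exp (2 * Real.pi * Complex.I / N)
  have ht : ∀ k, (eigProj N ζ A k).trace = (eigProj N ζ B k).trace := fun k => by
    simp only [trace_eigProj, h]
  have hx : ∀ k : ℕ, ∃ x : Matrix n n ℂ, k < N →
      xᴴ * x = eigProj N ζ A k ∧ x * xᴴ = eigProj N ζ B k ∧ x * eigProj N ζ A k = x ∧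
        eigProj N ζ B k * x = x := by
    intro k
    by_cases hk : k < N
    · obtain ⟨x, hx⟩ := exists_partialIsometry
        (by rw [eigProj_mul hζ hA hk hk, if_pos rfl]) (eigProj_isHermitian hζ hA uA hk)
        (by rw [eigProj_mul hζ hB hk hk, if_pos rfl]) (eigProj_isHermitian hζ hB uB hk) (ht k)
      exact ⟨x, fun _ => hx⟩
    · exact ⟨0, fun h => absurd h hk⟩
  choose x hx using hx
  obtain ⟨e1, e2, e3⟩ := sum_intertwine (y := fun k => (x k)ᴴ) hζ hN hA hB
    (fun k hk => (hx k hk).1) (fun k hk => (hx k hk).2.1)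
    (fun k hk => by rw [(hx k hk).2.1, (hx k hk).2.2.2])
    (fun k hk => by
      have := congrArg Matrix.conjTranspose (hx k hk).2.2.1
      rw [Matrix.conjTranspose_mul, eigProj_isHermitian hζ hA uA hk] at this
      rw [(hx k hk).1, this])
  refine ⟨_, ?_, e3⟩
  rw [Matrix.mem_unitaryGroup_iff', Matrix.star_eq_conjTranspose, Matrix.conjTranspose_sum]
  exact e1

open Polynomial in
/-- The traces of the powers of a matrix of order dividing `N` are the values at the `N`-th roots
of unity of a polynomial with integer coefficients. -/
theorem exists_trace_polynomial (hζ : IsPrimitiveRoot ζ N) (hN : N ≠ 0) (hA : A ^ N = 1) :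
    ∃ f : ℤ[X], ∀ j, (A ^ j).trace = aeval (ζ ^ j) f := by
  have hk : ∀ k : ℕ, ∃ a : ℕ, k < N → (eigProj N ζ A k).trace = a := by
    intro k
    by_cases hk : k < N
    · obtain ⟨a, _, _, h, _⟩ := exists_factor_of_idempotent
        (show eigProj N ζ A k * eigProj N ζ A k = eigProj N ζ A k by
          rw [eigProj_mul hζ hA hk hk, if_pos rfl])
      exact ⟨a, fun _ => h⟩
    · exact ⟨0, fun h => absurd h hk⟩
  choose a ha using hk
  refine ⟨∑ k ∈ Finset.range N, (a k : ℤ[X]) * X ^ k, fun j => ?_⟩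
  rw [pow_eq_sum_eigProj hζ hN hA, Matrix.trace_sum, map_sum]
  refine Finset.sum_congr rfl fun k hk => ?_
  rw [Matrix.trace_smul, ha k (Finset.mem_range.1 hk), map_mul, map_natCast, map_pow, aeval_X,
    smul_eq_mul, mul_comm, pow_mul]

/-- For prime `N`, the trace of a matrix of order dividing `N` determines the traces of its powers. -/
theorem trace_pow_eq_of_trace_eq (hN : N.Prime) (hA : A ^ N = 1) (hB : B ^ N = 1)
    (h0 : Fintype.card n = Fintype.card n') (h1 : A.trace = B.trace) (j : ℕ) :
    (A ^ j).trace = (B ^ j).trace := by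
  have hζ := Complex.isPrimitiveRoot_exp N hN.ne_zero
  set ζ := Complex.exp (2 * Real.pi * Complex.I / N)
  obtain ⟨f, hf⟩ := exists_trace_polynomial hζ hN.ne_zero hA
  obtain ⟨f', hf'⟩ := exists_trace_polynomial hζ hN.ne_zero hB
  by_cases hj : N ∣ j
  · obtain ⟨k, rfl⟩ := hj
    rw [pow_mul, hA, one_pow, pow_mul, hB, one_pow, Matrix.trace_one, Matrix.trace_one, h0]
  -- For `j` prime to `N`, both `ζ` and `ζ ^ j` have the cyclotomic polynomial as minimal
  -- polynomial, so an integer polynomial that vanishes at one vanishes at the other.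
  · have hζj : IsPrimitiveRoot (ζ ^ j) N :=
      hζ.pow_of_coprime j (((Nat.Prime.coprime_iff_not_dvd hN).2 hj).symm)
    have e1 : Polynomial.aeval ζ (f - f') = 0 := by
      rw [map_sub, sub_eq_zero]
      have e := hf 1; have e' := hf' 1
      rw [pow_one, pow_one] at e e'
      rw [← e, ← e', h1]
    have e2 : minpoly ℤ ζ ∣ f - f' :=
      minpoly.isIntegrallyClosed_dvd (hζ.isIntegral hN.pos) e1
    rw [← Polynomial.cyclotomic_eq_minpoly hζ hN.pos,
      Polynomial.cyclotomic_eq_minpoly hζj hN.pos] at e2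
    obtain ⟨p, hp⟩ := e2
    rw [hf, hf', ← sub_eq_zero, ← map_sub, hp, map_mul, minpoly.aeval, zero_mul]

/-- Numbers with equal `N`-th powers differ by an `N`-th root of unity `c`. Then `A` and `c • B`
have equal traces and order dividing `N`, and Galois conjugation carries this over to all powers.
When both traces vanish, `c = 1` will do. -/
theorem exists_trace_pow_eq (hN : N.Prime) (hA : A ^ N = 1) (hB : B ^ N = 1)
    (h0 : Fintype.card n = Fintype.card n') (h1 : A.trace ^ N = B.trace ^ N) :
    ∃ c : ℂ, c ^ N = 1 ∧ ∀ j, (A ^ j).trace = c ^ j * (B ^ j).trace := by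
  have key : ∀ c : ℂ, c ^ N = 1 → A.trace = c * B.trace →
      ∀ j, (A ^ j).trace = c ^ j * (B ^ j).trace := by
    intro c hc h j
    have hcB : (c • B) ^ N = 1 := by rw [smul_pow, hc, hB, one_smul]
    rw [trace_pow_eq_of_trace_eq hN hA hcB h0 (by rw [Matrix.trace_smul, smul_eq_mul, h]),
      smul_pow, Matrix.trace_smul, smul_eq_mul]
  by_cases hb : B.trace = 0
  · refine ⟨1, one_pow _, key 1 (one_pow _) ?_⟩
    rw [hb, zero_pow hN.ne_zero] at h1
    rw [hb, eq_zero_of_pow_eq_zero h1, mul_zero]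
  · refine ⟨A.trace / B.trace, ?_, key _ ?_ ?_⟩
    · rw [div_pow, h1, div_self (pow_ne_zero _ hb)]
    · rw [div_pow, h1, div_self (pow_ne_zero _ hb)]
    · rw [div_mul_cancel₀ _ hb]

end FiniteOrder

/-! ### Representations of cyclic groups -/

section CyclicReps

theorem pow_val_generator {N : ℕ} [NeZero N] {M : Type*} [Monoid M]
    (φ : Multiplicative (ZMod N) →* M) (g : Multiplicative (ZMod N)) :
    φ g = φ (Multiplicative.ofAdd 1) ^ (Multiplicative.toAdd g).val := by
  rw [← map_pow, ofAdd_one_pow_val]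

theorem orderOf_ofAdd_one {N : ℕ} [NeZero N] :
    orderOf (Multiplicative.ofAdd (1 : ZMod N)) = N := by
  rw [orderOf_ofAdd_eq_addOrderOf, ZMod.addOrderOf_one]

theorem map_generator_pow {N : ℕ} [NeZero N] {M : Type*} [Monoid M]
    (φ : Multiplicative (ZMod N) →* M) : φ (Multiplicative.ofAdd 1) ^ N = 1 := by
  rw [← map_pow, ofAdd_one_pow_card, map_one]

/-- The neutral element has order one and fixes the dimension, and the generator yields `c` and a
similarity of `ρ` with `c • ρ'`; then `u` sends the generator to `c`. Conversely, `u g ^ orderOf g =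
1`. -/
theorem sameCharacterPowers_iff {N : ℕ} (hN : N.Prime) {n n' : ℕ}
    (ρ : Multiplicative (ZMod N) →* Matrix (Fin n) (Fin n) ℂ)
    (ρ' : Multiplicative (ZMod N) →* Matrix (Fin n') (Fin n') ℂ) :
    SameCharacterPowers ρ ρ' ↔ DifferByCharacter ρ ρ' := by
  have : NeZero N := ⟨hN.ne_zero⟩
  constructor
  · intro h
    have h0 : n = n' := by
      have := h 1
      rw [orderOf_one, pow_one, pow_one, map_one, map_one, Matrix.trace_one, Matrix.trace_one] at this
      simpa using this
    have h1 := h (Multiplicative.ofAdd 1)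
    rw [orderOf_ofAdd_one] at h1
    set A := ρ (Multiplicative.ofAdd 1) with hA
    set B := ρ' (Multiplicative.ofAdd 1) with hB
    obtain ⟨c, hc, ht⟩ := exists_trace_pow_eq hN (map_generator_pow ρ) (map_generator_pow ρ')
      (by simpa using h0) h1
    have hcB : (c • B) ^ N = 1 := by rw [smul_pow, hc, hB, map_generator_pow, one_smul]
    obtain ⟨P, Q, e1, e2, e3⟩ := exists_similarity hN.ne_zero (map_generator_pow ρ) hcB
      (fun j => by rw [ht, smul_pow, Matrix.trace_smul, smul_eq_mul])
    have hc0 : c ≠ 0 := fun h => by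
      rw [h, zero_pow hN.ne_zero] at hc; exact zero_ne_one hc
    obtain ⟨φ, hφ⟩ := exists_hom_zmod (u := Units.mk0 c hc0) (N := N) (by ext; simpa using hc)
    refine ⟨(Units.coeHom ℂ).comp φ, P, Q, e1, e2, fun g => ?_⟩
    have hA' : A = P * (c • B) * Q := by
      rw [Matrix.mul_assoc, ← e3, ← Matrix.mul_assoc, e1, Matrix.one_mul]
    have hpow : ∀ k : ℕ, (P * (c • B) * Q) ^ k = P * (c • B) ^ k * Q := fun k => by
      induction k with
      | zero => rw [pow_zero, pow_zero, Matrix.mul_one, e1]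
      | succ k ih =>
        rw [pow_succ, ih, pow_succ]
        calc _ = P * (c • B) ^ k * (Q * P) * (c • B) * Q := by simp only [Matrix.mul_assoc]
          _ = _ := by rw [e2, Matrix.mul_one, Matrix.mul_assoc P]
    have hu : ((Units.coeHom ℂ).comp φ) g = c ^ (Multiplicative.toAdd g).val := by
      rw [pow_val_generator ((Units.coeHom ℂ).comp φ) g]
      simp [hφ]
    rw [pow_val_generator ρ g, pow_val_generator ρ' g, hu, ← hA, hA', hpow, smul_pow,
      Matrix.mul_smul, Matrix.smul_mul, ← hB]
  · rintro ⟨u, P, Q, e1, e2, h⟩ g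
    rw [h g, Matrix.trace_smul, Matrix.mul_assoc, Matrix.trace_mul_comm, Matrix.mul_assoc, e2,
      Matrix.mul_one, smul_eq_mul, mul_pow, ← map_pow, pow_orderOf_eq_one, map_one, one_mul]

/-- A diagonal unitary representation of the cyclic group of order `N`. -/
theorem exists_diagonal_hom {N n : ℕ} [NeZero N] {v : Fin n → ℂ} (hv : ∀ i, v i ^ N = 1) :
    ∃ φ : Multiplicative (ZMod N) →* Matrix.unitaryGroup (Fin n) ℂ,
      ∀ k : ℕ, (φ (Multiplicative.ofAdd 1 ^ k) : Matrix (Fin n) (Fin n) ℂ) =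
        Matrix.diagonal fun i => v i ^ k := by
  have h1 : ∀ i, v i * star (v i) = 1 := fun i => by
    have : ‖v i‖ = 1 := Complex.norm_eq_one_of_pow_eq_one (hv i) (NeZero.ne N)
    rw [Complex.star_def, Complex.mul_conj, Complex.normSq_eq_norm_sq, this]; simp
  have hu : Matrix.diagonal v ∈ Matrix.unitaryGroup (Fin n) ℂ := by
    rw [Matrix.mem_unitaryGroup_iff, Matrix.star_eq_conjTranspose, Matrix.diagonal_conjTranspose,
      Matrix.diagonal_mul_diagonal]
    simp only [Pi.star_apply, h1, Matrix.diagonal_one]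
  obtain ⟨φ, hφ⟩ := exists_hom_zmod (N := N) (u := (⟨Matrix.diagonal v, hu⟩ :
    Matrix.unitaryGroup (Fin n) ℂ)) (Subtype.ext (by
      change Matrix.diagonal v ^ N = 1
      rw [Matrix.diagonal_pow]
      have : v ^ N = 1 := funext hv
      rw [this]; exact Matrix.diagonal_one))
  refine ⟨φ, fun k => ?_⟩
  rw [map_pow, hφ]
  change Matrix.diagonal v ^ k = _
  rw [Matrix.diagonal_pow]; rfl

/-- The entries of the first of two representations of `ℤ/4` with equal refined characters. -/
def vecA : Fin 4 → ℂ := ![1, 1, -1, Complex.I]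

/-- The entries of the second of two representations of `ℤ/4` with equal refined characters. -/
def vecB : Fin 4 → ℂ := ![1, Complex.I, Complex.I, -Complex.I]

theorem vecA_pow (i : Fin 4) : vecA i ^ 4 = 1 := by
  fin_cases i <;> norm_num [vecA, Complex.I_pow_four]

theorem vecB_pow (i : Fin 4) : vecB i ^ 4 = 1 := by
  fin_cases i <;> norm_num [vecB, Complex.I_pow_four, neg_pow]

/-- The power sums of the two vectors differ only at exponent 2, where they are 2 and -2. The
corresponding group element has order two, so its character is squared and the sign is lost. -/
theorem sum_vecA : (∑ i, vecA i ^ 0 = 4) ∧ (∑ i, vecA i ^ 1 = 1 + Complex.I) ∧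
    (∑ i, vecA i ^ 2 = 2) ∧ (∑ i, vecA i ^ 3 = 1 - Complex.I) := by
  refine ⟨?_, ?_, ?_, ?_⟩ <;> simp [vecA, Fin.sum_univ_four, Complex.I_pow_three] <;> ring

theorem sum_vecB : (∑ i, vecB i ^ 0 = 4) ∧ (∑ i, vecB i ^ 1 = 1 + Complex.I) ∧
    (∑ i, vecB i ^ 2 = -2) ∧ (∑ i, vecB i ^ 3 = 1 - Complex.I) := by
  refine ⟨?_, ?_, ?_, ?_⟩ <;>
    simp [vecB, Fin.sum_univ_four, Complex.I_pow_three, neg_pow Complex.I 3] <;> ring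

theorem exists_repA : ∃ φ : Multiplicative (ZMod 4) →* Matrix.unitaryGroup (Fin 4) ℂ,
    ∀ k : ℕ, (φ (Multiplicative.ofAdd 1 ^ k) : Matrix (Fin 4) (Fin 4) ℂ) =
      Matrix.diagonal fun i => vecA i ^ k := exists_diagonal_hom vecA_pow

theorem exists_repB : ∃ φ : Multiplicative (ZMod 4) →* Matrix.unitaryGroup (Fin 4) ℂ,
    ∀ k : ℕ, (φ (Multiplicative.ofAdd 1 ^ k) : Matrix (Fin 4) (Fin 4) ℂ) =
      Matrix.diagonal fun i => vecB i ^ k := exists_diagonal_hom vecB_pow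

theorem one_add_I_ne_zero : (1 : ℂ) + Complex.I ≠ 0 := fun h => by
  have := congrArg Complex.re h; simp at this

theorem one_sub_I_ne_zero : (1 : ℂ) - Complex.I ≠ 0 := fun h => by
  have := congrArg Complex.re h; simp at this

theorem zmod_four_cases (g : Multiplicative (ZMod 4)) :
    ∃ k : ℕ, k < 4 ∧ g = Multiplicative.ofAdd 1 ^ k :=
  ⟨_, ZMod.val_lt _, (ofAdd_one_pow_val g).symm⟩

theorem orderOf_ofAdd_one_sq : orderOf ((Multiplicative.ofAdd (1 : ZMod 4)) ^ 2) = 2 := by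
  refine orderOf_eq_prime ?_ ?_
  · rw [← pow_mul]; exact ofAdd_one_pow_card
  · decide

theorem counterexample_reps : ∃ ρ ρ' : Multiplicative (ZMod 4) →* Matrix (Fin 4) (Fin 4) ℂ,
      ρ (Multiplicative.ofAdd 1) = Matrix.diagonal ![1, 1, -1, Complex.I] ∧
      ρ' (Multiplicative.ofAdd 1) = Matrix.diagonal ![1, Complex.I, Complex.I, -Complex.I] ∧
      (∀ g, (ρ g).trace ≠ 0) ∧ (∀ g, (ρ' g).trace ≠ 0) ∧
      SameCharacterPowers ρ ρ' ∧ ¬ DifferByCharacter ρ ρ' := by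
  obtain ⟨φ, hφ⟩ := exists_repA
  obtain ⟨φ', hφ'⟩ := exists_repB
  obtain ⟨a0, a1, a2, a3⟩ := sum_vecA
  obtain ⟨b0, b1, b2, b3⟩ := sum_vecB
  set ρ : Multiplicative (ZMod 4) →* Matrix (Fin 4) (Fin 4) ℂ :=
    (Matrix.unitaryGroup (Fin 4) ℂ).subtype.comp φ with hρ
  set ρ' : Multiplicative (ZMod 4) →* Matrix (Fin 4) (Fin 4) ℂ :=
    (Matrix.unitaryGroup (Fin 4) ℂ).subtype.comp φ' with hρ'
  have h : ∀ k : ℕ, ρ (Multiplicative.ofAdd 1 ^ k) = Matrix.diagonal fun i => vecA i ^ k := hφ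
  have h' : ∀ k : ℕ, ρ' (Multiplicative.ofAdd 1 ^ k) = Matrix.diagonal fun i => vecB i ^ k := hφ'
  have t : ∀ k : ℕ, (ρ (Multiplicative.ofAdd 1 ^ k)).trace = ∑ i, vecA i ^ k := fun k => by
    rw [h, Matrix.trace_diagonal]
  have t' : ∀ k : ℕ, (ρ' (Multiplicative.ofAdd 1 ^ k)).trace = ∑ i, vecB i ^ k := fun k => by
    rw [h', Matrix.trace_diagonal]
  refine ⟨ρ, ρ', ?_, ?_, fun g => ?_, fun g => ?_, fun g => ?_, ?_⟩
  · have := h 1; simp only [pow_one] at this; exact this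
  · have := h' 1; simp only [pow_one] at this; exact this
  · obtain ⟨k, hk, rfl⟩ := zmod_four_cases g
    rw [t]
    interval_cases k
    · rw [a0]; norm_num
    · rw [a1]; exact one_add_I_ne_zero
    · rw [a2]; norm_num
    · rw [a3]; exact one_sub_I_ne_zero
  · obtain ⟨k, hk, rfl⟩ := zmod_four_cases g
    rw [t']
    interval_cases k
    · rw [b0]; norm_num
    · rw [b1]; exact one_add_I_ne_zero
    · rw [b2]; norm_num
    · rw [b3]; exact one_sub_I_ne_zero
  · obtain ⟨k, hk, rfl⟩ := zmod_four_cases g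
    rw [t, t']
    interval_cases k
    · rw [a0, b0]
    · rw [a1, b1]
    · rw [a2, b2, orderOf_ofAdd_one_sq]; norm_num
    · rw [a3, b3]
  -- The generator has the nonzero character `1 + I` in both representations, which forces `u = 1`
  -- there and hence on its square, where 2 would have to equal -2.
  · rintro ⟨u, P, Q, e1, e2, hu⟩
    have htr : ∀ g, (ρ g).trace = u g * (ρ' g).trace := fun g => by
      rw [hu g, Matrix.trace_smul, Matrix.mul_assoc, Matrix.trace_mul_comm, Matrix.mul_assoc, e2,
        Matrix.mul_one, smul_eq_mul]
    have h1 := htr (Multiplicative.ofAdd 1 ^ 1)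
    rw [t, t', a1, b1, pow_one] at h1
    have hu1 : u (Multiplicative.ofAdd 1) = 1 :=
      mul_right_cancel₀ one_add_I_ne_zero (by rw [← h1, one_mul])
    have h2 := htr (Multiplicative.ofAdd 1 ^ 2)
    rw [t, t', a2, b2, map_pow, hu1] at h2
    norm_num at h2

end CyclicReps

/-! ### Shifts -/

section Shift
variable {ℓ : ℕ} [NeZero ℓ] {S T R : Type} [Fintype S] [DecidableEq S] [Fintype T] [DecidableEq T]
  [Fintype R] [DecidableEq R]

/-- Translation of configurations by one site. -/
def shiftConfig (ℓ : ℕ) (S : Type) : (ZMod ℓ → S) ≃ (ZMod ℓ → S) :=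
  Equiv.arrowCongr (Equiv.addRight (1 : ZMod ℓ)).symm (Equiv.refl S)

/-- Translation by one site. -/
def shiftOp (ℓ : ℕ) [NeZero ℓ] (S : Type) [Fintype S] [DecidableEq S] : Op (ZMod ℓ) S :=
  (1 : Op (ZMod ℓ) S).submatrix (shiftConfig ℓ S) id

theorem shiftOp_ct_mul (O : Op (ZMod ℓ) S) :
    (shiftOp ℓ S)ᴴ * O = O.submatrix (shiftConfig ℓ S).symm id := by
  rw [shiftOp, Matrix.conjTranspose_submatrix, Matrix.conjTranspose_one]
  ext f h
  rw [Matrix.mul_apply, Finset.sum_eq_single ((shiftConfig ℓ S).symm f)]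
  · rw [Matrix.submatrix_apply, Equiv.apply_symm_apply, id_eq, Matrix.one_apply_eq, one_mul]; rfl
  · intro g _ hg
    rw [Matrix.submatrix_apply, Matrix.one_apply_ne, zero_mul]
    intro h1
    exact hg (by rw [id_eq] at h1; rw [h1, Equiv.symm_apply_apply])
  · simp

theorem heis_shiftOp (O : Op (ZMod ℓ) S) :
    heis (shiftOp ℓ S) O = O.submatrix (shiftConfig ℓ S).symm (shiftConfig ℓ S).symm := by
  have h := shiftOp_ct_mul ((shiftOp ℓ S)ᴴ * O)ᴴ
  have h2 := congrArg Matrix.conjTranspose h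
  rw [Matrix.conjTranspose_mul, Matrix.conjTranspose_conjTranspose,
    Matrix.conjTranspose_conjTranspose, Matrix.conjTranspose_submatrix,
    Matrix.conjTranspose_conjTranspose, shiftOp_ct_mul] at h2
  rw [heis, shiftOp_ct_mul, h2]
  rfl

theorem shiftOp_mem : shiftOp ℓ S ∈ Matrix.unitaryGroup (ZMod ℓ → S) ℂ := by
  rw [Matrix.mem_unitaryGroup_iff', Matrix.star_eq_conjTranspose]
  have := heis_shiftOp (1 : Op (ZMod ℓ) S)
  rw [heis, Matrix.mul_one] at this
  rw [this]
  ext f h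
  simp [Matrix.one_apply]

theorem heis_shiftOp_prodOp (A : ZMod ℓ → Matrix S S ℂ) :
    heis (shiftOp ℓ S) (prodOp A) = prodOp fun i => A (i + 1) := by
  rw [heis_shiftOp]
  ext f h
  simp only [Matrix.submatrix_apply, prodOp, Matrix.of_apply]
  refine (Equiv.prod_comp (Equiv.addRight (1 : ZMod ℓ)) _).symm.trans ?_
  refine Finset.prod_congr rfl fun i _ => ?_
  simp [shiftConfig, Equiv.arrowCongr]

theorem heis_shiftOp_onSites (I : Finset (ZMod ℓ)) (M : Matrix S S ℂ) :
    heis (shiftOp ℓ S) (onSites I M) = onSites (I.image fun i => i - 1) M := by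
  rw [onSites, heis_shiftOp_prodOp, onSites]
  congr 1; funext i
  refine if_congr ?_ rfl rfl
  rw [Finset.mem_image]
  exact ⟨fun h => ⟨_, h, by ring⟩, by rintro ⟨a, ha, rfl⟩; simpa using ha⟩

theorem isLocal_shiftOp : IsLocal (near 1) (shiftOp ℓ S) := by
  refine ⟨shiftOp_mem, fun i j hij m m' => ?_⟩
  rw [siteOp, heis_shiftOp_onSites, Finset.image_singleton]
  refine (supportedOn_onSites _ _).commute ?_ (supportedOn_siteOp (Finset.mem_singleton_self j) m')
  rw [Finset.disjoint_singleton]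
  rintro rfl
  exact hij (near_iff.2 ⟨0, by omega, by push_cast; ring⟩)

theorem isSym_shiftOp {M : Matrix S S ℂ} (hM : M ∈ Matrix.unitaryGroup S ℂ) :
    IsSym 1 M (shiftOp ℓ S) := by
  refine ⟨isLocal_shiftOp, hM, ?_⟩
  have h := heis_shiftOp_onSites (ℓ := ℓ) Finset.univ M
  have h1 : (Finset.univ : Finset (ZMod ℓ)).image (fun i => i - 1) = Finset.univ :=
    Finset.image_univ_of_surjective fun i => ⟨i + 1, by ring⟩
  rw [h1, heis] at h
  change shiftOp ℓ S * _ = _ * shiftOp ℓ S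
  conv_lhs => rw [← h]
  rw [← Matrix.mul_assoc, ← Matrix.mul_assoc, mul_ct shiftOp_mem, Matrix.one_mul]

theorem endRatio_shiftOp [Nonempty S] {M : Matrix S S ℂ} {d : ℕ} (hℓ : 12 ≤ ℓ) :
    IsEndRatio 1 (shiftOp ℓ S) M d fun j => (mtr (M ^ j))⁻¹ := by
  -- At `y = 3` the symmetry of `[1, 3)` is shifted to `[0, 2)`, which misses the window `[2, 4)`.
  -- So the right end is 1, and only the normalization by one site is left.
  refine ⟨((3 : ℕ) : ZMod ℓ), 1, ⟨one_mem _, supportedOn_one _, ?_⟩, one_pow _,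
    fun j => by simp [ntr_one]⟩
  rw [Matrix.conjTranspose_one, Matrix.one_mul, heis_shiftOp_onSites]
  refine (supportedOn_onSites _ _).mono fun i hi => ?_
  have e1 : ((3 : ℕ) : ZMod ℓ) - ((1 : ℕ) : ZMod ℓ) = 0 + ((2 : ℕ) : ZMod ℓ) := by push_cast; ring
  have e2 : ((3 : ℕ) : ZMod ℓ) - ((2 * 1 : ℕ) : ZMod ℓ) = ((1 : ℕ) : ZMod ℓ) := by push_cast; ring
  rw [Finset.mem_compl, mem_arc_crd e1 (by omega)]
  rw [e2, Finset.mem_image] at hi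
  obtain ⟨a, ha, rfl⟩ := hi
  obtain ⟨k, hk, rfl⟩ := Finset.mem_image.1 ha
  rw [Finset.mem_range] at hk
  have e3 : ((1 : ℕ) : ZMod ℓ) + (k : ZMod ℓ) - 1 = 0 + (k : ZMod ℓ) := by push_cast; ring
  rw [e3, crd_add (by omega)]
  omega

/-- The shift of the first factor of every site. -/
def partialShift (ℓ : ℕ) [NeZero ℓ] (e : R ≃ S × T) : Op (ZMod ℓ) R := tens e (shiftOp ℓ S) 1

theorem isSym_partialShift (e : R ≃ S × T) {A : Matrix S S ℂ} {B : Matrix T T ℂ}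
    (hA : A ∈ Matrix.unitaryGroup S ℂ) (hB : B ∈ Matrix.unitaryGroup T ℂ) :
    IsSym 1 (stens e A B) (partialShift ℓ e) :=
  (isSym_shiftOp hA).tens (isSym_one hB)

theorem endRatio_partialShift [Nonempty S] [Nonempty T] (e : R ≃ S × T) {A : Matrix S S ℂ}
    {B : Matrix T T ℂ} {d : ℕ} (hA : A ∈ Matrix.unitaryGroup S ℂ)
    (hB : B ∈ Matrix.unitaryGroup T ℂ) (hℓ : 13 ≤ ℓ) (hAd : A ^ d = 1) (hBd : B ^ d = 1)
    (tA : ∀ j, mtr (A ^ j) ≠ 0) (tB : ∀ j, mtr (B ^ j) ≠ 0) :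
    IsEndRatio 1 (partialShift ℓ e) (stens e A B) d fun j => (mtr (A ^ j))⁻¹ := by
  have := (isSym_shiftOp (ℓ := ℓ) hA).endRatio_tens (e := e) (by omega) hAd tA
    (endRatio_shiftOp (d := d) (by omega)) (endRatio_one hB (by omega) hBd tB)
  simpa [partialShift] using this

/-- The spectator factor contributes a trivial end ratio, so one `σ` works for all `T`, `R` and `e`.
Shifts of factors with the same space `S` thus have the same GNVW index. -/
theorem exists_endRatio_dbl_partialShift [Nonempty S] (hℓ : 13 ≤ ℓ) :
    ∃ σ, ∀ (T R : Type) [Fintype T] [DecidableEq T] [Fintype R] [DecidableEq R] [Nonempty T]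
      (e : R ≃ S × T), IsEndRatio 1 (dbl (partialShift ℓ e)) (swapM R) 2 σ := by
  have hs := isSym_dbl (isLocal_shiftOp (ℓ := ℓ) (S := S))
  obtain ⟨σ, hσ⟩ := hs.exists_endRatio (by omega) two_pos swapM_sq
  refine ⟨σ, fun T R _ _ _ _ _ e => ?_⟩
  have := hs.endRatio_tens (e := (Equiv.prodCongr e e).trans (Equiv.prodProdProdComm S T S T))
    (by omega) swapM_sq mtr_swapM_pow_ne_zero hσ
    (endRatio_one (swapM_mem (S := T)) (by omega) swapM_sq mtr_swapM_pow_ne_zero)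
  rw [← swapM_stens, ← dbl_one, ← dbl_tens] at this
  simpa [partialShift] using this

theorem IsSymmetricQCA.of_isSym {G : Type} [Nonempty G] {ξ : ℕ} {μ : G → Matrix S S ℂ}
    {U : Op (ZMod ℓ) S} (h : ∀ g, IsSym ξ (μ g) U) : IsSymmetricQCA ξ μ U :=
  ⟨(h (Classical.arbitrary G)).loc.isQCA, fun g => by rw [← onSites_univ]; exact (h g).comm⟩

theorem exists_stens_hom {G : Type} [Group G] (e : R ≃ S × T) (φ : G →* Matrix.unitaryGroup S ℂ)
    (ψ : G →* Matrix.unitaryGroup T ℂ) : ∃ μ : G →* Matrix.unitaryGroup R ℂ,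
      ∀ g, (μ g : Matrix R R ℂ) = stens e (φ g) (ψ g) :=
  ⟨{ toFun := fun g => ⟨stens e (φ g) (ψ g), stens_mem (φ g).2 (ψ g).2⟩
     map_one' := Subtype.ext (by simp [stens_one])
     map_mul' := fun g h => Subtype.ext (by simp [stens_mul]) }, fun g => rfl⟩

theorem stens_comm (e : R ≃ S × T) (A : Matrix S S ℂ) (B : Matrix T T ℂ) :
    stens (e.trans (Equiv.prodComm S T)) B A = stens e A B := by
  ext p q
  simp [stens, mul_comm]

end Shift

/-- Each site carries the tensor product of the two representations of `counterexample_reps`; `U`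
shifts the first factor and `U'` the second. Their end ratios are the inverse normalized characters,
whose powers `orderOf g` agree. -/
theorem not_classified_order_four :
    ∃ (d ξ : ℕ) (μ : Multiplicative (ZMod 4) →* Matrix.unitaryGroup (Fin d) ℂ),
      (∀ g, (μ g : Matrix (Fin d) (Fin d) ℂ).trace ≠ 0) ∧
      ∀ D r : ℕ, ∃ ℓ₀ : ℕ, ∀ (ℓ : ℕ) [NeZero ℓ], ℓ₀ ≤ ℓ →
        ∃ (U U' : Op (ZMod ℓ) (Fin d)) (s : Multiplicative (ZMod 4) → ℂ),
          IsSymmetricQCA ξ (fun g => (μ g : Matrix (Fin d) (Fin d) ℂ)) U ∧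
          IsSymmetricQCA ξ (fun g => (μ g : Matrix (Fin d) (Fin d) ℂ)) U' ∧
          IsRefinedIndex ξ (fun g => (μ g : Matrix (Fin d) (Fin d) ℂ)) U s ∧
          IsRefinedIndex ξ (fun g => (μ g : Matrix (Fin d) (Fin d) ℂ)) U' s ∧
          ¬ StronglyEquivalent D r (fun g => (μ g : Matrix (Fin d) (Fin d) ℂ)) U U' := by
  obtain ⟨φ, hφ⟩ := exists_repA
  obtain ⟨ψ, hψ⟩ := exists_repB
  obtain ⟨a0, a1, a2, a3⟩ := sum_vecA
  obtain ⟨b0, b1, b2, b3⟩ := sum_vecB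
  have t : ∀ k : ℕ, (φ (Multiplicative.ofAdd 1 ^ k) : Matrix (Fin 4) (Fin 4) ℂ).trace =
      ∑ i, vecA i ^ k := fun k => by rw [hφ, Matrix.trace_diagonal]
  have t' : ∀ k : ℕ, (ψ (Multiplicative.ofAdd 1 ^ k) : Matrix (Fin 4) (Fin 4) ℂ).trace =
      ∑ i, vecB i ^ k := fun k => by rw [hψ, Matrix.trace_diagonal]
  have nA : ∀ g, (φ g : Matrix (Fin 4) (Fin 4) ℂ).trace ≠ 0 := fun g => by
    obtain ⟨k, hk, rfl⟩ := zmod_four_cases g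
    rw [t]
    interval_cases k
    · rw [a0]; norm_num
    · rw [a1]; exact one_add_I_ne_zero
    · rw [a2]; norm_num
    · rw [a3]; exact one_sub_I_ne_zero
  have nB : ∀ g, (ψ g : Matrix (Fin 4) (Fin 4) ℂ).trace ≠ 0 := fun g => by
    obtain ⟨k, hk, rfl⟩ := zmod_four_cases g
    rw [t']
    interval_cases k
    · rw [b0]; norm_num
    · rw [b1]; exact one_add_I_ne_zero
    · rw [b2]; norm_num
    · rw [b3]; exact one_sub_I_ne_zero
  have same : ∀ g, mtr (φ g : Matrix (Fin 4) (Fin 4) ℂ) ^ orderOf g =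
      mtr (ψ g : Matrix (Fin 4) (Fin 4) ℂ) ^ orderOf g := fun g => by
    rw [mtr, mtr, div_pow, div_pow]
    congr 1
    obtain ⟨k, hk, rfl⟩ := zmod_four_cases g
    rw [t, t']
    interval_cases k
    · rw [a0, b0]
    · rw [a1, b1]
    · rw [a2, b2, orderOf_ofAdd_one_sq]; norm_num
    · rw [a3, b3]
  -- `e` and `e'` are two readings of the same site, with the factors in either order, and
  -- `partialShift` always moves the first. This places both automata on one chain with one
  -- symmetry.
  let e : Fin 16 ≃ Fin 4 × Fin 4 := (finProdFinEquiv (m := 4) (n := 4)).symm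
  let e' : Fin 16 ≃ Fin 4 × Fin 4 := e.trans (Equiv.prodComm _ _)
  obtain ⟨μ, hμ⟩ := exists_stens_hom e φ ψ
  have hμ' : ∀ g, (μ g : Matrix (Fin 16) (Fin 16) ℂ) = stens e' (ψ g) (φ g) := fun g => by
    rw [hμ, stens_comm]
  have nμ : ∀ g, (μ g : Matrix (Fin 16) (Fin 16) ℂ).trace ≠ 0 := fun g => by
    rw [hμ, stens, trace_submatrix_equiv, Matrix.trace_kronecker]
    exact mul_ne_zero (nA g) (nB g)
  refine ⟨16, 1, μ, nμ, fun D r => ⟨20 * (1 + D * r) + 12 * r + 16, fun ℓ _ hℓ => ?_⟩⟩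
  have sU : ∀ g, IsSym 1 (μ g : Matrix (Fin 16) (Fin 16) ℂ) (partialShift ℓ e) := fun g => by
    rw [hμ]; exact isSym_partialShift e (φ g).2 (ψ g).2
  have sU' : ∀ g, IsSym 1 (μ g : Matrix (Fin 16) (Fin 16) ℂ) (partialShift ℓ e') := fun g => by
    rw [hμ']; exact isSym_partialShift e' (ψ g).2 (φ g).2
  have qU := IsSymmetricQCA.of_isSym sU
  have qU' := IsSymmetricQCA.of_isSym sU'
  have rU : ∀ (g : Multiplicative (ZMod 4)) (d : ℕ), g ^ d = 1 →
      IsEndRatio 1 (partialShift ℓ e) (μ g : Matrix (Fin 16) (Fin 16) ℂ) d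
      fun j => (mtr ((φ g : Matrix (Fin 4) (Fin 4) ℂ) ^ j))⁻¹ := fun g d hd => by
    rw [hμ]
    exact endRatio_partialShift e (φ g).2 (ψ g).2 (by omega) (by rw [coe_map_pow, hd, map_one]; rfl)
      (by rw [coe_map_pow, hd, map_one]; rfl) (mtr_map_pow_ne_zero nA g) (mtr_map_pow_ne_zero nB g)
  have rU' : ∀ (g : Multiplicative (ZMod 4)) (d : ℕ), g ^ d = 1 →
      IsEndRatio 1 (partialShift ℓ e') (μ g : Matrix (Fin 16) (Fin 16) ℂ) d
      fun j => (mtr ((ψ g : Matrix (Fin 4) (Fin 4) ℂ) ^ j))⁻¹ := fun g d hd => by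
    rw [hμ']
    exact endRatio_partialShift e' (ψ g).2 (φ g).2 (by omega) (by rw [coe_map_pow, hd, map_one]; rfl)
      (by rw [coe_map_pow, hd, map_one]; rfl) (mtr_map_pow_ne_zero nB g) (mtr_map_pow_ne_zero nA g)
  obtain ⟨σ, hσ⟩ := exists_endRatio_dbl_partialShift (ℓ := ℓ) (S := Fin 4) (by omega)
  obtain ⟨s, hs⟩ := exists_refinedIndex qU (by omega)
  obtain ⟨s', hs'⟩ := exists_refinedIndex qU' (by omega)
  have hss : s' = s := funext fun g => by
    rw [hs.eq qU (by omega) nμ (hσ _ _ e) g (rU g _ (pow_orderOf_eq_one g)),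
      hs'.eq qU' (by omega) nμ (hσ _ _ e') g (rU' g _ (pow_orderOf_eq_one g))]
    simp only [pow_one, inv_pow, same]
  refine ⟨_, _, s, qU, qU', hs, hss ▸ hs', fun h => ?_⟩
  set g : Multiplicative (ZMod 4) := Multiplicative.ofAdd 1 with hg
  have hg4 : g ^ 4 = 1 := ofAdd_one_pow_card
  obtain ⟨c, hc, h1⟩ := h.endRatio g (sU g) (sU' g) (by omega) (by norm_num : 0 < 4)
    (by rw [coe_map_pow, hg4, map_one]; rfl) (mtr_map_pow_ne_zero nμ g) (rU g 4 hg4) (rU' g 4 hg4)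
  have eA : ∀ k, mtr ((φ g : Matrix (Fin 4) (Fin 4) ℂ) ^ k) = (∑ i, vecA i ^ k) / 4 := fun k => by
    rw [coe_map_pow, mtr, t, Fintype.card_fin]; norm_num
  have eB : ∀ k, mtr ((ψ g : Matrix (Fin 4) (Fin 4) ℂ) ^ k) = (∑ i, vecB i ^ k) / 4 := fun k => by
    rw [coe_map_pow, mtr, t', Fintype.card_fin]; norm_num
  -- At the generator the power `j = 1` gives `c = 1`, and `j = 2` then contradicts the values 2 and
  -- -2 at its square.
  have v1 := h1 1
  have v2 := h1 2
  simp only [eA, eB] at v1 v2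
  rw [a1, b1, pow_one] at v1
  rw [a2, b2] at v2
  have hc1 : c = 1 := by
    refine mul_right_cancel₀ (inv_ne_zero (div_ne_zero one_add_I_ne_zero
      (by norm_num : (4 : ℂ) ≠ 0))) ?_
    rw [← v1, one_mul]
  rw [hc1] at v2
  norm_num at v2

/-! ### Matrix units in factors -/

section Factor
variable {n : Type} [Fintype n] [DecidableEq n]

/-- A nonzero element of minimal rank in an algebra of matrices generates a corner of dimension
one. -/
theorem exists_corner {A : StarSubalgebra ℂ (Matrix n n ℂ)} {h : Matrix n n ℂ} (hA : h ∈ A)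
    (h0 : h ≠ 0) (hmin : ∀ b ∈ A, b ≠ 0 → h.rank ≤ b.rank) {x : Matrix n n ℂ} (hx : x ∈ A) :
    ∃ c : ℂ, h * x * h = c • h := by
  set W := LinearMap.range h.mulVecLin with hW
  have hWn : Nontrivial W := by
    refine Submodule.nontrivial_iff_ne_bot.2 fun hb => h0 ?_
    rw [hW, LinearMap.range_eq_bot] at hb
    exact Matrix.mulVec_injective (by simpa [LinearMap.ext_iff, funext_iff] using hb)
  -- An eigenvector `w = h u` of `h * x` on the range of `h` is killed by `h * x - c`. Hence `h * x
  -- * h - c • h` annihilates `u` in addition to the kernel of `h`; its rank is smaller, and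
  -- minimality makes it zero.
  let g : W →ₗ[ℂ] W := ((h * x).mulVecLin.restrict (p := W) (q := W) (by
    intro w _
    exact ⟨x.mulVec w, by simp [Matrix.mulVec_mulVec]⟩))
  obtain ⟨c, hc⟩ := Module.End.exists_eigenvalue g
  obtain ⟨w, hw, hw0⟩ := hc.exists_hasEigenvector
  rw [Module.End.mem_eigenspace_iff] at hw
  obtain ⟨⟨w, u, hu⟩, rfl⟩ : ∃ w', w' = w := ⟨w, rfl⟩
  have hu' : h.mulVec u = w := hu
  have hw' : (h * x).mulVec w = c • w := congrArg Subtype.val hw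
  have hw0' : w ≠ 0 := fun h => hw0 (Subtype.ext h)
  refine ⟨c, ?_⟩
  by_contra hne
  have hb : h * x * h - c • h ≠ 0 := sub_ne_zero.2 hne
  have hrank := hmin _ (sub_mem (mul_mem (mul_mem hA hx) hA) (A.smul_mem hA c)) hb
  set b := h * x * h - c • h with hbdef
  have hlt : LinearMap.ker h.mulVecLin < LinearMap.ker b.mulVecLin := by
    refine lt_of_le_of_ne (fun v hv => ?_) fun heq => ?_
    · have hv' : h.mulVec v = 0 := hv
      change b.mulVec v = 0
      rw [hbdef, Matrix.sub_mulVec, ← Matrix.mulVec_mulVec, hv', Matrix.smul_mulVec, hv']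
      simp
    · have : u ∈ LinearMap.ker b.mulVecLin := by
        change b.mulVec u = 0
        rw [hbdef, Matrix.sub_mulVec, ← Matrix.mulVec_mulVec, hu', Matrix.smul_mulVec, hu', hw',
          sub_self]
      rw [← heq] at this
      exact hw0' (by rw [← hu']; exact this)
  have h1 := Submodule.finrank_lt_finrank_of_lt hlt
  have h2 := LinearMap.finrank_range_add_finrank_ker h.mulVecLin
  have h3 := LinearMap.finrank_range_add_finrank_ker b.mulVecLin
  rw [Matrix.rank, Matrix.rank] at hrank
  omega

open scoped ComplexOrder in
theorem eq_zero_of_conjTranspose_mul_self {x : Matrix n n ℂ} (h : xᴴ * x = 0) : x = 0 :=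
  Matrix.conjTranspose_mul_self_eq_zero.1 h

/-- For `a` of minimal rank, `h = aᴴ * a` is self-adjoint and still minimal, so `h * h` is a
multiple of `h`. The factor is real and nonzero, and rescaling gives a projection with a
one-dimensional corner. -/
theorem exists_minimal_projection [Nonempty n] (A : StarSubalgebra ℂ (Matrix n n ℂ)) :
    ∃ e ∈ A, e ≠ 0 ∧ eᴴ = e ∧ e * e = e ∧ ∀ x ∈ A, ∃ c : ℂ, e * x * e = c • e := by
  obtain ⟨a, ⟨haA, ha0⟩, hmin⟩ := (measure (Matrix.rank : Matrix n n ℂ → ℕ)).wf.has_min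
    {a | a ∈ A ∧ a ≠ 0} ⟨1, one_mem A, one_ne_zero⟩
  have hmin' : ∀ b ∈ A, b ≠ 0 → a.rank ≤ b.rank := fun b hb hb0 => not_lt.1 (hmin b ⟨hb, hb0⟩)
  set h := aᴴ * a with hh
  have hA : h ∈ A := mul_mem (star_mem haA) haA
  have h0 : h ≠ 0 := fun h0 => ha0 (eq_zero_of_conjTranspose_mul_self h0)
  have hH : hᴴ = h := by rw [hh, Matrix.conjTranspose_mul, Matrix.conjTranspose_conjTranspose]
  have hc := fun x hx => exists_corner hA h0 (fun b hb hb0 =>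
    (Matrix.rank_mul_le_right aᴴ a).trans (hmin' b hb hb0)) (x := x) hx
  obtain ⟨l, hl⟩ := hc 1 (one_mem A)
  rw [mul_one] at hl
  have hl0 : l ≠ 0 := by
    rintro rfl
    rw [zero_smul] at hl
    nth_rewrite 1 [← hH] at hl
    exact h0 (eq_zero_of_conjTranspose_mul_self hl)
  have hls : star l = l := by
    have := congrArg Matrix.conjTranspose hl
    rw [Matrix.conjTranspose_mul, Matrix.conjTranspose_smul, hH, hl] at this
    exact (smul_left_injective ℂ h0 this).symm
  refine ⟨l⁻¹ • h, A.smul_mem hA _, smul_ne_zero (inv_ne_zero hl0) h0, ?_, ?_, fun x hx => ?_⟩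
  · rw [Matrix.conjTranspose_smul, hH, star_inv₀, hls]
  · rw [Matrix.smul_mul, Matrix.mul_smul, hl, smul_smul l⁻¹ l, inv_mul_cancel₀ hl0, one_smul]
  · obtain ⟨c, hc⟩ := hc x hx
    refine ⟨l⁻¹ * c, ?_⟩
    rw [Matrix.smul_mul, Matrix.smul_mul, Matrix.mul_smul, hc, smul_smul, smul_smul, smul_smul]
    congr 1; ring

open scoped ComplexOrder in
theorem exists_smul_conjTranspose_mul_self {e x : Matrix n n ℂ} (he0 : e ≠ 0) (heH : eᴴ = e)
    (hee : e * e = e) (hx : x ≠ 0) {c : ℂ} (h : xᴴ * x = c • e) :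
    ∃ s : ℂ, (s • x)ᴴ * (s • x) = e := by
  have pos : ∀ y : Matrix n n ℂ, y ≠ 0 → 0 < (yᴴ * y).trace := fun y hy =>
    lt_of_le_of_ne (Matrix.posSemidef_conjTranspose_mul_self y).trace_nonneg
      fun h => hy (Matrix.trace_conjTranspose_mul_self_eq_zero_iff.1 h.symm)
  have h1 := pos x hx
  have h2 := pos e he0
  rw [heH, hee] at h2
  rw [h, Matrix.trace_smul, smul_eq_mul] at h1
  have hc : 0 < c := (pos_iff_pos_of_mul_pos h1).2 h2
  obtain ⟨t, ht, rfl⟩ : ∃ t : ℝ, 0 < t ∧ (t : ℂ) = c := by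
    rw [Complex.lt_def] at hc
    exact ⟨c.re, by simpa using hc.1, Complex.ext (by simp) (by simpa using hc.2)⟩
  refine ⟨((Real.sqrt t)⁻¹ : ℝ), ?_⟩
  rw [Matrix.conjTranspose_smul, Matrix.smul_mul, Matrix.mul_smul, h, smul_smul, smul_smul,
    Complex.star_def, Complex.conj_ofReal]
  have : (Real.sqrt t)⁻¹ * (Real.sqrt t)⁻¹ * t = 1 := by
    nth_rewrite 3 [← Real.mul_self_sqrt ht.le]
    have := (Real.sqrt_pos.2 ht).ne'
    field_simp
  rw [show (((Real.sqrt t)⁻¹ : ℝ) : ℂ) * (((Real.sqrt t)⁻¹ : ℝ) : ℂ) * (t : ℂ) = 1 by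
    exact_mod_cast this, one_smul]

/-- A star algebra of matrices with trivial center is spanned by a system of matrix units. -/
theorem exists_isMatrixUnits [Nonempty n] (A : StarSubalgebra ℂ (Matrix n n ℂ))
    (hc : ∀ z ∈ A, (∀ a ∈ A, Commute z a) → ∃ c : ℂ, z = c • 1) :
    ∃ (p : ℕ) (E : Fin p → Fin p → Matrix n n ℂ), IsMatrixUnits E ∧ (∀ i j, E i j ∈ A) ∧
      (∀ i j, (E i j)ᴴ = E j i) ∧
      ∀ a ∈ A, ∃ ρ : Matrix (Fin p) (Fin p) ℂ, a = ∑ i, ∑ j, ρ i j • E i j := by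
  classical
  obtain ⟨e, heA, he0, heH, hee, hcor⟩ := exists_minimal_projection A
  -- A maximal family of partial isometries with initial projection `e` and orthogonal ranges. Such
  -- families are linearly independent, so their size is bounded.
  let P : ℕ → Prop := fun p => ∃ f : Fin p → Matrix n n ℂ, (∀ i, f i ∈ A) ∧
    ∀ i j, (f i)ᴴ * f j = if i = j then e else 0
  have hP0 : P 0 := ⟨Fin.elim0, fun i => i.elim0, fun i => i.elim0⟩
  have hbound : ∀ p, P p → p ≤ Module.finrank ℂ (Matrix n n ℂ) := by
    rintro p ⟨f, -, hf⟩
    have hli : LinearIndependent ℂ f := by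
      refine Fintype.linearIndependent_iff.2 fun g hg i => ?_
      have := congrArg (fun y => (f i)ᴴ * y) hg
      simp only [Finset.mul_sum, Matrix.mul_smul, hf, mul_zero, smul_ite, smul_zero,
        Finset.sum_ite_eq, Finset.mem_univ, if_true] at this
      exact (smul_eq_zero.1 this).resolve_right he0
    simpa using hli.fintype_card_le_finrank
  set p := Nat.findGreatest P (Module.finrank ℂ (Matrix n n ℂ)) with hp
  have hPp : P p := Nat.findGreatest_spec (Nat.zero_le _) hP0
  have hPs : ¬ P (p + 1) := fun h =>
    Nat.findGreatest_is_greatest (Nat.lt_succ_self p) (hbound _ h) h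
  obtain ⟨f, hfA, hf⟩ := hPp
  have hfe : ∀ i, f i * e = f i := fun i => by
    have h1 : (f i * e - f i)ᴴ * (f i * e - f i) = 0 := by
      rw [Matrix.conjTranspose_sub, Matrix.conjTranspose_mul, heH, Matrix.sub_mul, Matrix.mul_sub,
        Matrix.mul_sub, Matrix.mul_assoc e, ← Matrix.mul_assoc (f i)ᴴ, Matrix.mul_assoc e, hf,
        if_pos rfl, hee, hee, sub_self]
    exact sub_eq_zero.1 (eq_zero_of_conjTranspose_mul_self h1)
  have hef : ∀ i, e * (f i)ᴴ = (f i)ᴴ := fun i => by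
    have := congrArg Matrix.conjTranspose (hfe i)
    rwa [Matrix.conjTranspose_mul, heH] at this
  set z := ∑ i, f i * (f i)ᴴ with hz
  have hzA : z ∈ A := sum_mem fun i _ => mul_mem (hfA i) (star_mem (hfA i))
  have hzH : zᴴ = z := by
    rw [hz, Matrix.conjTranspose_sum]
    exact Finset.sum_congr rfl fun i _ => by
      rw [Matrix.conjTranspose_mul, Matrix.conjTranspose_conjTranspose]
  have hfz : ∀ k, (f k)ᴴ * z = (f k)ᴴ := fun k => by
    simp only [hz, Finset.mul_sum, ← Matrix.mul_assoc, hf, ite_mul, zero_mul, Finset.sum_ite_eq,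
      Finset.mem_univ, if_true, hef]
  -- Otherwise the part of `r` outside `z` could be rescaled to one more member of the maximal
  -- family. It follows that `z` commutes with `A`, and the trivial center makes it 1.
  have hzr : ∀ r ∈ A, r * e = r → z * r = r := by
    intro r hr hre
    by_contra hne
    set x := r - z * r with hx
    have hx0 : x ≠ 0 := fun h => hne (sub_eq_zero.1 h).symm
    have hxA : x ∈ A := sub_mem hr (mul_mem hzA hr)
    have hxe : x * e = x := by rw [hx, Matrix.sub_mul, Matrix.mul_assoc, hre]
    have hfx : ∀ k, (f k)ᴴ * x = 0 := fun k => by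
      rw [hx, Matrix.mul_sub, ← Matrix.mul_assoc, hfz, sub_self]
    have hxf : ∀ k, xᴴ * f k = 0 := fun k => by
      have := congrArg Matrix.conjTranspose (hfx k)
      rwa [Matrix.conjTranspose_mul, Matrix.conjTranspose_conjTranspose,
        Matrix.conjTranspose_zero] at this
    obtain ⟨c, hc⟩ := hcor (xᴴ * x) (mul_mem (star_mem hxA) hxA)
    have hxx : xᴴ * x = c • e := by
      rw [← hc]
      have h1 : e * xᴴ = xᴴ := by
        have := congrArg Matrix.conjTranspose hxe
        rwa [Matrix.conjTranspose_mul, heH] at this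
      rw [← Matrix.mul_assoc, h1, Matrix.mul_assoc, hxe]
    obtain ⟨s, hs⟩ := exists_smul_conjTranspose_mul_self he0 heH hee hx0 hxx
    refine hPs ⟨Fin.cons (s • x) f, ?_, ?_⟩
    · refine Fin.cases ?_ fun i => ?_
      · exact A.smul_mem hxA s
      · exact hfA i
    · refine Fin.cases (Fin.cases ?_ fun j => ?_) fun i => Fin.cases ?_ fun j => ?_
      · simpa using hs
      · rw [Fin.cons_zero, Fin.cons_succ, Matrix.conjTranspose_smul, Matrix.smul_mul, hxf,
          smul_zero, if_neg (Fin.succ_ne_zero j).symm]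
      · rw [Fin.cons_zero, Fin.cons_succ, Matrix.mul_smul, hfx, smul_zero,
          if_neg (Fin.succ_ne_zero i)]
      · rw [Fin.cons_succ, Fin.cons_succ, hf]
        simp only [Fin.succ_inj]
  have hzrz : ∀ r ∈ A, z * r * z = r * z := by
    intro r hr
    conv_lhs => rw [hz, Finset.mul_sum]
    rw [hz, Finset.mul_sum]
    refine Finset.sum_congr rfl fun i _ => ?_
    rw [← Matrix.mul_assoc, ← Matrix.mul_assoc, Matrix.mul_assoc z r,
      hzr (r * f i) (mul_mem hr (hfA i)) (by rw [Matrix.mul_assoc, hfe])]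
  have hcomm : ∀ r ∈ A, Commute z r := by
    intro r hr
    have h1 := congrArg Matrix.conjTranspose (hzrz rᴴ (star_mem hr))
    rw [Matrix.conjTranspose_mul, Matrix.conjTranspose_mul, Matrix.conjTranspose_mul,
      Matrix.conjTranspose_conjTranspose, hzH, ← Matrix.mul_assoc, hzrz r hr] at h1
    exact h1.symm
  have hz1 : z = 1 := by
    obtain ⟨c, hcz⟩ := hc z hzA hcomm
    have h1 := hzr e heA hee
    rw [hcz, Matrix.smul_mul, Matrix.one_mul] at h1
    have h2 : c = 1 := smul_left_injective ℂ he0 (by simpa using h1)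
    rw [hcz, h2, one_smul]
  refine ⟨p, fun i j => f i * (f j)ᴴ, ⟨fun i j k l => ?_, hz1⟩,
    fun i j => mul_mem (hfA i) (star_mem (hfA j)), fun i j => ?_, fun a ha => ?_⟩
  · rw [Matrix.mul_assoc, ← Matrix.mul_assoc (f j)ᴴ, hf]
    split_ifs
    · rw [hef]
    · rw [Matrix.zero_mul, Matrix.mul_zero]
  · rw [Matrix.conjTranspose_mul, Matrix.conjTranspose_conjTranspose]
  · have hex : ∀ i j, ∃ c : ℂ, (f i)ᴴ * a * f j = c • e := fun i j => by
      obtain ⟨c, hc⟩ := hcor ((f i)ᴴ * a * f j) (mul_mem (mul_mem (star_mem (hfA i)) ha) (hfA j))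
      refine ⟨c, ?_⟩
      rw [← hc]
      simp only [Matrix.mul_assoc, hfe]
      rw [← Matrix.mul_assoc e, hef]
    choose ρ hρ using hex
    refine ⟨Matrix.of ρ, ?_⟩
    calc a = z * a * z := by rw [hz1, one_mul, mul_one]
      _ = ∑ i, ∑ j, f i * ((f i)ᴴ * a * f j) * (f j)ᴴ := by
        rw [hz, Finset.sum_mul, Finset.sum_mul]
        refine Finset.sum_congr rfl fun i _ => ?_
        rw [Finset.mul_sum]
        exact Finset.sum_congr rfl fun j _ => by simp only [Matrix.mul_assoc]
      _ = _ := by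
        refine Finset.sum_congr rfl fun i _ => Finset.sum_congr rfl fun j _ => ?_
        rw [hρ, Matrix.mul_smul, Matrix.smul_mul, hfe, Matrix.of_apply]

end Factor

/-! ### The algebra of an evolved region near its boundary -/

section Boundary
variable {ι S : Type} [Fintype ι] [DecidableEq ι] [Fintype S] [DecidableEq S]
  {N : ι → ι → Prop} {V : Op ι S} {K L R F : Finset ι}

/-- The part in `K` of the evolution of the algebra of the region `L`. -/
def boundaryAlg (hV : V ∈ Matrix.unitaryGroup (ι → S) ℂ) (K L : Finset ι) :
    StarSubalgebra ℂ (Op ι S) where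
  carrier := {O | SupportedOn K O ∧ SupportedOn L (heis Vᴴ O)}
  mul_mem' := fun ha hb => ⟨ha.1.mul hb.1, by
    rw [heis_mul (ct_mem hV)]; exact ha.2.mul hb.2⟩
  add_mem' := fun {a b} ha hb => ⟨ha.1.add hb.1, by
    have : heis Vᴴ (a + b) = heis Vᴴ a + heis Vᴴ b := by
      simp only [heis, Matrix.mul_add, Matrix.add_mul]
    rw [this]; exact ha.2.add hb.2⟩
  algebraMap_mem' := fun c => by
    rw [Algebra.algebraMap_eq_smul_one]
    refine ⟨(supportedOn_one _).smul c, ?_⟩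
    rw [heis_smul, heis_one (ct_mem hV)]
    exact (supportedOn_one _).smul c
  star_mem' := fun {a} ha => ⟨ha.1.conjTranspose, by
    have := ha.2.conjTranspose
    rw [heis_ct] at this; exact this⟩

theorem mem_boundaryAlg {hV : V ∈ Matrix.unitaryGroup (ι → S) ℂ} {O : Op ι S} :
    O ∈ boundaryAlg hV K L ↔ SupportedOn K O ∧ SupportedOn L (heis Vᴴ O) := Iff.rfl

/-- The geometry at the boundary between two regions `L` and `R`: the operators on `K` spread
to `L ∪ R`, those on `L` spread to `F ∪ K`, and those on `R` do not reach `F`. -/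
structure BoundaryGeometry (N : ι → ι → Prop) (K L R F : Finset ι) : Prop where
  symm : ∀ i j, N i j → N j i
  spread : ∀ k ∈ K, ∀ j, N k j → j ∈ L ∪ R
  disj : Disjoint L R
  disj' : Disjoint F K
  left : ∀ i ∈ L, ∀ j, N i j → j ∈ F ∪ K
  right : ∀ k ∈ R, ∀ j, N k j → j ∈ Fᶜ

theorem BoundaryGeometry.supportedOn_ct (hG : BoundaryGeometry N K L R F)
    (hV : IsLocal N V) {O : Op ι S} (hO : SupportedOn K O) :
    SupportedOn (L ∪ R) (heis Vᴴ O) :=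
  (hV.ct hG.symm).supportedOn hG.symm hG.spread hO

theorem BoundaryGeometry.supportedOn_left (hG : BoundaryGeometry N K L R F)
    (hV : IsLocal N V) {O : Op ι S} (hO : SupportedOn K O)
    (h : ∀ P, SupportedOn R P → Commute O (heis V P)) : SupportedOn L (heis Vᴴ O) := by
  refine (hG.supportedOn_ct hV hO).inter (Y := Rᶜ) (supportedOn_compl_of_commute fun P hP => ?_)
    fun i hi hi' => ?_
  · have := (commute_heis_iff hV.1).1 (h P hP).symm
    exact this.symm
  · rcases Finset.mem_union.1 hi with h | h
    · exact h
    · exact absurd h (Finset.mem_compl.1 hi')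

/-- An operator on `K` that commutes with the evolved algebra of `L` belongs to that of `R`. -/
theorem BoundaryGeometry.supportedOn_right (hG : BoundaryGeometry N K L R F)
    (hV : IsLocal N V) {O : Op ι S} (hO : SupportedOn K O)
    (h : ∀ a ∈ boundaryAlg hV.1 K L, Commute O a) : SupportedOn R (heis Vᴴ O) := by
  refine (hG.supportedOn_ct hV hO).inter (Y := Lᶜ) (supportedOn_iff.2 fun i hi m => ?_)
    fun i hi hi' => ?_
  · have hi : i ∈ L := by simpa using hi
    have hm : SupportedOn L (siteOp i m) := supportedOn_siteOp hi m
    set B := heis V (siteOp i m) with hB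
    have hBs : SupportedOn (F ∪ K) B := hV.supportedOn hG.symm hG.left hm
    suffices hc : Commute O B by
      have := (commute_heis_iff hV.1).1 hc.symm
      exact this.symm
    -- Evolving an operator on `L` may also reach `F`, beyond `K`. The coefficients over the matrix
    -- units of `F` live on `K` and still commute with the evolved operators on `R`, so they lie in
    -- `boundaryAlg`, with which `O` commutes.
    rw [← (isMatrixUnits_unitOp (S := S) F).sum_slice B]
    refine Commute.sum_right _ _ _ fun p _ => Commute.sum_right _ _ _ fun q _ =>
      Commute.mul_right (h _ ?_) (hO.commute hG.disj'.symm (supportedOn_unitOp F p q))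
    have hsK : SupportedOn K (slice (unitOp F) B p q) := by
      refine SupportedOn.inter (Y := F ∪ K) (supportedOn_slice B p q) ?_ fun j hj hj' => ?_
      · refine SupportedOn.sum _ fun r _ => ?_
        exact (((supportedOn_unitOp F _ _).mono Finset.subset_union_left).mul hBs).mul
          ((supportedOn_unitOp F _ _).mono Finset.subset_union_left)
      · exact (Finset.mem_union.1 hj').resolve_left (Finset.mem_compl.1 hj)
    refine mem_boundaryAlg.2 ⟨hsK, hG.supportedOn_left hV hsK fun P hP => ?_⟩
    have hPF : SupportedOn Fᶜ (heis V P) := hV.supportedOn hG.symm hG.right hP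
    have hcm : ∀ a b, Commute (heis V P) (unitOp F a b) := fun a b =>
      hPF.commute_compl (supportedOn_unitOp F a b)
    exact slice_semiconj hcm hcm (heis_commute hV.1 (hm.commute hG.disj hP)) p q
  · rcases Finset.mem_union.1 hi with h | h
    · exact absurd h (Finset.mem_compl.1 hi')
    · exact h

theorem BoundaryGeometry.commute_of_supportedOn (hG : BoundaryGeometry N K L R F)
    (hV : IsLocal N V) {O a : Op ι S} (hO : SupportedOn R (heis Vᴴ O))
    (ha : a ∈ boundaryAlg hV.1 K L) : Commute O a := by
  have := heis_commute hV.1 ((mem_boundaryAlg.1 ha).2.commute hG.disj hO)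
  rw [heis_heis_ct hV.1, heis_heis_ct hV.1] at this
  exact this.symm

/-- By `supportedOn_right` a central element comes from `R` as well as from `L`, and these are
disjoint. The boundary algebra is therefore a factor. -/
theorem BoundaryGeometry.exists_smul_of_central (hG : BoundaryGeometry N K L R F)
    (hV : IsLocal N V) {z : Op ι S} (hz : z ∈ boundaryAlg hV.1 K L)
    (h : ∀ a ∈ boundaryAlg hV.1 K L, Commute z a) : ∃ c : ℂ, z = c • 1 := by
  obtain ⟨c, hc⟩ := SupportedOn.exists_smul_of_disjoint hG.disj (mem_boundaryAlg.1 hz).2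
    (hG.supportedOn_right hV (mem_boundaryAlg.1 hz).1 h)
  refine ⟨c, ?_⟩
  rw [← heis_heis_ct hV.1 z, hc, heis_smul, heis_one hV.1]

/-- The end is the evolved symmetry of `L`, which commutes with all that evolves from `R`, times an
operator on `F`, which `R` does not reach. So nothing in it comes from `R`. -/
theorem BoundaryGeometry.end_mem (hG : BoundaryGeometry N K L R F)
    (hV : IsLocal N V) {M : Matrix S S ℂ} {T : Op ι S} (hT : IsEnd V M K L T)
    (hM : M ∈ Matrix.unitaryGroup S ℂ) : T ∈ boundaryAlg hV.1 K L := by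
  refine mem_boundaryAlg.2 ⟨hT.2.1, hG.supportedOn_left hV hT.2.1 fun P hP => ?_⟩
  set X := heis V (onSites L M) with hX
  have hXu : X ∈ Matrix.unitaryGroup (ι → S) ℂ := heis_mem hV.1 (onSites_mem hM L)
  have hXs : SupportedOn (F ∪ K) X :=
    hV.supportedOn hG.symm hG.left (supportedOn_onSites L M)
  have hY : SupportedOn F (Tᴴ * X) := by
    refine hT.2.2.inter (Y := F ∪ K)
      ((hT.2.1.conjTranspose.mono Finset.subset_union_right).mul hXs) fun j hj hj' => ?_
    exact (Finset.mem_union.1 hj').resolve_right (Finset.mem_compl.1 hj)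
  have hTX : T = X * (Tᴴ * X)ᴴ := by
    rw [Matrix.conjTranspose_mul, Matrix.conjTranspose_conjTranspose, ← Matrix.mul_assoc,
      mul_ct hXu, Matrix.one_mul]
  have hPF : SupportedOn Fᶜ (heis V P) := hV.supportedOn hG.symm hG.right hP
  rw [hTX]
  refine Commute.mul_left (heis_commute hV.1 ?_) (hPF.commute_compl hY.conjTranspose).symm
  exact (supportedOn_onSites L M).commute hG.disj hP

/-- The end of the evolved symmetry implements the symmetry on the evolved algebra of `L`. -/
theorem BoundaryGeometry.commute_end_ct_mul (hG : BoundaryGeometry N K L R F)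
    (hV : IsLocal N V) {M : Matrix S S ℂ} {T a : Op ι S}
    (hT : IsEnd V M K L T) (hM : M ∈ Matrix.unitaryGroup S ℂ)
    (hVM : Commute V (onSites Finset.univ M)) (ha : a ∈ boundaryAlg hV.1 K L) :
    Commute (Tᴴ * onSites K M) a := by
  obtain ⟨h1, h2⟩ := mem_boundaryAlg.1 ha
  have e1 := hT.conj hV.1 hM h1
  have e2 : heis V (onSites L M) * a * (heis V (onSites L M))ᴴ =
      onSites Finset.univ M * a * (onSites Finset.univ M)ᴴ := by
    have h3 := congrArg (heis V) (h2.conj_onSites hM (J := L) (J' := Finset.univ) (by simp))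
    rw [heis_mul hV.1, heis_mul hV.1, heis_mul hV.1, heis_mul hV.1, heis_heis_ct hV.1,
      ← heis_ct, ← heis_ct, heis_of_commute hV.1 hVM] at h3
    exact h3
  rw [e2, ← h1.conj_onSites hM (J := K) (J' := Finset.univ) (by simp)] at e1
  set Q := onSites K M with hQ
  have hQu : Q ∈ Matrix.unitaryGroup (ι → S) ℂ := onSites_mem hM K
  have e3 : Tᴴ * (T * a * Tᴴ) * Q = Tᴴ * (Q * a * Qᴴ) * Q := by rw [e1]
  have e4 : Tᴴ * (T * a * Tᴴ) * Q = a * (Tᴴ * Q) := by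
    rw [Matrix.mul_assoc T, ← Matrix.mul_assoc Tᴴ, ct_mul hT.1, Matrix.one_mul, Matrix.mul_assoc]
  have e5 : Tᴴ * (Q * a * Qᴴ) * Q = Tᴴ * Q * a := by
    simp only [Matrix.mul_assoc, ct_mul hQu, Matrix.mul_one]
  rw [e4, e5] at e3
  exact e3.symm

theorem onSites_swap_tens {I : Finset ι} {O P : Op ι S} (hO : SupportedOn I O)
    (hP : SupportedOn I P) : onSites I (swapM S) * tens (Equiv.refl _) O P =
      tens (Equiv.refl _) P O * onSites I (swapM S) := by
  have h1 : onSites I (swapM S) * onSites Iᶜ (swapM S) = onSites Finset.univ (swapM S) :=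
    onSites_union _ disjoint_compl_right (by intro i; simp [em])
  have h2 : ∀ A B : Op ι S, onSites Finset.univ (swapM S) * tens (Equiv.refl _) A B =
      tens (Equiv.refl _) B A * onSites Finset.univ (swapM S) := by
    intro A B
    ext f h
    rw [Matrix.mul_apply, Matrix.mul_apply, Finset.sum_eq_single fun i => (f i).swap,
      Finset.sum_eq_single fun i => (h i).swap]
    · simp [onSites_swapM_apply, tens_apply, mul_comm]
    · intro g _ hg
      rw [onSites_swapM_apply, if_neg, mul_zero]
      simpa using hg
    · simp
    · intro g _ hg
      rw [onSites_swapM_apply, if_neg, zero_mul]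
      intro h; exact hg (by rw [h]; simp)
    · simp
  have h3 : Commute (onSites Iᶜ (swapM S)) (tens (Equiv.refl _) O P) :=
    (supportedOn_onSites _ _).commute_compl (hO.tens hP)
  have h4 : onSites Iᶜ (swapM S) * onSites Iᶜ (swapM S) = (1 : Op ι (S × S)) := by
    rw [onSites_mul, swapM_mul_self, onSites_one]
  have h5 := h2 O P
  rw [← h1, Matrix.mul_assoc, h3.eq] at h5
  calc onSites I (swapM S) * tens (Equiv.refl _) O P
      = onSites I (swapM S) * (tens (Equiv.refl _) O P * onSites Iᶜ (swapM S)) *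
        onSites Iᶜ (swapM S) := by
        rw [Matrix.mul_assoc, Matrix.mul_assoc, h4, Matrix.mul_one]
    _ = _ := by rw [h5]; simp only [Matrix.mul_assoc, h4, Matrix.mul_one]

end Boundary

/-! ### The exchange of two copies of a matrix algebra -/

section UnitsTrace
variable {ι S κ : Type} [Fintype ι] [DecidableEq ι] [Fintype S] [DecidableEq S] [Fintype κ]
  [DecidableEq κ] {E : κ → κ → Op ι S}

theorem IsMatrixUnits.ntr_off (hE : IsMatrixUnits E) {a b : κ} (h : a ≠ b) : ntr (E a b) = 0 := by
  have h1 : E a b = E a b * E b b := by rw [hE.1, if_pos rfl]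
  rw [h1, ntr_mul_comm, hE.1, if_neg h.symm, ntr, Matrix.trace_zero, zero_div]

theorem IsMatrixUnits.ntr_diag [Nonempty S] (hE : IsMatrixUnits E) (a : κ) :
    (Fintype.card κ : ℂ) * ntr (E a a) = 1 := by
  have h1 : ∀ b, ntr (E b b) = ntr (E a a) := fun b => by
    have e1 : E b b = E b a * E a b := by rw [hE.1, if_pos rfl]
    rw [e1, ntr_mul_comm, hE.1, if_pos rfl]
  have h2 := ntr_one (ι := ι) (S := S)
  rw [← hE.2, ntr_sum, Finset.sum_congr rfl fun b _ => h1 b, Finset.sum_const, Finset.card_univ,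
    nsmul_eq_mul] at h2
  exact h2

/-- The exchange of two copies of a matrix algebra. -/
def swapUnits (E : κ → κ → Op ι S) : Op ι (S × S) :=
  ∑ i, ∑ j, tens (Equiv.refl _) (E i j) (E j i)

theorem tens_sum_left {α : Type} (s : Finset α) (A : α → Op ι S) (B : Op ι S) :
    tens (Equiv.refl (S × S)) (∑ a ∈ s, A a) B = ∑ a ∈ s, tens (Equiv.refl _) (A a) B := by
  ext f h
  simp only [tens_apply, Matrix.sum_apply, Finset.sum_mul]

theorem tens_sum_right {α : Type} (s : Finset α) (A : Op ι S) (B : α → Op ι S) :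
    tens (Equiv.refl (S × S)) A (∑ a ∈ s, B a) = ∑ a ∈ s, tens (Equiv.refl _) A (B a) := by
  ext f h
  simp only [tens_apply, Matrix.sum_apply, Finset.mul_sum]

theorem swapUnits_mul_left (hE : IsMatrixUnits E) (k l : κ) :
    swapUnits E * tens (Equiv.refl _) (E k l) 1 = tens (Equiv.refl _) 1 (E k l) * swapUnits E := by
  have z1 : ∀ B : Op ι S, tens (Equiv.refl (S × S)) 0 B = 0 := fun B => by
    ext f h; simp [tens_apply]
  have z2 : ∀ B : Op ι S, tens (Equiv.refl (S × S)) B 0 = 0 := fun B => by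
    ext f h; simp [tens_apply]
  have h1 : swapUnits E * tens (Equiv.refl _) (E k l) 1 =
      ∑ i, tens (Equiv.refl _) (E i l) (E k i) := by
    rw [swapUnits, Finset.sum_mul]
    refine Finset.sum_congr rfl fun i _ => ?_
    rw [Finset.sum_mul, Finset.sum_eq_single k]
    · rw [tens_mul, hE.1, if_pos rfl, mul_one]
    · intro j _ hj
      rw [tens_mul, hE.1, if_neg hj, z1]
    · simp
  have h2 : tens (Equiv.refl _) 1 (E k l) * swapUnits E =
      ∑ i, tens (Equiv.refl _) (E i l) (E k i) := by
    rw [swapUnits, Finset.mul_sum]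
    refine Finset.sum_congr rfl fun i _ => ?_
    rw [Finset.mul_sum, Finset.sum_eq_single l]
    · rw [tens_mul, hE.1, if_pos rfl, one_mul]
    · intro j _ hj
      rw [tens_mul, hE.1, if_neg (Ne.symm hj), z2]
    · simp
  rw [h1, h2]

theorem swapUnits_mul_right (hE : IsMatrixUnits E) (k l : κ) :
    swapUnits E * tens (Equiv.refl _) 1 (E k l) = tens (Equiv.refl _) (E k l) 1 * swapUnits E := by
  have z1 : ∀ B : Op ι S, tens (Equiv.refl (S × S)) 0 B = 0 := fun B => by
    ext f h; simp [tens_apply]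
  have z2 : ∀ B : Op ι S, tens (Equiv.refl (S × S)) B 0 = 0 := fun B => by
    ext f h; simp [tens_apply]
  have h1 : swapUnits E * tens (Equiv.refl _) 1 (E k l) =
      ∑ j, tens (Equiv.refl _) (E k j) (E j l) := by
    rw [swapUnits, Finset.sum_mul, Finset.sum_eq_single k]
    · rw [Finset.sum_mul]
      exact Finset.sum_congr rfl fun j _ => by rw [tens_mul, hE.1, if_pos rfl, mul_one]
    · intro i _ hi
      rw [Finset.sum_mul]
      exact Finset.sum_eq_zero fun j _ => by rw [tens_mul, hE.1, if_neg hi, z2]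
    · simp
  have h2 : tens (Equiv.refl _) (E k l) 1 * swapUnits E =
      ∑ j, tens (Equiv.refl _) (E k j) (E j l) := by
    rw [swapUnits, Finset.mul_sum, Finset.sum_eq_single l]
    · rw [Finset.mul_sum]
      exact Finset.sum_congr rfl fun j _ => by rw [tens_mul, hE.1, if_pos rfl, one_mul]
    · intro i _ hi
      rw [Finset.mul_sum]
      exact Finset.sum_eq_zero fun j _ => by rw [tens_mul, hE.1, if_neg (Ne.symm hi), z1]
    · simp
  rw [h1, h2]

theorem swapUnits_ct (hs : ∀ i j, (E i j)ᴴ = E j i) : (swapUnits E)ᴴ = swapUnits E := by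
  rw [swapUnits, Matrix.conjTranspose_sum, Finset.sum_comm]
  simp only [Matrix.conjTranspose_sum, tens_ct, hs]

theorem swapUnits_mul_self (hE : IsMatrixUnits E) : swapUnits E * swapUnits E = 1 := by
  have z1 : ∀ B : Op ι S, tens (Equiv.refl (S × S)) 0 B = 0 := fun B => by
    ext f h; simp [tens_apply]
  have z2 : ∀ B : Op ι S, tens (Equiv.refl (S × S)) B 0 = 0 := fun B => by
    ext f h; simp [tens_apply]
  have h1 : ∀ k l, swapUnits E * tens (Equiv.refl _) (E k l) (E l k) =
      tens (Equiv.refl _) (E l l) (E k k) := by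
    intro k l
    rw [swapUnits, Finset.sum_mul, Finset.sum_eq_single l]
    · rw [Finset.sum_mul, Finset.sum_eq_single k]
      · rw [tens_mul, hE.1, hE.1, if_pos rfl, if_pos rfl]
      · intro j _ hj
        rw [tens_mul, hE.1, if_neg hj, z1]
      · simp
    · intro i _ hi
      rw [Finset.sum_mul]
      exact Finset.sum_eq_zero fun j _ => by rw [tens_mul, hE.1 j i, if_neg hi, z2]
    · simp
  have h2 : swapUnits E * swapUnits E = ∑ k, ∑ l, tens (Equiv.refl _) (E l l) (E k k) := by
    nth_rewrite 2 [swapUnits]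
    rw [Finset.mul_sum]
    refine Finset.sum_congr rfl fun k _ => ?_
    rw [Finset.mul_sum]
    exact Finset.sum_congr rfl fun l _ => h1 k l
  rw [h2]
  simp only [← tens_sum_left, ← tens_sum_right, hE.2, tens_one]

/-- Only diagonal pairs contribute, each with the square of the common trace of the diagonal units.
The trace of the exchange thus measures the size of the algebra. -/
theorem ntr_swapUnits [Nonempty S] (hE : IsMatrixUnits E) :
    (Fintype.card κ : ℂ) * ntr (swapUnits E) = 1 := by
  have h : ntr (swapUnits E) = ∑ i, ntr (E i i) * ntr (E i i) := by
    rw [swapUnits, ntr_sum]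
    refine Finset.sum_congr rfl fun i _ => ?_
    rw [ntr_sum, Finset.sum_eq_single i]
    · rw [ntr_tens]
    · intro j _ hj
      rw [ntr_tens, hE.ntr_off hj, mul_zero]
    · simp
  rw [h, Finset.mul_sum]
  simp only [← mul_assoc, hE.ntr_diag, one_mul]
  rw [← ntr_sum, hE.2, ntr_one]

end UnitsTrace

/-! ### Comparing matrix algebras and their ends -/

section Straighten
variable {ι S : Type} [Fintype ι] [DecidableEq ι] [Fintype S] [DecidableEq S]
  {N : ι → ι → Prop} {V : Op ι S} {K L R F : Finset ι}

theorem commute_tens_of_units {κ : Type} [Fintype κ] [DecidableEq κ] {E : κ → κ → Op ι S}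
    (hE : IsMatrixUnits E) (g : Op ι S → Op ι (S × S)) {Q : Op ι (S × S)} {A : Op ι S}
    (hg : ∀ a b, g (a * b) = g a * g b) (hgs : ∀ (s : Finset κ) (f : κ → Op ι S), g (∑ a ∈ s, f a) = ∑ a ∈ s, g (f a))
    (h1 : ∀ k l, Commute Q (g (E k l))) (h2 : ∀ p q, Commute Q (g (slice E A p q))) :
    Commute Q (g A) := by
  rw [← hE.sum_slice A, hgs]
  refine Commute.sum_right _ _ _ fun p _ => ?_
  rw [hgs]
  refine Commute.sum_right _ _ _ fun q _ => ?_
  rw [hg]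
  exact (h2 p q).mul_right (h1 p q)

/-- The exchange of two copies of the evolved algebra of `L` near its boundary is the end of the
evolved exchange of two copies of `L`. -/
theorem BoundaryGeometry.isEnd_swapUnits (hG : BoundaryGeometry N K L R F) (hV : IsLocal N V)
    {κ : Type} [Fintype κ] [DecidableEq κ] {E : κ → κ → Op ι S}
    (hE : IsMatrixUnits E) (hs : ∀ i j, (E i j)ᴴ = E j i) (hA : ∀ i j, E i j ∈ boundaryAlg hV.1 K L)
    (hspan : ∀ a ∈ boundaryAlg hV.1 K L, ∃ ρ : Matrix κ κ ℂ, a = ∑ i, ∑ j, ρ i j • E i j) :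
    IsEnd (dbl V) (swapM S) K L (swapUnits E) := by
  have hu : swapUnits E ∈ Matrix.unitaryGroup (ι → S × S) ℂ := by
    rw [Matrix.mem_unitaryGroup_iff, Matrix.star_eq_conjTranspose, swapUnits_ct hs,
      swapUnits_mul_self hE]
  have hK : SupportedOn K (swapUnits E) :=
    SupportedOn.sum _ fun i _ => SupportedOn.sum _ fun j _ =>
      (mem_boundaryAlg.1 (hA i j)).1.tens (mem_boundaryAlg.1 (hA j i)).1
  refine ⟨hu, hK, supportedOn_iff.2 fun i hi m => ?_⟩
  have hi : i ∈ K := by simpa using hi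
  set X := heis (dbl V) (onSites L (swapM S)) with hX
  have hdV := dbl_mem hV.1
  -- The operators on `K` are generated by the boundary algebra and its commutant in `K`. On the
  -- former, `X` and `swapUnits E` both exchange the copies; on the latter, which comes from `R`,
  -- both act trivially.
  have hx : ∀ a ∈ boundaryAlg hV.1 K L, ∀ b ∈ boundaryAlg hV.1 K L,
      X * tens (Equiv.refl _) a b = tens (Equiv.refl _) b a * X := by
    intro a ha b hb
    have h1 := congrArg (heis (dbl V))
      (onSites_swap_tens (mem_boundaryAlg.1 ha).2 (mem_boundaryAlg.1 hb).2)
    rw [heis_mul hdV, heis_mul hdV, dbl, heis_tens, heis_tens, heis_heis_ct hV.1,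
      heis_heis_ct hV.1] at h1
    exact h1
  have h1A : (1 : Op ι S) ∈ boundaryAlg hV.1 K L := one_mem _
  have hQ1 : ∀ k l, Commute ((swapUnits E)ᴴ * X) (tens (Equiv.refl _) (E k l) 1) := by
    intro k l
    rw [swapUnits_ct hs, Commute, SemiconjBy, Matrix.mul_assoc, hx _ (hA k l) _ h1A,
      ← Matrix.mul_assoc, swapUnits_mul_right hE, Matrix.mul_assoc]
  have hQ2 : ∀ k l, Commute ((swapUnits E)ᴴ * X) (tens (Equiv.refl _) 1 (E k l)) := by
    intro k l
    rw [swapUnits_ct hs, Commute, SemiconjBy, Matrix.mul_assoc, hx _ h1A _ (hA k l),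
      ← Matrix.mul_assoc, swapUnits_mul_left hE, Matrix.mul_assoc]
  have hc : ∀ c, SupportedOn R (heis Vᴴ c) →
      Commute ((swapUnits E)ᴴ * X) (tens (Equiv.refl _) c 1) ∧
      Commute ((swapUnits E)ᴴ * X) (tens (Equiv.refl _) 1 c) := by
    intro c hc
    have hcE : ∀ i j, Commute (E i j) c := fun i j => (hG.commute_of_supportedOn hV hc (hA i j)).symm
    have hcX : ∀ d d' : Op ι S, SupportedOn R (heis Vᴴ d) → SupportedOn R (heis Vᴴ d') →
        Commute X (tens (Equiv.refl _) d d') := fun d d' hd hd' => by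
      have h1 := heis_commute hdV ((supportedOn_onSites L (swapM S)).commute hG.disj
        (hd.tens (e := Equiv.refl _) hd'))
      rwa [dbl, heis_tens, heis_heis_ct hV.1, heis_heis_ct hV.1] at h1
    have h1R : SupportedOn R (heis Vᴴ (1 : Op ι S)) := by
      rw [heis_one (ct_mem hV.1)]; exact supportedOn_one _
    rw [swapUnits_ct hs]
    refine ⟨Commute.mul_left ?_ (hcX c 1 hc h1R), Commute.mul_left ?_ (hcX 1 c h1R hc)⟩
    · exact Commute.sum_left _ _ _ fun i _ => Commute.sum_left _ _ _ fun j _ =>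
        tens_commute (hcE i j) (Commute.one_right _)
    · exact Commute.sum_left _ _ _ fun i _ => Commute.sum_left _ _ _ fun j _ =>
        tens_commute (Commute.one_right _) (hcE j i)
  have hsl : ∀ a, SupportedOn K a → ∀ p q, SupportedOn R (heis Vᴴ (slice E a p q)) := by
    intro a ha p q
    refine hG.supportedOn_right hV ?_ fun b hb => ?_
    · exact SupportedOn.sum _ fun r _ => ((mem_boundaryAlg.1 (hA _ _)).1.mul ha).mul
        (mem_boundaryAlg.1 (hA _ _)).1
    · obtain ⟨ρ, rfl⟩ := hspan b hb
      exact Commute.sum_right _ _ _ fun i _ => Commute.sum_right _ _ _ fun j _ =>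
        (hE.slice_commute a p q i j).smul_right _
  refine commute_siteOp_of_stens (e := Equiv.refl (S × S)) (fun a b => ?_) m
  rw [siteOp, ← tens_onSites]
  have hsplit : tens (Equiv.refl (S × S)) (onSites {i} a) (onSites {i} b) =
      tens (Equiv.refl _) (onSites {i} a) (1 : Op ι S) * tens (Equiv.refl _) 1 (onSites {i} b) := by
    rw [tens_mul, mul_one, one_mul]
  rw [hsplit]
  refine Commute.mul_right ?_ ?_
  · refine commute_tens_of_units hE (fun a => tens (Equiv.refl _) a 1)
      (fun a b => by rw [tens_mul, mul_one]) (fun s f => tens_sum_left s f 1) hQ1 fun p q => ?_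
    exact (hc _ (hsl _ (supportedOn_siteOp hi a) p q)).1
  · refine commute_tens_of_units hE (fun a => tens (Equiv.refl _) 1 a)
      (fun a b => by rw [tens_mul, mul_one]) (fun s f => tens_sum_right s 1 f) hQ2 fun p q => ?_
    exact (hc _ (hsl _ (supportedOn_siteOp hi b) p q)).2

theorem exists_conj_supported [Nonempty S] {X : Finset ι} {A B : Op ι S} {n : ℕ} (hn : n ≠ 0)
    (hA : SupportedOn X A) (hB : SupportedOn X B) (uA : A ∈ Matrix.unitaryGroup (ι → S) ℂ)
    (uB : B ∈ Matrix.unitaryGroup (ι → S) ℂ) (hAn : A ^ n = 1) (hBn : B ^ n = 1)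
    (h : ∀ j, ntr (A ^ j) = ntr (B ^ j)) :
    ∃ W ∈ Matrix.unitaryGroup (ι → S) ℂ, SupportedOn X W ∧ W * A = B * W := by
  obtain ⟨a, rfl⟩ := hA
  obtain ⟨b, rfl⟩ := hB
  have hpow : ∀ (o : Op X S) (j : ℕ), extendOp X o ^ j = extendOp X (o ^ j) := fun o j =>
    (map_pow (extendHom X) o j).symm
  have hun : ∀ o : Op X S, extendOp X o ∈ Matrix.unitaryGroup (ι → S) ℂ →
      o ∈ Matrix.unitaryGroup (X → S) ℂ := fun o ho => by
    rw [Matrix.mem_unitaryGroup_iff, Matrix.star_eq_conjTranspose]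
    refine extendOp_injective X ?_
    rw [extendOp_mul, extendOp_one, ← extendOp_conjTranspose]
    exact mul_ct ho
  have htr : ∀ j, (a ^ j).trace = (b ^ j).trace := fun j => by
    have h1 := h j
    rw [hpow, hpow, ntr, ntr, trace_extendOp, trace_extendOp] at h1
    have hc : (Fintype.card ({i // i ∉ X} → S) : ℂ) ≠ 0 := Nat.cast_ne_zero.2 Fintype.card_ne_zero
    have hc' : (Fintype.card (ι → S) : ℂ) ≠ 0 := Nat.cast_ne_zero.2 Fintype.card_ne_zero
    exact mul_right_cancel₀ hc ((div_left_inj' hc').1 h1)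
  obtain ⟨W, hW, hWab⟩ := exists_unitary_conj hn
    (extendOp_injective X (by rw [← hpow, hAn, extendOp_one]))
    (extendOp_injective X (by rw [← hpow, hBn, extendOp_one])) (hun a uA) (hun b uB) htr
  refine ⟨extendOp X W, ?_, ⟨W, rfl⟩, ?_⟩
  · rw [Matrix.mem_unitaryGroup_iff, Matrix.star_eq_conjTranspose, extendOp_conjTranspose,
      ← extendOp_mul, mul_ct hW, extendOp_one]
  · rw [← extendOp_mul, hWab, extendOp_mul]

theorem exists_partialIsometry_supported [Nonempty S] {X : Finset ι} {P Q : Op ι S}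
    (hP : SupportedOn X P) (hQ : SupportedOn X Q) (hPP : P * P = P) (hPH : Pᴴ = P)
    (hQQ : Q * Q = Q) (hQH : Qᴴ = Q) (h : ntr P = ntr Q) :
    ∃ x : Op ι S, SupportedOn X x ∧ xᴴ * x = P ∧ x * xᴴ = Q ∧ x * P = x ∧ Q * x = x := by
  obtain ⟨p, rfl⟩ := hP
  obtain ⟨q, rfl⟩ := hQ
  have htr : p.trace = q.trace := by
    rw [ntr, ntr, trace_extendOp, trace_extendOp] at h
    have hc : (Fintype.card ({i // i ∉ X} → S) : ℂ) ≠ 0 := Nat.cast_ne_zero.2 Fintype.card_ne_zero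
    have hc' : (Fintype.card (ι → S) : ℂ) ≠ 0 := Nat.cast_ne_zero.2 Fintype.card_ne_zero
    exact mul_right_cancel₀ hc ((div_left_inj' hc').1 h)
  obtain ⟨x, h1, h2, h3, h4⟩ := exists_partialIsometry
    (extendOp_injective X (by rw [extendOp_mul, hPP]))
    (extendOp_injective X (by rw [← extendOp_conjTranspose, hPH]))
    (extendOp_injective X (by rw [extendOp_mul, hQQ]))
    (extendOp_injective X (by rw [← extendOp_conjTranspose, hQH])) htr
  refine ⟨extendOp X x, ⟨x, rfl⟩, ?_, ?_, ?_, ?_⟩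
  · rw [extendOp_conjTranspose, ← extendOp_mul, h1]
  · rw [extendOp_conjTranspose, ← extendOp_mul, h2]
  · rw [← extendOp_mul, h3]
  · rw [← extendOp_mul, h4]

/-- Two systems of matrix units of the same size are unitarily equivalent. -/
theorem exists_intertwiner_units [Nonempty S] {κ : Type} [Fintype κ] [DecidableEq κ] [Nonempty κ]
    {X : Finset ι} {E E' : κ → κ → Op ι S} (hE : IsMatrixUnits E) (hE' : IsMatrixUnits E')
    (hs : ∀ i j, (E i j)ᴴ = E j i) (hs' : ∀ i j, (E' i j)ᴴ = E' j i)
    (hX : ∀ i j, SupportedOn X (E i j)) (hX' : ∀ i j, SupportedOn X (E' i j)) :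
    ∃ v ∈ Matrix.unitaryGroup (ι → S) ℂ, SupportedOn X v ∧ ∀ i j, v * E i j = E' i j * v := by
  obtain ⟨o⟩ : Nonempty κ := inferInstance
  have hκ : (Fintype.card κ : ℂ) ≠ 0 := fun h => by
    have := hE.ntr_diag o; rw [h, zero_mul] at this; exact zero_ne_one this
  -- Diagonal units of systems of the same size have the same trace. A partial isometry between two
  -- of them is carried to all others by the units.
  obtain ⟨x, hxX, h1, h2, h3, h4⟩ := exists_partialIsometry_supported (hX o o) (hX' o o)
    (by rw [hE.1, if_pos rfl]) (hs o o) (by rw [hE'.1, if_pos rfl]) (hs' o o)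
    (mul_left_cancel₀ hκ (by rw [hE.ntr_diag, hE'.ntr_diag]))
  set v := ∑ a, E' a o * x * E o a with hv
  have hvE : ∀ i j, v * E i j = E' i o * x * E o j := fun i j => by
    rw [hv, Finset.sum_mul, Finset.sum_eq_single i]
    · rw [Matrix.mul_assoc, hE.1, if_pos rfl]
    · intro a _ ha
      rw [Matrix.mul_assoc, hE.1, if_neg ha, Matrix.mul_zero]
    · simp
  have hEv : ∀ i j, E' i j * v = E' i o * x * E o j := fun i j => by
    rw [hv, Finset.mul_sum, Finset.sum_eq_single j]
    · rw [← Matrix.mul_assoc, ← Matrix.mul_assoc, hE'.1, if_pos rfl]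
    · intro a _ ha
      rw [← Matrix.mul_assoc, ← Matrix.mul_assoc, hE'.1, if_neg (Ne.symm ha), Matrix.zero_mul,
        Matrix.zero_mul]
    · simp
  refine ⟨v, ?_, SupportedOn.sum _ fun a _ => ((hX' _ _).mul hxX).mul (hX _ _), fun i j => by
    rw [hvE, hEv]⟩
  rw [Matrix.mem_unitaryGroup_iff, Matrix.star_eq_conjTranspose]
  have hvH : vᴴ = ∑ a, E a o * xᴴ * E' o a := by
    rw [hv, Matrix.conjTranspose_sum]
    refine Finset.sum_congr rfl fun a _ => ?_
    rw [Matrix.conjTranspose_mul, Matrix.conjTranspose_mul, hs, hs', Matrix.mul_assoc]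
  rw [hvH, Finset.mul_sum, ← hE'.2]
  refine Finset.sum_congr rfl fun a _ => ?_
  rw [← Matrix.mul_assoc, ← Matrix.mul_assoc, hvE, Matrix.mul_assoc (E' a o) x, h3,
    Matrix.mul_assoc (E' a o) x, h2, hE'.1, if_pos rfl, hE'.1, if_pos rfl]

end Straighten

/-! ### Straightening an automaton at one cut -/

section Straighten
variable {ι S : Type} [Fintype ι] [DecidableEq ι] [Fintype S] [DecidableEq S] [Nonempty S]
  {N : ι → ι → Prop} {V : Op ι S} {K L R F K₁ K₂ : Finset ι}

theorem unitOp_ct (X : Finset ι) (a b : X → S) : (unitOp X a b)ᴴ = unitOp X b a := by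
  rw [unitOp, unitOp, extendOp_conjTranspose, Matrix.conjTranspose_single, star_one]

/-- A symmetric unitary near the boundary of `L` that turns the evolved algebras of `L` and `R`
into the algebras of the two halves of `K`. -/
theorem BoundaryGeometry.exists_straightening (hG : BoundaryGeometry N K L R F)
    (hV : IsLocal N V) {M : Matrix S S ℂ} {n : ℕ} {T : Op ι S} (hn : n ≠ 0)
    (hM : M ∈ Matrix.unitaryGroup S ℂ) (hMn : M ^ n = 1) (htr : ∀ j, mtr (M ^ j) ≠ 0)
    (hVM : Commute V (onSites Finset.univ M)) (hT : IsEnd V M K L T) (hTn : T ^ n = 1)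
    (hd : Disjoint K₁ K₂) (hK : ∀ i, i ∈ K ↔ i ∈ K₁ ∨ i ∈ K₂) (hcard : K₁.card = K₂.card)
    (hTtr : ∀ j, ntr (T ^ j) = mtr (M ^ j) ^ K₁.card)
    {𝕊 : Op ι (S × S)} (h𝕊 : IsEnd (dbl V) (swapM S) K L 𝕊)
    (h𝕊tr : ‖ntr 𝕊‖ = ((Fintype.card S : ℝ) ^ K₁.card)⁻¹) :
    ∃ v ∈ Matrix.unitaryGroup (ι → S) ℂ, SupportedOn K v ∧ Commute v (onSites Finset.univ M) ∧
      (∀ O, SupportedOn K₁ O → SupportedOn L (heis Vᴴ (heis v O))) ∧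
      (∀ O, SupportedOn K₂ O → SupportedOn R (heis Vᴴ (heis v O))) := by
  obtain ⟨p, E, hE, hEA, hs, hspan⟩ := exists_isMatrixUnits (boundaryAlg hV.1 K L)
    fun z hz h => hG.exists_smul_of_central hV hz h
  have hsw := hG.isEnd_swapUnits hV hE hs hEA hspan
  have hp0 : (p : ℝ) ≠ 0 := fun h => by
    have := ntr_swapUnits hE
    rw [Fintype.card_fin, show (p : ℂ) = 0 by exact_mod_cast h, zero_mul] at this
    exact zero_ne_one this
  -- The given end of the evolved exchange and `swapUnits E` differ by a phase. The modulus of the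
  -- trace, `1 / p`, is prescribed, which gives the boundary algebra the size of the operator
  -- algebra of `K₁`.
  have hp : p = Fintype.card (K₁ → S) := by
    obtain ⟨c, hc⟩ := IsEnd.eq_smul (dbl_mem hV.1) swapM_mem hsw h𝕊
    have hc1 : ‖c‖ = 1 := norm_eq_one_of_smul_mem_unitary hsw.1 (hc ▸ h𝕊.1)
    have h1 := congrArg norm (ntr_swapUnits hE)
    rw [norm_mul, Fintype.card_fin, norm_one, Complex.norm_natCast] at h1
    rw [hc, ntr_smul, norm_mul, hc1, one_mul] at h𝕊tr
    rw [h𝕊tr] at h1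
    have h2 : (p : ℝ) = (Fintype.card S : ℝ) ^ K₁.card := by
      have h3 : ((Fintype.card S : ℝ) ^ K₁.card) ≠ 0 :=
        pow_ne_zero _ (Nat.cast_ne_zero.2 Fintype.card_ne_zero)
      field_simp at h1
      exact h1
    rw [Fintype.card_fun, Fintype.card_coe]
    exact_mod_cast h2
  have e : (K₁ → S) ≃ Fin p := Fintype.equivFinOfCardEq hp.symm
  have hK₁ : K₁ ⊆ K := fun i hi => (hK i).2 (Or.inl hi)
  have hK₂ : K₂ ⊆ K := fun i hi => (hK i).2 (Or.inr hi)
  have hE' : IsMatrixUnits fun a b => E (e a) (e b) := by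
    refine ⟨fun a b c d => ?_, ?_⟩
    · rw [hE.1]; simp only [e.injective.eq_iff]
    · rw [e.sum_comp fun i => E i i, hE.2]
  obtain ⟨v₀, uv₀, hv₀K, hv₀⟩ := exists_intertwiner_units (X := K) hE'
    (isMatrixUnits_unitOp (S := S) K₁) (fun i j => hs _ _) (unitOp_ct K₁)
    (fun i j => (mem_boundaryAlg.1 (hEA _ _)).1) (fun i j => (supportedOn_unitOp K₁ i j).mono hK₁)
  have hconj : ∀ i j, v₀ * E i j * v₀ᴴ = unitOp K₁ (e.symm i) (e.symm j) := fun i j => by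
    have := hv₀ (e.symm i) (e.symm j)
    simp only [Equiv.apply_symm_apply] at this
    rw [this, Matrix.mul_assoc, mul_ct uv₀, Matrix.mul_one]
  have hconj' : ∀ a b, v₀ᴴ * unitOp K₁ a b * v₀ = E (e a) (e b) := fun a b => by
    rw [Matrix.mul_assoc, ← hv₀, ← Matrix.mul_assoc, ct_mul uv₀, Matrix.one_mul]
  have hmap : ∀ r ∈ boundaryAlg hV.1 K L, SupportedOn K₁ (v₀ * r * v₀ᴴ) := by
    intro r hr
    obtain ⟨ρ, rfl⟩ := hspan r hr
    simp only [Finset.mul_sum, Finset.sum_mul, Matrix.mul_smul, Matrix.smul_mul, hconj]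
    exact SupportedOn.sum _ fun i _ => SupportedOn.sum _ fun j _ =>
      (supportedOn_unitOp K₁ _ _).smul _
  have hmap' : ∀ O, SupportedOn K₁ O → v₀ᴴ * O * v₀ ∈ boundaryAlg hV.1 K L := by
    intro O hO
    obtain ⟨o, rfl⟩ := hO.eq_sum_unitOp
    simp only [Finset.mul_sum, Finset.sum_mul, Matrix.mul_smul, Matrix.smul_mul, hconj']
    exact sum_mem fun i _ => sum_mem fun j _ => (boundaryAlg hV.1 K L).smul_mem (hEA _ _) _
  have hcm : ∀ O, (∀ r ∈ boundaryAlg hV.1 K L, Commute O r) → SupportedOn K O →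
      SupportedOn K₂ (v₀ * O * v₀ᴴ) := by
    intro O hO hOK
    refine ((hv₀K.mul hOK).mul hv₀K.conjTranspose).inter (Y := K₁ᶜ)
      (supportedOn_compl_of_commute fun P hP => ?_) fun i hi hi' => ?_
    · have h1 := hO _ (hmap' P hP)
      have h2 := heis_commute (ct_mem uv₀) h1
      simp only [heis, Matrix.conjTranspose_conjTranspose] at h2
      rwa [show v₀ * (v₀ᴴ * P * v₀) * v₀ᴴ = P by
        rw [← Matrix.mul_assoc, ← Matrix.mul_assoc, mul_ct uv₀, Matrix.one_mul, Matrix.mul_assoc,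
          mul_ct uv₀, Matrix.mul_one]] at h2
    · exact ((hK i).1 hi).resolve_left (Finset.mem_compl.1 hi')
  set Q := onSites K M with hQ
  have hQu : Q ∈ Matrix.unitaryGroup (ι → S) ℂ := onSites_mem hM K
  have hQn : Q ^ n = 1 := by rw [hQ, onSites_pow, hMn, onSites_one]
  -- `v₀` moves the boundary algebra to `K₁` and its commutant in `K` to `K₂`, but need not respect
  -- the symmetry. `T` lies in the former and `Tᴴ * Q` in the latter, so the conjugated symmetry of
  -- `K` still splits into a part `A` on `K₁` and a part `B` on `K₂`.
  set A := v₀ * T * v₀ᴴ with hA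
  set B := v₀ * (Tᴴ * Q) * v₀ᴴ with hB
  have hAs : SupportedOn K₁ A := hmap T (hG.end_mem hV hT hM)
  have hBs : SupportedOn K₂ B := hcm _ (fun r hr => hG.commute_end_ct_mul hV hT hM hVM hr)
    (hT.2.1.conjTranspose.mul (supportedOn_onSites K M))
  have hAB : A * B = v₀ * Q * v₀ᴴ := by
    calc A * B = v₀ * T * (v₀ᴴ * v₀) * Tᴴ * Q * v₀ᴴ := by
          rw [hA, hB]; simp only [Matrix.mul_assoc]
      _ = v₀ * (T * Tᴴ) * Q * v₀ᴴ := by rw [ct_mul uv₀, Matrix.mul_one, Matrix.mul_assoc v₀]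
      _ = _ := by rw [mul_ct hT.1, Matrix.mul_one]
  have hpow : ∀ (O : Op ι S) (j : ℕ), (v₀ * O * v₀ᴴ) ^ j = v₀ * O ^ j * v₀ᴴ := fun O j => by
    have := heis_pow (ct_mem uv₀) O j
    simpa only [heis, Matrix.conjTranspose_conjTranspose] using this
  have hntr : ∀ O : Op ι S, ntr (v₀ * O * v₀ᴴ) = ntr O := fun O => by
    have := ntr_conj (U := v₀ᴴ) (O := O) (by
      rw [Matrix.conjTranspose_conjTranspose, ct_mul uv₀])
    rwa [Matrix.conjTranspose_conjTranspose] at this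
  have hcAB : Commute A B := hAs.commute hd hBs
  have uA : A ∈ Matrix.unitaryGroup (ι → S) ℂ := mul_mem (mul_mem uv₀ hT.1) (ct_mem uv₀)
  have uB : B ∈ Matrix.unitaryGroup (ι → S) ℂ :=
    mul_mem (mul_mem uv₀ (mul_mem (ct_mem hT.1) hQu)) (ct_mem uv₀)
  have hAn : A ^ n = 1 := by rw [hA, hpow, hTn, Matrix.mul_one, mul_ct uv₀]
  have hBn : B ^ n = 1 := by
    have h1 := hcAB.mul_pow n
    rw [hAB, hpow, hQn, hAn, one_mul, Matrix.mul_one, mul_ct uv₀] at h1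
    exact h1.symm
  have hmtr : ∀ (I : Finset ι) (j : ℕ), ntr (onSites I M ^ j) = mtr (M ^ j) ^ I.card := fun I j => by
    rw [onSites_pow, ntr_onSites, mtr]
  have hAt : ∀ j, ntr (A ^ j) = ntr (onSites K₁ M ^ j) := fun j => by
    rw [hA, hpow, hntr, hTtr, hmtr]
  -- The traces of `A * B` and of `A` are those of the symmetry on `K` and on `K₁`; cancelling the
  -- latter, which are nonzero, leaves the traces of `B`.
  have hBt : ∀ j, ntr (B ^ j) = ntr (onSites K₂ M ^ j) := fun j => by
    have h1 : ntr (A ^ j * B ^ j) = ntr (Q ^ j) := by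
      rw [← hcAB.mul_pow, hAB, hpow, hntr]
    have hKc : K.card = K₁.card + K₂.card := by
      rw [← Finset.card_union_of_disjoint hd]
      congr 1; ext i; rw [hK, Finset.mem_union]
    rw [ntr_mul_of_disjoint hd (hAs.pow j) (hBs.pow j), hAt, hQ, hmtr, hmtr, hKc, pow_add] at h1
    rw [hmtr]
    exact mul_left_cancel₀ (pow_ne_zero _ (htr j)) h1
  have hn1 : ∀ I : Finset ι, onSites I M ^ n = 1 := fun I => by
    rw [onSites_pow, hMn, onSites_one]
  -- Equal traces of all powers make `A` and `B` conjugate to the symmetry within their halves. The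
  -- corrections `w₁` and `w₂` render the straightening symmetric without mixing the halves.
  obtain ⟨w₁, uw₁, sw₁, hw₁⟩ := exists_conj_supported hn hAs (supportedOn_onSites K₁ M) uA
    (onSites_mem hM K₁) hAn (hn1 K₁) hAt
  obtain ⟨w₂, uw₂, sw₂, hw₂⟩ := exists_conj_supported hn hBs (supportedOn_onSites K₂ M) uB
    (onSites_mem hM K₂) hBn (hn1 K₂) hBt
  have hvK : SupportedOn K (w₁ * w₂ * v₀) := ((sw₁.mono hK₁).mul (sw₂.mono hK₂)).mul hv₀K
  have hQ12 : onSites K₁ M * onSites K₂ M = Q := onSites_union M hd hK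
  have hvQ : Commute (w₁ * w₂ * v₀) Q := by
    have h1 : v₀ * Q = A * B * v₀ := by
      rw [hAB, Matrix.mul_assoc _ v₀ᴴ, ct_mul uv₀, Matrix.mul_one]
    calc w₁ * w₂ * v₀ * Q = w₁ * (w₂ * A) * B * v₀ := by
          rw [Matrix.mul_assoc, h1]; simp only [Matrix.mul_assoc]
      _ = (w₁ * A) * (w₂ * B) * v₀ := by
          rw [(sw₂.commute hd.symm hAs).eq]; simp only [Matrix.mul_assoc]
      _ = onSites K₁ M * (w₁ * onSites K₂ M) * w₂ * v₀ := by
          rw [hw₁, hw₂]; simp only [Matrix.mul_assoc]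
      _ = Q * (w₁ * w₂ * v₀) := by
          rw [(sw₁.commute hd (supportedOn_onSites K₂ M)).eq, ← hQ12]; simp only [Matrix.mul_assoc]
  have hQ' : onSites K M * onSites Kᶜ M = onSites Finset.univ M :=
    onSites_union M disjoint_compl_right (by intro i; simp [em])
  refine ⟨w₁ * w₂ * v₀, mul_mem (mul_mem uw₁ uw₂) uv₀, hvK, ?_, fun O hO => ?_, fun O hO => ?_⟩
  · rw [← hQ']
    exact hvQ.mul_right (hvK.commute disjoint_compl_right (supportedOn_onSites Kᶜ M))
  · have hO' : SupportedOn K₁ (heis w₁ O) := (sw₁.conjTranspose.mul hO).mul sw₁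
    have h1 : heis w₂ (heis w₁ O) = heis w₁ O :=
      heis_of_commute uw₂ (sw₂.commute hd.symm hO')
    rw [← heis_heis, ← heis_heis, h1]
    exact (mem_boundaryAlg.1 (hmap' _ hO')).2
  · have hO' : SupportedOn K₂ (heis w₂ O) := (sw₂.conjTranspose.mul hO).mul sw₂
    have h1 : heis w₁ O = O := heis_of_commute uw₁ (sw₁.commute hd hO)
    rw [← heis_heis, ← heis_heis, h1]
    refine hG.supportedOn_right hV
      ((hv₀K.conjTranspose.mul (hO'.mono hK₂)).mul hv₀K) fun r hr => ?_
    have h2 := heis_commute uv₀ (hO'.commute hd.symm (hmap r hr))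
    have h3 : heis v₀ (v₀ * r * v₀ᴴ) = r := by
      have := heis_heis_ct uv₀ r
      simpa only [heis, Matrix.conjTranspose_conjTranspose] using this
    rwa [h3] at h2

end Straighten

/-! ### Unitaries that preserve the cells of a partition -/

section Cells

variable {ι S : Type} [Fintype ι] [DecidableEq ι] [Fintype S] [DecidableEq S]

/-- Isolate one factor of an ordered product. -/
theorem exists_prod_ofFn_eq {A : Type*} [Monoid A] : ∀ {n : ℕ} (v : Fin n → A) (i : Fin n),
    ∃ P Q, (List.ofFn v).prod = P * v i * Q ∧
      ∀ H : Submonoid A, (∀ j, j ≠ i → v j ∈ H) → P ∈ H ∧ Q ∈ H := by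
  intro n
  induction n with
  | zero => exact fun v i => i.elim0
  | succ n ih =>
    intro v i
    rw [List.ofFn_succ, List.prod_cons]
    refine Fin.cases ?_ (fun i => ?_) i
    · refine ⟨1, (List.ofFn fun i : Fin n => v i.succ).prod, by rw [one_mul], fun H h =>
        ⟨one_mem _, Submonoid.list_prod_mem _ fun x hx => ?_⟩⟩
      obtain ⟨j, rfl⟩ := (List.mem_ofFn' _ _).1 hx
      exact h _ (Fin.succ_ne_zero j)
    · obtain ⟨P, Q, h1, h2⟩ := ih (fun j => v j.succ) i
      refine ⟨v 0 * P, Q, by rw [h1]; simp only [mul_assoc], fun H h => ?_⟩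
      obtain ⟨hP, hQ⟩ := h2 H fun j hj => h _ fun h' => hj (Fin.succ_injective _ h')
      exact ⟨mul_mem (h 0 (Fin.succ_ne_zero i).symm) hP, hQ⟩

theorem prod_ofFn_mem {A : Type*} [Monoid A] {n : ℕ} {v : Fin n → A} (H : Submonoid A)
    (h : ∀ j, v j ∈ H) : (List.ofFn v).prod ∈ H :=
  Submonoid.list_prod_mem _ fun x hx => by
    obtain ⟨j, rfl⟩ := (List.mem_ofFn' _ _).1 hx
    exact h j

theorem mem_centralizer_singleton {A : Type*} [Monoid A] {x Z : A} :
    x ∈ Submonoid.centralizer {Z} ↔ Commute x Z := by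
  rw [Submonoid.mem_centralizer_iff]
  exact ⟨fun h => (h Z rfl).symm, fun h g hg => by rw [Set.mem_singleton_iff.1 hg]; exact h.eq.symm⟩

theorem prod_ofFn_commute {A : Type*} [Monoid A] {n : ℕ} {v : Fin n → A} {Z : A}
    (h : ∀ j, Commute (v j) Z) : Commute (List.ofFn v).prod Z :=
  mem_centralizer_singleton.1 (prod_ofFn_mem _ fun j => mem_centralizer_singleton.2 (h j))

/-- Only one factor of an ordered product acts on an operator that the other factors commute
with. -/
theorem prod_ofFn_conj {n : ℕ} {v : Fin n → Op ι S} (hv : ∀ j, v j ∈ Matrix.unitaryGroup (ι → S) ℂ)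
    (hc : ∀ j j', j ≠ j' → Commute (v j) (v j')) {i : Fin n} {O : Op ι S}
    (hO : ∀ j, j ≠ i → Commute (v j) O) :
    heis (List.ofFn v).prod O = heis (v i) O ∧
      heis (List.ofFn v).prodᴴ O = heis (v i)ᴴ O := by
  obtain ⟨P, Q, h, hm⟩ := exists_prod_ofFn_eq v i
  obtain ⟨uP, uQ⟩ := hm (Matrix.unitaryGroup (ι → S) ℂ) fun j _ => hv j
  have hcen : ∀ Z, (∀ j, j ≠ i → Commute (v j) Z) → Commute P Z ∧ Commute Q Z := fun Z hZ => by
    obtain ⟨h1, h2⟩ := hm (Submonoid.centralizer {Z}) fun j hj =>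
      mem_centralizer_singleton.2 (hZ j hj)
    exact ⟨mem_centralizer_singleton.1 h1, mem_centralizer_singleton.1 h2⟩
  obtain ⟨PO, QO⟩ := hcen O hO
  obtain ⟨Pv, Qv⟩ := hcen (v i) fun j hj => hc j i hj
  have key : ∀ W : Op ι S, W ∈ Matrix.unitaryGroup (ι → S) ℂ → Commute W O → Commute W (v i) →
      heis W (heis (v i) O) = heis (v i) O ∧ heis Wᴴ (heis (v i)ᴴ O) = heis (v i)ᴴ O := by
    intro W hW h1 h2
    have h3 := commute_ct (hv i) h2.symm
    have h4 := commute_ct hW h2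
    have h5 := (commute_ct hW h3.symm)
    have h6 := commute_ct hW h1
    refine ⟨heis_of_commute hW ?_, heis_of_commute (ct_mem hW) ?_⟩
    · exact (h3.symm.mul_right h1).mul_right h2
    · rw [heis, Matrix.conjTranspose_conjTranspose]
      exact (h4.mul_right h6).mul_right h5
  constructor
  · rw [h, ← heis_heis, ← heis_heis, heis_of_commute uP PO, (key Q uQ QO Qv).1]
  · rw [h, Matrix.conjTranspose_mul, Matrix.conjTranspose_mul, ← heis_heis, ← heis_heis,
      heis_of_commute (ct_mem uQ) (commute_ct uQ QO), (key P uP PO Pv).2]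

theorem commute_of_heis {n : Type} [Fintype n] [DecidableEq n] {U A : Matrix n n ℂ}
    (hU : U ∈ Matrix.unitaryGroup n ℂ) (h : heis U A = A) : Commute U A := by
  rw [Commute, SemiconjBy]
  nth_rewrite 1 [← h]
  rw [heis, ← mul_assoc, ← mul_assoc, mul_ct hU, one_mul]

/-- It suffices to check on one-site operators that an algebra of operators is preserved. -/
theorem supportedOn_conj_of_siteOp {X : Op ι S} (hX : X ∈ Matrix.unitaryGroup (ι → S) ℂ)
    {E : Finset ι} (h : ∀ i ∈ E, ∀ m, SupportedOn E (heis Xᴴ (siteOp i m))) {O : Op ι S}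
    (hO : SupportedOn E O) : SupportedOn E (heis Xᴴ O) := by
  refine supportedOn_iff.2 fun j hj m => (commute_heis_iff (ct_mem hX)).2 ?_
  refine hO.commute (disjoint_compl_right (a := E)) (supportedOn_iff.2 fun i hi m' => ?_)
  have hi : i ∈ E := by simpa using hi
  exact ((commute_heis_iff (ct_mem hX)).1 ((h i hi m').commute
    (Finset.disjoint_singleton_right.2 hj) (supportedOn_singleton.2 ⟨m, rfl⟩))).symm

/-- A unitary that commutes with the symmetry and preserves the operator algebra of every cell of a
partition is a product of symmetric gates acting on the cells. -/
theorem exists_prod_of_preserves [Nonempty S] {M : Matrix S S ℂ} {k : ℕ}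
    {C : Fin (k + 1) → Finset ι} (hM : M ∈ Matrix.unitaryGroup S ℂ) (htr : mtr M ≠ 0)
    (hC : ∀ i j, i ≠ j → Disjoint (C i) (C j)) (hcov : ∀ s, ∃ i, s ∈ C i) {X : Op ι S}
    (hX : X ∈ Matrix.unitaryGroup (ι → S) ℂ) (hXM : Commute X (onSites Finset.univ M))
    (h : ∀ i O, SupportedOn (C i) O → SupportedOn (C i) (heis Xᴴ O)) :
    ∃ u : Fin (k + 1) → Op ι S, (∀ i, u i ∈ Matrix.unitaryGroup (ι → S) ℂ ∧
      SupportedOn (C i) (u i) ∧ Commute (u i) (onSites Finset.univ M)) ∧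
      X = (List.ofFn u).prod := by
  set Q := onSites (Finset.univ : Finset ι) M with hQ
  have uQ : Q ∈ Matrix.unitaryGroup (ι → S) ℂ := onSites_mem hM _
  have hex := fun i => exists_factor hX (E := C i) fun O hO => by
    have := h i O hO
    rwa [heis, Matrix.conjTranspose_conjTranspose] at this
  choose u uu us uX using hex
  have hact : ∀ i O, SupportedOn (C i) O → heis Xᴴ O = heis (u i)ᴴ O := fun i O hO => by
    have h1 : heis ((u i)ᴴ * X)ᴴ O = O :=
      heis_of_commute (ct_mem (mul_mem (ct_mem (uu i)) hX))
        (commute_ct (mul_mem (ct_mem (uu i)) hX) ((uX i).commute_compl hO))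
    rw [Matrix.conjTranspose_mul, Matrix.conjTranspose_conjTranspose, ← heis_heis] at h1
    rw [← h1, heis_ct_heis (uu i), h1]
  -- The action of `u i` on its cell is that of `X`, which commutes with the symmetry, so `u i`
  -- commutes with `Q` up to a scalar. The scalar is 1 because conjugation preserves the nonzero
  -- trace of `Q`.
  have huQ : ∀ i, Commute (u i) Q := fun i => by
    have h1 : SupportedOn (C i) (heis (u i) Q * Qᴴ) := by
      have := ((us i).conjTranspose).mul ((us i).conj_onSites_mem (J := Finset.univ) hM)
      rw [heis]
      simpa only [Matrix.mul_assoc] using this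
    have h2 : ∀ O, SupportedOn (C i) O → Commute (heis (u i) Q * Qᴴ) O := fun O hO => by
      have hO1 : SupportedOn (C i) (heis Q O) := by
        have := hO.conj_onSites_mem (J := Finset.univ) (ct_mem hM)
        rwa [← onSites_conjTranspose, Matrix.conjTranspose_conjTranspose] at this
      have hXQ : Commute Xᴴ Qᴴ := commute_ct hX (commute_ct uQ hXM.symm).symm
      have h3 : heis Qᴴ (heis (u i)ᴴ (heis Q O)) = heis (u i)ᴴ O := by
        rw [← hact i _ hO1, heis_heis, hXQ.eq, ← heis_heis, heis_ct_heis uQ, hact i O hO]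
      have uW := mul_mem (heis_mem (uu i) uQ) (ct_mem uQ)
      have h4 := commute_ct (ct_mem uW) (commute_of_heis (ct_mem uW) (A := O) (by
        have e : (heis (u i) Q * Qᴴ)ᴴ = Q * ((u i)ᴴ * (Qᴴ * u i)) := by
          simp [heis, Matrix.conjTranspose_mul, Matrix.mul_assoc]
        rw [e, ← heis_heis, ← heis_heis, ← heis_heis, h3, heis_heis_ct (uu i)]))
      rwa [Matrix.conjTranspose_conjTranspose] at h4
    obtain ⟨c, hc⟩ := (h1.inter (supportedOn_compl_of_commute h2) (Z := ∅)
      fun s h3 h4 => absurd h3 (Finset.mem_compl.1 h4)).exists_eq_smul_one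
    have h3 : heis (u i) Q = c • Q := by
      have := congrArg (· * Q) hc
      simpa [Matrix.mul_assoc, ct_mul uQ] using this
    have h4 : ntr (heis (u i) Q) = ntr Q := ntr_conj (mul_ct (uu i))
    have h5 : ntr Q ≠ 0 := by
      rw [hQ, ntr_onSites]; exact pow_ne_zero _ htr
    rw [h3, ntr_smul, mul_eq_right₀ h5] at h4
    rw [h4, one_smul] at h3
    rw [Commute, SemiconjBy, ← h3, heis, ← mul_assoc, ← mul_assoc, mul_ct (uu i), one_mul, ← heis,
      h3]
  have hcomm : ∀ i j, i ≠ j → Commute (u i) (u j) := fun i j hij => (us i).commute (hC i j hij) (us j)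
  set P := (List.ofFn u).prod with hP
  have uP : P ∈ Matrix.unitaryGroup (ι → S) ℂ := prod_ofFn_mem _ uu
  have hPX : SupportedOn ∅ (Pᴴ * X) := by
    refine supportedOn_iff.2 fun s _ m => ?_
    obtain ⟨i, hi⟩ := hcov s
    have hO := supportedOn_siteOp (S := S) hi m
    have h1 := (prod_ofFn_conj uu hcomm (i := i) (O := siteOp s m) fun j hj =>
      (us j).commute (hC j i hj) hO).2
    have h2 : heis (Pᴴ * X)ᴴ (siteOp s m) = siteOp s m := by
      rw [Matrix.conjTranspose_mul, Matrix.conjTranspose_conjTranspose, ← heis_heis,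
        hact i _ hO, ← h1, heis_heis_ct uP]
    have h3 := commute_ct (ct_mem (mul_mem (ct_mem uP) hX))
      (commute_of_heis (ct_mem (mul_mem (ct_mem uP) hX)) h2)
    rwa [Matrix.conjTranspose_conjTranspose] at h3
  obtain ⟨z, hz⟩ := hPX.exists_eq_smul_one
  have hXP : X = z • P := by
    have := congrArg (P * ·) hz
    simpa [← Matrix.mul_assoc, mul_ct uP] using this
  have hz1 : ‖z‖ = 1 := by
    rw [hXP] at hX
    exact norm_eq_one_of_smul_mem_unitary uP hX
  -- The product of the gates equals `X` up to a phase, which the first gate absorbs.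
  refine ⟨Fin.cons (z • u 0) fun i => u i.succ, fun i => ?_, ?_⟩
  · refine Fin.cases ?_ (fun i => ?_) i
    · exact ⟨smul_mem_unitary (uu 0) hz1, (us 0).smul z, (huQ 0).smul_left z⟩
    · exact ⟨uu _, us _, huQ _⟩
  · rw [hXP, hP, List.ofFn_succ, List.ofFn_succ]
    simp [Matrix.smul_mul]

end Cells

/-! ### Two layers of gates from straightened cuts -/

section Cells

variable {ι S : Type} [Fintype ι] [DecidableEq ι] [Fintype S] [DecidableEq S]

/-- If local unitaries `v i` straighten `V` at the boundaries between the cells of a partition, then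
`V` is a product of two layers of gates. -/
theorem exists_two_layers [Nonempty S] {M : Matrix S S ℂ} {k : ℕ}
    {C A B K : Fin (k + 1) → Finset ι} (hM : M ∈ Matrix.unitaryGroup S ℂ) (htr : mtr M ≠ 0)
    (hC : ∀ i j, i ≠ j → Disjoint (C i) (C j)) (hcov : ∀ s, ∃ i, s ∈ C i)
    (hA : ∀ i, A i ⊆ C i) (hB : ∀ i, B i ⊆ C i) (hAB : ∀ i, Disjoint (A i) (B i))
    (hK : ∀ i s, s ∈ K (i + 1) ↔ s ∈ B i ∨ s ∈ A (i + 1)) {V : Op ι S}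
    (hV : V ∈ Matrix.unitaryGroup (ι → S) ℂ) (hVM : Commute V (onSites Finset.univ M))
    {v : Fin (k + 1) → Op ι S} (hv : ∀ i, v i ∈ Matrix.unitaryGroup (ι → S) ℂ ∧
      SupportedOn (K i) (v i) ∧ Commute (v i) (onSites Finset.univ M))
    (hVA : ∀ i O, SupportedOn (A i) O → SupportedOn (C i) (heis Vᴴ (heis (v i) O)))
    (hVB : ∀ i O, SupportedOn (B i) O → SupportedOn (C i) (heis Vᴴ (heis (v (i + 1)) O)))
    (hVO : ∀ i, ∀ s ∈ C i, s ∉ A i → s ∉ B i → ∀ m, SupportedOn (C i) (heis Vᴴ (siteOp s m))) :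
    (∀ i j, i ≠ j → Disjoint (K i) (K j)) ∧
    ∃ u : Fin (k + 1) → Op ι S, (∀ i, u i ∈ Matrix.unitaryGroup (ι → S) ℂ ∧
      SupportedOn (C i) (u i) ∧ Commute (u i) (onSites Finset.univ M)) ∧
      V = (List.ofFn u).prod * (List.ofFn v).prod := by
  have hK' : ∀ i s, s ∈ K i ↔ s ∈ B (i - 1) ∨ s ∈ A i := fun i s => by
    have := hK (i - 1) s
    rwa [sub_add_cancel] at this
  have hCC : ∀ {i j s}, s ∈ C i → s ∈ C j → i = j := fun {i j s} hi hj => by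
    by_contra hij
    exact Finset.disjoint_left.1 (hC i j hij) hi hj
  have hKd : ∀ i j, i ≠ j → Disjoint (K i) (K j) := fun i j hij =>
    Finset.disjoint_left.2 fun s hi hj => by
      rcases (hK' i s).1 hi with h1 | h1 <;> rcases (hK' j s).1 hj with h2 | h2
      · exact hij (sub_left_injective (hCC (hB _ h1) (hB _ h2)))
      · have := hCC (hB _ h1) (hA _ h2)
        subst this
        exact Finset.disjoint_left.1 (hAB _) h2 h1
      · have := hCC (hA _ h1) (hB _ h2)
        subst this
        exact Finset.disjoint_left.1 (hAB _) h1 h2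
      · exact hij (hCC (hA _ h1) (hA _ h2))
  refine ⟨hKd, ?_⟩
  have hAK : ∀ i, A i ⊆ K i := fun i s hs => (hK' i s).2 (Or.inr hs)
  have hBK : ∀ i, B i ⊆ K (i + 1) := fun i s hs => (hK i s).2 (Or.inl hs)
  set P := (List.ofFn v).prod with hP
  have uP : P ∈ Matrix.unitaryGroup (ι → S) ℂ := prod_ofFn_mem _ fun i => (hv i).1
  have hcomm : ∀ i j, i ≠ j → Commute (v i) (v j) := fun i j hij =>
    (hv i).2.1.commute (hKd i j hij) (hv j).2.1
  have hPa : ∀ i O, SupportedOn (K i) O → heis P O = heis (v i) O := fun i O hO =>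
    (prod_ofFn_conj (fun i => (hv i).1) hcomm fun j hj => (hv j).2.1.commute (hKd j i hj) hO).1
  -- `V * Pᴴ` preserves the cells. A site of `A i` sees only the gate `v i` at the left cut, a site
  -- of `B i` only `v (i + 1)` at the right cut, and an inner site no gate at all. Indices in `Fin
  -- (k + 1)` wrap around like the ring.
  obtain ⟨u, hu, hprod⟩ := exists_prod_of_preserves hM htr hC hcov (mul_mem hV (ct_mem uP))
    (hVM.mul_left (commute_ct uP (prod_ofFn_commute fun i => (hv i).2.2))) (by
      intro i O hO
      refine supportedOn_conj_of_siteOp (mul_mem hV (ct_mem uP)) (fun s hs m => ?_) hO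
      rw [Matrix.conjTranspose_mul, Matrix.conjTranspose_conjTranspose, ← heis_heis]
      by_cases h1 : s ∈ A i
      · have h2 := supportedOn_siteOp (S := S) h1 m
        rw [hPa i _ (h2.mono (hAK i))]
        exact hVA i _ h2
      by_cases h2 : s ∈ B i
      · have h3 := supportedOn_siteOp (S := S) h2 m
        rw [hPa _ _ (h3.mono (hBK i))]
        exact hVB i _ h3
      rw [heis_of_commute uP (prod_ofFn_commute fun j => ?_)]
      · exact hVO i s hs h1 h2 m
      · refine (hv j).2.1.commute (Finset.disjoint_singleton_right.2 fun hj => ?_)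
          (supportedOn_singleton.2 ⟨m, rfl⟩)
        rcases (hK' j s).1 hj with h3 | h3
        · exact h2 (hCC hs (hB _ h3) ▸ h3)
        · exact h1 (hCC hs (hA _ h3) ▸ h3))
  exact ⟨u, hu, by rw [← hprod, Matrix.mul_assoc, ct_mul uP, Matrix.mul_one]⟩

end Cells

/-! ### Straightening on the ring -/

section Straighten

variable {ℓ : ℕ} {S : Type} [NeZero ℓ] [Fintype S] [DecidableEq S] {ξ : ℕ} {M : Matrix S S ℂ}
  {V : Op (ZMod ℓ) S}

theorem boundaryGeometry_near (hℓ : 12 * ξ + 1 ≤ ℓ) (y : ZMod ℓ) :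
    BoundaryGeometry (near ξ) (arc (y - (ξ : ZMod ℓ)) (2 * ξ))
      (arc (y - ((2 * ξ : ℕ) : ZMod ℓ)) (2 * ξ)) (arc y (2 * ξ))
      (arc (y - ((3 * ξ : ℕ) : ZMod ℓ)) (2 * ξ)) := by
  set b := y - ((6 * ξ : ℕ) : ZMod ℓ) with hb
  have e1 : y - (ξ : ZMod ℓ) = b + ((5 * ξ : ℕ) : ZMod ℓ) := by rw [hb]; push_cast; ring
  have e2 : y - ((2 * ξ : ℕ) : ZMod ℓ) = b + ((4 * ξ : ℕ) : ZMod ℓ) := by rw [hb]; push_cast; ring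
  have e3 : y - ((3 * ξ : ℕ) : ZMod ℓ) = b + ((3 * ξ : ℕ) : ZMod ℓ) := by rw [hb]; push_cast; ring
  have e4 : y = b + ((6 * ξ : ℕ) : ZMod ℓ) := by rw [hb]; push_cast; ring
  have m1 := fun z => mem_arc_crd (n := 2 * ξ) e1 (by omega) (z := z)
  have m2 := fun z => mem_arc_crd (n := 2 * ξ) e2 (by omega) (z := z)
  have m3 := fun z => mem_arc_crd (n := 2 * ξ) e3 (by omega) (z := z)
  have m4 := fun z => mem_arc_crd (n := 2 * ξ) e4 (by omega) (z := z)
  constructor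
  · exact near_symm ξ
  · intro i hi j hij
    have := near_crd b hij
    have hl := crd_lt b j
    rw [m1] at hi
    rw [Finset.mem_union, m2, m4]
    omega
  · refine Finset.disjoint_left.2 fun z hz => ?_
    rw [m2] at hz; rw [m4]; omega
  · refine Finset.disjoint_left.2 fun z hz => ?_
    rw [m3] at hz; rw [m1]; omega
  · intro i hi j hij
    have := near_crd b hij
    have hl := crd_lt b j
    rw [m2] at hi
    rw [Finset.mem_union, m3, m1]
    omega
  · intro i hi j hij
    have := near_crd b hij
    have hl := crd_lt b j
    have hl' := crd_lt b i
    rw [m4] at hi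
    rw [Finset.mem_compl, m3]
    omega

/-- Primality enters here. The hypothesis controls only the trace of the end itself;
`exists_trace_pow_eq` compares all its powers with those of the symmetry on `ξ` sites, up to `c ^
j`. Dividing the end by `c` keeps it normalized and makes the traces agree. -/
theorem IsSym.exists_straightening [Nonempty S] {N : ℕ} (hV : IsSym ξ M V) (hℓ : 12 * ξ + 1 ≤ ℓ)
    (hN : N.Prime) (hM : M ^ N = 1) (htr : ∀ j, mtr (M ^ j) ≠ 0) {σ τ : ℕ → ℂ}
    (hσ : IsEndRatio ξ (dbl V) (swapM S) 2 σ) (hσ1 : ‖σ 1‖ = 1) (hτ : IsEndRatio ξ V M N τ)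
    (hτ1 : τ 1 ^ N = 1) (y : ZMod ℓ) :
    ∃ v ∈ Matrix.unitaryGroup (ZMod ℓ → S) ℂ, SupportedOn (arc (y - (ξ : ZMod ℓ)) (2 * ξ)) v ∧
      Commute v (onSites Finset.univ M) ∧
      (∀ O, SupportedOn (arc (y - (ξ : ZMod ℓ)) ξ) O →
        SupportedOn (arc (y - ((2 * ξ : ℕ) : ZMod ℓ)) (2 * ξ)) (heis Vᴴ (heis v O))) ∧
      (∀ O, SupportedOn (arc y ξ) O → SupportedOn (arc y (2 * ξ)) (heis Vᴴ (heis v O))) := by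
  obtain ⟨T, hT, hTN, hTt⟩ := hV.endRatio_at hℓ hM htr hτ y
  obtain ⟨𝕊, h𝕊, -, h𝕊t⟩ := (isSym_dbl hV.loc).endRatio_at hℓ swapM_sq mtr_swapM_pow_ne_zero hσ y
  have hc : (arc (y - (ξ : ZMod ℓ)) ξ).card = ξ := card_arc (by omega)
  have hc' : (arc y ξ).card = ξ := card_arc (by omega)
  have hdK : Disjoint (arc (y - (ξ : ZMod ℓ)) ξ) (arc y ξ) ∧ ∀ i, i ∈ arc (y - (ξ : ZMod ℓ)) (2 * ξ) ↔
      i ∈ arc (y - (ξ : ZMod ℓ)) ξ ∨ i ∈ arc y ξ := by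
    have e0 : y - (ξ : ZMod ℓ) = y - (ξ : ZMod ℓ) + ((0 : ℕ) : ZMod ℓ) := by simp
    have e1 : y = y - (ξ : ZMod ℓ) + (ξ : ZMod ℓ) := by ring
    have m0 := fun z => mem_arc_crd (n := ξ) e0 (by omega) (z := z)
    have m1 := fun z => mem_arc_crd (n := ξ) e1 (by omega) (z := z)
    have m2 := fun z => mem_arc_crd (n := 2 * ξ) e0 (by omega) (z := z)
    refine ⟨Finset.disjoint_left.2 fun z hz => ?_, fun z => ?_⟩
    · rw [m0] at hz; rw [m1]; omega
    · rw [m0, m1, m2]; omega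
  have hn1 : onSites (arc y ξ) M ^ N = 1 := by rw [onSites_pow, hM, onSites_one]
  have htN : ∀ j, ntr (onSites (arc y ξ) M ^ j) = mtr (M ^ j) ^ ξ := fun j => by
    rw [onSites_pow, ntr_onSites, hc', mtr]
  have hTt' : ∀ j, ntr (T ^ j) = τ j * mtr (M ^ j) ^ ξ := fun j => by
    rw [hTt, div_mul_cancel₀ _ (pow_ne_zero _ (htr j))]
  have hcard : (Fintype.card (ZMod ℓ → S) : ℂ) ≠ 0 := Nat.cast_ne_zero.2 Fintype.card_ne_zero
  obtain ⟨c, hcN, hcj⟩ := exists_trace_pow_eq hN hTN hn1 rfl (by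
    have h1 := hTt' 1
    have h2 := htN 1
    have h3 : ntr (T ^ 1) ^ N = ntr (onSites (arc y ξ) M ^ 1) ^ N := by
      rw [h1, h2, mul_pow, hτ1, one_mul]
    rw [pow_one, pow_one, ntr, ntr, div_pow, div_pow] at h3
    simpa [hcard] using h3)
  have hcn : ‖c‖ = 1 := by
    have := congrArg norm hcN
    rw [norm_pow, norm_one] at this
    exact (pow_eq_one_iff_of_nonneg (norm_nonneg c) hN.ne_zero).1 this
  have hc0 : c ≠ 0 := fun h => by simp [h] at hcn
  have hcin : ‖c⁻¹‖ = 1 := by rw [norm_inv, hcn, inv_one]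
  refine (boundaryGeometry_near hℓ y).exists_straightening hV.loc hN.ne_zero hV.mem hM htr hV.comm
    (hT.smul hcin) (by rw [smul_pow, hTN, inv_pow, hcN, inv_one, one_smul]) hdK.1 hdK.2
    (by rw [hc, hc']) (fun j => ?_) h𝕊 ?_
  · rw [hc, ← htN, smul_pow, ntr_smul, ntr, ntr, hcj, mul_div_assoc, ← mul_assoc, ← mul_pow,
      inv_mul_cancel₀ hc0, one_pow, one_mul]
  · have h1 := h𝕊t 1
    rw [pow_one, pow_one, mtr_swapM, eq_div_iff (pow_ne_zero _ (by simp [Fintype.card_ne_zero]))]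
      at h1
    rw [← h1, norm_mul, hσ1, one_mul, hc, norm_pow, norm_inv]
    simp

end Straighten

/-! ### Cutting the ring into cells -/

section RingCells

variable {ℓ : ℕ} {S G : Type} [NeZero ℓ] [Fintype S] [DecidableEq S] {ξ D r : ℕ} {M : Matrix S S ℂ}
  {V : Op (ZMod ℓ) S}

/-- A symmetric unitary that can be straightened everywhere is a symmetric circuit of depth two. -/
theorem IsSym.isSymmetricCircuit [Nonempty S] (hV : IsSym ξ M V) (hℓ : 12 * ξ + 1 ≤ ℓ)
    (htr : mtr M ≠ 0) (hD : 2 ≤ D) (hr : 8 * ξ + 2 ≤ r) {μ : G → Matrix S S ℂ}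
    (hμ : ∀ O : Op (ZMod ℓ) S, Commute O (onSites Finset.univ M) → CommutesWithSymmetry μ O)
    (hs : ∀ y : ZMod ℓ, ∃ v ∈ Matrix.unitaryGroup (ZMod ℓ → S) ℂ,
      SupportedOn (arc (y - (ξ : ZMod ℓ)) (2 * ξ)) v ∧ Commute v (onSites Finset.univ M) ∧
      (∀ O, SupportedOn (arc (y - (ξ : ZMod ℓ)) ξ) O →
        SupportedOn (arc (y - ((2 * ξ : ℕ) : ZMod ℓ)) (2 * ξ)) (heis Vᴴ (heis v O))) ∧
      (∀ O, SupportedOn (arc y ξ) O → SupportedOn (arc y (2 * ξ)) (heis Vᴴ (heis v O)))) :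
    IsSymmetricCircuit D r μ V := by
  choose v uv sv cv hL hR using hs
  -- A cell has room for the two regions of length `2 * ξ` at its cuts, and the extra site keeps it
  -- nonempty for `ξ = 0`. The last cell takes the remainder and is at most twice as long, whence
  -- the bound `8 * ξ + 2` on the range.
  set c := 4 * ξ + 1 with hc
  obtain ⟨k, hk1, hk2⟩ : ∃ k, (k + 1) * c ≤ ℓ ∧ ℓ < (k + 2) * c := by
    have h1 := Nat.div_add_mod ℓ c
    have h2 := Nat.mod_lt ℓ (show 0 < c by omega)
    have h3 : 1 ≤ ℓ / c := (Nat.one_le_div_iff (by omega)).2 (by omega)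
    refine ⟨ℓ / c - 1, ?_, ?_⟩
    · rw [Nat.sub_add_cancel h3, mul_comm]; omega
    · rw [show ℓ / c - 1 + 2 = ℓ / c + 1 by omega, Nat.add_mul, mul_comm]; omega
  let pos : Fin (k + 1) → ℕ := fun i => i * c
  let len : Fin (k + 1) → ℕ := fun i => if (i : ℕ) = k then ℓ - k * c else c
  have hlen : ∀ i, c ≤ len i ∧ len i ≤ 2 * c ∧ pos i + len i ≤ ℓ := fun i => by
    have h3 : (k + 1) * c = k * c + c := by ring
    have h4 : (k + 2) * c = k * c + 2 * c := by ring
    simp only [len, pos]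
    split_ifs with h
    · rw [h]; omega
    · have h1 : (i : ℕ) + 1 ≤ k := by have := i.2; omega
      have h2 := Nat.mul_le_mul_right c h1
      rw [Nat.add_mul, Nat.one_mul] at h2
      omega
  have hlt : ∀ i j : Fin (k + 1), i < j → pos i + len i ≤ pos j := fun i j hij => by
    have h1 : (i : ℕ) + 1 ≤ j := hij
    have h2 := Nat.mul_le_mul_right c h1
    rw [Nat.add_mul, Nat.one_mul] at h2
    simp only [len, pos]
    rw [if_neg (by have := j.2; omega)]
    exact h2
  -- The last cell ends at `ℓ`, which is 0 in `ZMod ℓ` and the start of the first cell.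
  have hnext : ∀ i : Fin (k + 1), ((pos i + len i : ℕ) : ZMod ℓ) = ((pos (i + 1) : ℕ) : ZMod ℓ) := by
    intro i
    simp only [len, pos]
    split_ifs with h
    · have : i = Fin.last k := Fin.ext h
      subst this
      rw [Fin.last_add_one]
      simp only [Fin.val_last, Fin.val_zero, Nat.zero_mul, Nat.cast_zero]
      rw [Nat.add_sub_cancel' (by have : (k + 1) * c = k * c + c := by ring
                                  omega)]
      exact ZMod.natCast_self ℓ
    · rw [Fin.val_add_one, if_neg (fun h' => h (by rw [h']; rfl))]
      congr 1; ring
  have mem : ∀ {α n : ℕ}, α + n ≤ ℓ → ∀ z : ZMod ℓ, z ∈ arc ((α : ℕ) : ZMod ℓ) n ↔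
      α ≤ crd 0 z ∧ crd 0 z < α + n := fun h z => mem_arc_crd (b := 0) (by simp) h
  let y : Fin (k + 1) → ZMod ℓ := fun i => ((pos i : ℕ) : ZMod ℓ)
  let C : Fin (k + 1) → Finset (ZMod ℓ) := fun i => arc (y i) (len i)
  let A : Fin (k + 1) → Finset (ZMod ℓ) := fun i => arc (y i) ξ
  let B : Fin (k + 1) → Finset (ZMod ℓ) := fun i => arc ((pos i + len i - ξ : ℕ) : ZMod ℓ) ξ
  let K : Fin (k + 1) → Finset (ZMod ℓ) := fun i => arc (y i - (ξ : ZMod ℓ)) (2 * ξ)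
  have mC : ∀ i z, z ∈ C i ↔ pos i ≤ crd 0 z ∧ crd 0 z < pos i + len i := fun i z =>
    mem (hlen i).2.2 z
  have mA : ∀ i z, z ∈ A i ↔ pos i ≤ crd 0 z ∧ crd 0 z < pos i + ξ := fun i z =>
    mem (by have := hlen i; omega) z
  have mB : ∀ i z, z ∈ B i ↔ pos i + len i - ξ ≤ crd 0 z ∧ crd 0 z < pos i + len i := fun i z => by
    have := hlen i
    rw [mem (by omega)]
    omega
  have hsub : ∀ i (n : ℕ), n ≤ len i →
      ((pos i + len i - n : ℕ) : ZMod ℓ) = y (i + 1) - (n : ZMod ℓ) := fun i n hn => by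
    rw [Nat.cast_sub (by omega), hnext]
  obtain ⟨hKd, u, hu, hVu⟩ := exists_two_layers (C := C) (A := A) (B := B) (K := K) (V := V)
    (v := fun i => v (y i)) hV.mem htr
    (fun i j hij => Finset.disjoint_left.2 fun z hi hj => by
      rw [mC] at hi hj
      rcases lt_or_gt_of_ne hij with h | h
      · have := hlt _ _ h; omega
      · have := hlt _ _ h; omega)
    (fun z => by
      have hz := crd_lt 0 z
      by_cases h : crd 0 z < k * c
      · have h1 : crd 0 z / c < k := (Nat.div_lt_iff_lt_mul (by omega)).2 h
        refine ⟨⟨crd 0 z / c, by omega⟩, (mC _ _).2 ?_⟩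
        have h2 := Nat.div_add_mod (crd 0 z) c
        have h3 := Nat.mod_lt (crd 0 z) (show 0 < c by omega)
        simp only [pos, len]
        rw [if_neg (by omega), mul_comm]
        omega
      · refine ⟨Fin.last k, (mC _ _).2 ?_⟩
        simp only [pos, len, Fin.val_last, if_true]
        omega)
    (fun i z hz => by have := hlen i; rw [mA] at hz; rw [mC]; omega)
    (fun i z hz => by have := hlen i; rw [mB] at hz; rw [mC]; omega)
    (fun i => Finset.disjoint_left.2 fun z hA hB => by
      have := hlen i
      rw [mA] at hA; rw [mB] at hB; omega)
    (fun i z => by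
      have h1 := hlen i
      have e0 : y (i + 1) - (ξ : ZMod ℓ) = y (i + 1) - (ξ : ZMod ℓ) + ((0 : ℕ) : ZMod ℓ) := by simp
      have e1 : y (i + 1) = y (i + 1) - (ξ : ZMod ℓ) + (ξ : ZMod ℓ) := by ring
      simp only [K, B, A]
      rw [hsub i ξ (by omega), mem_arc_crd e0 (by omega), mem_arc_crd e0 (by omega),
        mem_arc_crd e1 (by omega)]
      omega)
    hV.loc.1 hV.comm (fun i => ⟨uv _, sv _, cv _⟩)
    (fun i O hO => (hR (y i) O hO).mono fun z hz => by
      have := hlen i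
      rw [mem (by omega)] at hz; rw [mC]; omega)
    (fun i O hO => (hL (y (i + 1)) O (by
      rwa [← hsub i ξ (by have := hlen i; omega)])).mono fun z hz => by
        have := hlen i
        rw [← hsub i (2 * ξ) (by omega), mem (by omega)] at hz
        rw [mC]; omega)
    (fun i s hs hsA hsB m => (hV.loc.ct (near_symm ξ)).supportedOn (near_symm ξ) (X := {s})
      (fun a ha j hj => by
        have h1 := hlen i
        rw [Finset.mem_singleton] at ha
        subst ha
        have h2 := near_crd 0 hj
        have h3 := crd_lt 0 j
        rw [mC] at hs ⊢
        rw [mA] at hsA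
        rw [mB] at hsB
        omega)
      (supportedOn_singleton.2 ⟨m, rfl⟩))
  have hdC : ∀ i j : Fin (k + 1), i ≠ j → Disjoint (C i) (C j) := fun i j hij =>
    Finset.disjoint_left.2 fun z hi hj => by
      rw [mC] at hi hj
      rcases lt_or_gt_of_ne hij with h | h
      · have := hlt _ _ h; omega
      · have := hlt _ _ h; omega
  refine ⟨[(List.ofFn u).prod, (List.ofFn fun i => v (y i)).prod], hD, fun W hW => ?_, by simp [hVu]⟩
  rw [List.mem_cons, List.mem_singleton] at hW
  rcases hW with rfl | rfl
  · exact ⟨k + 1, y, len, u, fun j => by have := hlen j; omega, hdC,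
      fun j => ⟨(hu j).1, (hu j).2.1, hμ _ (hu j).2.2⟩, rfl⟩
  · exact ⟨k + 1, fun i => y i - (ξ : ZMod ℓ), fun _ => 2 * ξ, fun i => v (y i),
      fun j => by show 2 * ξ ≤ r; omega, hKd, fun j => ⟨uv _, sv _, hμ _ (cv _)⟩, rfl⟩

theorem IsSymmetricCircuit.tens_one {T R : Type} [Fintype T] [DecidableEq T] [Fintype R]
    [DecidableEq R] (e : R ≃ S × T) {μ : G → Matrix S S ℂ} (ν : G → Matrix T T ℂ)
    {W : Op (ZMod ℓ) S} (hW : IsSymmetricCircuit D r μ W) :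
    IsSymmetricCircuit D r (fun g => stens e (μ g) (ν g)) (tens e W (1 : Op (ZMod ℓ) T)) := by
  let φ : Op (ZMod ℓ) S →* Op (ZMod ℓ) R :=
    { toFun := fun U => tens e U 1
      map_one' := SpinChain.tens_one
      map_mul' := fun U V => by rw [tens_mul, mul_one] }
  obtain ⟨Ws, hlen, hlay, rfl⟩ := hW
  refine ⟨Ws.map φ, by simpa using hlen, fun Z hZ => ?_, map_list_prod φ Ws⟩
  obtain ⟨V, hV, rfl⟩ := List.mem_map.1 hZ
  obtain ⟨k, x, n, v, hn, hdis, hv, rfl⟩ := hlay V hV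
  refine ⟨k, x, n, fun j => φ (v j), hn, hdis, fun j => ⟨tens_mem (hv j).1 (one_mem _),
    (hv j).2.1.tens ?_, fun g => ?_⟩, ?_⟩
  · exact supportedOn_iff.2 fun i _ m => Commute.one_left _
  · rw [← tens_prodOp]
    exact tens_commute ((hv j).2.2 g) (Commute.one_left _)
  · rw [map_list_prod, List.map_ofFn]
    rfl

/-- QCA that differ by a symmetric circuit are strongly equivalent. -/
theorem IsSymmetricCircuit.stronglyEquivalent {μ : G → Matrix S S ℂ} {W U U' : Op (ZMod ℓ) S}
    (hW : IsSymmetricCircuit D r μ W) (h : U' = W * U) : StronglyEquivalent D r μ U U' :=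
  ⟨0, _, hW.tens_one (Equiv.refl _) fun g => prodOp fun _ : Fin 0 => μ g, by
    rw [withAncillas_eq, withAncillas_eq, tens_mul, mul_one, h]⟩

end RingCells

/-! ### Classification for prime order -/

section Classification

variable {ℓ : ℕ} {S : Type} [NeZero ℓ] [Fintype S] [DecidableEq S] {ξ D r d N : ℕ}

/-- The end ratio of `U' U†` is the quotient of the end ratios, up to a root of unity. -/
theorem IsSym.endRatio_mul_ct [Nonempty S] {M : Matrix S S ℂ} {U U' : Op (ZMod ℓ) S}
    (hU : IsSym ξ M U) (hU' : IsSym ξ M U') (hℓ : 20 * (3 * ξ) + 1 ≤ ℓ) (hd0 : 0 < d)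
    (hd : M ^ d = 1) (htr : ∀ j, mtr (M ^ j) ≠ 0) {τ τ' τV : ℕ → ℂ} (hτ : IsEndRatio ξ U M d τ)
    (hτ' : IsEndRatio ξ U' M d τ') (hτV : IsEndRatio (ξ + ξ) (U' * Uᴴ) M d τV) :
    ∃ c : ℂ, c ^ d = 1 ∧ ∀ j, τ' j = c ^ j * (τ j * τV j) := by
  have hV := hU.ct.mul hU'
  have h1 := hU.endRatio_mul hV (by omega) hd0 hd htr hτ hτV
  rw [Matrix.mul_assoc, ct_mul hU.loc.1, Matrix.mul_one] at h1
  have h2 := hU'.endRatio_mono (ξ' := ξ + (ξ + ξ)) (by omega) (by omega) hd htr hτ'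
  exact (hU'.mono (by omega)).endRatio_unique (by omega) hd htr h1 h2

theorem norm_eq_one_of_pow_eq_one {c : ℂ} {n : ℕ} (hn : n ≠ 0) (h : c ^ n = 1) : ‖c‖ = 1 := by
  have := congrArg norm h
  rw [norm_pow, norm_one] at this
  exact (pow_eq_one_iff_of_nonneg (norm_nonneg c) hn).1 this

section

variable [NeZero N] {μ : Multiplicative (ZMod N) →* Matrix.unitaryGroup S ℂ} {U U' : Op (ZMod ℓ) S}

theorem exists_endRatios [Nonempty S] (hℓ : 12 * ξ + 4 ≤ ℓ)
    (hU : IsSymmetricQCA ξ (fun g => (μ g : Matrix S S ℂ)) U) :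
    (∃ σ, IsEndRatio ξ (dbl U) (swapM S) 2 σ) ∧
      ∀ g, ∃ τ, IsEndRatio ξ U (μ g : Matrix S S ℂ) (orderOf g) τ :=
  ⟨(isSym_dbl hU.1.isLocal).exists_endRatio (by omega) two_pos swapM_sq, fun g =>
    (hU.isSym (fun g => (μ g).2) g).exists_endRatio (by omega) (orderOf_pos g)
      (coe_map_pow_orderOf μ g)⟩

theorem existsUnique_refinedIndex [Nonempty S] (hℓ : 12 * ξ + 4 ≤ ℓ)
    (htr : ∀ g, (μ g : Matrix S S ℂ).trace ≠ 0)
    (hU : IsSymmetricQCA ξ (fun g => (μ g : Matrix S S ℂ)) U) :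
    ∃! s, IsRefinedIndex ξ (fun g => (μ g : Matrix S S ℂ)) U s := by
  obtain ⟨s, hs⟩ := exists_refinedIndex hU hℓ
  refine ⟨s, hs, fun s' hs' => funext fun g => ?_⟩
  obtain ⟨⟨σ, hσ⟩, hτ⟩ := exists_endRatios hℓ hU
  obtain ⟨τ, hτ⟩ := hτ g
  rw [hs'.eq hU (by omega) htr hσ g hτ, hs.eq hU (by omega) htr hσ g hτ]

theorem StronglyEquivalent.refinedIndex_eq [Nonempty S]
    (h : StronglyEquivalent D r (fun g => (μ g : Matrix S S ℂ)) U U')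
    (hℓ : 20 * (ξ + D * r) + 12 * r + 4 ≤ ℓ) (htr : ∀ g, (μ g : Matrix S S ℂ).trace ≠ 0)
    (hU : IsSymmetricQCA ξ (fun g => (μ g : Matrix S S ℂ)) U)
    (hU' : IsSymmetricQCA ξ (fun g => (μ g : Matrix S S ℂ)) U') {s s' : Multiplicative (ZMod N) → ℂ}
    (hs : IsRefinedIndex ξ (fun g => (μ g : Matrix S S ℂ)) U s)
    (hs' : IsRefinedIndex ξ (fun g => (μ g : Matrix S S ℂ)) U' s') (g : Multiplicative (ZMod N)) :
    s g = s' g := by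
  obtain ⟨⟨σ, hσ⟩, hτ⟩ := exists_endRatios (by omega) hU
  obtain ⟨⟨σ', hσ'⟩, hτ'⟩ := exists_endRatios (by omega) hU'
  obtain ⟨τ, hτ⟩ := hτ g
  obtain ⟨τ', hτ'⟩ := hτ' g
  obtain ⟨c, hc, hcj⟩ := h.endRatio g (hU.isSym (fun g => (μ g).2) g)
    (hU'.isSym (fun g => (μ g).2) g) (by omega) (orderOf_pos g) (coe_map_pow_orderOf μ g)
    (mtr_map_pow_ne_zero htr g) hτ hτ'
  rw [hs.eq hU (by omega) htr hσ g hτ, hs'.eq hU' (by omega) htr hσ' g hτ',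
    h.endRatio_dbl hU.1.isLocal hU'.1.isLocal (by omega) hσ hσ', hcj, pow_one, mul_pow, hc, one_mul]

/-- By multiplicativity the end ratios of `U' * Uᴴ` are quotients of those of `U'` and `U`. Equal
indices make them trivial in the sense needed for straightening at every point, so `U' * Uᴴ` is a
circuit of two layers. -/
theorem stronglyEquivalent_of_refinedIndex_eq [Nonempty S] (hN : N.Prime) (hD : 2 ≤ D)
    (hr : 16 * ξ + 2 ≤ r) (hℓ : 60 * ξ + 4 ≤ ℓ) (htr : ∀ g, (μ g : Matrix S S ℂ).trace ≠ 0)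
    (hU : IsSymmetricQCA ξ (fun g => (μ g : Matrix S S ℂ)) U)
    (hU' : IsSymmetricQCA ξ (fun g => (μ g : Matrix S S ℂ)) U') {s : Multiplicative (ZMod N) → ℂ}
    (hs : IsRefinedIndex ξ (fun g => (μ g : Matrix S S ℂ)) U s)
    (hs' : IsRefinedIndex ξ (fun g => (μ g : Matrix S S ℂ)) U' s) :
    StronglyEquivalent D r (fun g => (μ g : Matrix S S ℂ)) U U' := by
  obtain ⟨⟨σ, hσ⟩, hτ⟩ := exists_endRatios (by omega) hU
  obtain ⟨⟨σ', hσ'⟩, hτ'⟩ := exists_endRatios (by omega) hU'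
  set γ : Multiplicative (ZMod N) := Multiplicative.ofAdd 1 with hγ
  have hγN : orderOf γ = N := orderOf_ofAdd_one
  have hsU := hU.isSym (fun g => (μ g).2) γ
  have hsU' := hU'.isSym (fun g => (μ g).2) γ
  set M : Matrix S S ℂ := (μ γ : Matrix S S ℂ) with hM
  have hMN : M ^ N = 1 := by
    have := coe_map_pow_orderOf μ γ
    rwa [hγN] at this
  have hMtr : ∀ j, mtr (M ^ j) ≠ 0 := mtr_map_pow_ne_zero htr γ
  obtain ⟨τ, hτγ⟩ := hτ γ
  obtain ⟨τ', hτγ'⟩ := hτ' γ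
  -- At the neutral element the end ratio is 1 and the refined index is the GNVW index alone. This
  -- separates the two factors of the indices at the generator.
  have hone : ∀ {W : Op (ZMod ℓ) S} {ρ : ℕ → ℂ}, IsSymmetricQCA ξ (fun g => (μ g : Matrix S S ℂ)) W →
      IsEndRatio ξ (dbl W) (swapM S) 2 ρ →
      IsRefinedIndex ξ (fun g => (μ g : Matrix S S ℂ)) W s → s 1 = ((‖ρ 1‖⁻¹ : ℝ) : ℂ) := by
    intro W ρ hW hρ hsW
    obtain ⟨η, hη⟩ := (exists_endRatios (by omega) hW).2 1
    rw [hsW.eq hW (by omega) htr hρ 1 hη]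
    obtain ⟨y, T, hT, hT1, ht⟩ := hη
    rw [orderOf_one, pow_one] at hT1
    have : η 1 = 1 := by
      rw [ht, hT1, one_pow, ntr_one, pow_one, map_one]
      rw [show mtr ((1 : Matrix.unitaryGroup S ℂ) : Matrix S S ℂ) = 1 from mtr_one, one_pow, div_one]
    rw [this, one_pow, mul_one]
  have hσσ : ‖σ 1‖ = ‖σ' 1‖ := by
    have h1 := (hone hU hσ hs).symm.trans (hone hU' hσ' hs')
    exact inv_injective (by exact_mod_cast h1)
  have hσ0 : ‖σ 1‖ ≠ 0 := norm_ne_zero_iff.2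
    ((isSym_dbl hU.1.isLocal).endRatio_ne_zero (by omega) swapM_sq mtr_swapM_pow_ne_zero hσ 1)
  have hττ : τ 1 ^ N = τ' 1 ^ N := by
    have h1 := hs.eq hU (by omega) htr hσ γ hτγ
    rw [hs'.eq hU' (by omega) htr hσ' γ hτγ', hγN, hσσ] at h1
    refine (mul_left_cancel₀ ?_ h1).symm
    rw [hσσ] at hσ0
    exact_mod_cast inv_ne_zero hσ0
  rw [hγN] at hτγ hτγ'
  have hV : IsSym (ξ + ξ) M (U' * Uᴴ) := hsU.ct.mul hsU'
  obtain ⟨τV, hτV⟩ := hV.exists_endRatio (by omega) hN.pos hMN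
  obtain ⟨σV, hσV⟩ := (isSym_dbl hV.loc).exists_endRatio (by omega) two_pos swapM_sq
  obtain ⟨c, hc, hcj⟩ := hsU.endRatio_mul_ct hsU' (by omega) hN.pos hMN hMtr hτγ hτγ' hτV
  have hσV' := hσV
  rw [← dbl_mul, ← dbl_ct] at hσV'
  obtain ⟨c', hc', hcj'⟩ := (isSym_dbl hU.1.isLocal).endRatio_mul_ct (isSym_dbl hU'.1.isLocal)
    (by omega) two_pos swapM_sq mtr_swapM_pow_ne_zero hσ hσ' hσV'
  have hσV1 : ‖σV 1‖ = 1 := by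
    have h1 := congrArg norm (hcj' 1)
    rw [pow_one, norm_mul, norm_mul, norm_eq_one_of_pow_eq_one two_ne_zero hc', one_mul, ← hσσ] at h1
    exact (mul_eq_left₀ hσ0).1 h1.symm
  have hτV1 : τV 1 ^ N = 1 := by
    have h1 := congrArg (· ^ N) (hcj 1)
    simp only [pow_one, mul_pow, hc, one_mul] at h1
    rw [← hττ] at h1
    exact (mul_eq_left₀ (pow_ne_zero _ (hsU.endRatio_ne_zero (by omega) hMN hMtr hτγ 1))).1 h1.symm
  refine (hV.isSymmetricCircuit (by omega) (by simpa using hMtr 1) hD (by omega) (fun O hO g => ?_)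
    (hV.exists_straightening (by omega) hN hMN hMtr hσV hσV1 hτV hτV1)).stronglyEquivalent ?_
  -- Commuting with the symmetry of the generator is enough, since every group element is a power of
  -- it.
  · have h1 := hO.pow_right (Multiplicative.toAdd g).val
    rw [onSites_pow, hM, coe_map_pow, hγ, ofAdd_one_pow_val, onSites_univ] at h1
    exact h1
  · rw [Matrix.mul_assoc, ct_mul hU.1.1, Matrix.mul_one]

end

/-- For prime order, the refined indices are well defined and classify symmetric QCA up to strong
equivalence. -/
theorem classified_prime_order (ξ : ℕ) : ∃ r₀ : ℕ, ∀ D r : ℕ, 2 ≤ D → r₀ ≤ r → ∃ ℓ₀ : ℕ,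
    ∀ (ℓ : ℕ) [NeZero ℓ], ℓ₀ ≤ ℓ → ∀ N : ℕ, N.Prime → ∀ (d : ℕ)
      (μ : Multiplicative (ZMod N) →* Matrix.unitaryGroup (Fin d) ℂ),
      (∀ g, (μ g : Matrix (Fin d) (Fin d) ℂ).trace ≠ 0) →
      (∀ U : Op (ZMod ℓ) (Fin d),
        IsSymmetricQCA ξ (fun g => (μ g : Matrix (Fin d) (Fin d) ℂ)) U →
        ∃! s : Multiplicative (ZMod N) → ℂ,
          IsRefinedIndex ξ (fun g => (μ g : Matrix (Fin d) (Fin d) ℂ)) U s) ∧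
      (∀ U U' : Op (ZMod ℓ) (Fin d),
        IsSymmetricQCA ξ (fun g => (μ g : Matrix (Fin d) (Fin d) ℂ)) U →
        IsSymmetricQCA ξ (fun g => (μ g : Matrix (Fin d) (Fin d) ℂ)) U' →
        ∀ s s' : Multiplicative (ZMod N) → ℂ,
          IsRefinedIndex ξ (fun g => (μ g : Matrix (Fin d) (Fin d) ℂ)) U s →
          IsRefinedIndex ξ (fun g => (μ g : Matrix (Fin d) (Fin d) ℂ)) U' s' →
          ((∀ g, s g = s' g) ↔
            StronglyEquivalent D r (fun g => (μ g : Matrix (Fin d) (Fin d) ℂ)) U U')) := by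
  -- The range is `8 * (2 * ξ) + 2`, as `U' * Uᴴ` has spreading length `2 * ξ`. In the bound on `ℓ`,
  -- `60 * ξ` serves the construction of the circuit, and the terms in `D` and `r` serve the
  -- invariance under given circuits.
  refine ⟨16 * ξ + 2, fun D r hD hr => ⟨60 * ξ + 20 * (ξ + D * r) + 12 * r + 4,
    fun ℓ _ hℓ N hN d μ htr => ?_⟩⟩
  have : NeZero N := ⟨hN.ne_zero⟩
  -- For `d = 0` the trace at the neutral element would vanish.
  have : Nonempty (Fin d) := by
    by_contra h
    rw [not_nonempty_iff] at h
    exact htr 1 (by simp [Matrix.trace])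
  refine ⟨fun U hU => existsUnique_refinedIndex (by omega) htr hU, fun U U' hU hU' s s' hs hs' =>
    ⟨fun h => ?_, fun h => h.refinedIndex_eq (by omega) htr hU hU' hs hs'⟩⟩
  obtain rfl : s = s' := funext h
  exact stronglyEquivalent_of_refinedIndex_eq hN hD hr (by omega) htr hU hU' hs hs'

end Classification

end SpinChain

theorem mainTheorem2 :
    -- equal powers of characters, for prime order
    (∀ N : ℕ, N.Prime → ∀ (n n' : ℕ)
      (ρ : Multiplicative (ZMod N) →* Matrix (Fin n) (Fin n) ℂ)
      (ρ' : Multiplicative (ZMod N) →* Matrix (Fin n') (Fin n') ℂ),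
      SpinChain.SameCharacterPowers ρ ρ' ↔ SpinChain.DifferByCharacter ρ ρ') ∧
    -- for prime order, the refined indices are well defined and classify up to strong equivalence
    (∀ ξ : ℕ, ∃ r₀ : ℕ, ∀ D r : ℕ, 2 ≤ D → r₀ ≤ r → ∃ ℓ₀ : ℕ, ∀ (ℓ : ℕ) [NeZero ℓ], ℓ₀ ≤ ℓ →
      ∀ N : ℕ, N.Prime → ∀ (d : ℕ)
        (μ : Multiplicative (ZMod N) →* Matrix.unitaryGroup (Fin d) ℂ),
        (∀ g, (μ g : Matrix (Fin d) (Fin d) ℂ).trace ≠ 0) →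
        (∀ U : SpinChain.Op (ZMod ℓ) (Fin d),
          SpinChain.IsSymmetricQCA ξ (fun g => (μ g : Matrix (Fin d) (Fin d) ℂ)) U →
          ∃! s : Multiplicative (ZMod N) → ℂ,
            SpinChain.IsRefinedIndex ξ (fun g => (μ g : Matrix (Fin d) (Fin d) ℂ)) U s) ∧
        (∀ U U' : SpinChain.Op (ZMod ℓ) (Fin d),
          SpinChain.IsSymmetricQCA ξ (fun g => (μ g : Matrix (Fin d) (Fin d) ℂ)) U →
          SpinChain.IsSymmetricQCA ξ (fun g => (μ g : Matrix (Fin d) (Fin d) ℂ)) U' →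
          ∀ s s' : Multiplicative (ZMod N) → ℂ,
            SpinChain.IsRefinedIndex ξ (fun g => (μ g : Matrix (Fin d) (Fin d) ℂ)) U s →
            SpinChain.IsRefinedIndex ξ (fun g => (μ g : Matrix (Fin d) (Fin d) ℂ)) U' s' →
            ((∀ g, s g = s' g) ↔
              SpinChain.StronglyEquivalent D r
                (fun g => (μ g : Matrix (Fin d) (Fin d) ℂ)) U U'))) ∧
    -- the counterexample of order four, for representations
    (∃ ρ ρ' : Multiplicative (ZMod 4) →* Matrix (Fin 4) (Fin 4) ℂ,
      ρ (Multiplicative.ofAdd 1) = Matrix.diagonal ![1, 1, -1, Complex.I] ∧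
      ρ' (Multiplicative.ofAdd 1) = Matrix.diagonal ![1, Complex.I, Complex.I, -Complex.I] ∧
      (∀ g, (ρ g).trace ≠ 0) ∧ (∀ g, (ρ' g).trace ≠ 0) ∧
      SpinChain.SameCharacterPowers ρ ρ' ∧ ¬ SpinChain.DifferByCharacter ρ ρ') ∧
    -- the refined indices do not classify for order four
    (∃ (d ξ : ℕ) (μ : Multiplicative (ZMod 4) →* Matrix.unitaryGroup (Fin d) ℂ),
      (∀ g, (μ g : Matrix (Fin d) (Fin d) ℂ).trace ≠ 0) ∧
      ∀ D r : ℕ, ∃ ℓ₀ : ℕ, ∀ (ℓ : ℕ) [NeZero ℓ], ℓ₀ ≤ ℓ →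
        ∃ (U U' : SpinChain.Op (ZMod ℓ) (Fin d)) (s : Multiplicative (ZMod 4) → ℂ),
          SpinChain.IsSymmetricQCA ξ (fun g => (μ g : Matrix (Fin d) (Fin d) ℂ)) U ∧
          SpinChain.IsSymmetricQCA ξ (fun g => (μ g : Matrix (Fin d) (Fin d) ℂ)) U' ∧
          SpinChain.IsRefinedIndex ξ (fun g => (μ g : Matrix (Fin d) (Fin d) ℂ)) U s ∧
          SpinChain.IsRefinedIndex ξ (fun g => (μ g : Matrix (Fin d) (Fin d) ℂ)) U' s ∧
          ¬ SpinChain.StronglyEquivalent D r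
            (fun g => (μ g : Matrix (Fin d) (Fin d) ℂ)) U U') :=
  ⟨fun _ hN _ _ ρ ρ' => SpinChain.sameCharacterPowers_iff hN ρ ρ',
    SpinChain.classified_prime_order, SpinChain.counterexample_reps,
    SpinChain.not_classified_order_four⟩
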